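/- **Setting.** Let $D\subset\mathbb R^2$ be a bounded domain of class $C^2$ whose exterior $\mathbb R^2\setminus\overline D$ is connected, so that $\partial D$ is a simple closed $C^2$ curve. Parametrize it positively by arc length, write $\sigma$ for arc length, $T$ for the unit tangent, $\nu$ for the outward unit normal, and $\tau_D$ for the signed curvature defined by $\frac{dT}{ds}=\tau_D\,\nu$ (so $\tau_D=-1/r$ on a circle of radius $r$). Let $f\in C^1(\partial D)$, with tangential derivative $f'$, and let $H$ be harmonic in $\mathbb R^2$. With $G(x,y)=\frac1{2\pi}\ln|x-y|$ put, for a density $\vartheta\in L^2(\partial D)$, $$S_D[\vartheta](x)=\int_{\partial D}G(x,y)\vartheta(y)\,d\sigma(y),\qquad D_D[\vartheta](x)=\int_{\partial D}\frac{\partial G(x,y)}{\partial\nu(y)}\vartheta(y)\,d\sigma(y),\qquad x\in\mathbb R^2\setminus\overline D,$$ $$K_D^*[\vartheta](x)=\mathrm{p.v.}\int_{\partial D}\frac{\partial G(x,y)}{\partial\nu(x)}\vartheta(y)\,d\sigma(y),\qquad K_D^{(1)}[\vartheta](x)=\mathrm{p.v.}\int_{\partial D}K_1(x,y)\vartheta(y)\,d\sigma(y),\qquad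 x\in\partial D,$$ where $$2\pi K_1(x,y)=-2\frac{\langle x-y,\nu(x)\rangle\langle x-y,f(x)\nu(x)-f(y)\nu(y)\rangle}{|x-y|^4}+\frac{\langle f(x)\nu(x)-f(y)\nu(y),\nu(x)\rangle}{|x-y|^2}-\frac{\langle x-y,\tau_D(x)f(x)\nu(x)+f'(x)T(x)\rangle}{|x-y|^2}+\frac{\langle x-y,\nu(x)\rangle}{|x-y|^2}\bigl(f(x)\tau_D(x)-f(y)\tau_D(y)\bigr).$$ Let $\phi,\phi^{(1)}\in L^2(\partial D)$ be the densities with, almost everywhere on $\partial D$, $$\Bigl(\tfrac12 I+K_D^*\Bigr)[\phi]=-\frac{\partial H}{\partial\nu},\qquad \Bigl(\tfrac12 I+K_D^*\Bigr)[\phi^{(1)}]=-\Bigl(f\frac{\partial^2H}{\partial\nu^2}-f'\frac{\partial H}{\partial T}+K_D^{(1)}[\phi]\Bigr).$$ Let $\varphi$ be the unperturbed electric potential: $\Delta\varphi=0$ in $\mathbb R^2\setminus\overline D$, $\frac{\partial\varphi}{\partial\nu}=0$ on $\partial D$, $\varphi=H+O(|x|^{-1})$ as $|x|\to\infty$. Boundary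 values on $\partial D$ of fields in the exterior are limits along $x+t\nu(x)$ as $t\to0^+$, both for almost every $x\in\partial D$ and in $L^2(\partial D)$. **Theorem.** The first-order electric potential, that is, the solution $\varphi^{(1)}$ of $$\Delta\varphi^{(1)}=0\ \text{ in }\mathbb R^2\setminus\overline D,\qquad \frac{\partial\varphi^{(1)}}{\partial\nu}=f'\frac{\partial\varphi}{\partial T}-f\frac{\partial^2\varphi}{\partial\nu^2}\ \text{ on }\partial D,\qquad \varphi^{(1)}=O(|x|^{-1})\ \text{ as }|x|\to\infty,$$ exists, is unique, and is given by $$\varphi^{(1)}(x)=S_D[\phi^{(1)}](x)-S_D[\tau_D f\phi](x)+D_D[f\phi](x),\qquad x\in\mathbb R^2\setminus\overline D.$$ (In other words, a function on $\mathbb R^2\setminus\overline D$ solves this problem if and only if it is given by this formula.) -/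

import Mathlib

open Set Filter Topology MeasureTheory Asymptotics

/-- The Euclidean plane. -/
abbrev Plane : Type := EuclideanSpace ℝ (Fin 2)

noncomputable section

/-! ### Planar domains of class `C²` and the geometry of their boundary

The boundary is a simple closed curve, given by an arc-length parametrization `γ` of length `L`.
Functions on the boundary are functions of the arc length `s`. -/

/-- Unit tangent vector `T` at `γ s`. -/
def tangent (γ : ℝ → Plane) (s : ℝ) : Plane := deriv γ s

/-- Unit normal vector `ν` at `γ s`: the tangent rotated clockwise by a right angle. It is the
outward normal when the domain lies to the left of `γ`. -/
def normal (γ : ℝ → Plane) (s : ℝ) : Plane := !₂[deriv γ s 1, -(deriv γ s 0)]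

/-- Signed curvature `τ`, given by `γ'' = τ ν`. With the outward normal it is `-1 / r` on a circle
of radius `r`, which is the sign for which the line element of the curve `γ + ε f ν` is
`(1 - ε τ f) dσ + O(ε²)`. -/
def curvature (γ : ℝ → Plane) (s : ℝ) : ℝ := inner ℝ (deriv (deriv γ) s) (normal γ s)

/-- `D` is a bounded domain of class `C²` with connected exterior, and `γ` is a positively oriented
arc-length parametrization, of period `L`, of its boundary, which is a simple closed curve. -/
structure IsC2Domain (D : Set Plane) (γ : ℝ → Plane) (L : ℝ) : Prop where
  isOpen : IsOpen D
  isConnected : IsConnected D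
  isBounded : Bornology.IsBounded D
  isConnected_exterior : IsConnected (closure D)ᶜ
  length_pos : 0 < L
  contDiff : ContDiff ℝ 2 γ
  periodic : Function.Periodic γ L
  unit_speed : ∀ s, ‖deriv γ s‖ = 1
  injOn : InjOn γ (Ico 0 L)
  frontier_eq : frontier D = range γ
  inner_side : ∀ s, ∀ᶠ t in 𝓝[>] (0 : ℝ), γ s - t • normal γ s ∈ D
  outer_side : ∀ s, ∀ᶠ t in 𝓝[>] (0 : ℝ), γ s + t • normal γ s ∈ (closure D)ᶜ

/-- Arc-length measure on the boundary, in the arc-length parameter. -/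
def arcMeasure (L : ℝ) : Measure ℝ := volume.restrict (Ioc 0 L)

/-! ### Directional derivatives and boundary values -/

/-- First derivative of `u` at `x` in the direction `v`. -/
def dirDeriv (u : Plane → ℝ) (x v : Plane) : ℝ := fderiv ℝ u x v

/-- Second derivative of `u` at `x` in the direction `v`. -/
def dirDeriv₂ (u : Plane → ℝ) (x v : Plane) : ℝ := fderiv ℝ (fun z => fderiv ℝ u z v) x v

/-- `e` is the exterior boundary value of a field `F` (which may depend on the foot point `s`):
`F (γ s + t ν(s)) s` tends to `e s` as `t → 0⁺`, both for almost every `s` and in `L²`. -/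
def HasExteriorTrace (γ : ℝ → Plane) (L : ℝ) (F : Plane → ℝ → ℝ) (e : ℝ → ℝ) : Prop :=
  (∀ᵐ s ∂(arcMeasure L),
    Tendsto (fun t : ℝ => F (γ s + t • normal γ s) s) (𝓝[>] 0) (𝓝 (e s))) ∧
  Tendsto (fun t : ℝ =>
    eLpNorm (fun s => F (γ s + t • normal γ s) s - e s) 2 (arcMeasure L)) (𝓝[>] 0) (𝓝 0)

/-! ### Layer potentials -/

/-- Fundamental solution `G(x, y) = (1 / 2π) log |x - y|` of the Laplacian in the plane. -/
def green (x y : Plane) : ℝ := 1 / (2 * Real.pi) * Real.log ‖x - y‖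

/-- Single-layer potential `S[ϑ]`. -/
def singleLayer (γ : ℝ → Plane) (L : ℝ) (ϑ : ℝ → ℝ) (x : Plane) : ℝ :=
  ∫ t, green x (γ t) * ϑ t ∂(arcMeasure L)

/-- Double-layer potential `D[ϑ]`, with kernel `∂G(x, y) / ∂ν(y)`. -/
def doubleLayer (γ : ℝ → Plane) (L : ℝ) (ϑ : ℝ → ℝ) (x : Plane) : ℝ :=
  ∫ t, dirDeriv (fun y => green x y) (γ t) (normal γ t) * ϑ t ∂(arcMeasure L)

/-- The principal value `p.v. ∫ k(s, t) ϑ(t) dσ(t)` at the boundary point `γ s` exists and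
equals `v`. -/
def HasPV (γ : ℝ → Plane) (L : ℝ) (k : ℝ → ℝ → ℝ) (ϑ : ℝ → ℝ) (s v : ℝ) : Prop :=
  Tendsto (fun ε : ℝ => ∫ t in {t | ε < ‖γ s - γ t‖}, k s t * ϑ t ∂(arcMeasure L))
    (𝓝[>] 0) (𝓝 v)

/-- Kernel `∂G(x, y) / ∂ν(x)` of the Neumann-Poincaré operator `K*`, at `x = γ s`, `y = γ t`. -/
def npKernel (γ : ℝ → Plane) (s t : ℝ) : ℝ :=
  dirDeriv (fun x => green x (γ t)) (γ s) (normal γ s)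

/-- Kernel `K₁(x, y)` at `x = γ s`, `y = γ t` of the first-order term `K⁽¹⁾` of the
Neumann-Poincaré operator under the boundary perturbation `γ + ε f ν`. -/
def npKernel₁ (γ : ℝ → Plane) (f : ℝ → ℝ) (s t : ℝ) : ℝ :=
  let r : Plane := γ s - γ t
  let δ : Plane := f s • normal γ s - f t • normal γ t
  1 / (2 * Real.pi) *
    (-2 * (inner ℝ r (normal γ s) * inner ℝ r δ) / ‖r‖ ^ 4
      + inner ℝ δ (normal γ s) / ‖r‖ ^ 2
      - inner ℝ r ((curvature γ s * f s) • normal γ s + deriv f s • tangent γ s) / ‖r‖ ^ 2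
      + inner ℝ r (normal γ s) / ‖r‖ ^ 2 * (f s * curvature γ s - f t * curvature γ t))

/-! ### Densities and boundary value problems -/

/-- `φ ∈ L²(∂D)` and `(½ I + K*)[φ] = -∂H/∂ν` on `∂D`, that is `φ = -(½ I + K*)⁻¹[∂H/∂ν]`. -/
def IsZerothDensity (γ : ℝ → Plane) (L : ℝ) (H : Plane → ℝ) (φ : ℝ → ℝ) : Prop :=
  MemLp φ 2 (arcMeasure L) ∧
  ∀ᵐ s ∂(arcMeasure L), ∃ k : ℝ, HasPV γ L (npKernel γ) φ s k ∧
    1 / 2 * φ s + k = -dirDeriv H (γ s) (normal γ s)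

/-- `φ₁ ∈ L²(∂D)` and `(½ I + K*)[φ₁] = -(f ∂²H/∂ν² - f' ∂H/∂T + K⁽¹⁾[φ])` on `∂D`. -/
def IsFirstDensity (γ : ℝ → Plane) (L : ℝ) (H : Plane → ℝ) (f φ φ₁ : ℝ → ℝ) : Prop :=
  MemLp φ₁ 2 (arcMeasure L) ∧
  ∀ᵐ s ∂(arcMeasure L), ∃ k k₁ : ℝ,
    HasPV γ L (npKernel γ) φ₁ s k ∧ HasPV γ L (npKernel₁ γ f) φ s k₁ ∧
    1 / 2 * φ₁ s + k =
      -(f s * dirDeriv₂ H (γ s) (normal γ s) - deriv f s * dirDeriv H (γ s) (tangent γ s) + k₁)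

/-- `w` solves `Δw = 0` outside `closure D`, `∂w/∂ν = 0` on `∂D`, `w = H + O(|x|⁻¹)`. -/
structure IsUnperturbedPotential (D : Set Plane) (γ : ℝ → Plane) (L : ℝ) (H w : Plane → ℝ) :
    Prop where
  harmonic : InnerProductSpace.HarmonicOnNhd w (closure D)ᶜ
  neumann : HasExteriorTrace γ L (fun x s => dirDeriv w x (normal γ s)) (fun _ => 0)
  decay : (fun x => w x - H x) =O[Bornology.cobounded Plane] fun x => ‖x‖⁻¹

/-- `u` solves `Δu = 0` outside `closure D`, `∂u/∂ν = f' ∂w/∂T - f ∂²w/∂ν²` on `∂D`,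
`u = O(|x|⁻¹)`, where `w` is the unperturbed potential. -/
structure IsFirstOrderPotential (D : Set Plane) (γ : ℝ → Plane) (L : ℝ) (f : ℝ → ℝ)
    (w u : Plane → ℝ) : Prop where
  harmonic : InnerProductSpace.HarmonicOnNhd u (closure D)ᶜ
  neumann : ∃ wT wνν : ℝ → ℝ,
    HasExteriorTrace γ L (fun x s => dirDeriv w x (tangent γ s)) wT ∧
    HasExteriorTrace γ L (fun x s => dirDeriv₂ w x (normal γ s)) wνν ∧
    HasExteriorTrace γ L (fun x s => dirDeriv u x (normal γ s))
      (fun s => deriv f s * wT s - f s * wνν s)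
  decay : u =O[Bornology.cobounded Plane] fun x => ‖x‖⁻¹

end

/-!
The plane is identified with `ℂ`. The gradient of a harmonic function is then the conjugate of a
holomorphic function, and the gradients of both layer potentials become Cauchy transforms over the
boundary curve (`hasFDerivAt_singleLayer`; for the double layer after an integration by parts).
Everything asked about boundary values reduces to Cauchy integrals with densities in `L²`.

**Boundary values.** A family of functions of the arc length, indexed by the distance `ε` to the
curve, has a `TraceLim` if it converges almost everywhere and in mean square as `ε → 0⁺`. For the
Cauchy kernel `1 / (1 - exp (-z))` of the circle such limits come from the Fourier series: the
integral against a density is the Poisson integral of its projection to nonpositive frequencies,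
and Poisson integrals converge at Lebesgue points and, by Parseval, in mean square. On a curve of
class `C²` the Cauchy kernel differs from that of the circle by a bounded kernel, so Cauchy integrals
have limits too (`IsArcCurve.traceLim_cauchyInt`), and the real part gives the jump relation
(`IsArcCurve.traceLim_normal`).

**Regularity of the zeroth density.** Second derivatives of the unperturbed potential have boundary
values only if `φ` has a weak derivative in `L²` (`IsArcCurve.exists_weakDeriv`). The integral
equation for `φ` has a right-hand side of class `C¹`. Splitting a smooth kernel off from the bounded
one leaves an equation `φ + R φ = a` with `‖R‖ < 1` and with `a` weakly differentiable. By the jump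
relation, `R` together with a companion of norm less than one acts on the graph of the weak
derivative. The graph is closed, so the fixed point lies in it (`exists_partner_of_contraction`).

**The boundary condition.** By uniqueness, `w = H + S[φ]`. In complex form the kernel `K₁` is the
real part of `a / (z - c)² + b / (z - c)` at a boundary point `z`, where `a` vanishes at that point
with `a' = b c'` (`npKernel₁_eq`). Off the curve the same expression, evaluated at `z`
displaced along the normal, is what the formula for the first-order potential and the derivatives of
`w` leave after the density `φ⁽¹⁾` is taken out. The difference between the displaced kernel and the
truncated one is dominated by the Poisson kernel, and its total mass tends to zero, because after
rescaling it becomes a multiple of `(x - i)⁻²`. Hence at Lebesgue points the displaced integral tends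
to the principal value without a jump (`IsArcCurve.tendsto_integral_truncDiff_mul`), and the second
integral equation turns into the Neumann condition (`FirstOrderData.boundary_condition`).

**Decay.** The logarithmic term at infinity is the total charge of the single layers. It is the flux
of the potential, hence the integral of the Neumann datum, which is the boundary limit of an exact
derivative up to a multiple of `∂w/∂ν = 0` (`FirstOrderData.integral_first_eq`).

**Uniqueness.** No boundary values of the solution itself are given, only those of its normal
derivative. The energy identity is therefore applied to `arctan v` in place of `v`, with a cut-off
function of the distance to the boundary and one at infinity. In normal coordinates the inner cut-off
contributes at most the mean of `|∂v/∂ν|` over parallel curves, which tends to zero, and the outer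
one tends to zero by the decay of `v` (`IsC2Domain.energy_le`, `IsC2Domain.eq_zero_of_neumann`).
-/

noncomputable section

/-! ### Limits of functions of the arc length, almost everywhere and in mean square -/

/-- The functions `F ε` are square integrable for small `ε > 0` and converge to `e` as `ε → 0⁺`,
both almost everywhere and in mean square. -/
structure TraceLim {E : Type*} [NormedAddCommGroup E] (μ : Measure ℝ) (F : ℝ → ℝ → E)
    (e : ℝ → E) : Prop where
  memLp_family : ∀ᶠ ε in 𝓝[>] (0 : ℝ), MemLp (F ε) 2 μ
  ae_tendsto : ∀ᵐ s ∂μ, Tendsto (fun ε => F ε s) (𝓝[>] 0) (𝓝 (e s))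
  l2_tendsto : Tendsto (fun ε => eLpNorm (fun s => F ε s - e s) 2 μ) (𝓝[>] 0) (𝓝 0)

namespace TraceLim

variable {E : Type*} [NormedAddCommGroup E] {μ : Measure ℝ} {F G : ℝ → ℝ → E} {e e' : ℝ → E}

theorem aestronglyMeasurable (h : TraceLim μ F e) : AEStronglyMeasurable e μ := by
  obtain ⟨u, hu⟩ := exists_seq_tendsto (𝓝[>] (0 : ℝ))
  obtain ⟨N, hN⟩ := eventually_atTop.1 (hu.eventually h.memLp_family)
  refine aestronglyMeasurable_of_tendsto_ae (u := atTop) (f := fun n => F (u (n + N)))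
    (fun n => (hN _ (by omega)).1) ?_
  filter_upwards [h.ae_tendsto] with s hs
  exact (hs.comp hu).comp (tendsto_add_atTop_nat N)

theorem memLp (h : TraceLim μ F e) : MemLp e 2 μ := by
  have h1 : ∀ᶠ ε in 𝓝[>] (0 : ℝ), eLpNorm (fun s => F ε s - e s) 2 μ < 1 :=
    h.l2_tendsto.eventually (gt_mem_nhds one_pos)
  obtain ⟨ε, hε, hm⟩ := (h1.and h.memLp_family).exists
  have h2 : MemLp (fun s => F ε s - e s) 2 μ :=
    ⟨hm.1.sub h.aestronglyMeasurable, hε.trans ENNReal.one_lt_top⟩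
  have h3 : e = F ε - fun s => F ε s - e s := by ext s; simp
  rw [h3]
  exact hm.sub h2

theorem add (hF : TraceLim μ F e) (hG : TraceLim μ G e') :
    TraceLim μ (fun ε s => F ε s + G ε s) (fun s => e s + e' s) where
  memLp_family := by
    filter_upwards [hF.memLp_family, hG.memLp_family] with ε h1 h2 using h1.add h2
  ae_tendsto := by
    filter_upwards [hF.ae_tendsto, hG.ae_tendsto] with s h1 h2 using h1.add h2
  l2_tendsto := by
    have h := hF.l2_tendsto.add hG.l2_tendsto
    rw [add_zero] at h
    refine tendsto_of_tendsto_of_tendsto_of_le_of_le' tendsto_const_nhds h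
      (Eventually.of_forall fun _ => zero_le) ?_
    filter_upwards [hF.memLp_family, hG.memLp_family] with ε h1 h2
    have : (fun s => F ε s + G ε s - (e s + e' s)) =
      (fun s => F ε s - e s) + fun s => G ε s - e' s := by
      ext s; simp only [Pi.add_apply]; abel
    rw [this]
    exact eLpNorm_add_le (h1.1.sub hF.aestronglyMeasurable) (h2.1.sub hG.aestronglyMeasurable)
      one_le_two

/-- Multiplication by a bounded function, also with values in another space. -/
theorem comp_bound {E' : Type*} [NormedAddCommGroup E'] (hF : TraceLim μ F e) (A : ℝ → E → E')
    (C : ℝ) (hA : ∀ s, Continuous (A s)) (hAm : ∀ g : ℝ → E, AEStronglyMeasurable g μ →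
      AEStronglyMeasurable (fun s => A s (g s)) μ)
    (hC : ∀ᵐ s ∂μ, ∀ x y, ‖A s x - A s y‖ ≤ C * ‖x - y‖) (h0 : ∀ s, A s 0 = 0) :
    TraceLim μ (fun ε s => A s (F ε s)) (fun s => A s (e s)) where
  memLp_family := by
    filter_upwards [hF.memLp_family] with ε h1
    refine MemLp.of_le_mul (c := C) h1 (hAm _ h1.1) ?_
    filter_upwards [hC] with s hs
    simpa [h0] using hs (F ε s) 0
  ae_tendsto := by
    filter_upwards [hF.ae_tendsto] with s h1 using ((hA s).tendsto _).comp h1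
  l2_tendsto := by
    have h : Tendsto (fun ε => ENNReal.ofReal C * eLpNorm (fun s => F ε s - e s) 2 μ)
        (𝓝[>] 0) (𝓝 (ENNReal.ofReal C * 0)) :=
      ENNReal.Tendsto.const_mul hF.l2_tendsto (Or.inr ENNReal.ofReal_ne_top)
    rw [mul_zero] at h
    refine tendsto_of_tendsto_of_tendsto_of_le_of_le' tendsto_const_nhds h
      (Eventually.of_forall fun _ => zero_le) (Eventually.of_forall fun ε => ?_)
    refine eLpNorm_le_mul_eLpNorm_of_ae_le_mul ?_ 2
    filter_upwards [hC] with s hs using hs _ _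

theorem congr (hF : TraceLim μ F e) (h1 : ∀ᶠ ε in 𝓝[>] (0 : ℝ), ∀ᵐ s ∂μ, G ε s = F ε s)
    (h2 : ∀ᵐ s ∂μ, ∀ᶠ ε in 𝓝[>] (0 : ℝ), G ε s = F ε s) (h3 : ∀ᵐ s ∂μ, e' s = e s) :
    TraceLim μ G e' where
  memLp_family := by
    filter_upwards [hF.memLp_family, h1] with ε h h'
    exact (memLp_congr_ae h').2 h
  ae_tendsto := by
    filter_upwards [hF.ae_tendsto, h2, h3] with s h h' h''
    rw [h'', tendsto_congr' h']; exact h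
  l2_tendsto := by
    refine hF.l2_tendsto.congr' ?_
    filter_upwards [h1] with ε h
    refine eLpNorm_congr_ae ?_
    filter_upwards [h, h3] with s hs hs'
    rw [hs, hs']

theorem congr_limit (hF : TraceLim μ F e) (h3 : ∀ᵐ s ∂μ, e' s = e s) : TraceLim μ F e' :=
  hF.congr (Eventually.of_forall fun _ => Eventually.of_forall fun _ => rfl)
    (Eventually.of_forall fun _ => Eventually.of_forall fun _ => rfl) h3

/-- It suffices that the two families agree on a set carrying the measure, for all small `ε`. -/
theorem congr_of_forall (hF : TraceLim μ F e) {ε₀ : ℝ} (hε₀ : 0 < ε₀) {S : Set ℝ}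
    (hS : ∀ᵐ s ∂μ, s ∈ S) (h : ∀ ε, 0 < ε → ε < ε₀ → ∀ s ∈ S, G ε s = F ε s)
    (h3 : ∀ᵐ s ∂μ, e' s = e s) : TraceLim μ G e' := by
  have hm : ∀ᶠ ε in 𝓝[>] (0 : ℝ), 0 < ε ∧ ε < ε₀ := Ioo_mem_nhdsGT hε₀
  refine hF.congr ?_ ?_ h3
  · filter_upwards [hm] with ε hε
    filter_upwards [hS] with s hs using h ε hε.1 hε.2 s hs
  · filter_upwards [hS] with s hs
    filter_upwards [hm] with ε hε using h ε hε.1 hε.2 s hs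

/-- A bounded family that converges almost everywhere converges in mean square. -/
theorem of_bounded [IsFiniteMeasure μ] (C : ℝ)
    (hm : ∀ᶠ ε in 𝓝[>] (0 : ℝ), AEStronglyMeasurable (F ε) μ)
    (hb : ∀ᶠ ε in 𝓝[>] (0 : ℝ), ∀ᵐ s ∂μ, ‖F ε s‖ ≤ C)
    (h : ∀ᵐ s ∂μ, Tendsto (fun ε => F ε s) (𝓝[>] 0) (𝓝 (e s))) : TraceLim μ F e where
  memLp_family := by
    filter_upwards [hm, hb] with ε h1 h2 using MemLp.of_bound h1 C h2
  ae_tendsto := h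
  l2_tendsto := by
    have hem : AEStronglyMeasurable e μ := by
      obtain ⟨u, hu⟩ := exists_seq_tendsto (𝓝[>] (0 : ℝ))
      obtain ⟨N, hN⟩ := eventually_atTop.1 (hu.eventually hm)
      refine aestronglyMeasurable_of_tendsto_ae (u := atTop) (f := fun n => F (u (n + N)))
        (fun n => (hN _ (by omega))) ?_
      filter_upwards [h] with s hs
      exact (hs.comp hu).comp (tendsto_add_atTop_nat N)
    have heb : ∀ᵐ s ∂μ, ‖e s‖ ≤ C := by
      obtain ⟨u, hu⟩ := exists_seq_tendsto (𝓝[>] (0 : ℝ))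
      obtain ⟨N, hN⟩ := eventually_atTop.1 (hu.eventually hb)
      have : ∀ᵐ s ∂μ, ∀ n, ‖F (u (n + N)) s‖ ≤ C := ae_all_iff.2 fun n => hN _ (by omega)
      filter_upwards [h, this] with s hs hs'
      exact le_of_tendsto ((hs.comp hu).comp (tendsto_add_atTop_nat N)).norm
        (Eventually.of_forall hs')
    have key : Tendsto (fun ε => ∫⁻ s, ‖F ε s - e s‖ₑ ^ (2 : ℝ) ∂μ) (𝓝[>] 0) (𝓝 0) := by
      refine tendsto_of_seq_tendsto fun u hu => ?_
      obtain ⟨N, hN⟩ := eventually_atTop.1 (hu.eventually (hm.and hb))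
      refine (tendsto_add_atTop_iff_nat N).1 ?_
      have := tendsto_lintegral_of_dominated_convergence' (μ := μ)
        (F := fun n s => ‖F (u (n + N)) s - e s‖ₑ ^ (2 : ℝ)) (f := fun _ => 0)
        (fun _ => ENNReal.ofReal (2 * C) ^ (2 : ℝ)) ?_ ?_ ?_ ?_
      · simpa using this
      · intro n
        exact (((hN (n + N) (by omega)).1.sub hem).enorm).pow_const _
      · intro n
        filter_upwards [(hN (n + N) (by omega)).2, heb] with s h2 h3
        gcongr
        rw [← ofReal_norm]
        exact ENNReal.ofReal_le_ofReal ((norm_sub_le _ _).trans (by linarith))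
      · simp only [lintegral_const]
        exact ENNReal.mul_ne_top (ENNReal.rpow_ne_top_of_nonneg (by norm_num)
          ENNReal.ofReal_ne_top) (measure_ne_top _ _)
      · filter_upwards [h] with s hs
        have h1 : Tendsto (fun n => ‖F (u (n + N)) s - e s‖ₑ) atTop (𝓝 0) := by
          have := (((hs.comp hu).comp (tendsto_add_atTop_nat N)).sub_const (e s)).enorm
          simpa using this
        have := (ENNReal.continuous_rpow_const (y := (2 : ℝ))).tendsto 0 |>.comp h1
        simpa [Function.comp_def] using this
    have h2 := ((ENNReal.continuous_rpow_const (y := (1 / 2 : ℝ))).tendsto 0).comp key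
    refine (h2.congr fun ε => ?_).trans (by simp)
    simp [eLpNorm_eq_lintegral_rpow_enorm_toReal]

theorem tendsto_integral [NormedSpace ℝ E] [IsFiniteMeasure μ]
    (hF : TraceLim μ F e) : Tendsto (fun ε => ∫ s, F ε s ∂μ) (𝓝[>] 0) (𝓝 (∫ s, e s ∂μ)) := by
  refine tendsto_integral_of_L1' e hF.aestronglyMeasurable ?_ ?_
  · filter_upwards [hF.memLp_family] with ε h using h.integrable one_le_two
  · have h : Tendsto (fun ε => eLpNorm (fun s => F ε s - e s) 2 μ * μ univ ^ (1 / 2 : ℝ))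
        (𝓝[>] 0) (𝓝 0) := by
      have := ENNReal.Tendsto.mul_const (b := μ univ ^ (1 / 2 : ℝ)) hF.l2_tendsto
        (Or.inr (ENNReal.rpow_ne_top_of_nonneg (by norm_num) (measure_ne_top _ _)))
      simpa using this
    refine tendsto_of_tendsto_of_tendsto_of_le_of_le' tendsto_const_nhds h
      (Eventually.of_forall fun _ => zero_le) ?_
    filter_upwards [hF.memLp_family] with ε h1
    have := eLpNorm_le_eLpNorm_mul_rpow_measure_univ (p := 1) (q := 2) one_le_two
      (h1.1.sub hF.aestronglyMeasurable)
    refine le_trans (le_of_eq ?_) (this.trans (le_of_eq ?_))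
    · rfl
    · norm_num; rfl

end TraceLim

namespace TraceLim

variable {𝕜 : Type*} [RCLike 𝕜] {μ : Measure ℝ} {F G : ℝ → ℝ → 𝕜} {e e' : ℝ → 𝕜}

theorem bdd_mul (hF : TraceLim μ F e) {m : ℝ → 𝕜} {C : ℝ} (hm : AEStronglyMeasurable m μ)
    (hC : ∀ s, ‖m s‖ ≤ C) : TraceLim μ (fun ε s => m s * F ε s) (fun s => m s * e s) := by
  refine hF.comp_bound (fun s x => m s * x) C (fun s => by fun_prop) (fun g hg => hm.mul hg)
    (Eventually.of_forall fun s x y => ?_) (by simp)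
  rw [← mul_sub, norm_mul]
  exact mul_le_mul_of_nonneg_right (hC s) (norm_nonneg _)

theorem const_mul (hF : TraceLim μ F e) (c : 𝕜) :
    TraceLim μ (fun ε s => c * F ε s) (fun s => c * e s) :=
  hF.bdd_mul (C := ‖c‖) aestronglyMeasurable_const fun _ => le_rfl

theorem neg (hF : TraceLim μ F e) : TraceLim μ (fun ε s => -F ε s) (fun s => -e s) := by
  simpa using hF.const_mul (-1)

theorem sub (hF : TraceLim μ F e) (hG : TraceLim μ G e') :
    TraceLim μ (fun ε s => F ε s - G ε s) (fun s => e s - e' s) := by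
  simpa [sub_eq_add_neg] using hF.add hG.neg

theorem re (hF : TraceLim μ F e) :
    TraceLim μ (fun ε s => RCLike.re (F ε s)) (fun s => RCLike.re (e s)) := by
  refine hF.comp_bound (fun s x => RCLike.re x) 1 (fun s => RCLike.continuous_re)
    (fun g hg => RCLike.continuous_re.comp_aestronglyMeasurable hg)
    (Eventually.of_forall fun s x y => ?_) (by simp)
  rw [← map_sub, one_mul]
  exact RCLike.norm_re_le_norm _

/-- A factor that tends to zero with `ε`. -/
theorem vanish (hF : TraceLim μ F e) {m : ℝ → 𝕜} {C : ℝ} (hm : AEStronglyMeasurable m μ)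
    (hC : ∀ s, ‖m s‖ ≤ C) :
    TraceLim μ (fun ε s => ((ε : ℝ) : 𝕜) * (m s * F ε s)) (fun _ => 0) := by
  have h := hF.bdd_mul hm hC
  have hε : Tendsto (fun ε : ℝ => ((ε : ℝ) : 𝕜)) (𝓝[>] 0) (𝓝 0) := by
    have := (RCLike.continuous_ofReal (K := 𝕜)).tendsto (0 : ℝ)
    simpa using this.mono_left nhdsWithin_le_nhds
  refine ⟨?_, ?_, ?_⟩
  · filter_upwards [h.memLp_family] with ε h1 using h1.const_mul _
  · filter_upwards [h.ae_tendsto] with s h1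
    simpa using hε.mul h1
  · have h1 : Tendsto (fun ε : ℝ => ‖((ε : ℝ) : 𝕜)‖ₑ *
        (eLpNorm (fun s => m s * F ε s - m s * e s) 2 μ + eLpNorm (fun s => m s * e s) 2 μ))
        (𝓝[>] 0) (𝓝 (0 * (0 + eLpNorm (fun s => m s * e s) 2 μ))) := by
      refine ENNReal.Tendsto.mul ?_ (Or.inr (by simpa using h.memLp.2.ne))
        (h.l2_tendsto.add_const _) (Or.inr (by simp))
      simpa using hε.enorm
    rw [zero_mul] at h1
    refine tendsto_of_tendsto_of_tendsto_of_le_of_le' tendsto_const_nhds h1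
      (Eventually.of_forall fun _ => zero_le) ?_
    filter_upwards [h.memLp_family] with ε h2
    have h3 : (fun s => ((ε : ℝ) : 𝕜) * (m s * F ε s) - 0) =
        (((ε : ℝ) : 𝕜)) • ((fun s => m s * F ε s - m s * e s) + fun s => m s * e s) := by
      ext s; simp
    rw [h3, eLpNorm_const_smul]
    gcongr
    exact eLpNorm_add_le (h2.1.sub h.aestronglyMeasurable) h.aestronglyMeasurable one_le_two

/-- Integral operators whose kernels are uniformly bounded and converge almost everywhere. -/
theorem of_bounded_kernel [IsFiniteMeasure μ] {b : ℝ → ℝ → ℝ → 𝕜} {b₀ : ℝ → ℝ → 𝕜} {C ε₀ : ℝ}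
    {h : ℝ → 𝕜} (hε₀ : 0 < ε₀) {S : Set ℝ} (hS : ∀ᵐ s ∂μ, s ∈ S) (hh : Integrable h μ)
    (hm : ∀ ε, 0 < ε → ε < ε₀ → Measurable (Function.uncurry (b ε)))
    (hb : ∀ ε, 0 < ε → ε < ε₀ → ∀ s ∈ S, ∀ t ∈ S, ‖b ε s t‖ ≤ C)
    (hl : ∀ s ∈ S, ∀ᵐ t ∂μ, Tendsto (fun ε => b ε s t) (𝓝[>] 0) (𝓝 (b₀ s t))) :
    TraceLim μ (fun ε s => ∫ t, b ε s t * h t ∂μ) (fun s => ∫ t, b₀ s t * h t ∂μ) := by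
  have hr : ∀ᶠ ε in 𝓝[>] (0 : ℝ), 0 < ε ∧ ε < ε₀ := Ioo_mem_nhdsGT hε₀
  refine of_bounded (C * ∫ t, ‖h t‖ ∂μ) ?_ ?_ ?_
  · filter_upwards [hr] with ε hε
    have h1 : AEStronglyMeasurable (fun p : ℝ × ℝ => b ε p.1 p.2 * h p.2) (μ.prod μ) :=
      (hm ε hε.1 hε.2).aestronglyMeasurable.mul hh.1.comp_snd
    exact h1.integral_prod_right'
  · filter_upwards [hr] with ε hε
    filter_upwards [hS] with s hs
    rw [← integral_const_mul]
    refine norm_integral_le_of_norm_le (hh.norm.const_mul C) ?_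
    filter_upwards [hS] with t ht
    rw [norm_mul]
    exact mul_le_mul_of_nonneg_right (hb ε hε.1 hε.2 s hs t ht) (norm_nonneg _)
  · filter_upwards [hS] with s hs
    refine tendsto_integral_filter_of_dominated_convergence (fun t => C * ‖h t‖) ?_ ?_
      (hh.norm.const_mul C) ?_
    · filter_upwards [hr] with ε hε
      exact ((hm ε hε.1 hε.2).comp measurable_prodMk_left).aestronglyMeasurable.mul hh.1
    · filter_upwards [hr] with ε hε
      filter_upwards [hS] with t ht
      rw [norm_mul]
      exact mul_le_mul_of_nonneg_right (hb ε hε.1 hε.2 s hs t ht) (norm_nonneg _)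
    · filter_upwards [hl s hs] with t ht using ht.mul_const _

end TraceLim

instance arcMeasure_isFinite (L : ℝ) : IsFiniteMeasure (arcMeasure L) := by
  unfold arcMeasure; infer_instance

theorem TraceLim.hasExteriorTrace {γ : ℝ → Plane} {L : ℝ} {F : Plane → ℝ → ℝ} {e : ℝ → ℝ}
    (h : TraceLim (arcMeasure L) (fun ε s => F (γ s + ε • normal γ s) s) e) :
    HasExteriorTrace γ L F e := ⟨h.ae_tendsto, h.l2_tendsto⟩

/-! ### Lebesgue points and kernels dominated by the Poisson kernel -/

/-- `s` is a Lebesgue point of `h` in the form in which it is used: the Poisson means of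
`‖h - h s‖` at `s` tend to zero. -/
def IsPoissonPoint {E : Type*} [NormedAddCommGroup E] (L : ℝ) (h : ℝ → E) (s : ℝ) : Prop :=
  Tendsto (fun ε : ℝ => ∫ t, ε / (ε ^ 2 + (s - t) ^ 2) * ‖h t - h s‖ ∂(arcMeasure L))
    (𝓝[>] 0) (𝓝 0)

/-- The Poisson kernel is dominated by a geometric series of indicators of dyadic balls. -/
theorem poisson_le_dyadic {ε u : ℝ} (hε : 0 < ε) :
    ∃ k : ℕ, |u| < 2 ^ k * ε ∧ ε / (ε ^ 2 + u ^ 2) ≤ 4 * (1 / 4) ^ k / ε := by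
  have hex : ∃ k : ℕ, |u| < 2 ^ k * ε := by
    obtain ⟨k, hk⟩ := pow_unbounded_of_one_lt (|u| / ε) (one_lt_two : (1 : ℝ) < 2)
    exact ⟨k, by rwa [div_lt_iff₀ hε] at hk⟩
  classical
  refine ⟨Nat.find hex, Nat.find_spec hex, ?_⟩
  rcases hk : Nat.find hex with _ | k
  · have : ε / (ε ^ 2 + u ^ 2) ≤ 1 / ε := by
      rw [div_le_div_iff₀ (by positivity) hε]; nlinarith [sq_nonneg u]
    refine this.trans ?_
    gcongr
    norm_num
  · have h1 : ¬ |u| < 2 ^ k * ε := Nat.find_min hex (by omega)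
    push Not at h1
    have h2 : (2 ^ k * ε) ^ 2 ≤ u ^ 2 := by
      rw [← sq_abs u]; gcongr
    rw [div_le_div_iff₀ (by positivity) hε]
    have h3 : (1 / 4 : ℝ) ^ (k + 1) * 4 * (2 ^ k * ε) ^ 2 = ε ^ 2 := by
      rw [mul_pow, ← pow_mul, mul_comm k 2, pow_mul, pow_succ]
      have : (1 / 4 : ℝ) ^ k * (2 ^ 2) ^ k = 1 := by rw [← mul_pow]; norm_num
      linear_combination ε ^ 2 * this
    have h4 : 0 ≤ (1 / 4 : ℝ) ^ (k + 1) := by positivity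
    nlinarith [mul_le_mul_of_nonneg_left h2 h4, mul_nonneg h4 (sq_nonneg ε)]

/-- If the averages of `g` over small balls centred at `s` are small, then so is its integral against
the Poisson kernel: the kernel is dominated by a geometric sum of normalized indicators of balls. -/
theorem lintegral_poisson_le {g : ℝ → ENNReal} (hg : AEMeasurable g volume) {s r₀ η ε : ℝ}
    (hε : 0 < ε) (hη : 0 ≤ η) (h : ∀ r, 0 < r → r ≤ r₀ →
      ∫⁻ t in Metric.ball s r, g t ≤ ENNReal.ofReal (η * r)) (hr₀ : 0 < r₀) :
    ∫⁻ t in Metric.ball s r₀, ENNReal.ofReal (ε / (ε ^ 2 + (s - t) ^ 2)) * g t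
      ≤ ENNReal.ofReal (8 * η) := by
  have h1 : ∀ t, ENNReal.ofReal (ε / (ε ^ 2 + (s - t) ^ 2)) * g t ≤
      ∑' k : ℕ, ENNReal.ofReal (4 * (1 / 4) ^ k / ε) *
        (Metric.ball s (2 ^ k * ε)).indicator g t := by
    intro t
    obtain ⟨k, hk, hk'⟩ := poisson_le_dyadic (u := s - t) hε
    refine le_trans ?_ (ENNReal.le_tsum k)
    rw [indicator_of_mem (by rw [Metric.mem_ball, Real.dist_eq, abs_sub_comm]; exact hk)]
    gcongr
  have h2 : ∀ k : ℕ, ∫⁻ t in Metric.ball s r₀, (Metric.ball s (2 ^ k * ε)).indicator g t ≤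
      ENNReal.ofReal (η * (2 ^ k * ε)) := by
    intro k
    rw [lintegral_indicator Metric.isOpen_ball.measurableSet,
      Measure.restrict_restrict Metric.isOpen_ball.measurableSet]
    rcases le_total (2 ^ k * ε) r₀ with hle | hle
    · refine le_trans (lintegral_mono_set inter_subset_left) (h _ (by positivity) hle)
    · refine le_trans (lintegral_mono_set inter_subset_right) ((h _ hr₀ le_rfl).trans ?_)
      gcongr
  calc _ ≤ ∫⁻ t in Metric.ball s r₀, ∑' k : ℕ, ENNReal.ofReal (4 * (1 / 4) ^ k / ε) *
        (Metric.ball s (2 ^ k * ε)).indicator g t := lintegral_mono h1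
    _ = ∑' k : ℕ, ENNReal.ofReal (4 * (1 / 4) ^ k / ε) * ∫⁻ t in Metric.ball s r₀,
        (Metric.ball s (2 ^ k * ε)).indicator g t := by
      rw [lintegral_tsum]
      · congr 1; ext k
        rw [lintegral_const_mul' _ _ ENNReal.ofReal_ne_top]
      · intro k
        exact (hg.restrict.indicator Metric.isOpen_ball.measurableSet).const_mul _
    _ ≤ ∑' k : ℕ, ENNReal.ofReal (4 * η * (1 / 2) ^ k) := by
      refine ENNReal.tsum_le_tsum fun k => ?_
      refine (mul_le_mul_right (h2 k) _).trans ?_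
      rw [← ENNReal.ofReal_mul (by positivity)]
      refine ENNReal.ofReal_le_ofReal (le_of_eq ?_)
      have : (1 / 4 : ℝ) ^ k * 2 ^ k = (1 / 2) ^ k := by rw [← mul_pow]; norm_num
      rw [← this]; field_simp
    _ = ENNReal.ofReal (8 * η) := by
      rw [← ENNReal.ofReal_tsum_of_nonneg (fun k => by positivity)
        (summable_geometric_two.mul_left _), tsum_mul_left, tsum_geometric_two]
      congr 1; ring

/-- Away from `s` the Poisson kernel tends to zero uniformly, so only the small averages near `s`
matter in the limit. -/
theorem tendsto_lintegral_poisson {g : ℝ → ENNReal} (hg : AEMeasurable g volume) {s : ℝ}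
    (h : ∀ η : ℝ, 0 < η → ∃ r₀ : ℝ, 0 < r₀ ∧ ∀ r, 0 < r → r ≤ r₀ →
      ∫⁻ t in Metric.ball s r, g t ≤ ENNReal.ofReal (η * r)) (hfin : ∫⁻ t, g t ≠ ⊤) :
    Tendsto (fun ε : ℝ => ∫⁻ t, ENNReal.ofReal (ε / (ε ^ 2 + (s - t) ^ 2)) * g t)
      (𝓝[>] 0) (𝓝 0) := by
  rw [ENNReal.tendsto_nhds_zero]
  intro δ hδ
  obtain ⟨η, hη, hηδ⟩ : ∃ η : ℝ, 0 < η ∧ ENNReal.ofReal (8 * η) ≤ δ / 2 := by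
    rcases eq_or_ne δ ⊤ with rfl | hδt
    · exact ⟨1, one_pos, by simp [ENNReal.top_div]⟩
    · have hδ2 : 0 < δ.toReal := ENNReal.toReal_pos hδ.ne' hδt
      refine ⟨δ.toReal / 16, by positivity, ?_⟩
      rw [show 8 * (δ.toReal / 16) = δ.toReal / 2 by ring, ENNReal.ofReal_div_of_pos two_pos,
        ENNReal.ofReal_toReal hδt]
      simp
  obtain ⟨r₀, hr₀, hr⟩ := h η hη
  have h3 : Tendsto (fun ε : ℝ => ENNReal.ofReal (ε / r₀ ^ 2) * ∫⁻ t, g t) (𝓝[>] 0)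
      (𝓝 (ENNReal.ofReal (0 / r₀ ^ 2) * ∫⁻ t, g t)) := by
    refine ENNReal.Tendsto.mul_const ?_ (Or.inr hfin)
    refine ENNReal.tendsto_ofReal ?_
    exact (tendsto_id.mono_left nhdsWithin_le_nhds).div_const _
  simp only [zero_div, ENNReal.ofReal_zero, zero_mul] at h3
  have hδ' : 0 < δ / 2 := ENNReal.half_pos hδ.ne'
  filter_upwards [self_mem_nhdsWithin, (ENNReal.tendsto_nhds_zero.1 h3) _ hδ'] with ε hε hε2
  rw [mem_Ioi] at hε
  rw [← lintegral_add_compl _ (Metric.isOpen_ball (x := s) (ε := r₀)).measurableSet]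
  have hfar : ∫⁻ t in (Metric.ball s r₀)ᶜ, ENNReal.ofReal (ε / (ε ^ 2 + (s - t) ^ 2)) * g t ≤
      ENNReal.ofReal (ε / r₀ ^ 2) * ∫⁻ t, g t := by
    rw [← lintegral_const_mul' _ _ ENNReal.ofReal_ne_top]
    refine (setLIntegral_mono' Metric.isOpen_ball.measurableSet.compl fun t ht => ?_).trans
      (setLIntegral_le_lintegral _ _)
    have h4 : r₀ ≤ |s - t| := by
      rw [mem_compl_iff, Metric.mem_ball, Real.dist_eq, abs_sub_comm] at ht; linarith
    have : r₀ ^ 2 ≤ ε ^ 2 + (s - t) ^ 2 := by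
      rw [← sq_abs (s - t)]; nlinarith
    gcongr
  calc _ ≤ δ / 2 + δ / 2 := add_le_add
        ((lintegral_poisson_le hg hε hη.le hr hr₀).trans hηδ) (hfar.trans hε2)
    _ = δ := ENNReal.add_halves δ

/-- The Lebesgue differentiation theorem. -/
theorem ae_isPoissonPoint {E : Type*} [NormedAddCommGroup E] {L : ℝ} {h : ℝ → E}
    (hh : Integrable h (arcMeasure L)) : ∀ᵐ s ∂(arcMeasure L), IsPoissonPoint L h s := by
  have hi : Integrable ((Ioc 0 L).indicator h) volume :=
    (integrable_indicator_iff measurableSet_Ioc).2 hh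
  have h1 := IsUnifLocDoublingMeasure.ae_tendsto_average_norm_sub (volume : Measure ℝ)
    hi.locallyIntegrable 1
  have hS : ∀ᵐ s ∂(arcMeasure L), s ∈ Ioo 0 L := by
    unfold arcMeasure
    rw [← restrict_Ioo_eq_restrict_Ioc]
    exact ae_restrict_mem measurableSet_Ioo
  have h1' : ∀ᵐ s ∂(arcMeasure L), _ := ae_restrict_of_ae (s := Ioc 0 L) h1
  filter_upwards [h1', hS] with s hs hsm
  unfold IsPoissonPoint
  have hsE : (Ioc 0 L).indicator h s = h s := indicator_of_mem (Ioo_subset_Ioc_self hsm) h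
  set g : ℝ → ENNReal := (Ioc 0 L).indicator fun t => ‖h t - h s‖ₑ with hgdef
  have hgi : IntegrableOn (fun t => h t - h s) (Ioc 0 L) :=
    Integrable.sub hh (integrable_const _)
  have hgm : AEMeasurable g volume := by
    refine (aemeasurable_indicator_iff measurableSet_Ioc).2 ?_
    exact hgi.1.enorm
  have hfin : ∫⁻ t, g t ≠ ⊤ := by
    rw [hgdef, lintegral_indicator measurableSet_Ioc]
    exact hgi.2.ne
  have key := tendsto_lintegral_poisson hgm (s := s) ?_ hfin
  · have h2 := (ENNReal.tendsto_toReal ENNReal.zero_ne_top).comp key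
    rw [ENNReal.toReal_zero] at h2
    refine h2.congr' ?_
    filter_upwards [self_mem_nhdsWithin] with ε hε
    rw [mem_Ioi] at hε
    have hp : ∀ t, 0 ≤ ε / (ε ^ 2 + (s - t) ^ 2) := fun t => by positivity
    rw [integral_eq_lintegral_of_nonneg_ae
      (Eventually.of_forall fun t => mul_nonneg (hp t) (norm_nonneg _))]
    · simp only [Function.comp_apply]
      congr 1
      unfold arcMeasure
      rw [← lintegral_indicator measurableSet_Ioc]
      refine lintegral_congr fun t => ?_
      by_cases ht : t ∈ Ioc 0 L
      · rw [hgdef, indicator_of_mem ht, indicator_of_mem ht, ENNReal.ofReal_mul (hp t), ofReal_norm]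
      · rw [hgdef, indicator_of_notMem ht, indicator_of_notMem ht, mul_zero]
    · refine AEStronglyMeasurable.mul ?_ hgi.1.norm
      exact (Measurable.aestronglyMeasurable (by fun_prop))
  · intro η hη
    have h2 := hs (l := 𝓝[>] (0 : ℝ)) (fun _ => s) (fun r => r) tendsto_id (by
      filter_upwards [self_mem_nhdsWithin] with r hr
      simp only [one_mul]
      exact Metric.mem_closedBall_self (le_of_lt hr))
    have h3 := (h2.eventually (gt_mem_nhds (half_pos hη)))
    rw [eventually_nhdsWithin_iff, Metric.eventually_nhds_iff] at h3
    obtain ⟨r₁, hr₁, h3⟩ := h3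
    obtain ⟨r₂, hr₂, hr₂s⟩ : ∃ r₂ > 0, Metric.ball s r₂ ⊆ Ioo 0 L :=
      Metric.isOpen_iff.1 isOpen_Ioo s hsm
    refine ⟨min (r₁ / 2) (r₂ / 2), by positivity, fun r hr hrle => ?_⟩
    have hr1 : r < r₁ := by have := min_le_left (r₁ / 2) (r₂ / 2); linarith
    have hr2 : r < r₂ := by have := min_le_right (r₁ / 2) (r₂ / 2); linarith
    have h4 := h3 (by simpa [Real.dist_eq, abs_of_pos hr] using hr1 : dist r 0 < r₁) hr
    rw [setAverage_eq, Real.volume_real_closedBall hr.le, smul_eq_mul, inv_mul_lt_iff₀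
      (by positivity)] at h4
    have hint : IntegrableOn (fun t => ‖(Ioc 0 L).indicator h t - (Ioc 0 L).indicator h s‖)
        (Metric.closedBall s r) := by
      refine Integrable.norm (Integrable.sub hi.integrableOn ?_)
      exact integrableOn_const measure_closedBall_lt_top.ne
    calc ∫⁻ t in Metric.ball s r, g t
        ≤ ∫⁻ t in Metric.closedBall s r,
          ‖(Ioc 0 L).indicator h t - (Ioc 0 L).indicator h s‖ₑ := by
          refine (setLIntegral_mono' Metric.isOpen_ball.measurableSet fun t ht => ?_).trans
            (lintegral_mono_set Metric.ball_subset_closedBall)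
          have : t ∈ Ioc 0 L := Ioo_subset_Ioc_self (hr₂s (Metric.ball_subset_ball hr2.le ht))
          rw [hgdef, indicator_of_mem this, indicator_of_mem this, hsE]
      _ = ENNReal.ofReal (∫ t in Metric.closedBall s r,
          ‖(Ioc 0 L).indicator h t - (Ioc 0 L).indicator h s‖) := by
          rw [ofReal_integral_eq_lintegral_ofReal hint
            (Eventually.of_forall fun t => norm_nonneg _)]
          simp only [ofReal_norm]
      _ ≤ ENNReal.ofReal (η * r) := ENNReal.ofReal_le_ofReal (by linarith)

/-- At a Lebesgue point, a family of kernels dominated by the Poisson kernel acts in the limit like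
multiplication by the limit of its total mass. -/
theorem IsPoissonPoint.tendsto_integral {𝕜 : Type*} [RCLike 𝕜] {L : ℝ} {h : ℝ → 𝕜} {s : ℝ}
    (hs : IsPoissonPoint L h s) (hh : Integrable h (arcMeasure L)) {N : ℝ → ℝ → 𝕜} {C ε₀ : ℝ}
    {m : 𝕜} (hε₀ : 0 < ε₀)
    (hNm : ∀ ε, 0 < ε → ε < ε₀ → AEStronglyMeasurable (N ε) (arcMeasure L))
    (hN : ∀ ε, 0 < ε → ε < ε₀ → ∀ᵐ t ∂(arcMeasure L), ‖N ε t‖ ≤ C * (ε / (ε ^ 2 + (s - t) ^ 2)))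
    (hm : Tendsto (fun ε => ∫ t, N ε t ∂(arcMeasure L)) (𝓝[>] 0) (𝓝 m)) :
    Tendsto (fun ε => ∫ t, N ε t * h t ∂(arcMeasure L)) (𝓝[>] 0) (𝓝 (m * h s)) := by
  have hr : ∀ᶠ ε in 𝓝[>] (0 : ℝ), 0 < ε ∧ ε < ε₀ := Ioo_mem_nhdsGT hε₀
  have hb : ∀ ε, 0 < ε → ε < ε₀ → ∀ᵐ t ∂(arcMeasure L), ‖N ε t‖ ≤ |C| / ε := by
    intro ε h0 h1
    filter_upwards [hN ε h0 h1] with t ht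
    refine ht.trans ?_
    have : ε / (ε ^ 2 + (s - t) ^ 2) ≤ 1 / ε := by
      rw [div_le_div_iff₀ (by positivity) h0]; nlinarith [sq_nonneg (s - t)]
    calc _ ≤ |C| * (1 / ε) := mul_le_mul (le_abs_self C) this (by positivity) (abs_nonneg _)
      _ = _ := by ring
  have hdi : Integrable (fun t => h t - h s) (arcMeasure L) := hh.sub (integrable_const _)
  have h1 : Tendsto (fun ε => ∫ t, N ε t * (h t - h s) ∂(arcMeasure L)) (𝓝[>] 0) (𝓝 0) := by
    refine squeeze_zero_norm' ?_ (by simpa using hs.const_mul C)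
    filter_upwards [hr] with ε hε
    rw [← integral_const_mul]
    refine norm_integral_le_of_norm_le (Integrable.const_mul ?_ _) ?_
    · refine hdi.norm.bdd_mul (c := 1 / ε)
        (Measurable.aestronglyMeasurable (by fun_prop)) (Eventually.of_forall fun t => ?_)
      have h0 := hε.1
      rw [Real.norm_of_nonneg (by positivity), div_le_div_iff₀ (by positivity) h0]
      nlinarith [sq_nonneg (s - t)]
    · filter_upwards [hN ε hε.1 hε.2] with t ht
      rw [norm_mul, ← mul_assoc]
      exact mul_le_mul_of_nonneg_right ht (norm_nonneg _)
  have h2 := h1.add (hm.mul_const (h s))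
  rw [zero_add] at h2
  refine h2.congr' ?_
  filter_upwards [hr] with ε hε
  have hNi : Integrable (N ε) (arcMeasure L) :=
    (integrable_const (|C| / ε)).mono' (hNm ε hε.1 hε.2) (hb ε hε.1 hε.2)
  rw [← integral_mul_const, ← integral_add (hdi.bdd_mul (hNm ε hε.1 hε.2) (hb ε hε.1 hε.2))
    (hNi.mul_const _)]
  refine integral_congr_ae (Eventually.of_forall fun t => ?_)
  simp only; ring

/-! ### The Cauchy kernel of the circle -/

/-- On one period, `1 - exp (-z)` vanishes only at `z = 0`, and there to first order. -/
theorem norm_one_sub_exp_lower {x y : ℝ} (hx0 : 0 ≤ x) (hx1 : x ≤ 1) (hy : |y| ≤ Real.pi) :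
    (x + |y|) / 5 ≤ ‖1 - Complex.exp (-(x + y * Complex.I))‖ := by
  have hre : Complex.exp (-(x + y * Complex.I)) =
      ((Real.exp (-x) * Real.cos y : ℝ) : ℂ) + ((-(Real.exp (-x) * Real.sin y) : ℝ) : ℂ) *
        Complex.I := by
    rw [neg_add, Complex.exp_add, ← neg_mul, Complex.exp_mul_I]
    push_cast
    rw [Complex.cos_neg, Complex.sin_neg]; ring
  have hsq : ‖1 - Complex.exp (-(x + y * Complex.I))‖ ^ 2 =
      (1 - Real.exp (-x)) ^ 2 + 4 * Real.exp (-x) * Real.sin (y / 2) ^ 2 := by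
    rw [hre, ← Complex.normSq_eq_norm_sq, Complex.normSq_apply]
    simp only [Complex.sub_re, Complex.one_re, Complex.add_re, Complex.ofReal_re, Complex.mul_re,
      Complex.I_re, Complex.ofReal_im, Complex.I_im, Complex.sub_im, Complex.one_im,
      Complex.add_im, Complex.mul_im]
    have h1 : Real.cos y = 1 - 2 * Real.sin (y / 2) ^ 2 := by
      have := Real.cos_two_mul (y / 2)
      rw [show 2 * (y / 2) = y by ring] at this
      nlinarith [Real.sin_sq_add_cos_sq (y / 2)]
    have h2 := Real.sin_sq_add_cos_sq y
    have h3 : Real.sin (y / 2) ^ 2 = (1 - Real.cos y) / 2 := by linarith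
    rw [h3]
    linear_combination Real.exp (-x) ^ 2 * h2
  have h1 : x / 2 ≤ 1 - Real.exp (-x) := by
    have h2 : Real.exp (-x) * (1 + x) ≤ 1 := by
      have := Real.add_one_le_exp x
      have h3 : Real.exp (-x) * Real.exp x = 1 := by rw [← Real.exp_add]; simp
      nlinarith [Real.exp_pos (-x)]
    nlinarith [Real.exp_pos (-x)]
  have h2 : (1 : ℝ) / 3 ≤ Real.exp (-x) := by
    have h3 : Real.exp (-1) ≤ Real.exp (-x) := Real.exp_le_exp.2 (by linarith)
    have h4 : Real.exp (-1) * Real.exp 1 = 1 := by rw [← Real.exp_add]; simp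
    have h5 := Real.exp_one_lt_d9
    nlinarith [Real.exp_pos (-1)]
  have h3 : |y| / Real.pi ≤ |Real.sin (y / 2)| := by
    have h4 := Real.mul_le_sin (x := |y| / 2) (by positivity) (by linarith)
    have h5 : |Real.sin (y / 2)| = Real.sin (|y| / 2) := by
      rcases abs_cases y with ⟨h, h'⟩ | ⟨h, h'⟩
      · rw [h] at h4 ⊢
        rw [abs_of_nonneg]; refine le_trans ?_ h4; positivity
      · rw [h] at h4 ⊢
        rw [neg_div, Real.sin_neg, abs_of_nonpos]
        rw [neg_div, Real.sin_neg] at h4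
        have : 0 ≤ 2 / Real.pi * -(y / 2) := mul_nonneg (by positivity) (by linarith)
        linarith
    rw [h5]; refine le_trans (le_of_eq ?_) h4; field_simp
  have h4 : y ^ 2 / 10 ≤ Real.sin (y / 2) ^ 2 := by
    rw [← sq_abs (Real.sin _), ← sq_abs y]
    have h5 : (|y| / Real.pi) ^ 2 ≤ |Real.sin (y / 2)| ^ 2 := by gcongr
    refine le_trans ?_ h5
    rw [div_pow]
    have : Real.pi ^ 2 ≤ 10 := by nlinarith [Real.pi_lt_d2, Real.pi_pos]
    gcongr
  have h5 : ((x + |y|) / 5) ^ 2 ≤ ‖1 - Complex.exp (-(x + y * Complex.I))‖ ^ 2 := by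
    rw [hsq]
    have h6 : (x / 2) ^ 2 ≤ (1 - Real.exp (-x)) ^ 2 := by gcongr
    have h7 : 4 * (1 / 3) * (y ^ 2 / 10) ≤ 4 * Real.exp (-x) * Real.sin (y / 2) ^ 2 := by gcongr
    nlinarith [sq_abs y, sq_nonneg (x - |y|)]
  exact le_of_sq_le_sq h5 (norm_nonneg _)
  where
    le_of_sq_le_sq {a b : ℝ} (h : a ^ 2 ≤ b ^ 2) (hb : 0 ≤ b) : a ≤ b := by
      exact le_of_abs_le (by rw [← abs_of_nonneg hb]; exact sq_le_sq.1 h)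

/-- The Cauchy kernel of the circle differs from that of the line by a bounded function. -/
theorem norm_inv_one_sub_exp_sub_inv_le {x y : ℝ} (hx0 : 0 ≤ x) (hx1 : x ≤ 1)
    (hy : |y| ≤ Real.pi) (hne : 0 < x + |y|) :
    ‖(1 - Complex.exp (-(x + y * Complex.I)))⁻¹ - ((x : ℂ) + y * Complex.I)⁻¹‖ ≤ 6 := by
  have hl := norm_one_sub_exp_lower hx0 hx1 hy
  set z : ℂ := x + y * Complex.I with hz
  have hre : z.re = x := by simp [hz]
  have him : z.im = y := by simp [hz]
  have hzn : ‖z‖ ≤ x + |y| := by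
    have := Complex.norm_le_abs_re_add_abs_im z
    rwa [hre, him, abs_of_nonneg hx0] at this
  have hz0 : z ≠ 0 := by
    intro h
    rw [h] at hre him
    simp only [Complex.zero_re, Complex.zero_im] at hre him
    rw [← hre, ← him] at hne; simp at hne
  have hl' : ‖z‖ / 5 ≤ ‖1 - Complex.exp (-z)‖ := le_trans (by gcongr) hl
  have hzp : 0 < ‖z‖ := norm_pos_iff.2 hz0
  have hw0 : 1 - Complex.exp (-z) ≠ 0 := norm_pos_iff.1 (lt_of_lt_of_le (by positivity) hl')
  rcases le_total ‖z‖ 1 with h1 | h1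
  · rw [inv_sub_inv hw0 hz0, norm_div, norm_mul, div_le_iff₀ (by positivity)]
    have h2 := Complex.norm_exp_sub_one_sub_id_le (x := -z) (by rwa [norm_neg])
    have h3 : z - (1 - Complex.exp (-z)) = Complex.exp (-z) - 1 - -z := by ring
    rw [h3]
    rw [norm_neg] at h2
    nlinarith
  · refine (norm_sub_le _ _).trans ?_
    rw [norm_inv, norm_inv]
    have h2 : ‖1 - Complex.exp (-z)‖⁻¹ ≤ 5 := by
      rw [inv_le_comm₀ (norm_pos_iff.2 hw0) (by norm_num)]; linarith
    have h3 : ‖z‖⁻¹ ≤ 1 := inv_le_one_of_one_le₀ h1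
    linarith

/-- The trigonometric monomial `exp (2πi n s / L)`. -/
def trigMon (L : ℝ) (n : ℤ) (s : ℝ) : ℂ := Complex.exp (2 * Real.pi * Complex.I * n * s / L)

theorem continuous_trigMon (L : ℝ) (n : ℤ) : Continuous (trigMon L n) := by
  unfold trigMon; fun_prop

theorem norm_trigMon (L : ℝ) (n : ℤ) (s : ℝ) : ‖trigMon L n s‖ = 1 := by
  unfold trigMon
  rw [show (2 * Real.pi * Complex.I * n * s / L : ℂ) = ((2 * Real.pi * n * s / L : ℝ) : ℂ) *
    Complex.I by push_cast; ring, Complex.norm_exp_ofReal_mul_I]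

theorem trigMon_zero (L : ℝ) (s : ℝ) : trigMon L 0 s = 1 := by simp [trigMon]

theorem trigMon_mul (L : ℝ) (m n : ℤ) (s : ℝ) :
    trigMon L m s * trigMon L n s = trigMon L (m + n) s := by
  unfold trigMon; rw [← Complex.exp_add]; congr 1; push_cast; ring

theorem trigMon_sub (L : ℝ) (n : ℤ) (s t : ℝ) :
    trigMon L n (s - t) = trigMon L n s * trigMon L (-n) t := by
  unfold trigMon; rw [← Complex.exp_add]; congr 1; push_cast; ring

/-- The Fourier coefficient of `f` on `(0, L]`, not normalized by the length. -/
def trigCoef (L : ℝ) (f : ℝ → ℂ) (n : ℤ) : ℂ := ∫ t, trigMon L (-n) t * f t ∂(arcMeasure L)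

theorem fourierCoeffOn_eq_trigCoef {L : ℝ} (hL : 0 < L) (f : ℝ → ℂ) (n : ℤ) :
    fourierCoeffOn hL f n = (1 / L : ℝ) • trigCoef L f n := by
  rw [fourierCoeffOn_eq_integral, intervalIntegral.integral_of_le hL.le]
  simp only [sub_zero]
  unfold trigCoef arcMeasure trigMon
  congr 1
  refine integral_congr_ae (Eventually.of_forall fun t => ?_)
  simp only [smul_eq_mul]
  rw [fourier_coe_apply]
  simp

theorem hasSum_sq_trigCoef {L : ℝ} (hL : 0 < L) {f : ℝ → ℂ} (hf : MemLp f 2 (arcMeasure L)) :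
    HasSum (fun n => ‖trigCoef L f n‖ ^ 2) (L * ∫ t, ‖f t‖ ^ 2 ∂(arcMeasure L)) := by
  have h := (hasSum_sq_fourierCoeffOn hL hf).mul_left (L ^ 2)
  rw [intervalIntegral.integral_of_le hL.le] at h
  convert! h using 1
  · ext n
    rw [fourierCoeffOn_eq_trigCoef, norm_smul, Real.norm_of_nonneg (by positivity)]
    field_simp
  · simp only [sub_zero, smul_eq_mul, arcMeasure]
    field_simp

/-- Orthogonal projection of a square integrable function onto the span of a set of trigonometric
monomials. -/
theorem exists_trigCoef_indicator {L : ℝ} (hL : 0 < L) {f : ℝ → ℂ} (hf : MemLp f 2 (arcMeasure L))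
    (S : Set ℤ) : ∃ e : ℝ → ℂ, MemLp e 2 (arcMeasure L) ∧
      ∀ n, trigCoef L e n = S.indicator (trigCoef L f) n := by
  have : Fact (0 < L) := ⟨hL⟩
  have hL2 : MemLp f 2 (volume.restrict (Ioc 0 (0 + L))) := by simpa [arcMeasure] using hf
  have h := hL2.memLp_liftIoc.haarAddCircle
  set F : Lp ℂ 2 (@AddCircle.haarAddCircle L _) := h.toLp
  have hmem : Memℓp (S.indicator fun n => fourierBasis.repr F n) 2 := by
    refine (lp.memℓp (fourierBasis.repr F)).mono' (fun n => ?_)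
    by_cases hn : n ∈ S
    · rw [indicator_of_mem hn]
    · rw [indicator_of_notMem hn]; simp
  set g : Lp ℂ 2 (@AddCircle.haarAddCircle L _) := fourierBasis.repr.symm ⟨_, hmem⟩ with hg
  have hgm : MemLp (fun s : ℝ => g (s : AddCircle L)) 2 (arcMeasure L) := by
    have h1 : MemLp (g : AddCircle L → ℂ) 2 volume :=
      (memLp_haarAddCircle_iff).1 (Lp.memLp g)
    have h2 := h1.comp_measurePreserving (AddCircle.measurePreserving_mk L 0)
    rw [zero_add] at h2
    exact h2
  have hcg : ∀ n, trigCoef L (fun s : ℝ => g (s : AddCircle L)) n = L • fourierCoeff g n := by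
    intro n
    rw [fourierCoeff_eq_intervalIntegral g n 0, zero_add, intervalIntegral.integral_of_le hL.le,
      smul_smul, mul_one_div_cancel hL.ne', one_smul]
    unfold trigCoef arcMeasure trigMon
    refine integral_congr_ae (Eventually.of_forall fun t => ?_)
    simp only [smul_eq_mul]
    rw [fourier_coe_apply]
  have hcF : ∀ n, trigCoef L f n = L • fourierCoeff F n := by
    intro n
    rw [fourierCoeff_congr_ae h.coeFn_toLp, fourierCoeff_eq_intervalIntegral _ n 0, zero_add,
      intervalIntegral.integral_of_le hL.le, smul_smul, mul_one_div_cancel hL.ne', one_smul]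
    unfold trigCoef arcMeasure trigMon
    refine setIntegral_congr_fun measurableSet_Ioc fun t ht => ?_
    simp only [smul_eq_mul]
    rw [fourier_coe_apply, AddCircle.liftIoc_coe_apply (by simpa using ht)]
  refine ⟨_, hgm, fun n => ?_⟩
  rw [hcg, ← fourierBasis_repr, hg, LinearIsometryEquiv.apply_symm_apply]
  change L • S.indicator (fun n => fourierBasis.repr F n) n = _
  by_cases hn : n ∈ S
  · rw [indicator_of_mem hn, indicator_of_mem hn, hcF, fourierBasis_repr]
  · rw [indicator_of_notMem hn, indicator_of_notMem hn, smul_zero]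

/-- The kernel `1 / (1 - exp (-2π (ε + iu) / L))`, the generating function of the monomials of
nonpositive frequency. -/
def circleKer (L ε u : ℝ) : ℂ :=
  (1 - Complex.exp (-((2 * Real.pi / L * ε : ℝ) + (2 * Real.pi / L * u : ℝ) * Complex.I)))⁻¹

theorem continuous_circleKer {L ε : ℝ} (hL : 0 < L) (hε : 0 < ε) : Continuous (circleKer L ε) := by
  unfold circleKer
  refine Continuous.inv₀ (by fun_prop) fun u h => ?_
  have h1 : ‖Complex.exp (-((2 * Real.pi / L * ε : ℝ) + (2 * Real.pi / L * u : ℝ) * Complex.I))‖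
      = 1 := by
    rw [← sub_eq_zero.1 h]; simp
  rw [Complex.norm_exp] at h1
  simp only [Complex.neg_re, Complex.add_re, Complex.ofReal_re, Complex.mul_re, Complex.I_re,
    Complex.ofReal_im, Complex.I_im, mul_zero, mul_one, sub_self, add_zero, Real.exp_eq_one_iff,
    neg_eq_zero] at h1
  have : 0 < 2 * Real.pi / L * ε := by positivity
  linarith

/-- The ratio `exp (-2π ε / L)` of the geometric series of `circleKer`. -/
def circleRatio (L ε : ℝ) : ℝ := Real.exp (-(2 * Real.pi / L * ε))

theorem circleRatio_pos (L ε : ℝ) : 0 < circleRatio L ε := Real.exp_pos _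

theorem circleRatio_lt_one {L ε : ℝ} (hL : 0 < L) (hε : 0 < ε) : circleRatio L ε < 1 := by
  unfold circleRatio
  rw [Real.exp_lt_one_iff, neg_lt_zero]; positivity

theorem hasSum_circleKer {L ε : ℝ} (hL : 0 < L) (hε : 0 < ε) (u : ℝ) :
    HasSum (fun n : ℕ => ((circleRatio L ε ^ n : ℝ) : ℂ) * trigMon L (-n) u)
      (circleKer L ε u) := by
  have h : ‖Complex.exp (-((2 * Real.pi / L * ε : ℝ) + (2 * Real.pi / L * u : ℝ) * Complex.I))‖
      < 1 := by
    rw [Complex.norm_exp]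
    simp only [Complex.neg_re, Complex.add_re, Complex.ofReal_re, Complex.mul_re, Complex.I_re,
      Complex.ofReal_im, Complex.I_im, mul_zero, mul_one, sub_self, add_zero]
    exact circleRatio_lt_one hL hε
  have h1 := hasSum_geometric_of_norm_lt_one h
  convert! h1 using 1
  ext n
  unfold circleRatio trigMon
  push_cast
  rw [← Complex.exp_nat_mul, ← Complex.exp_nat_mul, ← Complex.exp_add]
  congr 1; ring

theorem hasSum_integral_circleKer {L ε : ℝ} (hL : 0 < L) (hε : 0 < ε) {f : ℝ → ℂ}
    (hf : Integrable f (arcMeasure L)) (s : ℝ) :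
    HasSum (fun n : ℕ => ((circleRatio L ε ^ n : ℝ) : ℂ) * (trigMon L (-n) s * trigCoef L f (-n)))
      (∫ t, circleKer L ε (s - t) * f t ∂(arcMeasure L)) := by
  have h1 := hasSum_integral_of_summable_integral_norm (μ := arcMeasure L)
    (F := fun (n : ℕ) t => ((circleRatio L ε ^ n : ℝ) : ℂ) * trigMon L (-n) (s - t) * f t) ?_ ?_
  · convert! h1 using 1
    · ext n
      unfold trigCoef
      rw [← integral_const_mul, ← integral_const_mul]
      congr 1; ext t
      rw [trigMon_sub]; ring
    · congr 1; ext t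
      exact (((hasSum_circleKer hL hε (s - t)).mul_right (f t)).tsum_eq).symm
  · intro n
    refine hf.bdd_mul (c := 1) ?_ (Eventually.of_forall fun t => ?_)
    · have := continuous_trigMon L (-n)
      exact Continuous.aestronglyMeasurable (by fun_prop)
    · rw [norm_mul, norm_trigMon, mul_one, Complex.norm_real,
        Real.norm_of_nonneg (pow_nonneg (circleRatio_pos _ _).le _)]
      exact pow_le_one₀ (circleRatio_pos _ _).le (circleRatio_lt_one hL hε).le
  · have : ∀ n : ℕ, ∫ t, ‖((circleRatio L ε ^ n : ℝ) : ℂ) * trigMon L (-n) (s - t) * f t‖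
        ∂(arcMeasure L) = circleRatio L ε ^ n * ∫ t, ‖f t‖ ∂(arcMeasure L) := by
      intro n
      rw [← integral_const_mul]
      congr 1; ext t
      rw [norm_mul, norm_mul, norm_trigMon, mul_one, Complex.norm_real,
        Real.norm_of_nonneg (pow_nonneg (circleRatio_pos _ _).le _)]
    simp_rw [this]
    exact (summable_geometric_of_lt_one (circleRatio_pos _ _).le
      (circleRatio_lt_one hL hε)).mul_right _

theorem hasSum_integral_circleKer' {L ε : ℝ} (hL : 0 < L) (hε : 0 < ε) {f : ℝ → ℂ}
    (hf : Integrable f (arcMeasure L)) (s : ℝ) :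
    HasSum (fun n : ℕ => ((circleRatio L ε ^ n : ℝ) : ℂ) * (trigMon L n s * trigCoef L f n))
      (∫ t, circleKer L ε (t - s) * f t ∂(arcMeasure L)) := by
  have h1 := hasSum_integral_circleKer hL hε (f := fun t => (starRingEnd ℂ) (f t)) (by
    exact (Complex.conjCLE.toContinuousLinearMap).integrable_comp hf) s
  have h2 := (Complex.hasSum_conj'.2 h1)
  have hm : ∀ n : ℤ, ∀ t, (starRingEnd ℂ) (trigMon L n t) = trigMon L (-n) t := by
    intro n t
    unfold trigMon
    rw [← Complex.exp_conj]
    congr 1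
    simp [Complex.conj_ofReal, map_ofNat]
  have hk : ∀ u, (starRingEnd ℂ) (circleKer L ε u) = circleKer L ε (-u) := by
    intro u
    unfold circleKer
    rw [map_inv₀, map_sub, map_one, ← Complex.exp_conj]
    congr 4
    simp [Complex.conj_ofReal, map_ofNat]
  convert! h2 using 1
  · ext n
    simp only [map_mul, Complex.conj_ofReal, hm, neg_neg, trigCoef]
    rw [← integral_conj]
    congr 3; ext t
    simp [hm]
  · rw [← integral_conj]
    congr 1; ext t
    simp [hk]

/-- The Poisson kernel of the circle, as a complex-valued function. -/
def circlePoisson (L ε u : ℝ) : ℂ := circleKer L ε u + circleKer L ε (-u) - 1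

theorem continuous_circlePoisson {L ε : ℝ} (hL : 0 < L) (hε : 0 < ε) :
    Continuous (circlePoisson L ε) := by
  have := continuous_circleKer hL hε
  unfold circlePoisson; fun_prop

theorem circlePoisson_neg (L ε u : ℝ) : circlePoisson L ε (-u) = circlePoisson L ε u := by
  unfold circlePoisson; rw [neg_neg]; ring

theorem conj_circleKer (L ε u : ℝ) : (starRingEnd ℂ) (circleKer L ε u) = circleKer L ε (-u) := by
  unfold circleKer
  rw [map_inv₀, map_sub, map_one, ← Complex.exp_conj]
  congr 4
  simp [Complex.conj_ofReal, map_ofNat]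

theorem circleKer_sub_int_mul {L : ℝ} (hL : 0 < L) (ε u : ℝ) (k : ℤ) :
    circleKer L ε (u - k * L) = circleKer L ε u := by
  unfold circleKer
  congr 2
  rw [show (-((2 * Real.pi / L * ε : ℝ) + (2 * Real.pi / L * (u - k * L) : ℝ) * Complex.I) : ℂ) =
    -((2 * Real.pi / L * ε : ℝ) + (2 * Real.pi / L * u : ℝ) * Complex.I) +
      k * (2 * Real.pi * Complex.I) by
        have : (L : ℂ) ≠ 0 := by exact_mod_cast hL.ne'
        push_cast; field_simp; ring, Complex.exp_add, Complex.exp_int_mul_two_pi_mul_I, mul_one]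

theorem ae_mem_Ioo (L : ℝ) : ∀ᵐ s ∂(arcMeasure L), s ∈ Ioo 0 L := by
  unfold arcMeasure
  rw [← restrict_Ioo_eq_restrict_Ioc]
  exact ae_restrict_mem measurableSet_Ioo

theorem ae_mem_Ioc (L : ℝ) : ∀ᵐ s ∂(arcMeasure L), s ∈ Ioc 0 L :=
  ae_restrict_mem measurableSet_Ioc

/-- For an interior point `s`, the distance to `t` modulo the period is comparable to `|s - t|`. -/
theorem exists_period_shift {L s : ℝ} (hs : s ∈ Ioo 0 L) : ∃ c : ℝ, 0 < c ∧ c ≤ 1 ∧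
    ∀ t ∈ Ioc 0 L, ∃ k : ℤ, |s - t - k * L| ≤ L / 2 ∧ c * |s - t| ≤ |s - t - k * L| := by
  obtain ⟨h0, hL⟩ := hs
  have hLp : 0 < L := h0.trans hL
  set d := min s (L - s)
  have hd : 0 < d := lt_min h0 (by linarith)
  have hds : d ≤ s := min_le_left _ _
  have hds' : d ≤ L - s := min_le_right _ _
  have hc1 : d / L ≤ 1 := by rw [div_le_one hLp]; linarith
  refine ⟨d / L, by positivity, hc1, fun t ht => ?_⟩
  have hb : ∀ x, |x| ≤ L → d / L * |x| ≤ d := fun x hx => by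
    calc d / L * |x| ≤ d / L * L := by gcongr
      _ = d := by field_simp
  have hu : |s - t| ≤ L := by rw [abs_le]; constructor <;> linarith [ht.1, ht.2]
  rcases le_or_gt |s - t| (L / 2) with h | h
  · exact ⟨0, by simpa using h, by simpa using mul_le_of_le_one_left (abs_nonneg _) hc1⟩
  · rcases lt_abs.1 h with h' | h'
    · refine ⟨1, ?_, (hb _ hu).trans ?_⟩
      · rw [abs_le]; push_cast; constructor <;> linarith [ht.1, ht.2]
      · rw [abs_of_nonpos (by push_cast; linarith [ht.1, ht.2])]; push_cast; linarith [ht.1]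
    · refine ⟨-1, ?_, (hb _ hu).trans ?_⟩
      · rw [abs_le]; push_cast; constructor <;> linarith [ht.1, ht.2]
      · rw [abs_of_nonneg (by push_cast; linarith [ht.1, ht.2])]; push_cast; linarith [ht.2]

/-- For a fixed `s` interior to the period, the periodic Poisson kernel is comparable with that of
the half-plane; the constant depends on the distance of `s` to the endpoints. -/
theorem norm_circlePoisson_le {L : ℝ} (hL : 0 < L) {s : ℝ} (hs : s ∈ Ioo 0 L) :
    ∃ C : ℝ, ∀ ε, 0 < ε → ε < L / (2 * Real.pi) → ∀ t ∈ Ioc 0 L,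
      ‖circlePoisson L ε (s - t)‖ ≤ C * (ε / (ε ^ 2 + (s - t) ^ 2)) := by
  obtain ⟨c, hc0, hc1, hc⟩ := exists_period_shift hs
  have hpi := Real.pi_pos
  set κ := 2 * Real.pi / L with hκ
  have hκp : 0 < κ := by positivity
  refine ⟨50 / (κ * c ^ 2), fun ε hε hε' t ht => ?_⟩
  obtain ⟨k, hk1, hk2⟩ := hc t ht
  have hper : circlePoisson L ε (s - t) = circlePoisson L ε (s - t - k * L) := by
    unfold circlePoisson
    rw [circleKer_sub_int_mul hL,
      show -(s - t - k * L) = -(s - t) - (-k : ℤ) * L by push_cast; ring,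
      circleKer_sub_int_mul hL]
  rw [hper]
  set u := s - t - k * L with hu
  have hx1 : κ * ε ≤ 1 := by
    rw [lt_div_iff₀ (by positivity)] at hε'
    rw [hκ, div_mul_eq_mul_div, div_le_one hL]; linarith
  have hy : |κ * u| ≤ Real.pi := by
    rw [abs_mul, abs_of_pos hκp]
    calc κ * |u| ≤ κ * (L / 2) := by gcongr
      _ = Real.pi := by rw [hκ]; field_simp
  have hlow := norm_one_sub_exp_lower (x := κ * ε) (y := κ * u) (by positivity) hx1 hy
  set q : ℂ := Complex.exp (-((κ * ε : ℝ) + (κ * u : ℝ) * Complex.I)) with hq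
  have hlp : 0 < ‖1 - q‖ := lt_of_lt_of_le (by positivity) hlow
  have hq0 : 1 - q ≠ 0 := norm_pos_iff.1 hlp
  have hqn : ‖q‖ = Real.exp (-(κ * ε)) := by rw [hq, Complex.norm_exp]; simp
  -- the closed form of the Poisson kernel
  have hP : circlePoisson L ε u = ((1 - ‖q‖ ^ 2 : ℝ) : ℂ) / ((‖1 - q‖ ^ 2 : ℝ) : ℂ) := by
    have h1 : circleKer L ε u = (1 - q)⁻¹ := rfl
    unfold circlePoisson
    rw [← conj_circleKer, h1, map_inv₀, map_sub, map_one]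
    have hq0' : 1 - (starRingEnd ℂ) q ≠ 0 := by
      intro h
      apply hq0
      have := congrArg (starRingEnd ℂ) h
      simpa using this
    have h2 : ((‖1 - q‖ ^ 2 : ℝ) : ℂ) = (1 - q) * (1 - (starRingEnd ℂ) q) := by
      have h := Complex.mul_conj (1 - q)
      rw [Complex.normSq_eq_norm_sq] at h
      rw [← h]; simp
    have h3 : ((1 - ‖q‖ ^ 2 : ℝ) : ℂ) = 1 - q * (starRingEnd ℂ) q := by
      rw [Complex.mul_conj, Complex.normSq_eq_norm_sq]; push_cast; ring
    rw [h2, h3]; field_simp; ring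
  rw [hP, norm_div, Complex.norm_real, Complex.norm_real, Real.norm_of_nonneg (sq_nonneg _),
    Real.norm_of_nonneg (by
      rw [hqn, sub_nonneg]; exact pow_le_one₀ (Real.exp_pos _).le (Real.exp_le_one_iff.2 (by
        have : 0 < κ * ε := by positivity
        linarith)))]
  have hnum : 1 - ‖q‖ ^ 2 ≤ 2 * (κ * ε) := by
    rw [hqn, ← Real.exp_nat_mul]
    have := Real.add_one_le_exp (((2 : ℕ) : ℝ) * -(κ * ε))
    push_cast at this ⊢; linarith
  have hden : κ ^ 2 * c ^ 2 * (ε ^ 2 + (s - t) ^ 2) / 25 ≤ ‖1 - q‖ ^ 2 := by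
    have h1 : κ * (ε + c * |s - t|) / 5 ≤ ‖1 - q‖ := by
      refine le_trans ?_ hlow
      rw [abs_mul, abs_of_pos hκp, ← mul_add]; gcongr
    have h2 : (κ * (ε + c * |s - t|) / 5) ^ 2 ≤ ‖1 - q‖ ^ 2 := by gcongr
    refine le_trans ?_ h2
    rw [← sq_abs (s - t)]
    have h3 : c ^ 2 * ε ^ 2 ≤ ε ^ 2 := by
      have : c ^ 2 ≤ 1 := pow_le_one₀ hc0.le hc1
      nlinarith [sq_nonneg ε]
    have h4 : 0 ≤ ε * (c * |s - t|) := by positivity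
    have h5 : c ^ 2 * (ε ^ 2 + |s - t| ^ 2) ≤ (ε + c * |s - t|) ^ 2 := by nlinarith
    have h6 : 0 ≤ κ ^ 2 := sq_nonneg _
    calc _ = κ ^ 2 * (c ^ 2 * (ε ^ 2 + |s - t| ^ 2)) / 25 := by ring
      _ ≤ κ ^ 2 * (ε + c * |s - t|) ^ 2 / 25 := by gcongr
      _ = _ := by ring
  calc (1 - ‖q‖ ^ 2) / ‖1 - q‖ ^ 2 ≤ 2 * (κ * ε) / (κ ^ 2 * c ^ 2 * (ε ^ 2 + (s - t) ^ 2) / 25) := by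
        gcongr
    _ = 50 / (κ * c ^ 2) * (ε / (ε ^ 2 + (s - t) ^ 2)) := by field_simp; norm_num

theorem trigCoef_trigMon {L : ℝ} (hL : 0 < L) (m n : ℤ) :
    trigCoef L (trigMon L m) n = if n = m then (L : ℂ) else 0 := by
  unfold trigCoef
  simp_rw [trigMon_mul]
  split_ifs with h
  · subst h
    simp [trigMon_zero, arcMeasure, hL.le]
  · have hL' : (L : ℂ) ≠ 0 := by exact_mod_cast hL.ne'
    have hk : ((-n + m : ℤ) : ℂ) ≠ 0 := by
      have : -n + m ≠ 0 := by omega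
      exact_mod_cast this
    have hc : (2 * Real.pi * Complex.I * ((-n + m : ℤ) : ℂ) / L : ℂ) ≠ 0 := by
      have hπ : (Real.pi : ℂ) ≠ 0 := by exact_mod_cast Real.pi_ne_zero
      exact div_ne_zero (mul_ne_zero (mul_ne_zero (mul_ne_zero two_ne_zero hπ)
        Complex.I_ne_zero) hk) hL'
    have h1 := integral_exp_mul_complex (a := 0) (b := L) hc
    rw [intervalIntegral.integral_of_le hL.le] at h1
    have h2 : ∀ t : ℝ, trigMon L (-n + m) t =
        Complex.exp (2 * Real.pi * Complex.I * ((-n + m : ℤ) : ℂ) / L * t) := by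
      intro t; unfold trigMon; congr 1; ring
    unfold arcMeasure
    simp_rw [h2]
    rw [h1]
    have h3 : (2 * Real.pi * Complex.I * ((-n + m : ℤ) : ℂ) / L * (L : ℝ) : ℂ) =
        ((-n + m : ℤ) : ℂ) * (2 * Real.pi * Complex.I) := by field_simp
    rw [h3, Complex.exp_int_mul_two_pi_mul_I]
    simp

theorem integral_circlePoisson {L ε : ℝ} (hL : 0 < L) (hε : 0 < ε) {f : ℝ → ℂ}
    (hf : Integrable f (arcMeasure L)) (s : ℝ) :
    ∫ t, circlePoisson L ε (s - t) * f t ∂(arcMeasure L) =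
      (∫ t, circleKer L ε (s - t) * f t ∂(arcMeasure L)) +
      (∫ t, circleKer L ε (t - s) * f t ∂(arcMeasure L)) - trigCoef L f 0 := by
  have hi : ∀ g : ℝ → ℝ, Continuous g →
      Integrable (fun t => circleKer L ε (g t) * f t) (arcMeasure L) := by
    intro g hg
    have hb : ∃ C, ∀ u, ‖circleKer L ε u‖ ≤ C := by
      refine ⟨∑' n : ℕ, circleRatio L ε ^ n, fun u => ?_⟩
      rw [← (hasSum_circleKer hL hε u).tsum_eq]
      have hs := summable_geometric_of_lt_one (circleRatio_pos L ε).le (circleRatio_lt_one hL hε)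
      refine tsum_of_norm_bounded hs.hasSum fun n => ?_
      rw [norm_mul, norm_trigMon, mul_one, Complex.norm_real,
        Real.norm_of_nonneg (pow_nonneg (circleRatio_pos _ _).le _)]
    obtain ⟨C, hC⟩ := hb
    exact hf.bdd_mul ((continuous_circleKer hL hε).comp hg).aestronglyMeasurable
      (Eventually.of_forall fun t => hC _)
  unfold trigCoef
  rw [← integral_add (hi _ (by fun_prop)) (hi _ (by fun_prop)), ← integral_sub]
  · congr 1; ext t
    unfold circlePoisson
    rw [neg_zero, trigMon_zero, neg_sub]; ring
  · exact (hi _ (by fun_prop)).add (hi _ (by fun_prop))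
  · simpa [trigMon_zero] using hf

theorem integrable_trigMon (L : ℝ) (m : ℤ) : Integrable (trigMon L m) (arcMeasure L) :=
  Integrable.of_bound (continuous_trigMon L m).aestronglyMeasurable 1
    (Eventually.of_forall fun t => (norm_trigMon L m t).le)

theorem integral_circlePoisson_trigMon {L ε : ℝ} (hL : 0 < L) (hε : 0 < ε) (m : ℤ) (s : ℝ) :
    ∫ t, circlePoisson L ε (s - t) * trigMon L m t ∂(arcMeasure L) =
      L * (circleRatio L ε : ℂ) ^ m.natAbs * trigMon L m s := by
  have hi := integrable_trigMon L m
  rw [integral_circlePoisson hL hε hi]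
  have h1 := hasSum_integral_circleKer hL hε hi s
  have h2 := hasSum_integral_circleKer' hL hε hi s
  simp_rw [trigCoef_trigMon hL] at h1 h2 ⊢
  have h1' := h1.unique (hasSum_single m.natAbs fun n hn => by
    rcases eq_or_ne (-(n : ℤ)) m with h | h
    · exfalso; apply hn; omega
    · rw [if_neg h]; simp)
  have h2' := h2.unique (hasSum_single m.natAbs fun n hn => by
    rcases eq_or_ne (n : ℤ) m with h | h
    · exfalso; apply hn; omega
    · rw [if_neg h]; simp)
  rw [h1', h2']
  rcases lt_trichotomy m 0 with h | h | h
  · have e1 : -((m.natAbs : ℕ) : ℤ) = m := by omega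
    have e2 : ((m.natAbs : ℕ) : ℤ) ≠ m := by omega
    have e3 : (0 : ℤ) ≠ m := by omega
    rw [if_neg e2, if_neg e3, if_pos e1, e1]
    push_cast; ring
  · subst h; simp [trigMon_zero]
  · have e1 : -((m.natAbs : ℕ) : ℤ) ≠ m := by omega
    have e2 : ((m.natAbs : ℕ) : ℤ) = m := by omega
    have e3 : (0 : ℤ) ≠ m := by omega
    rw [if_neg e1, if_neg e3, if_pos e2, e2]
    push_cast; ring

/-- The Poisson integral is a Fourier multiplier. -/
theorem trigCoef_poisson {L ε : ℝ} (hL : 0 < L) (hε : 0 < ε) {f : ℝ → ℂ}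
    (hf : Integrable f (arcMeasure L)) (n : ℤ) :
    trigCoef L (fun s => ∫ t, circlePoisson L ε (s - t) * f t ∂(arcMeasure L)) n =
      L * (circleRatio L ε : ℂ) ^ n.natAbs * trigCoef L f n := by
  unfold trigCoef
  simp_rw [← integral_const_mul]
  rw [integral_integral_swap]
  · congr 1; ext t
    have h := integral_circlePoisson_trigMon hL hε (-n) t
    rw [Int.natAbs_neg] at h
    calc _ = ∫ s, (circlePoisson L ε (t - s) * trigMon L (-n) s) * f t ∂(arcMeasure L) := by
          congr 1; ext s
          rw [← circlePoisson_neg, neg_sub]; ring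
      _ = _ := by rw [integral_mul_const, h]; ring
  · have hb : ∃ C, ∀ p ∈ Icc (0 : ℝ) L ×ˢ Icc (0 : ℝ) L, ‖circlePoisson L ε (p.1 - p.2)‖ ≤ C := by
      have hc := continuous_circlePoisson hL hε
      exact (isCompact_Icc.prod isCompact_Icc).exists_bound_of_continuousOn
        (f := fun p : ℝ × ℝ => circlePoisson L ε (p.1 - p.2))
        (Continuous.continuousOn (by fun_prop))
    obtain ⟨C, hC⟩ := hb
    have hm : ∀ᵐ p ∂(arcMeasure L).prod (arcMeasure L), p ∈ Ioc (0 : ℝ) L ×ˢ Ioc (0 : ℝ) L := by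
      unfold arcMeasure
      rw [Measure.prod_restrict]
      exact ae_restrict_mem (measurableSet_Ioc.prod measurableSet_Ioc)
    have h1 : Integrable (fun p : ℝ × ℝ => f p.2) ((arcMeasure L).prod (arcMeasure L)) :=
      hf.comp_snd _
    have h2 := h1.bdd_mul (f := fun p : ℝ × ℝ => trigMon L (-n) p.1 * circlePoisson L ε (p.1 - p.2))
      (c := C) (by
        have hc := continuous_circlePoisson hL hε
        have := continuous_trigMon L (-n)
        exact Continuous.aestronglyMeasurable (by fun_prop)) (by
        filter_upwards [hm] with p hp
        rw [norm_mul, norm_trigMon, one_mul]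
        exact hC p ⟨Ioc_subset_Icc_self hp.1, Ioc_subset_Icc_self hp.2⟩)
    refine h2.congr (Eventually.of_forall fun p => ?_)
    simp only [Function.uncurry]; ring

/-- Poisson integrals of a square integrable function converge to the function. -/
theorem TraceLim.circlePoisson {L : ℝ} (hL : 0 < L) {f : ℝ → ℂ} (hf : MemLp f 2 (arcMeasure L)) :
    TraceLim (arcMeasure L)
      (fun ε s => ∫ t, circlePoisson L ε (s - t) * f t ∂(arcMeasure L)) (fun s => L * f s) := by
  have hfi : Integrable f (arcMeasure L) := hf.integrable one_le_two
  have hpi := Real.pi_pos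
  -- square integrability at fixed `ε`, where the kernel is bounded
  have hmem : ∀ ε, 0 < ε →
      MemLp (fun s => ∫ t, _root_.circlePoisson L ε (s - t) * f t ∂(arcMeasure L)) 2
        (arcMeasure L) := by
    intro ε hε
    have hc := continuous_circlePoisson hL hε
    have hb : ∃ C, ∀ p ∈ Icc (0 : ℝ) L ×ˢ Icc (0 : ℝ) L,
        ‖_root_.circlePoisson L ε (p.1 - p.2)‖ ≤ C :=
      (isCompact_Icc.prod isCompact_Icc).exists_bound_of_continuousOn
        (f := fun p : ℝ × ℝ => _root_.circlePoisson L ε (p.1 - p.2))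
        (Continuous.continuousOn (by fun_prop))
    obtain ⟨C, hC⟩ := hb
    refine MemLp.of_bound ?_ (C * ∫ t, ‖f t‖ ∂(arcMeasure L)) ?_
    · have h1 : AEStronglyMeasurable
          (fun p : ℝ × ℝ => _root_.circlePoisson L ε (p.1 - p.2) * f p.2)
          ((arcMeasure L).prod (arcMeasure L)) :=
        (Continuous.aestronglyMeasurable (by fun_prop)).mul hfi.1.comp_snd
      exact h1.integral_prod_right'
    · filter_upwards [ae_mem_Ioc L] with s hs
      rw [← integral_const_mul]
      refine norm_integral_le_of_norm_le (hfi.norm.const_mul C) ?_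
      filter_upwards [ae_mem_Ioc L] with t ht
      rw [norm_mul]
      exact mul_le_mul_of_nonneg_right
        (hC (s, t) ⟨Ioc_subset_Icc_self hs, Ioc_subset_Icc_self ht⟩) (norm_nonneg _)
  refine ⟨?_, ?_, ?_⟩
  · filter_upwards [self_mem_nhdsWithin] with ε hε using hmem ε hε
  -- almost everywhere: convergence at the Lebesgue points of `f`
  · filter_upwards [ae_isPoissonPoint hfi, ae_mem_Ioo L] with s hs hsm
    obtain ⟨C, hC⟩ := norm_circlePoisson_le hL hsm
    refine hs.tendsto_integral hfi (N := fun ε t => _root_.circlePoisson L ε (s - t)) (C := C)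
      (ε₀ := L / (2 * Real.pi)) (by positivity) (fun ε h0 _ => ?_) (fun ε h0 h1 => ?_) ?_
    · have hc := continuous_circlePoisson hL h0
      exact Continuous.aestronglyMeasurable (by fun_prop)
    · filter_upwards [ae_mem_Ioc L] with t ht using hC ε h0 h1 t ht
    · refine tendsto_const_nhds.congr' ?_
      filter_upwards [self_mem_nhdsWithin] with ε hε
      have := integral_circlePoisson_trigMon hL hε 0 s
      simpa [trigMon_zero] using this.symm
  -- in mean square: Parseval and dominated convergence for the Fourier coefficients
  · have hcoef : ∀ ε, 0 < ε → ∀ n,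
        trigCoef L (fun s => (∫ t, _root_.circlePoisson L ε (s - t) * f t ∂(arcMeasure L))
          - L * f s) n = L * ((circleRatio L ε : ℂ) ^ n.natAbs - 1) * trigCoef L f n := by
      intro ε hε n
      have h1 := trigCoef_poisson hL hε hfi n
      have hb : ∀ g : ℝ → ℂ, Integrable g (arcMeasure L) →
          Integrable (fun s => trigMon L (-n) s * g s) (arcMeasure L) := fun g hg =>
        hg.bdd_mul (continuous_trigMon _ _).aestronglyMeasurable
          (Eventually.of_forall fun t => (norm_trigMon L _ t).le)
      unfold trigCoef at h1 ⊢
      simp_rw [mul_sub]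
      rw [integral_sub (hb _ ((hmem ε hε).integrable one_le_two)) (hb _ (hfi.const_mul _)), h1]
      have : ∀ t, trigMon L (-n) t * (L * f t) = L * (trigMon L (-n) t * f t) := fun t => by ring
      simp_rw [this]
      rw [integral_const_mul]; ring
    have hL2 : ∀ ε, 0 < ε → MemLp (fun s =>
        (∫ t, _root_.circlePoisson L ε (s - t) * f t ∂(arcMeasure L)) - L * f s) 2
          (arcMeasure L) := fun ε hε => (hmem ε hε).sub (hf.const_mul _)
    have hlim : Tendsto (fun ε => ∑' n : ℤ,
        ‖(L : ℂ) * ((circleRatio L ε : ℂ) ^ n.natAbs - 1) * trigCoef L f n‖ ^ 2)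
        (𝓝[>] 0) (𝓝 0) := by
      suffices h : Tendsto (fun ε => ∑' n : ℤ,
          ‖(L : ℂ) * ((circleRatio L ε : ℂ) ^ n.natAbs - 1) * trigCoef L f n‖ ^ 2)
          (𝓝[>] 0) (𝓝 (∑' _ : ℤ, (0 : ℝ))) by simpa using h
      refine tendsto_tsum_of_dominated_convergence
        (bound := fun n => L ^ 2 * ‖trigCoef L f n‖ ^ 2)
        ((hasSum_sq_trigCoef hL hf).summable.mul_left _) (fun n => ?_) ?_
      · have hr : Tendsto (fun ε => circleRatio L ε) (𝓝[>] 0) (𝓝 1) := by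
          have : Continuous (circleRatio L) := by unfold circleRatio; fun_prop
          have := this.tendsto 0
          simp only [circleRatio, mul_zero, neg_zero, Real.exp_zero] at this
          exact this.mono_left nhdsWithin_le_nhds
        have hr' : Tendsto (fun ε => (circleRatio L ε : ℂ)) (𝓝[>] 0) (𝓝 1) := by
          have := (Complex.continuous_ofReal.tendsto 1).comp hr
          simpa [Function.comp_def] using this
        have := (((((hr'.pow n.natAbs).sub_const 1).const_mul (L : ℂ)).mul_const
          (trigCoef L f n)).norm).pow 2
        simpa using this
      · filter_upwards [self_mem_nhdsWithin] with ε hε n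
        rw [Real.norm_of_nonneg (sq_nonneg _), norm_mul, norm_mul, Complex.norm_real,
          Real.norm_of_nonneg hL.le, mul_pow, mul_pow]
        have h1 : ‖(circleRatio L ε : ℂ) ^ n.natAbs - 1‖ ≤ 1 := by
          rw [show (circleRatio L ε : ℂ) ^ n.natAbs - 1 =
            ((circleRatio L ε ^ n.natAbs - 1 : ℝ) : ℂ) by push_cast; ring, Complex.norm_real,
            Real.norm_eq_abs, abs_le]
          have h2 := pow_nonneg (circleRatio_pos L ε).le n.natAbs
          have h3 := pow_le_one₀ (n := n.natAbs) (circleRatio_pos L ε).le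
            (circleRatio_lt_one hL hε).le
          constructor <;> linarith
        have h2 : ‖(circleRatio L ε : ℂ) ^ n.natAbs - 1‖ ^ 2 ≤ 1 := pow_le_one₀ (norm_nonneg _) h1
        calc _ ≤ L ^ 2 * 1 * ‖trigCoef L f n‖ ^ 2 := by gcongr
          _ = _ := by ring
    have hlim2 := hlim.const_mul (L⁻¹)
    rw [mul_zero] at hlim2
    have hlim3 := ((ENNReal.continuous_ofReal.tendsto _).comp
      ((Real.continuous_sqrt.tendsto _).comp hlim2))
    rw [Real.sqrt_zero, ENNReal.ofReal_zero] at hlim3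
    refine hlim3.congr' ?_
    filter_upwards [self_mem_nhdsWithin] with ε hε
    have h1 := (hasSum_sq_trigCoef hL (hL2 ε hε)).tsum_eq
    simp_rw [hcoef ε hε] at h1
    simp only [Function.comp_apply]
    rw [h1, inv_mul_cancel_left₀ hL.ne', (hL2 ε hε).eLpNorm_eq_integral_rpow_norm two_ne_zero
      ENNReal.ofNat_ne_top]
    congr 1
    rw [Real.sqrt_eq_rpow]
    simp

/-- The operators with kernel `circleKer` converge, almost everywhere and in mean square. -/
theorem TraceLim.circleKer {L : ℝ} (hL : 0 < L) {f : ℝ → ℂ} (hf : MemLp f 2 (arcMeasure L)) :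
    ∃ e, TraceLim (arcMeasure L)
      (fun ε s => ∫ t, circleKer L ε (s - t) * f t ∂(arcMeasure L)) e := by
  obtain ⟨e, he, hec⟩ := exists_trigCoef_indicator hL hf (Iic 0)
  have hei := he.integrable one_le_two
  have hfi := hf.integrable one_le_two
  refine ⟨_, (TraceLim.circlePoisson hL he).congr_of_forall one_pos
    (S := univ) (Eventually.of_forall fun _ => mem_univ _)
    (fun ε hε _ s _ => ?_) (Eventually.of_forall fun _ => rfl)⟩
  -- The Poisson integral of the projection of `f` to nonpositive frequencies is the `circleKer`
  -- integral of `f`.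
  rw [integral_circlePoisson hL hε hei]
  have h1 := hasSum_integral_circleKer hL hε hei s
  have h1' := hasSum_integral_circleKer hL hε hfi s
  have h2 := hasSum_integral_circleKer' hL hε hei s
  have h2' := h2.unique (hasSum_single 0 fun n hn => by
    rw [hec, indicator_of_notMem (by simp; omega)]; simp)
  have e1 : (fun n : ℕ => ((circleRatio L ε ^ n : ℝ) : ℂ) * (trigMon L (-n) s * trigCoef L e (-n)))
      = fun n : ℕ => ((circleRatio L ε ^ n : ℝ) : ℂ) * (trigMon L (-n) s * trigCoef L f (-n)) := by
    ext n
    rw [hec, indicator_of_mem (by simp)]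
  rw [e1] at h1
  rw [h1.unique h1', h2']
  simp [trigMon_zero]

/-- The real part of the circle kernel is half the constant kernel plus half the Poisson kernel, an
approximate identity. -/
theorem TraceLim.re_circleKer {L : ℝ} (hL : 0 < L) {f : ℝ → ℝ} (hf : MemLp f 2 (arcMeasure L)) :
    TraceLim (arcMeasure L)
      (fun ε s => ∫ t, (_root_.circleKer L ε (s - t)).re * f t ∂(arcMeasure L))
      (fun s => (1 / 2) * (∫ t, f t ∂(arcMeasure L)) + L / 2 * f s) := by
  have hfi : Integrable f (arcMeasure L) := hf.integrable one_le_two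
  have h := ((TraceLim.circlePoisson hL hf.ofReal).re).const_mul (1 / 2)
  have hc : TraceLim (arcMeasure L) (fun _ _ => (1 / 2) * (∫ t, f t ∂(arcMeasure L)))
      (fun _ => (1 / 2) * (∫ t, f t ∂(arcMeasure L))) :=
    TraceLim.of_bounded _ (Eventually.of_forall fun _ => aestronglyMeasurable_const)
      (Eventually.of_forall fun _ => Eventually.of_forall fun _ => le_rfl)
      (Eventually.of_forall fun _ => tendsto_const_nhds)
  refine (hc.add h).congr_of_forall one_pos (S := univ) (Eventually.of_forall fun _ => mem_univ _)
    (fun ε hε _ s _ => ?_) (Eventually.of_forall fun s => ?_)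
  · have hcont := continuous_circleKer hL hε
    have hcP := continuous_circlePoisson hL hε
    have hre : ∀ u, (_root_.circleKer L ε u).re = 1 / 2 * 1 +
        1 / 2 * (_root_.circlePoisson L ε u).re := by
      intro u
      unfold _root_.circlePoisson
      rw [← conj_circleKer]
      simp only [Complex.sub_re, Complex.add_re, Complex.conj_re, Complex.one_re]; ring
    have hb : ∃ C, ∀ t ∈ Icc (0 : ℝ) L, ‖_root_.circlePoisson L ε (s - t)‖ ≤ C :=
      isCompact_Icc.exists_bound_of_continuousOn
        (f := fun t => _root_.circlePoisson L ε (s - t)) (Continuous.continuousOn (by fun_prop))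
    obtain ⟨C, hC⟩ := hb
    have hPi : Integrable (fun t => _root_.circlePoisson L ε (s - t) * (f t : ℂ))
        (arcMeasure L) := by
      refine hfi.ofReal.bdd_mul (c := C) (Continuous.aestronglyMeasurable (by fun_prop)) ?_
      filter_upwards [ae_mem_Ioc L] with t ht using hC t (Ioc_subset_Icc_self ht)
    have h1 : ∀ t, (_root_.circleKer L ε (s - t)).re * f t = 1 / 2 * f t +
        1 / 2 * RCLike.re (_root_.circlePoisson L ε (s - t) * (f t : ℂ)) := by
      intro t; rw [hre]
      simp only [RCLike.re_to_complex, Complex.re_mul_ofReal]; ring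
    simp_rw [h1]
    rw [integral_add (hfi.const_mul _) (hPi.re.const_mul _), integral_const_mul,
      integral_const_mul, integral_re hPi]
    rfl
  · simp; ring

/-! ### Closed curves of class `C²` in the complex plane -/

/-- A simple closed `C²` curve in the complex plane, parametrized by arc length. -/
structure IsArcCurve (c : ℝ → ℂ) (L : ℝ) : Prop where
  length_pos : 0 < L
  contDiff : ContDiff ℝ 2 c
  periodic : Function.Periodic c L
  unit_speed : ∀ s, ‖deriv c s‖ = 1
  injOn : InjOn c (Ico 0 L)

/-- The parallel curve `c + ε ν`, where `ν = -i c'`. -/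
def parallel (c : ℝ → ℂ) (ε s : ℝ) : ℂ := c s - ε * Complex.I * deriv c s

/-- The signed curvature `τ` of a curve in the complex plane, given by `c'' = τ ν`. -/
def curvC (c : ℝ → ℂ) (s : ℝ) : ℝ :=
  (deriv (deriv c) s * (starRingEnd ℂ) (-Complex.I * deriv c s)).re

theorem parallel_zero (c : ℝ → ℂ) (s : ℝ) : parallel c 0 s = c s := by simp [parallel]

namespace IsArcCurve

variable {c : ℝ → ℂ} {L : ℝ}

theorem contDiff_deriv (hc : IsArcCurve c L) : ContDiff ℝ 1 (deriv c) :=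
  ((contDiff_succ_iff_deriv (n := 1)).1 hc.contDiff).2.2

theorem hasDerivAt (hc : IsArcCurve c L) (s : ℝ) : HasDerivAt c (deriv c s) s :=
  ((hc.contDiff.differentiable (by norm_num)) s).hasDerivAt

theorem hasDerivAt_deriv (hc : IsArcCurve c L) (s : ℝ) :
    HasDerivAt (deriv c) (deriv (deriv c) s) s :=
  ((hc.contDiff_deriv.differentiable (by norm_num)) s).hasDerivAt

theorem continuous_deriv (hc : IsArcCurve c L) : Continuous (deriv c) :=
  hc.contDiff_deriv.continuous

theorem continuous (hc : IsArcCurve c L) : Continuous c := hc.contDiff.continuous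

theorem continuous_deriv₂ (hc : IsArcCurve c L) : Continuous (deriv (deriv c)) :=
  hc.contDiff_deriv.continuous_deriv le_rfl

theorem deriv_ne_zero (hc : IsArcCurve c L) (s : ℝ) : deriv c s ≠ 0 := by
  have := hc.unit_speed s
  intro h; rw [h] at this; simp at this

theorem deriv_mul_conj (hc : IsArcCurve c L) (s : ℝ) :
    deriv c s * (starRingEnd ℂ) (deriv c s) = 1 := by
  rw [Complex.mul_conj, Complex.normSq_eq_norm_sq, hc.unit_speed]; simp

theorem conj_deriv (hc : IsArcCurve c L) (s : ℝ) :
    (starRingEnd ℂ) (deriv c s) = (deriv c s)⁻¹ :=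
  eq_inv_of_mul_eq_one_right (hc.deriv_mul_conj s)

theorem deriv_periodic (hc : IsArcCurve c L) : Function.Periodic (deriv c) L := by
  intro s
  have h : (fun t => c (t + L)) = c := funext hc.periodic
  rw [← deriv_comp_add_const, h]

theorem deriv₂_periodic (hc : IsArcCurve c L) : Function.Periodic (deriv (deriv c)) L := by
  intro s
  have h : (fun t => deriv c (t + L)) = deriv c := funext hc.deriv_periodic
  rw [← deriv_comp_add_const, h]

theorem curvC_periodic (hc : IsArcCurve c L) : Function.Periodic (curvC c) L := by
  intro s; unfold curvC; rw [hc.deriv₂_periodic, hc.deriv_periodic]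

theorem continuous_curvC (hc : IsArcCurve c L) : Continuous (curvC c) := by
  have h1 := hc.continuous_deriv
  have h2 := hc.continuous_deriv₂
  unfold curvC
  exact Complex.continuous_re.comp (h2.mul (Complex.continuous_conj.comp (by fun_prop)))

/-- The acceleration of a curve of unit speed is normal to it. -/
theorem deriv₂_eq (hc : IsArcCurve c L) (s : ℝ) :
    deriv (deriv c) s = curvC c s * (-Complex.I * deriv c s) := by
  have h1 : HasDerivAt (fun t => deriv c t * (starRingEnd ℂ) (deriv c t))
      (deriv (deriv c) s * (starRingEnd ℂ) (deriv c s) +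
        deriv c s * (starRingEnd ℂ) (deriv (deriv c) s)) s :=
    (hc.hasDerivAt_deriv s).mul (Complex.conjCLE.toContinuousLinearMap.hasFDerivAt.comp_hasDerivAt
      s (hc.hasDerivAt_deriv s))
  have h2 : (fun t => deriv c t * (starRingEnd ℂ) (deriv c t)) = fun _ => 1 :=
    funext hc.deriv_mul_conj
  rw [h2] at h1
  have h3 := h1.unique (hasDerivAt_const s 1)
  set a := deriv (deriv c) s * (starRingEnd ℂ) (deriv c s) with ha
  have h4 : a + (starRingEnd ℂ) a = 0 := by
    rw [ha, map_mul, Complex.conj_conj, mul_comm ((starRingEnd ℂ) _) (deriv c s)]; exact h3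
  have hre : a.re = 0 := by
    have := congrArg Complex.re h4
    simp only [Complex.add_re, Complex.conj_re, Complex.zero_re] at this; linarith
  have hcv : curvC c s = -a.im := by
    unfold curvC
    rw [map_mul, show deriv (deriv c) s * ((starRingEnd ℂ) (-Complex.I) *
      (starRingEnd ℂ) (deriv c s)) = (starRingEnd ℂ) (-Complex.I) * a by rw [ha]; ring]
    simp
  have ha' : a = a.im * Complex.I := by
    apply Complex.ext <;> simp [hre]
  have : deriv (deriv c) s = a * deriv c s := by
    rw [ha, mul_assoc, mul_comm ((starRingEnd ℂ) _), hc.deriv_mul_conj, mul_one]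
  rw [this, hcv, ha']
  push_cast
  simp
  ring

theorem hasDerivAt_parallel (hc : IsArcCurve c L) (ε s : ℝ) :
    HasDerivAt (parallel c ε) (((1 - ε * curvC c s : ℝ) : ℂ) * deriv c s) s := by
  have h := (hc.hasDerivAt s).sub ((hc.hasDerivAt_deriv s).const_mul ((ε : ℂ) * Complex.I))
  refine h.congr_deriv ?_
  rw [hc.deriv₂_eq]
  push_cast
  linear_combination (ε * curvC c s * deriv c s : ℂ) * Complex.I_sq

theorem continuous_parallel (hc : IsArcCurve c L) :
    Continuous fun p : ℝ × ℝ => parallel c p.1 p.2 := by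
  have := hc.continuous; have := hc.continuous_deriv
  unfold parallel; fun_prop

theorem parallel_periodic (hc : IsArcCurve c L) (ε : ℝ) : Function.Periodic (parallel c ε) L := by
  intro s; unfold parallel; rw [hc.periodic, hc.deriv_periodic]

/-- Continuous periodic functions are bounded. -/
theorem _root_.Function.Periodic.exists_bound {E : Type*} [NormedAddCommGroup E] {g : ℝ → E}
    {L : ℝ} (hg : Function.Periodic g L) (hL : 0 < L) (hgc : Continuous g) :
    ∃ M : ℝ, 0 < M ∧ ∀ s, ‖g s‖ ≤ M := by
  obtain ⟨M, hM⟩ := isCompact_Icc.exists_bound_of_continuousOn (s := Icc 0 L) hgc.continuousOn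
  refine ⟨max M 1, by positivity, fun s => ?_⟩
  obtain ⟨y, hy, hys⟩ := hg.exists_mem_Ico₀ hL s
  rw [hys]
  exact (hM y (Ico_subset_Icc_self hy)).trans (le_max_left _ _)

/-- One constant for the curvature, the second derivative and the Taylor remainders of the curve. -/
theorem exists_deriv₂_bound (hc : IsArcCurve c L) : ∃ M : ℝ, 0 < M ∧
    (∀ s, |curvC c s| ≤ M) ∧ (∀ s, ‖deriv (deriv c) s‖ ≤ M) ∧
    (∀ s t, ‖deriv c s - deriv c t‖ ≤ M * |s - t|) ∧
    ∀ s t, ‖c s - c t - (s - t) * deriv c s‖ ≤ M * |s - t| ^ 2 := by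
  obtain ⟨M, hM0, hM⟩ := hc.curvC_periodic.exists_bound hc.length_pos hc.continuous_curvC
  have hM2 : ∀ s, ‖deriv (deriv c) s‖ ≤ M := by
    intro s
    rw [hc.deriv₂_eq, norm_mul, norm_mul, norm_neg, Complex.norm_I, hc.unit_speed,
      Complex.norm_real, mul_one, mul_one]
    exact hM s
  have hT : ∀ s t, ‖deriv c s - deriv c t‖ ≤ M * |s - t| := by
    intro s t
    have := convex_univ.norm_image_sub_le_of_norm_hasDerivWithin_le (f := deriv c)
      (fun x _ => (hc.hasDerivAt_deriv x).hasDerivWithinAt) (fun x _ => hM2 x)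
      (mem_univ t) (mem_univ s)
    simpa using this
  refine ⟨M, hM0, hM, hM2, hT, fun s t => ?_⟩
  have h1 : ∀ x ∈ uIcc t s, HasDerivWithinAt (fun x => c x - x * deriv c s)
      (deriv c x - deriv c s) (uIcc t s) x := by
    intro x _
    have h2 : HasDerivAt (fun x : ℝ => c x - (x : ℂ) * deriv c s) (deriv c x - 1 * deriv c s) x :=
      (hc.hasDerivAt x).sub ((Complex.ofRealCLM.hasDerivAt (x := x)).mul_const (deriv c s))
    rw [one_mul] at h2
    exact h2.hasDerivWithinAt
  have h3 := (convex_uIcc t s).norm_image_sub_le_of_norm_hasDerivWithin_le (C := M * |s - t|) h1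
    (fun x hx => (hT x s).trans (mul_le_mul_of_nonneg_left (by
      rw [abs_sub_comm x s, abs_sub_comm s t]
      have := abs_sub_right_of_mem_uIcc hx
      rwa [abs_sub_comm s x, abs_sub_comm t s, abs_sub_comm x s] at *) hM0.le))
      left_mem_uIcc right_mem_uIcc
  calc _ = ‖c s - s * deriv c s - (c t - t * deriv c s)‖ := by congr 1; ring
    _ ≤ M * |s - t| * ‖s - t‖ := h3
    _ = _ := by rw [Real.norm_eq_abs]; ring

theorem exists_int_of_eq (hc : IsArcCurve c L) {s t : ℝ} (h : c s = c t) :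
    ∃ k : ℤ, s = t + k * L := by
  have hL := hc.length_pos
  have e : ∀ x, c (toIcoMod hL 0 x) = c x := by
    intro x
    rw [toIcoMod]
    exact hc.periodic.sub_zsmul_eq _
  have h1 : toIcoMod hL 0 s = toIcoMod hL 0 t := by
    apply hc.injOn
    · simpa using toIcoMod_mem_Ico hL 0 s
    · simpa using toIcoMod_mem_Ico hL 0 t
    · rw [e, e, h]
  rw [toIcoMod, toIcoMod] at h1
  refine ⟨toIcoDiv hL 0 s - toIcoDiv hL 0 t, ?_⟩
  simp only [zsmul_eq_mul] at h1
  push_cast; linarith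

theorem eq_of_mem_Ioc (hc : IsArcCurve c L) {s t : ℝ} (hs : s ∈ Ioc 0 L) (ht : t ∈ Ioc 0 L)
    (h : c s = c t) : s = t := by
  obtain ⟨k, hk⟩ := hc.exists_int_of_eq h
  have hL := hc.length_pos
  have h1 : k < 1 := by
    have : (k : ℝ) * L < 1 * L := by linarith [hs.2, ht.1]
    exact_mod_cast lt_of_mul_lt_mul_right this hL.le
  have h2 : -1 < k := by
    have : (-1 : ℝ) * L < k * L := by linarith [hs.1, ht.2]
    exact_mod_cast lt_of_mul_lt_mul_right this hL.le
  have : k = 0 := by omega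
  subst this; simpa using hk

/-- The normal coordinates `(s, ε) ↦ c(s) + ε ν(s)` are bi-Lipschitz near the curve. -/
theorem exists_parallel_lower (hc : IsArcCurve c L) : ∃ c₀ ε₀ : ℝ, 0 < c₀ ∧ 0 < ε₀ ∧
    ε₀ ≤ L / (2 * Real.pi) / 2 ∧ (∀ s, ε₀ * |curvC c s| ≤ 1 / 2) ∧
    ∀ s t ε ε', |s - t| ≤ L / 2 → |ε| ≤ ε₀ → |ε'| ≤ ε₀ →
      c₀ * (|s - t| + |ε - ε'|) ≤ ‖parallel c ε s - parallel c ε' t‖ := by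
  have hL := hc.length_pos
  obtain ⟨M, hM0, hMτ, -, hT, hcT⟩ := hc.exists_deriv₂_bound
  set δ := 1 / (8 * M) with hδ
  have hδ0 : 0 < δ := by positivity
  -- away from the diagonal the curve keeps a positive distance from itself
  obtain ⟨m, hm0, hm⟩ : ∃ m : ℝ, 0 < m ∧ ∀ s t, δ ≤ |s - t| → |s - t| ≤ L / 2 →
      m ≤ ‖c s - c t‖ := by
    set K : Set (ℝ × ℝ) := Icc 0 L ×ˢ {u : ℝ | δ ≤ |u| ∧ |u| ≤ L / 2} with hK
    have hKc : IsCompact K := by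
      refine isCompact_Icc.prod ?_
      refine (isCompact_Icc (a := -(L / 2)) (b := L / 2)).of_isClosed_subset ?_ ?_
      · exact (isClosed_le continuous_const continuous_abs).inter
          (isClosed_le continuous_abs continuous_const)
      · intro u hu; exact abs_le.1 hu.2
    have hcont : Continuous fun p : ℝ × ℝ => ‖c p.1 - c (p.1 - p.2)‖ := by
      have := hc.continuous; fun_prop
    have hpos : ∀ p ∈ K, 0 < ‖c p.1 - c (p.1 - p.2)‖ := by
      rintro ⟨s, u⟩ ⟨-, hu1, hu2⟩
      simp only at hu1 hu2 ⊢
      rw [norm_pos_iff, sub_ne_zero]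
      intro h
      obtain ⟨k, hk⟩ := hc.exists_int_of_eq h
      have hu : u = k * L := by linarith
      have hk0 : k ≠ 0 := by
        rintro rfl
        rw [hu] at hu1; simp at hu1; linarith
      have : (1 : ℝ) ≤ |(k : ℝ)| := by exact_mod_cast Int.one_le_abs hk0
      rw [hu, abs_mul, abs_of_pos hL] at hu2
      nlinarith
    obtain ⟨m, hm0, hm⟩ := hKc.exists_forall_le' hcont.continuousOn (a := 0) hpos
    refine ⟨m, hm0, fun s t h1 h2 => ?_⟩
    obtain ⟨y, hy, hys⟩ := hc.periodic.exists_mem_Ico₀ hL s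
    have hkey : c t = c (y - (s - t)) := by
      have h3 : (fun x => c (x - (s - t))) (s) = (fun x => c (x - (s - t))) y := by
        obtain ⟨n, hn⟩ := hc.exists_int_of_eq hys
        have : y - (s - t) = s - (s - t) - n * L := by rw [hn]; ring
        simp only
        rw [this, hc.periodic.sub_int_mul_eq]
      simpa using h3
    rw [hys, hkey]
    exact hm (y, s - t) ⟨Ico_subset_Icc_self hy, h1, h2⟩
  set ε₀ := min (min δ (m / 4)) (L / (2 * Real.pi) / 2) with hε₀
  have hε₀0 : 0 < ε₀ := by
    have := Real.pi_pos
    refine lt_min (lt_min hδ0 (by positivity)) (by positivity)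
  have hε₀δ : ε₀ ≤ δ := (min_le_left _ _).trans (min_le_left _ _)
  have hε₀m : ε₀ ≤ m / 4 := (min_le_left _ _).trans (min_le_right _ _)
  set c₀ := min (1 / 4) ((m / 2) / (L / 2 + 2 * ε₀)) with hc₀
  refine ⟨c₀, ε₀, by positivity, hε₀0, min_le_right _ _, fun s => ?_, ?_⟩
  · calc ε₀ * |curvC c s| ≤ δ * M := by gcongr; exact hMτ s
      _ ≤ 1 / 2 := by rw [hδ]; field_simp; norm_num
  intro s t ε ε' hst hε hε'
  have hee : |ε - ε'| ≤ 2 * ε₀ := (abs_sub _ _).trans (by linarith)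
  rcases le_or_gt δ |s - t| with h | h
  -- away from the diagonal, the displacements are small compared with `m`
  · have h1 := hm s t h hst
    have h2 : ‖parallel c ε s - parallel c ε' t‖ ≥ ‖c s - c t‖ - (|ε| + |ε'|) := by
      have e : c s - c t = (parallel c ε s - parallel c ε' t) +
          (ε * Complex.I * deriv c s - ε' * Complex.I * deriv c t) := by unfold parallel; ring
      have e2 : ‖(ε * Complex.I * deriv c s - ε' * Complex.I * deriv c t : ℂ)‖ ≤ |ε| + |ε'| := by
        refine (norm_sub_le _ _).trans (le_of_eq ?_)
        simp [hc.unit_speed]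
      have e3 := norm_add_le (parallel c ε s - parallel c ε' t)
        (ε * Complex.I * deriv c s - ε' * Complex.I * deriv c t)
      rw [← e] at e3
      linarith
    have h3 : m / 2 ≤ ‖parallel c ε s - parallel c ε' t‖ := by linarith
    refine le_trans ?_ h3
    calc c₀ * (|s - t| + |ε - ε'|) ≤ (m / 2) / (L / 2 + 2 * ε₀) * (L / 2 + 2 * ε₀) := by
          gcongr; exact min_le_right _ _
      _ = m / 2 := by field_simp
  -- near the diagonal, Taylor expansion at `s`: the main term is the right-angled displacement by
  -- `s - t` along the tangent and by `ε - ε'` along the normal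
  · have e : parallel c ε s - parallel c ε' t =
        ((s - t : ℝ) + (-(ε - ε') : ℝ) * Complex.I) * deriv c s +
        ((c s - c t - (s - t) * deriv c s) - ε' * Complex.I * (deriv c s - deriv c t)) := by
      unfold parallel; push_cast; ring
    have h1 : (|s - t| + |ε - ε'|) / 2 ≤
        ‖(((s - t : ℝ) + (-(ε - ε') : ℝ) * Complex.I) * deriv c s : ℂ)‖ := by
      rw [norm_mul, hc.unit_speed, mul_one]
      have a1 := Complex.abs_re_le_norm ((s - t : ℝ) + (-(ε - ε') : ℝ) * Complex.I : ℂ)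
      have a2 := Complex.abs_im_le_norm ((s - t : ℝ) + (-(ε - ε') : ℝ) * Complex.I : ℂ)
      simp only [Complex.add_re, Complex.ofReal_re, Complex.mul_re, Complex.I_re, mul_zero,
        Complex.ofReal_im, Complex.I_im, add_zero, Complex.add_im,
        Complex.mul_im, mul_one, zero_add, abs_neg, sub_self] at a1 a2
      linarith
    have h2 : ‖(c s - c t - (s - t) * deriv c s) - ε' * Complex.I * (deriv c s - deriv c t)‖ ≤
        |s - t| / 4 := by
      refine (norm_sub_le _ _).trans ?_
      have b1 := hcT s t
      have b2 : ‖ε' * Complex.I * (deriv c s - deriv c t)‖ ≤ δ * (M * |s - t|) := by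
        rw [norm_mul, norm_mul, Complex.norm_I, mul_one, Complex.norm_real, Real.norm_eq_abs]
        exact mul_le_mul (hε'.trans hε₀δ) (hT s t) (norm_nonneg _) hδ0.le
      have hMδ : M * δ = 1 / 8 := by rw [hδ]; field_simp
      have b3 : M * |s - t| ^ 2 ≤ M * (δ * |s - t|) := by
        rw [sq]; gcongr
      have b4 : M * (δ * |s - t|) = 1 / 8 * |s - t| := by rw [← mul_assoc, hMδ]
      have b5 : δ * (M * |s - t|) = 1 / 8 * |s - t| := by rw [← hMδ]; ring
      linarith
    rw [e]
    have h3 := norm_sub_norm_le (((s - t : ℝ) + (-(ε - ε') : ℝ) * Complex.I) * deriv c s : ℂ)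
      (-((c s - c t - (s - t) * deriv c s) - ε' * Complex.I * (deriv c s - deriv c t)))
    rw [norm_neg, sub_neg_eq_add] at h3
    have h4 : c₀ * (|s - t| + |ε - ε'|) ≤ 1 / 4 * (|s - t| + |ε - ε'|) := by
      gcongr; exact min_le_left _ _
    have := abs_nonneg (s - t)
    have := abs_nonneg (ε - ε')
    linarith

end IsArcCurve

/-! ### Boundary limits of Cauchy integrals -/

namespace IsArcCurve

variable {c : ℝ → ℂ} {L : ℝ}

/-- The lower Lipschitz constant of the normal coordinates. -/
def lowerConst (hc : IsArcCurve c L) : ℝ := hc.exists_parallel_lower.choose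

/-- The half-width of the neighbourhood of the curve on which normal coordinates are used. -/
def width (hc : IsArcCurve c L) : ℝ := hc.exists_parallel_lower.choose_spec.choose

theorem lowerConst_pos (hc : IsArcCurve c L) : 0 < hc.lowerConst :=
  hc.exists_parallel_lower.choose_spec.choose_spec.1

theorem width_pos (hc : IsArcCurve c L) : 0 < hc.width :=
  hc.exists_parallel_lower.choose_spec.choose_spec.2.1

theorem width_le (hc : IsArcCurve c L) : hc.width ≤ L / (2 * Real.pi) / 2 :=
  hc.exists_parallel_lower.choose_spec.choose_spec.2.2.1

theorem width_mul_curvC_le (hc : IsArcCurve c L) (s : ℝ) : hc.width * |curvC c s| ≤ 1 / 2 :=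
  hc.exists_parallel_lower.choose_spec.choose_spec.2.2.2.1 s

theorem parallel_lower (hc : IsArcCurve c L) {s t ε ε' : ℝ} (h : |s - t| ≤ L / 2)
    (hε : |ε| ≤ hc.width) (hε' : |ε'| ≤ hc.width) :
    hc.lowerConst * (|s - t| + |ε - ε'|) ≤ ‖parallel c ε s - parallel c ε' t‖ :=
  hc.exists_parallel_lower.choose_spec.choose_spec.2.2.2.2 s t ε ε' h hε hε'

theorem exists_shift (hc : IsArcCurve c L) (s t : ℝ) : ∃ k : ℤ, |s - t - k * L| ≤ L / 2 := by
  have hL := hc.length_pos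
  refine ⟨round ((s - t) / L), ?_⟩
  have h := abs_sub_round ((s - t) / L)
  have e : s - t - round ((s - t) / L) * L = ((s - t) / L - round ((s - t) / L)) * L := by
    field_simp
  rw [e, abs_mul, abs_of_pos hL]
  calc _ ≤ 1 / 2 * L := by gcongr
    _ = L / 2 := by ring

theorem parallel_shift (hc : IsArcCurve c L) (ε t : ℝ) (k : ℤ) :
    parallel c ε (t + k * L) = parallel c ε t := by
  have := (hc.parallel_periodic ε).int_mul k t
  simpa using this

theorem shift (hc : IsArcCurve c L) (t : ℝ) (k : ℤ) : c (t + k * L) = c t := by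
  simpa [parallel_zero] using hc.parallel_shift 0 t k

theorem parallel_sub_lower (hc : IsArcCurve c L) {s t ε : ℝ} {k : ℤ}
    (h : |s - t - k * L| ≤ L / 2) (hε : 0 ≤ ε) (hε' : ε ≤ hc.width) :
    hc.lowerConst * (|s - t - k * L| + ε) ≤ ‖parallel c ε s - c t‖ := by
  have h1 := hc.parallel_lower (s := s) (t := t + k * L) (ε := ε) (ε' := 0)
    (by rwa [← sub_sub]) (by rwa [abs_of_nonneg hε]) (by simpa using hc.width_pos.le)
  rwa [parallel_zero, hc.shift, sub_zero, abs_of_nonneg hε, ← sub_sub] at h1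

theorem parallel_sub_ne (hc : IsArcCurve c L) {ε : ℝ} (hε : 0 < ε) (hε' : ε ≤ hc.width)
    (s t : ℝ) : parallel c ε s - c t ≠ 0 := by
  obtain ⟨k, hk⟩ := hc.exists_shift s t
  have h := hc.parallel_sub_lower hk hε.le hε'
  have : 0 < hc.lowerConst * (|s - t - k * L| + ε) :=
    mul_pos hc.lowerConst_pos (by positivity)
  exact norm_pos_iff.1 (this.trans_le h)

theorem sub_ne (hc : IsArcCurve c L) {s t : ℝ} (hs : s ∈ Ioc 0 L) (ht : t ∈ Ioc 0 L)
    (h : t ≠ s) : c s - c t ≠ 0 := fun h' => h (hc.eq_of_mem_Ioc hs ht (sub_eq_zero.1 h')).symm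

/-- The Cauchy kernel of the curve minus the Cauchy kernel of the circle of the same length. -/
def cauchyRem (c : ℝ → ℂ) (L ε s t : ℝ) : ℂ :=
  (parallel c ε s - c t)⁻¹ -
    Complex.I * (deriv c s)⁻¹ * ((2 * Real.pi / L : ℝ) : ℂ) * circleKer L ε (s - t)

/-- The Cauchy kernel of the curve and that of the circle both differ from the Cauchy kernel of the
tangent line by bounded functions, uniformly in the displacement. -/
theorem exists_cauchyRem_bound (hc : IsArcCurve c L) : ∃ C : ℝ, ∀ ε, 0 < ε → ε < hc.width →
    ∀ s t, ‖cauchyRem c L ε s t‖ ≤ C := by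
  have hL := hc.length_pos
  have hpi := Real.pi_pos
  obtain ⟨M, hM0, -, -, -, hcT⟩ := hc.exists_deriv₂_bound
  set κ := 2 * Real.pi / L with hκ
  have hκp : 0 < κ := by positivity
  have hl := hc.lowerConst_pos
  refine ⟨2 * M / hc.lowerConst + κ * 6, fun ε hε hε' s t => ?_⟩
  obtain ⟨k, hk⟩ := hc.exists_shift s t
  have hper : cauchyRem c L ε s t = cauchyRem c L ε s (t + k * L) := by
    unfold cauchyRem
    rw [hc.shift, ← sub_sub, circleKer_sub_int_mul hL]
  rw [hper]
  have hlow := hc.parallel_sub_lower hk hε.le hε'.le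
  rw [← hc.shift t k] at hlow
  set t' := t + k * L with ht'
  have hu : s - t - k * L = s - t' := by rw [ht']; ring
  rw [hu] at hk hlow
  set u := s - t' with hudef
  -- `-i T ζ` is the difference vector with the curve replaced by its tangent at `s`
  set ζ : ℂ := (ε : ℂ) + u * Complex.I with hζ
  have hζn : (|u| + ε) / 2 ≤ ‖ζ‖ := by
    have a1 := Complex.abs_re_le_norm ζ
    have a2 := Complex.abs_im_le_norm ζ
    simp only [hζ, Complex.add_re, Complex.ofReal_re, Complex.mul_re, Complex.I_re, mul_zero,
      Complex.ofReal_im, Complex.I_im, add_zero, Complex.add_im, Complex.mul_im,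
      mul_one, zero_add, sub_self] at a1 a2
    rw [abs_of_pos hε] at a1
    rw [hζ]; linarith
  have hζ0 : ζ ≠ 0 := norm_pos_iff.1 (lt_of_lt_of_le (by positivity) hζn)
  have hT0 := hc.deriv_ne_zero s
  have hR0 : parallel c ε s - c t' ≠ 0 := hc.parallel_sub_ne hε hε'.le s t'
  have e : cauchyRem c L ε s t' = ((parallel c ε s - c t')⁻¹ - (-Complex.I * deriv c s * ζ)⁻¹) -
      Complex.I * (deriv c s)⁻¹ * (κ * (circleKer L ε u - (κ * ζ)⁻¹)) := by
    unfold cauchyRem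
    have hκ0 : (κ : ℂ) ≠ 0 := by exact_mod_cast hκp.ne'
    have hI := Complex.I_ne_zero
    have : (-Complex.I * deriv c s * ζ)⁻¹ = Complex.I * (deriv c s)⁻¹ * ζ⁻¹ := by
      rw [mul_inv, mul_inv, inv_neg, Complex.inv_I, neg_neg]
    rw [this]
    field_simp
    ring
  rw [e]
  refine (norm_sub_le _ _).trans (add_le_add ?_ ?_)
  -- the curve against its tangent: the Taylor remainder is quadratic
  · have hZ0 : -Complex.I * deriv c s * ζ ≠ 0 := by
      simp [hT0, hζ0]
    rw [inv_sub_inv hR0 hZ0, norm_div, norm_mul, norm_mul, norm_mul, norm_neg, Complex.norm_I,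
      hc.unit_speed, one_mul, one_mul]
    have e2 : -Complex.I * deriv c s * ζ - (parallel c ε s - c t') =
        -(c s - c t' - (s - t') * deriv c s) := by
      unfold parallel
      rw [hζ, hudef]; push_cast
      linear_combination (-(s - t') * deriv c s : ℂ) * Complex.I_sq
    rw [e2, norm_neg, div_le_div_iff₀ (mul_pos (norm_pos_iff.2 hR0) (norm_pos_iff.2 hζ0)) hl]
    have h1 := hcT s t'
    rw [← hudef] at h1
    have h3 : hc.lowerConst * (|u| + ε) * ((|u| + ε) / 2) ≤ ‖parallel c ε s - c t'‖ * ‖ζ‖ :=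
      mul_le_mul hlow hζn (by positivity) (norm_nonneg _)
    have h4 : |u| ^ 2 ≤ (|u| + ε) ^ 2 := by gcongr; linarith
    calc _ ≤ M * |u| ^ 2 * hc.lowerConst := by gcongr
      _ ≤ M * (|u| + ε) ^ 2 * hc.lowerConst := by gcongr
      _ = 2 * M * (hc.lowerConst * (|u| + ε) * ((|u| + ε) / 2)) := by ring
      _ ≤ _ := by gcongr
  -- the circle against its tangent
  · rw [norm_mul, norm_mul, norm_mul, Complex.norm_I, norm_inv, hc.unit_speed, Complex.norm_real,
      Real.norm_of_nonneg hκp.le, inv_one, one_mul, one_mul]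
    gcongr
    have hx1 : κ * ε ≤ 1 := by
      have h1 : ε ≤ L / (2 * Real.pi) := by
        have := hc.width_le
        have : 0 < L / (2 * Real.pi) := by positivity
        linarith
      rw [le_div_iff₀ (by positivity)] at h1
      rw [hκ, div_mul_eq_mul_div, div_le_one hL]; linarith
    have hy : |κ * u| ≤ Real.pi := by
      rw [abs_mul, abs_of_pos hκp]
      calc κ * |u| ≤ κ * (L / 2) := by gcongr
        _ = Real.pi := by rw [hκ]; field_simp
    have := norm_inv_one_sub_exp_sub_inv_le (x := κ * ε) (y := κ * u) (by positivity) hx1 hy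
      (by positivity)
    refine le_trans (le_of_eq ?_) this
    unfold circleKer
    congr 3
    rw [hζ]; push_cast; ring

theorem tendsto_parallel (c : ℝ → ℂ) (s : ℝ) :
    Tendsto (fun ε => parallel c ε s) (𝓝[>] 0) (𝓝 (c s)) := by
  have : Continuous fun ε : ℝ => parallel c ε s := by unfold parallel; fun_prop
  have := this.tendsto 0
  rw [parallel_zero] at this
  exact this.mono_left nhdsWithin_le_nhds

theorem tendsto_inv_parallel_sub (hc : IsArcCurve c L) {s t : ℝ} (hs : s ∈ Ioo 0 L)
    (ht : t ∈ Ioo 0 L) (h : t ≠ s) :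
    Tendsto (fun ε => (parallel c ε s - c t)⁻¹) (𝓝[>] 0) (𝓝 (c s - c t)⁻¹) :=
  ((tendsto_parallel c s).sub_const _).inv₀
    (hc.sub_ne (Ioo_subset_Ioc_self hs) (Ioo_subset_Ioc_self ht) h)

theorem circleKer_zero_eq {L u : ℝ} (hL : 0 < L) (hu : |u| < L) (hu0 : u ≠ 0) :
    1 - Complex.exp (-((2 * Real.pi / L * 0 : ℝ) + (2 * Real.pi / L * u : ℝ) * Complex.I)) ≠ 0 := by
  have hpi := Real.pi_pos
  intro h
  have h1 := sub_eq_zero.1 h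
  rw [eq_comm, Complex.exp_eq_one_iff] at h1
  obtain ⟨n, hn⟩ := h1
  have h2 := congrArg Complex.im hn
  simp at h2
  have h3 : u = -n * L := by
    field_simp at h2
    linarith
  have hn0 : n ≠ 0 := by
    rintro rfl
    apply hu0; rw [h3]; simp
  have h4 : (1 : ℝ) ≤ |(n : ℝ)| := by exact_mod_cast Int.one_le_abs hn0
  rw [h3, abs_mul, abs_neg, abs_of_pos hL] at hu
  nlinarith

theorem tendsto_circleKer {L u : ℝ} (hL : 0 < L) (hu : |u| < L) (hu0 : u ≠ 0) :
    Tendsto (fun ε => circleKer L ε u) (𝓝[>] 0) (𝓝 (circleKer L 0 u)) := by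
  unfold circleKer
  refine Tendsto.inv₀ ?_ (circleKer_zero_eq hL hu hu0)
  have : Continuous fun ε : ℝ => 1 - Complex.exp (-((2 * Real.pi / L * ε : ℝ) +
    (2 * Real.pi / L * u : ℝ) * Complex.I)) := by fun_prop
  exact (this.tendsto 0).mono_left nhdsWithin_le_nhds

theorem re_circleKer_zero {L u : ℝ} (hL : 0 < L) (hu : |u| < L) (hu0 : u ≠ 0) :
    (circleKer L 0 u).re = 1 / 2 := by
  have h := circleKer_zero_eq hL hu hu0
  unfold circleKer
  set q := Complex.exp (-((2 * Real.pi / L * 0 : ℝ) + (2 * Real.pi / L * u : ℝ) * Complex.I))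
    with hq
  have hn : ‖q‖ = 1 := by rw [hq, Complex.norm_exp]; simp
  have hn2 : q.re ^ 2 + q.im ^ 2 = 1 := by
    have := Complex.normSq_eq_norm_sq q
    rw [hn, Complex.normSq_apply] at this; linarith
  have hns : Complex.normSq (1 - q) = 2 * (1 - q.re) := by
    rw [Complex.normSq_apply]
    simp only [Complex.sub_re, Complex.one_re, Complex.sub_im, Complex.one_im]
    linear_combination hn2
  have hne : Complex.normSq (1 - q) ≠ 0 := (Complex.normSq_pos.2 h).ne'
  rw [Complex.inv_re, hns, Complex.sub_re, Complex.one_re]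
  rw [hns] at hne
  have hne' : 1 - q.re ≠ 0 := right_ne_zero_of_mul hne
  field_simp

theorem measurable_parallel (hc : IsArcCurve c L) (ε : ℝ) : Measurable (parallel c ε) := by
  have := hc.continuous; have := hc.continuous_deriv
  unfold parallel
  exact Continuous.measurable (by fun_prop)

theorem ae_ne (L s : ℝ) : ∀ᵐ t ∂(arcMeasure L), t ≠ s := by
  unfold arcMeasure
  exact ae_restrict_of_ae (Measure.ae_ne _ s)

theorem traceLim_cauchyRem (hc : IsArcCurve c L) {h : ℝ → ℂ} (hh : Integrable h (arcMeasure L)) :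
    TraceLim (arcMeasure L) (fun ε s => ∫ t, cauchyRem c L ε s t * h t ∂(arcMeasure L))
      (fun s => ∫ t, cauchyRem c L 0 s t * h t ∂(arcMeasure L)) := by
  have hL := hc.length_pos
  obtain ⟨C, hC⟩ := hc.exists_cauchyRem_bound
  refine TraceLim.of_bounded_kernel (C := C) hc.width_pos (ae_mem_Ioo L) hh (fun ε hε _ => ?_)
    (fun ε hε hε' s _ t _ => hC ε hε hε' s t) (fun s hs => ?_)
  · have h1 := hc.measurable_parallel ε
    have h2 := hc.continuous.measurable
    have h3 := hc.continuous_deriv.measurable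
    have h4 := (continuous_circleKer hL hε).measurable
    unfold cauchyRem Function.uncurry
    fun_prop
  · filter_upwards [ae_ne L s, ae_mem_Ioo L] with t hts ht
    have hu : |s - t| < L := by rw [abs_lt]; constructor <;> linarith [hs.1, hs.2, ht.1, ht.2]
    have h1 := (hc.tendsto_inv_parallel_sub hs ht hts).sub
      ((tendsto_circleKer hL hu (sub_ne_zero.2 hts.symm)).const_mul
        (Complex.I * (deriv c s)⁻¹ * ((2 * Real.pi / L : ℝ) : ℂ)))
    unfold cauchyRem
    rwa [parallel_zero]

/-- The Cauchy integral of `h` with respect to arc length, at the point `c(s) + ε ν(s)`. -/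
def _root_.cauchyInt (c : ℝ → ℂ) (L ε : ℝ) (h : ℝ → ℂ) (s : ℝ) : ℂ :=
  ∫ t, (parallel c ε s - c t)⁻¹ * h t ∂(arcMeasure L)

/-- The boundary limit of the Cauchy integral. -/
def _root_.cauchyLim (c : ℝ → ℂ) (L : ℝ) (h : ℝ → ℂ) : ℝ → ℂ :=
  Classical.epsilon fun e => TraceLim (arcMeasure L) (fun ε => cauchyInt c L ε h) e

theorem integrable_bounded_mul {h : ℝ → ℂ} (hh : Integrable h (arcMeasure L)) {k : ℝ → ℂ}
    (hk : Measurable k) {C : ℝ} (hC : ∀ t, ‖k t‖ ≤ C) :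
    Integrable (fun t => k t * h t) (arcMeasure L) :=
  hh.bdd_mul hk.aestronglyMeasurable (Eventually.of_forall hC)

theorem exists_circleKer_bound {L ε : ℝ} (hL : 0 < L) (hε : 0 < ε) :
    ∃ C, ∀ u, ‖circleKer L ε u‖ ≤ C := by
  refine ⟨∑' n : ℕ, circleRatio L ε ^ n, fun u => ?_⟩
  rw [← (hasSum_circleKer hL hε u).tsum_eq]
  have hs := summable_geometric_of_lt_one (circleRatio_pos L ε).le (circleRatio_lt_one hL hε)
  refine tsum_of_norm_bounded hs.hasSum fun n => ?_
  rw [norm_mul, norm_trigMon, mul_one, Complex.norm_real,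
    Real.norm_of_nonneg (pow_nonneg (circleRatio_pos _ _).le _)]

/-- Comparison of the Cauchy integral with that of the circle. -/
theorem cauchyInt_eq (hc : IsArcCurve c L) {h : ℝ → ℂ} (hh : Integrable h (arcMeasure L)) {ε : ℝ}
    (hε : 0 < ε) (hε' : ε < hc.width) (s : ℝ) :
    cauchyInt c L ε h s = (∫ t, cauchyRem c L ε s t * h t ∂(arcMeasure L)) +
      Complex.I * (deriv c s)⁻¹ * ((2 * Real.pi / L : ℝ) : ℂ) *
        ∫ t, circleKer L ε (s - t) * h t ∂(arcMeasure L) := by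
  have hL := hc.length_pos
  obtain ⟨C, hC⟩ := hc.exists_cauchyRem_bound
  obtain ⟨C', hC'⟩ := exists_circleKer_bound hL hε
  have h2 := hc.continuous.measurable
  have h4 := (continuous_circleKer hL hε).measurable
  rw [← integral_const_mul, ← integral_add]
  · unfold cauchyInt
    congr 1; ext t
    unfold cauchyRem; ring
  · refine integrable_bounded_mul hh ?_ (hC ε hε hε' s)
    unfold cauchyRem; fun_prop
  · exact (integrable_bounded_mul hh (by fun_prop) (fun t => hC' (s - t))).const_mul _

/-- Cauchy integrals of square integrable densities have boundary limits, almost everywhere and in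
mean square. -/
theorem traceLim_cauchyInt (hc : IsArcCurve c L) {h : ℝ → ℂ} (hh : MemLp h 2 (arcMeasure L)) :
    TraceLim (arcMeasure L) (fun ε => cauchyInt c L ε h) (cauchyLim c L h) := by
  have hL := hc.length_pos
  have hi := hh.integrable one_le_two
  have hex : ∃ e, TraceLim (arcMeasure L) (fun ε => cauchyInt c L ε h) e := by
    obtain ⟨e, he⟩ := TraceLim.circleKer hL hh
    have h1 := (hc.traceLim_cauchyRem hi).add (he.bdd_mul
      (m := fun s => Complex.I * (deriv c s)⁻¹ * ((2 * Real.pi / L : ℝ) : ℂ))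
      (C := ‖((2 * Real.pi / L : ℝ) : ℂ)‖) ?_ ?_)
    · exact ⟨_, h1.congr_of_forall hc.width_pos (S := univ) (Eventually.of_forall mem_univ)
        (fun ε h0 h1 s _ => hc.cauchyInt_eq hi h0 h1 s) (Eventually.of_forall fun _ => rfl)⟩
    · have := hc.continuous_deriv.measurable
      exact Measurable.aestronglyMeasurable (by fun_prop)
    · intro s
      simp [hc.unit_speed]
  exact Classical.epsilon_spec hex

/-- The kernel of the adjoint Neumann–Poincaré operator, without the factor `1 / 2π`. -/
def _root_.normalKer (c : ℝ → ℂ) (s t : ℝ) : ℝ := (-Complex.I * deriv c s * (c s - c t)⁻¹).re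

theorem measurable_normalKer (hc : IsArcCurve c L) :
    Measurable (Function.uncurry (normalKer c)) := by
  have := hc.continuous.measurable; have := hc.continuous_deriv.measurable
  unfold normalKer Function.uncurry; fun_prop

/-- On a curve of class `C²` the chord is normal only to second order, so the Neumann-Poincaré kernel
is bounded. -/
theorem exists_normalKer_bound (hc : IsArcCurve c L) : ∃ C : ℝ, ∀ s t, |normalKer c s t| ≤ C := by
  obtain ⟨M, hM0, -, -, -, hcT⟩ := hc.exists_deriv₂_bound
  have hl := hc.lowerConst_pos
  refine ⟨M / hc.lowerConst ^ 2, fun s t => ?_⟩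
  obtain ⟨k, hk⟩ := hc.exists_shift s t
  have hlow := hc.parallel_sub_lower hk le_rfl hc.width_pos.le
  rw [parallel_zero, add_zero] at hlow
  have h1 := hcT s (t + k * L)
  rw [hc.shift, ← sub_sub] at h1
  set u := s - t - k * L with hu
  have h2 : normalKer c s t = (-Complex.I * deriv c s * (starRingEnd ℂ) (c s - c t)).re /
      Complex.normSq (c s - c t) := by
    unfold normalKer
    rw [Complex.inv_def, ← mul_assoc, Complex.re_mul_ofReal, div_eq_mul_inv]
  set w := c s - c t - (s - (t + k * L : ℝ)) * deriv c s with hw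
  have h3 : (-Complex.I * deriv c s * (starRingEnd ℂ) (c s - c t)).re =
      (-Complex.I * deriv c s * (starRingEnd ℂ) w).re := by
    have e : c s - c t = w + (u : ℂ) * deriv c s := by rw [hw, hu]; push_cast; ring
    have e2 : -Complex.I * deriv c s * (starRingEnd ℂ) (c s - c t) =
        -Complex.I * deriv c s * (starRingEnd ℂ) w +
        (-(u : ℝ) : ℂ) * Complex.I * (deriv c s * (starRingEnd ℂ) (deriv c s)) := by
      rw [e, map_add, map_mul, Complex.conj_ofReal]; ring
    rw [e2, hc.deriv_mul_conj]
    simp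
  have h4 : |(-Complex.I * deriv c s * (starRingEnd ℂ) w).re| ≤ M * |u| ^ 2 := by
    refine (Complex.abs_re_le_norm _).trans ?_
    rw [norm_mul, norm_mul, norm_neg, Complex.norm_I, hc.unit_speed, one_mul, one_mul,
      RCLike.norm_conj]
    exact h1
  rw [h2, h3, abs_div, abs_of_nonneg (Complex.normSq_nonneg _), Complex.normSq_eq_norm_sq]
  rcases eq_or_ne (c s - c t) 0 with h0 | h0
  · rw [h0]; simp; positivity
  · rw [div_le_div_iff₀ (by positivity) (by positivity)]
    have h5 : (hc.lowerConst * |u|) ^ 2 ≤ ‖c s - c t‖ ^ 2 := by gcongr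
    calc _ ≤ M * |u| ^ 2 * hc.lowerConst ^ 2 := by gcongr
      _ = M * (hc.lowerConst * |u|) ^ 2 := by ring
      _ ≤ _ := by gcongr

theorem integrable_normalKer_mul (hc : IsArcCurve c L) {h : ℝ → ℝ}
    (hh : Integrable h (arcMeasure L)) (s : ℝ) :
    Integrable (fun t => normalKer c s t * h t) (arcMeasure L) := by
  obtain ⟨C, hC⟩ := hc.exists_normalKer_bound
  exact hh.bdd_mul (hc.measurable_normalKer.comp measurable_prodMk_left).aestronglyMeasurable
    (Eventually.of_forall fun t => hC s t)

/-- The jump relation for the normal derivative of the single-layer potential. -/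
theorem traceLim_normal (hc : IsArcCurve c L) {h : ℝ → ℝ} (hh : MemLp h 2 (arcMeasure L)) :
    TraceLim (arcMeasure L)
      (fun ε s => (-Complex.I * deriv c s * cauchyInt c L ε (fun t => (h t : ℂ)) s).re)
      (fun s => Real.pi * h s + ∫ t, normalKer c s t * h t ∂(arcMeasure L)) := by
  have hL := hc.length_pos
  have hi := hh.integrable one_le_two
  have hiC : Integrable (fun t => (h t : ℂ)) (arcMeasure L) := hi.ofReal
  obtain ⟨C, hC⟩ := hc.exists_cauchyRem_bound
  -- the Cauchy kernel splits into the bounded remainder, which has no jump, and the circle kernel,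
  -- whose real part contributes the jump `π h`
  have h1 := ((hc.traceLim_cauchyRem hiC).bdd_mul (m := fun s => -Complex.I * deriv c s) (C := 1)
    (by
      have := hc.continuous_deriv
      exact Continuous.aestronglyMeasurable (by fun_prop))
    (fun s => by simp [hc.unit_speed])).re
  have h2 := (TraceLim.re_circleKer hL hh).const_mul (2 * Real.pi / L)
  refine (h1.add h2).congr_of_forall hc.width_pos (S := univ) (Eventually.of_forall mem_univ)
    (fun ε hε hε' s _ => ?_) ?_
  · rw [hc.cauchyInt_eq hiC hε hε']
    obtain ⟨C', hC'⟩ := exists_circleKer_bound hL hε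
    have h4 := (continuous_circleKer hL hε).measurable
    have hint : Integrable (fun t => circleKer L ε (s - t) * (h t : ℂ)) (arcMeasure L) :=
      integrable_bounded_mul hiC (by fun_prop) (fun t => hC' (s - t))
    have e : ∫ t, (circleKer L ε (s - t)).re * h t ∂(arcMeasure L) =
        (∫ t, circleKer L ε (s - t) * (h t : ℂ) ∂(arcMeasure L)).re := by
      rw [← RCLike.re_eq_complex_re, ← integral_re hint]
      congr 1; ext t
      simp
    rw [e]
    simp only [RCLike.re_to_complex]
    rw [← Complex.re_ofReal_mul (2 * Real.pi / L), ← Complex.add_re]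
    congr 1
    have hT0 := hc.deriv_ne_zero s
    rw [mul_add]
    congr 1
    calc _ = (-(Complex.I * Complex.I)) * (deriv c s * (deriv c s)⁻¹) *
          ((2 * Real.pi / L : ℝ) : ℂ) *
          ∫ t, circleKer L ε (s - t) * (h t : ℂ) ∂(arcMeasure L) := by ring
      _ = _ := by rw [mul_inv_cancel₀ hT0, Complex.I_mul_I]; ring
  -- identification of the limit: the mean over the curve produced by the circle kernel cancels
  · filter_upwards [ae_mem_Ioo L] with s hs
    have hae : ∀ᵐ t ∂(arcMeasure L), (-Complex.I * deriv c s * cauchyRem c L 0 s t).re =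
        normalKer c s t - Real.pi / L := by
      filter_upwards [ae_ne L s, ae_mem_Ioo L] with t hts ht
      have hu : |s - t| < L := by rw [abs_lt]; constructor <;> linarith [hs.1, hs.2, ht.1, ht.2]
      have hr := re_circleKer_zero hL hu (sub_ne_zero.2 hts.symm)
      have hT0 := hc.deriv_ne_zero s
      have e : -Complex.I * deriv c s * cauchyRem c L 0 s t =
          -Complex.I * deriv c s * (c s - c t)⁻¹ - ((2 * Real.pi / L : ℝ) : ℂ) *
            circleKer L 0 (s - t) := by
        unfold cauchyRem
        rw [parallel_zero, mul_sub]
        congr 1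
        calc _ = (-(Complex.I * Complex.I)) * (deriv c s * (deriv c s)⁻¹) *
              ((2 * Real.pi / L : ℝ) : ℂ) * circleKer L 0 (s - t) := by ring
          _ = _ := by rw [mul_inv_cancel₀ hT0, Complex.I_mul_I]; ring
      rw [e, Complex.sub_re, Complex.re_ofReal_mul, hr]
      unfold normalKer
      ring
    have hCb : ∀ᵐ t ∂(arcMeasure L), ‖cauchyRem c L 0 s t‖ ≤ C := by
      filter_upwards [ae_ne L s, ae_mem_Ioo L] with t hts ht
      have hu : |s - t| < L := by rw [abs_lt]; constructor <;> linarith [hs.1, hs.2, ht.1, ht.2]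
      have h1 := (hc.tendsto_inv_parallel_sub hs ht hts).sub
        ((tendsto_circleKer hL hu (sub_ne_zero.2 hts.symm)).const_mul
          (Complex.I * (deriv c s)⁻¹ * ((2 * Real.pi / L : ℝ) : ℂ)))
      have h2 : Tendsto (fun ε => cauchyRem c L ε s t) (𝓝[>] 0) (𝓝 (cauchyRem c L 0 s t)) := by
        unfold cauchyRem
        rwa [parallel_zero]
      refine le_of_tendsto h2.norm ?_
      filter_upwards [Ioo_mem_nhdsGT hc.width_pos] with ε hε using hC ε hε.1 hε.2 s t
    have hmeas : Measurable fun t => cauchyRem c L 0 s t := by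
      have := hc.continuous.measurable
      unfold cauchyRem circleKer; fun_prop
    have hint : Integrable (fun t => cauchyRem c L 0 s t * (h t : ℂ)) (arcMeasure L) :=
      hiC.bdd_mul hmeas.aestronglyMeasurable hCb
    have e1 : RCLike.re (-Complex.I * deriv c s *
        ∫ t, cauchyRem c L 0 s t * (h t : ℂ) ∂(arcMeasure L)) =
        ∫ t, (normalKer c s t * h t - Real.pi / L * h t) ∂(arcMeasure L) := by
      rw [← integral_const_mul, ← integral_re (hint.const_mul _)]
      refine integral_congr_ae ?_
      filter_upwards [hae] with t ht
      rw [← sub_mul, ← ht, ← mul_assoc, RCLike.re_to_complex, Complex.re_mul_ofReal]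
    rw [e1, integral_sub (hc.integrable_normalKer_mul hi s) (hi.const_mul _), integral_const_mul]
    field_simp
    ring

/-- Kernels that vanish on the diagonal to first order, divided by the Cauchy denominator, are
bounded, and the offset from the boundary may be removed. -/
theorem traceLim_lipschitz (hc : IsArcCurve c L) {m : ℝ → ℝ → ℂ} {K : ℝ}
    (hm : Measurable (Function.uncurry m)) (hK0 : 0 ≤ K)
    (hK : ∀ s t, ∀ k : ℤ, ‖m s t‖ ≤ K * |s - t - k * L|)
    {h : ℝ → ℂ} (hh : Integrable h (arcMeasure L)) :
    TraceLim (arcMeasure L)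
      (fun ε s => ∫ t, (parallel c ε s - c t)⁻¹ * m s t * h t ∂(arcMeasure L))
      (fun s => ∫ t, (c s - c t)⁻¹ * m s t * h t ∂(arcMeasure L)) := by
  refine TraceLim.of_bounded_kernel (C := K / hc.lowerConst) hc.width_pos (ae_mem_Ioo L) hh
    (fun ε hε _ => ?_) (fun ε hε hε' s _ t _ => ?_) (fun s hs => ?_)
  · have h1 := hc.measurable_parallel ε
    have h2 := hc.continuous.measurable
    have h3 : Measurable fun p : ℝ × ℝ => m p.1 p.2 := hm
    unfold Function.uncurry
    fun_prop
  · obtain ⟨k, hk⟩ := hc.exists_shift s t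
    have hlow := hc.parallel_sub_lower hk hε.le hε'.le
    have h0 := hc.parallel_sub_ne hε hε'.le s t
    rw [norm_mul, norm_inv, inv_mul_eq_div,
      div_le_div_iff₀ (norm_pos_iff.2 h0) hc.lowerConst_pos]
    have hl := hc.lowerConst_pos
    calc ‖m s t‖ * hc.lowerConst ≤ K * |s - t - k * L| * hc.lowerConst := by gcongr; exact hK s t k
      _ = K * (hc.lowerConst * (|s - t - k * L| + 0)) := by ring
      _ ≤ K * (hc.lowerConst * (|s - t - k * L| + ε)) := by gcongr
      _ ≤ _ := by gcongr
  · filter_upwards [ae_ne L s, ae_mem_Ioo L] with t hts ht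
    exact (hc.tendsto_inv_parallel_sub hs ht hts).mul_const _

/-- The kernel `Re (ν(s) m(s, t) / (c(s) - c(t)))`. -/
def _root_.weightedKer (c : ℝ → ℂ) (m : ℝ → ℝ → ℂ) (s t : ℝ) : ℝ :=
  (-Complex.I * deriv c s * m s t * (c s - c t)⁻¹).re

/-- The symbol of `weightedKer` is one on the diagonal, up to first order. -/
structure _root_.IsUnitSymbol (L : ℝ) (m : ℝ → ℝ → ℂ) (K : ℝ) : Prop where
  measurable : Measurable (Function.uncurry m)
  nonneg : 0 ≤ K
  norm_sub_le : ∀ s t, ∀ k : ℤ, ‖m s t - 1‖ ≤ K * |s - t - k * L|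

theorem measurable_weightedKer (hc : IsArcCurve c L) {m : ℝ → ℝ → ℂ} {K : ℝ}
    (hm : IsUnitSymbol L m K) : Measurable (Function.uncurry (weightedKer c m)) := by
  have := hc.continuous.measurable; have := hc.continuous_deriv.measurable
  have h3 : Measurable fun p : ℝ × ℝ => m p.1 p.2 := hm.measurable
  unfold weightedKer Function.uncurry; fun_prop

theorem exists_weightedKer_bound (hc : IsArcCurve c L) {m : ℝ → ℝ → ℂ} {K : ℝ}
    (hm : IsUnitSymbol L m K) : ∃ C : ℝ, ∀ s t, |weightedKer c m s t| ≤ C := by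
  obtain ⟨C, hC⟩ := hc.exists_normalKer_bound
  have hl := hc.lowerConst_pos
  have hK0 := hm.nonneg
  refine ⟨C + K / hc.lowerConst, fun s t => ?_⟩
  have e : weightedKer c m s t = normalKer c s t +
      (-Complex.I * deriv c s * (m s t - 1) * (c s - c t)⁻¹).re := by
    unfold weightedKer normalKer
    rw [← Complex.add_re]; congr 1; ring
  rw [e]
  refine (abs_add_le _ _).trans (add_le_add (hC s t) ((Complex.abs_re_le_norm _).trans ?_))
  rw [norm_mul, norm_mul, norm_mul, norm_neg, Complex.norm_I, hc.unit_speed, one_mul, one_mul,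
    norm_inv]
  rcases eq_or_ne (c s - c t) 0 with h0 | h0
  · rw [h0]; simp; positivity
  · obtain ⟨k, hk⟩ := hc.exists_shift s t
    have hlow := hc.parallel_sub_lower hk le_rfl hc.width_pos.le
    rw [parallel_zero, add_zero] at hlow
    rw [← div_eq_mul_inv, div_le_div_iff₀ (norm_pos_iff.2 h0) hl]
    calc _ ≤ K * |s - t - k * L| * hc.lowerConst := by gcongr; exact hm.norm_sub_le s t k
      _ = K * (hc.lowerConst * |s - t - k * L|) := by ring
      _ ≤ _ := by gcongr

theorem integrable_weightedKer_mul (hc : IsArcCurve c L) {m : ℝ → ℝ → ℂ} {K : ℝ}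
    (hm : IsUnitSymbol L m K) {h : ℝ → ℝ}
    (hh : Integrable h (arcMeasure L)) (s : ℝ) :
    Integrable (fun t => weightedKer c m s t * h t) (arcMeasure L) := by
  obtain ⟨C, hC⟩ := hc.exists_weightedKer_bound hm
  exact hh.bdd_mul ((hc.measurable_weightedKer hm).comp measurable_prodMk_left).aestronglyMeasurable
    (Eventually.of_forall fun t => hC s t)

/-- The jump relation for kernels whose symbol is one on the diagonal. -/
theorem traceLim_weighted (hc : IsArcCurve c L) {m : ℝ → ℝ → ℂ} {K : ℝ}
    (hm : IsUnitSymbol L m K) {h : ℝ → ℝ} (hh : MemLp h 2 (arcMeasure L)) :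
    TraceLim (arcMeasure L)
      (fun ε s => (-Complex.I * deriv c s *
        ∫ t, (parallel c ε s - c t)⁻¹ * m s t * (h t : ℂ) ∂(arcMeasure L)).re)
      (fun s => Real.pi * h s + ∫ t, weightedKer c m s t * h t ∂(arcMeasure L)) := by
  have hi := hh.integrable one_le_two
  have hiC : Integrable (fun t => (h t : ℂ)) (arcMeasure L) := hi.ofReal
  have hl := hc.lowerConst_pos
  have hK0 := hm.nonneg
  have hm3 : Measurable fun p : ℝ × ℝ => m p.1 p.2 := hm.measurable
  have hcm := hc.continuous.measurable
  have hdm := hc.continuous_deriv.measurable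
  have h1 := ((hc.traceLim_lipschitz (m := fun s t => m s t - 1)
    (Measurable.sub hm3 measurable_const) hK0 hm.norm_sub_le hiC).bdd_mul
    (m := fun s => -Complex.I * deriv c s) (C := 1)
    (Measurable.aestronglyMeasurable (by fun_prop)) (fun s => by simp [hc.unit_speed])).re
  have h2 := hc.traceLim_normal hh
  have hms : ∀ s, Measurable fun t => m s t := fun s => hm3.comp measurable_prodMk_left
  refine (h2.add h1).congr_of_forall hc.width_pos (S := univ) (Eventually.of_forall mem_univ)
    (fun ε hε hε' s _ => ?_) (Eventually.of_forall fun s => ?_)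
  · rw [RCLike.re_to_complex, ← Complex.add_re, ← mul_add]
    unfold cauchyInt
    have hb1 : ∀ t, ‖(parallel c ε s - c t)⁻¹‖ ≤ (hc.lowerConst * ε)⁻¹ := by
      intro t
      obtain ⟨k, hk⟩ := hc.exists_shift s t
      have hlow := hc.parallel_sub_lower hk hε.le hε'.le
      rw [norm_inv]
      refine inv_anti₀ (by positivity) (le_trans ?_ hlow)
      gcongr
      linarith [abs_nonneg (s - t - k * L)]
    have hb2 : ∀ t, ‖(parallel c ε s - c t)⁻¹ * (m s t - 1)‖ ≤ K / hc.lowerConst := by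
      intro t
      obtain ⟨k, hk⟩ := hc.exists_shift s t
      have hlow := hc.parallel_sub_lower hk hε.le hε'.le
      have h0 := hc.parallel_sub_ne hε hε'.le s t
      rw [norm_mul, norm_inv, inv_mul_eq_div, div_le_div_iff₀ (norm_pos_iff.2 h0) hl]
      calc ‖m s t - 1‖ * hc.lowerConst ≤ K * |s - t - k * L| * hc.lowerConst := by
            gcongr; exact hm.norm_sub_le s t k
        _ = K * (hc.lowerConst * (|s - t - k * L| + 0)) := by ring
        _ ≤ K * (hc.lowerConst * (|s - t - k * L| + ε)) := by gcongr
        _ ≤ _ := by gcongr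
    have hmm := hms s
    rw [← integral_add (integrable_bounded_mul hiC (by fun_prop) hb1)
      (integrable_bounded_mul hiC (by fun_prop) hb2)]
    congr 3; ext t; ring
  · have hb : ∀ t, ‖(c s - c t)⁻¹ * (m s t - 1)‖ ≤ K / hc.lowerConst := by
      intro t
      rw [norm_mul, norm_inv, inv_mul_eq_div]
      rcases eq_or_ne (c s - c t) 0 with h0 | h0
      · rw [h0]; simp; positivity
      · obtain ⟨k, hk⟩ := hc.exists_shift s t
        have hlow := hc.parallel_sub_lower hk le_rfl hc.width_pos.le
        rw [parallel_zero, add_zero] at hlow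
        rw [div_le_div_iff₀ (norm_pos_iff.2 h0) hl]
        calc _ ≤ K * |s - t - k * L| * hc.lowerConst := by gcongr; exact hm.norm_sub_le s t k
          _ = K * (hc.lowerConst * |s - t - k * L|) := by ring
          _ ≤ _ := by gcongr
    have hmm := hms s
    have hint := integrable_bounded_mul hiC (by fun_prop) hb
    rw [add_assoc]
    congr 1
    rw [← integral_const_mul, ← integral_re (hint.const_mul _),
      ← integral_add (hc.integrable_normalKer_mul hi s) (hint.const_mul _).re]
    congr 1; ext t
    unfold weightedKer normalKer
    rw [RCLike.re_to_complex, ← mul_assoc, Complex.re_mul_ofReal, ← add_mul, ← Complex.add_re]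
    congr 2; ring

/-- The symbol `c'(s) / c'(t)`. -/
theorem isUnitSymbol_left (hc : IsArcCurve c L) :
    ∃ K, IsUnitSymbol L (fun s t => deriv c s * (deriv c t)⁻¹) K := by
  obtain ⟨M, hM0, -, -, hT, -⟩ := hc.exists_deriv₂_bound
  have := hc.continuous_deriv.measurable
  refine ⟨M, by unfold Function.uncurry; fun_prop, hM0.le, fun s t k => ?_⟩
  have h1 := hT s (t + k * L)
  have h2 : deriv c (t + k * L) = deriv c t := by
    have := hc.deriv_periodic.int_mul k t
    simpa using this
  rw [h2, ← sub_sub] at h1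
  have e : deriv c s * (deriv c t)⁻¹ - 1 = (deriv c s - deriv c t) * (deriv c t)⁻¹ := by
    rw [sub_mul, mul_inv_cancel₀ (hc.deriv_ne_zero t)]
  rw [e, norm_mul, norm_inv, hc.unit_speed, inv_one, mul_one]
  exact h1

/-- The symbol `c'(t) / c'(s)`. -/
theorem isUnitSymbol_right (hc : IsArcCurve c L) :
    ∃ K, IsUnitSymbol L (fun s t => (deriv c s)⁻¹ * deriv c t) K := by
  obtain ⟨M, hM0, -, -, hT, -⟩ := hc.exists_deriv₂_bound
  have := hc.continuous_deriv.measurable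
  refine ⟨M, by unfold Function.uncurry; fun_prop, hM0.le, fun s t k => ?_⟩
  have h1 := hT s (t + k * L)
  have h2 : deriv c (t + k * L) = deriv c t := by
    have := hc.deriv_periodic.int_mul k t
    simpa using this
  rw [h2, ← sub_sub] at h1
  have e : (deriv c s)⁻¹ * deriv c t - 1 = -((deriv c s)⁻¹ * (deriv c s - deriv c t)) := by
    rw [mul_sub, inv_mul_cancel₀ (hc.deriv_ne_zero s)]; ring
  rw [e, norm_neg, norm_mul, norm_inv, hc.unit_speed, inv_one, one_mul]
  exact h1

end IsArcCurve

/-! ### Cauchy transforms off the curve -/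

/-- The Cauchy transform of a density on the curve. -/
def cauchyTr (c : ℝ → ℂ) (L : ℝ) (h : ℝ → ℂ) (z : ℂ) : ℂ :=
  ∫ t, (z - c t)⁻¹ * h t ∂(arcMeasure L)

/-- Minus the derivative of the Cauchy transform. -/
def cauchyTr₂ (c : ℝ → ℂ) (L : ℝ) (h : ℝ → ℂ) (z : ℂ) : ℂ :=
  ∫ t, ((z - c t) ^ 2)⁻¹ * h t ∂(arcMeasure L)

namespace IsArcCurve

variable {c : ℝ → ℂ} {L : ℝ}

theorem isCompact_range (hc : IsArcCurve c L) : IsCompact (range c) := by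
  have : range c = c '' Icc 0 L := by
    ext z; constructor
    · rintro ⟨s, rfl⟩
      obtain ⟨y, hy, hys⟩ := hc.periodic.exists_mem_Ico₀ hc.length_pos s
      exact ⟨y, Ico_subset_Icc_self hy, hys.symm⟩
    · rintro ⟨s, -, rfl⟩; exact ⟨s, rfl⟩
  rw [this]
  exact isCompact_Icc.image hc.continuous

theorem exists_dist_lower (hc : IsArcCurve c L) {z : ℂ} (hz : z ∉ range c) :
    ∃ d : ℝ, 0 < d ∧ ∀ x ∈ Metric.ball z d, ∀ t, d ≤ ‖x - c t‖ := by
  obtain ⟨r, hr, hrz⟩ := Metric.isOpen_iff.1 hc.isCompact_range.isClosed.isOpen_compl z hz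
  refine ⟨r / 2, by positivity, fun x hx t => ?_⟩
  have h1 : r ≤ ‖z - c t‖ := by
    by_contra h
    push Not at h
    exact hrz (by rw [Metric.mem_ball, dist_comm, dist_eq_norm]; exact h) ⟨t, rfl⟩
  have h2 : ‖x - z‖ < r / 2 := by rwa [← dist_eq_norm]
  have h3 := norm_sub_norm_le (z - c t) (z - x)
  rw [sub_sub_sub_cancel_left, norm_sub_rev z x] at h3
  linarith

theorem integrable_inv_mul (hc : IsArcCurve c L) {h : ℝ → ℂ} (hh : Integrable h (arcMeasure L))
    {z : ℂ} (hz : z ∉ range c) : Integrable (fun t => (z - c t)⁻¹ * h t) (arcMeasure L) := by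
  obtain ⟨d, hd, hd'⟩ := hc.exists_dist_lower hz
  have := hc.continuous.measurable
  refine integrable_bounded_mul hh (by fun_prop) (C := d⁻¹) fun t => ?_
  rw [norm_inv]
  exact inv_anti₀ hd (hd' z (Metric.mem_ball_self hd) t)

theorem integrable_inv_sq_mul (hc : IsArcCurve c L) {h : ℝ → ℂ} (hh : Integrable h (arcMeasure L))
    {z : ℂ} (hz : z ∉ range c) :
    Integrable (fun t => ((z - c t) ^ 2)⁻¹ * h t) (arcMeasure L) := by
  obtain ⟨d, hd, hd'⟩ := hc.exists_dist_lower hz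
  have := hc.continuous.measurable
  refine integrable_bounded_mul hh (by fun_prop) (C := (d ^ 2)⁻¹) fun t => ?_
  rw [norm_inv, norm_pow]
  have := hd' z (Metric.mem_ball_self hd) t
  exact inv_anti₀ (by positivity) (by gcongr)

theorem hasDerivAt_cauchyTr (hc : IsArcCurve c L) {h : ℝ → ℂ} (hh : Integrable h (arcMeasure L))
    {z : ℂ} (hz : z ∉ range c) : HasDerivAt (cauchyTr c L h) (-cauchyTr₂ c L h z) z := by
  obtain ⟨d, hd, hd'⟩ := hc.exists_dist_lower hz
  have hcm := hc.continuous.measurable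
  have hne : ∀ x ∈ Metric.ball z d, ∀ t, x - c t ≠ 0 := fun x hx t =>
    norm_pos_iff.1 (hd.trans_le (hd' x hx t))
  have key := hasDerivAt_integral_of_dominated_loc_of_deriv_le (μ := arcMeasure L)
    (F := fun x t => (x - c t)⁻¹ * h t) (F' := fun x t => -(((x - c t) ^ 2)⁻¹ * h t))
    (x₀ := z) (s := Metric.ball z d) (bound := fun t => (d ^ 2)⁻¹ * ‖h t‖)
    (Metric.ball_mem_nhds z hd) ?_ (hc.integrable_inv_mul hh hz) ?_ ?_ (hh.norm.const_mul _) ?_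
  · have h1 := key.2
    rw [integral_neg] at h1
    exact h1
  · refine Eventually.of_forall fun x => ?_
    exact (Measurable.aestronglyMeasurable (by fun_prop)).mul hh.1
  · exact ((Measurable.aestronglyMeasurable (by fun_prop)).mul hh.1).neg
  · refine Eventually.of_forall fun t x hx => ?_
    rw [norm_neg, norm_mul, norm_inv, norm_pow]
    have := hd' x hx t
    have h0 : 0 < d ^ 2 := by positivity
    gcongr
  · refine Eventually.of_forall fun t x hx => ?_
    have h1 := (((hasDerivAt_id x).sub_const (c t)).inv (hne x hx t)).mul_const (h t)
    refine h1.congr_deriv ?_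
    simp only [id]
    ring

theorem cauchyTr_parallel (c : ℝ → ℂ) (L ε : ℝ) (h : ℝ → ℂ) (s : ℝ) :
    cauchyTr c L h (parallel c ε s) = cauchyInt c L ε h s := rfl

theorem parallel_notMem (hc : IsArcCurve c L) {ε : ℝ} (hε : 0 < ε) (hε' : ε ≤ hc.width) (s : ℝ) :
    parallel c ε s ∉ range c := by
  rintro ⟨t, ht⟩
  exact hc.parallel_sub_ne hε hε' s t (sub_eq_zero.2 ht.symm)

end IsArcCurve

/-! ### Weak derivatives along the curve -/

/-- `ψ` is the weak derivative of `φ` on the circle of length `L`: test functions are `C¹` and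
take equal values at `0` and `L`. -/
def WeakDeriv (L : ℝ) (φ ψ : ℝ → ℝ) : Prop :=
  ∀ η : ℝ → ℝ, ContDiff ℝ 1 η → η 0 = η L →
    ∫ t, φ t * deriv η t ∂(arcMeasure L) = -∫ t, ψ t * η t ∂(arcMeasure L)

theorem integrable_mul_continuous {𝕜 : Type*} [RCLike 𝕜] {L : ℝ} {h g : ℝ → 𝕜}
    (hh : Integrable h (arcMeasure L)) (hg : Continuous g) :
    Integrable (fun t => h t * g t) (arcMeasure L) := by
  obtain ⟨C, hC⟩ := (isCompact_Icc (a := 0) (b := L)).exists_bound_of_continuousOn hg.continuousOn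
  refine hh.mul_bdd (c := C) hg.aestronglyMeasurable ?_
  exact (ae_restrict_mem measurableSet_Ioc).mono fun t ht => hC t (Ioc_subset_Icc_self ht)

theorem integral_arcMeasure {E : Type*} [NormedAddCommGroup E] [NormedSpace ℝ E]
    {L : ℝ} (hL : 0 ≤ L) (g : ℝ → E) : ∫ t, g t ∂(arcMeasure L) = ∫ t in (0)..L, g t := by
  rw [intervalIntegral.integral_of_le hL, arcMeasure]

theorem integrable_of_continuous {E : Type*} [NormedAddCommGroup E]
    {L : ℝ} {g : ℝ → E} (hg : Continuous g) : Integrable g (arcMeasure L) :=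
  (hg.locallyIntegrable.integrableOn_isCompact isCompact_Icc).mono_set Ioc_subset_Icc_self

theorem memLp_mul_continuous {𝕜 : Type*} [RCLike 𝕜] {L : ℝ} {h g : ℝ → 𝕜} {p : ENNReal}
    (hh : MemLp h p (arcMeasure L)) (hg : Continuous g) :
    MemLp (fun t => g t * h t) p (arcMeasure L) := by
  obtain ⟨C, hC⟩ := (isCompact_Icc (a := 0) (b := L)).exists_bound_of_continuousOn hg.continuousOn
  refine hh.of_le_mul (c := C) (hg.aestronglyMeasurable.mul hh.1) ?_
  filter_upwards [ae_restrict_mem measurableSet_Ioc] with t ht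
  rw [norm_mul]
  gcongr
  exact hC t (Ioc_subset_Icc_self ht)

theorem memLp_of_continuous {𝕜 : Type*} [RCLike 𝕜] {L : ℝ} {g : ℝ → 𝕜} {p : ENNReal}
    (hg : Continuous g) : MemLp g p (arcMeasure L) := by
  have := memLp_mul_continuous (L := L) (p := p) (memLp_const (1 : 𝕜)) hg
  simpa using this

theorem integral_deriv_mul_arcMeasure {𝕜 : Type*} [RCLike 𝕜] {L : ℝ} (hL : 0 ≤ L)
    {g g' η η' : ℝ → 𝕜}
    (hg : ∀ t, HasDerivAt g (g' t) t) (hg' : Continuous g') (hη : ∀ t, HasDerivAt η (η' t) t)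
    (hη' : Continuous η') (h0 : g 0 * η 0 = g L * η L) :
    ∫ t, g t * η' t ∂(arcMeasure L) = -∫ t, g' t * η t ∂(arcMeasure L) := by
  rw [integral_arcMeasure hL, integral_arcMeasure hL,
    intervalIntegral.integral_mul_deriv_eq_deriv_mul (fun t _ => hg t) (fun t _ => hη t)
      (hg'.intervalIntegrable _ _) (hη'.intervalIntegrable _ _), h0]
  simp

namespace WeakDeriv

variable {L : ℝ} {φ ψ φ' ψ' : ℝ → ℝ}

theorem of_hasDerivAt (hL : 0 ≤ L) {g g' : ℝ → ℝ} (hg : ∀ t, HasDerivAt g (g' t) t)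
    (hg' : Continuous g') (h0 : g 0 = g L) : WeakDeriv L g g' := by
  intro η hη hη0
  exact integral_deriv_mul_arcMeasure hL hg hg'
    (fun t => (hη.differentiable one_ne_zero t).hasDerivAt) (hη.continuous_deriv le_rfl)
    (by rw [h0, hη0])

theorem congr (h : WeakDeriv L φ ψ) (h1 : φ' =ᵐ[arcMeasure L] φ) (h2 : ψ' =ᵐ[arcMeasure L] ψ) :
    WeakDeriv L φ' ψ' := by
  intro η hη hη0
  have e1 : ∫ t, φ' t * deriv η t ∂(arcMeasure L) = ∫ t, φ t * deriv η t ∂(arcMeasure L) :=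
    integral_congr_ae (h1.mono fun t ht => by simp only [ht])
  have e2 : ∫ t, ψ' t * η t ∂(arcMeasure L) = ∫ t, ψ t * η t ∂(arcMeasure L) :=
    integral_congr_ae (h2.mono fun t ht => by simp only [ht])
  rw [e1, e2, h η hη hη0]

theorem lin (h : WeakDeriv L φ ψ) (h' : WeakDeriv L φ' ψ')
    (i1 : Integrable φ (arcMeasure L)) (i2 : Integrable ψ (arcMeasure L))
    (i3 : Integrable φ' (arcMeasure L)) (i4 : Integrable ψ' (arcMeasure L)) (a b : ℝ) :
    WeakDeriv L (fun t => a * φ t + b * φ' t) (fun t => a * ψ t + b * ψ' t) := by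
  intro η hη hη0
  have c1 := hη.continuous_deriv le_rfl
  have c2 := hη.continuous
  simp only [add_mul, mul_assoc]
  rw [integral_add ((integrable_mul_continuous i1 c1).const_mul a)
      ((integrable_mul_continuous i3 c1).const_mul b),
    integral_add ((integrable_mul_continuous i2 c2).const_mul a)
      ((integrable_mul_continuous i4 c2).const_mul b),
    integral_const_mul, integral_const_mul, integral_const_mul, integral_const_mul,
    h η hη hη0, h' η hη hη0]
  ring

/-- Complex test functions. -/
theorem complex (h : WeakDeriv L φ ψ) (i1 : Integrable φ (arcMeasure L))
    (i2 : Integrable ψ (arcMeasure L)) {η η' : ℝ → ℂ} (hη : ∀ t, HasDerivAt η (η' t) t)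
    (hη' : Continuous η') (h0 : η 0 = η L) :
    ∫ t, (φ t : ℂ) * η' t ∂(arcMeasure L) = -∫ t, (ψ t : ℂ) * η t ∂(arcMeasure L) := by
  have hηc : Continuous η := continuous_iff_continuousAt.2 fun t => (hη t).continuousAt
  have hre : ∀ t, HasDerivAt (fun t => (η t).re) (η' t).re t := fun t =>
    (Complex.reCLM.hasFDerivAt.comp_hasDerivAt t (hη t))
  have him : ∀ t, HasDerivAt (fun t => (η t).im) (η' t).im t := fun t =>
    (Complex.imCLM.hasFDerivAt.comp_hasDerivAt t (hη t))
  have dre : deriv (fun t => (η t).re) = fun t => (η' t).re := funext fun t => (hre t).deriv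
  have dim : deriv (fun t => (η t).im) = fun t => (η' t).im := funext fun t => (him t).deriv
  have cre : ContDiff ℝ 1 fun t => (η t).re := by
    refine contDiff_one_iff_deriv.2 ⟨fun t => (hre t).differentiableAt, ?_⟩
    rw [dre]; exact Complex.continuous_re.comp hη'
  have cim : ContDiff ℝ 1 fun t => (η t).im := by
    refine contDiff_one_iff_deriv.2 ⟨fun t => (him t).differentiableAt, ?_⟩
    rw [dim]; exact Complex.continuous_im.comp hη'
  have e1 := h _ cre (by simp only [h0])
  have e2 := h _ cim (by simp only [h0])
  rw [dre] at e1
  rw [dim] at e2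
  have j1 : Integrable (fun t => (φ t : ℂ) * η' t) (arcMeasure L) :=
    integrable_mul_continuous i1.ofReal hη'
  have j2 : Integrable (fun t => (ψ t : ℂ) * η t) (arcMeasure L) :=
    integrable_mul_continuous i2.ofReal hηc
  have r1 : (∫ t, (φ t : ℂ) * η' t ∂(arcMeasure L)).re = ∫ t, φ t * (η' t).re ∂(arcMeasure L) := by
    rw [← RCLike.re_to_complex, ← integral_re j1]; congr 1; ext t; simp
  have r2 : (∫ t, (φ t : ℂ) * η' t ∂(arcMeasure L)).im = ∫ t, φ t * (η' t).im ∂(arcMeasure L) := by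
    rw [← RCLike.im_to_complex, ← integral_im j1]; congr 1; ext t; simp
  have r3 : (∫ t, (ψ t : ℂ) * η t ∂(arcMeasure L)).re = ∫ t, ψ t * (η t).re ∂(arcMeasure L) := by
    rw [← RCLike.re_to_complex, ← integral_re j2]; congr 1; ext t; simp
  have r4 : (∫ t, (ψ t : ℂ) * η t ∂(arcMeasure L)).im = ∫ t, ψ t * (η t).im ∂(arcMeasure L) := by
    rw [← RCLike.im_to_complex, ← integral_im j2]; congr 1; ext t; simp
  apply Complex.ext
  · rw [Complex.neg_re, r1, r3, e1]
  · rw [Complex.neg_im, r2, r4, e2]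

/-- Product rule. -/
theorem mul_contDiff (h : WeakDeriv L φ ψ) (i1 : Integrable φ (arcMeasure L))
    (i2 : Integrable ψ (arcMeasure L)) {f : ℝ → ℝ} (hf : ContDiff ℝ 1 f) (hf0 : f 0 = f L) :
    WeakDeriv L (fun t => f t * φ t) (fun t => deriv f t * φ t + f t * ψ t) := by
  intro η hη hη0
  have c1 := hη.continuous_deriv le_rfl
  have c2 := hη.continuous
  have c3 := hf.continuous_deriv le_rfl
  have c4 := hf.continuous
  have e := h (fun t => f t * η t) (hf.mul hη) (by simp only [hf0, hη0])
  have hd : deriv (fun t => f t * η t) = fun t => deriv f t * η t + f t * deriv η t :=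
    funext fun t => ((hf.differentiable one_ne_zero t).hasDerivAt.mul
      (hη.differentiable one_ne_zero t).hasDerivAt).deriv
  rw [hd] at e
  have j1 : Integrable (fun t => φ t * (deriv f t * η t)) (arcMeasure L) :=
    integrable_mul_continuous i1 (c3.mul c2)
  have j2 : Integrable (fun t => φ t * (f t * deriv η t)) (arcMeasure L) :=
    integrable_mul_continuous i1 (c4.mul c1)
  have j3 : Integrable (fun t => ψ t * (f t * η t)) (arcMeasure L) :=
    integrable_mul_continuous i2 (c4.mul c2)
  simp only [mul_add] at e
  rw [integral_add j1 j2] at e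
  have e3 : ∫ t, f t * φ t * deriv η t ∂(arcMeasure L) =
      ∫ t, φ t * (f t * deriv η t) ∂(arcMeasure L) := by congr 1; ext t; ring
  have e4 : ∫ t, (deriv f t * φ t + f t * ψ t) * η t ∂(arcMeasure L) =
      ∫ t, φ t * (deriv f t * η t) ∂(arcMeasure L) + ∫ t, ψ t * (f t * η t) ∂(arcMeasure L) := by
    rw [← integral_add j1 j3]; congr 1; ext t; ring
  rw [e3, e4]
  linarith

end WeakDeriv

/-- A bounded measurable kernel defines an operator on `L²` of the curve, of norm at most the
Hilbert-Schmidt norm of the kernel. -/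
theorem exists_kernelOperator {L : ℝ} {k : ℝ → ℝ → ℝ} (hk : Measurable (Function.uncurry k)) {C : ℝ}
    (hC : ∀ s ∈ Ioc 0 L, ∀ t ∈ Ioc 0 L, |k s t| ≤ C) :
    ∃ A : Lp ℝ 2 (arcMeasure L) →L[ℝ] Lp ℝ 2 (arcMeasure L),
      (∀ φ : Lp ℝ 2 (arcMeasure L),
        A φ =ᵐ[arcMeasure L] fun s => ∫ t, k s t * φ t ∂(arcMeasure L)) ∧
      ‖A‖ ^ 2 ≤ ∫ p, (Function.uncurry k p) ^ 2 ∂((arcMeasure L).prod (arcMeasure L)) := by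
  set μ := arcMeasure L with hμ
  have hmem : ∀ᵐ s ∂μ, s ∈ Ioc 0 L := ae_restrict_mem measurableSet_Ioc
  have hks : ∀ s, Measurable fun t => k s t := fun s => hk.comp measurable_prodMk_left
  have hkL : ∀ s ∈ Ioc 0 L, MemLp (fun t => k s t) 2 μ := fun s hs =>
    MemLp.of_bound (hks s).aestronglyMeasurable C (hmem.mono fun t ht => hC s hs t ht)
  have hint : ∀ s ∈ Ioc 0 L, ∀ φ : ℝ → ℝ, Integrable φ μ → Integrable (fun t => k s t * φ t) μ :=
    fun s hs φ hφ => hφ.bdd_mul (hks s).aestronglyMeasurable (hmem.mono fun t ht => hC s hs t ht)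
  have hφi : ∀ φ : Lp ℝ 2 μ, Integrable φ μ := fun φ => (Lp.memLp φ).integrable one_le_two
  have hk2 : Integrable (fun p => (Function.uncurry k p) ^ 2) (μ.prod μ) := by
    refine Integrable.of_bound (C := C ^ 2) (hk.pow_const 2).aestronglyMeasurable ?_
    have : ∀ᵐ p ∂(μ.prod μ), p ∈ Ioc 0 L ×ˢ Ioc 0 L := by
      rw [hμ]; unfold arcMeasure
      rw [Measure.prod_restrict]
      exact ae_restrict_mem (measurableSet_Ioc.prod measurableSet_Ioc)
    filter_upwards [this] with p hp
    rw [norm_pow]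
    gcongr
    exact hC p.1 hp.1 p.2 hp.2
  -- the pointwise Cauchy-Schwarz inequality
  have hcs : ∀ φ : Lp ℝ 2 μ, ∀ s ∈ Ioc 0 L,
      (∫ t, k s t * φ t ∂μ) ^ 2 ≤ (∫ t, k s t ^ 2 ∂μ) * ‖φ‖ ^ 2 := by
    intro φ s hs
    have e1 : inner ℝ ((hkL s hs).toLp _) φ = ∫ t, k s t * φ t ∂μ := by
      rw [L2.inner_def]
      refine integral_congr_ae ((hkL s hs).coeFn_toLp.mono fun t ht => ?_)
      simp only [ht]
      simp [mul_comm]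
    have e2 : ‖(hkL s hs).toLp _‖ ^ 2 = ∫ t, k s t ^ 2 ∂μ := by
      rw [← real_inner_self_eq_norm_sq, L2.inner_def]
      refine integral_congr_ae ((hkL s hs).coeFn_toLp.mono fun t ht => ?_)
      simp only [ht]
      simp [sq]
    rw [← e1, ← e2, ← mul_pow]
    exact sq_le_sq' (neg_le_of_abs_le (abs_real_inner_le_norm _ _)) (real_inner_le_norm _ _)
  have hmeas : ∀ φ : Lp ℝ 2 μ, AEStronglyMeasurable (fun s => ∫ t, k s t * φ t ∂μ) μ := by
    intro φ
    have h1 : AEStronglyMeasurable (fun p : ℝ × ℝ => k p.1 p.2 * φ p.2) (μ.prod μ) :=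
      hk.aestronglyMeasurable.mul ((Lp.aestronglyMeasurable φ).comp_snd)
    exact h1.integral_prod_right'
  have hLp : ∀ φ : Lp ℝ 2 μ, MemLp (fun s => ∫ t, k s t * φ t ∂μ) 2 μ := by
    intro φ
    refine MemLp.of_bound (hmeas φ) (C * ∫ t, |φ t| ∂μ) (hmem.mono fun s hs => ?_)
    rw [← integral_const_mul]
    refine norm_integral_le_of_norm_le ((hφi φ).abs.const_mul C) (hmem.mono fun t ht => ?_)
    rw [norm_mul]
    exact mul_le_mul_of_nonneg_right (hC s hs t ht) (abs_nonneg _)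
  let A₀ : Lp ℝ 2 μ →ₗ[ℝ] Lp ℝ 2 μ :=
    { toFun := fun φ => (hLp φ).toLp _
      map_add' := fun φ ψ => by
        rw [← MemLp.toLp_add, MemLp.toLp_eq_toLp_iff]
        filter_upwards [hmem] with s hs
        rw [Pi.add_apply, ← integral_add (hint s hs _ (hφi φ)) (hint s hs _ (hφi ψ))]
        refine integral_congr_ae ((Lp.coeFn_add φ ψ).mono fun t ht => ?_)
        simp only [ht, Pi.add_apply]; ring
      map_smul' := fun a φ => by
        rw [RingHom.id_apply, ← MemLp.toLp_const_smul, MemLp.toLp_eq_toLp_iff]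
        filter_upwards [hmem] with s hs
        rw [Pi.smul_apply, smul_eq_mul, ← integral_const_mul]
        refine integral_congr_ae ((Lp.coeFn_smul a φ).mono fun t ht => ?_)
        simp only [ht, Pi.smul_apply, smul_eq_mul]; ring }
  set S := ∫ p, (Function.uncurry k p) ^ 2 ∂(μ.prod μ) with hS
  have hS0 : 0 ≤ S := integral_nonneg fun p => sq_nonneg _
  have hbound : ∀ φ, ‖A₀ φ‖ ≤ Real.sqrt S * ‖φ‖ := by
    intro φ
    refine abs_le_of_sq_le_sq' ?_ (by positivity) |>.2
    rw [mul_pow, Real.sq_sqrt hS0]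
    have e2 : ‖A₀ φ‖ ^ 2 = ∫ s, (∫ t, k s t * φ t ∂μ) ^ 2 ∂μ := by
      rw [← real_inner_self_eq_norm_sq, L2.inner_def]
      refine integral_congr_ae ((hLp φ).coeFn_toLp.mono fun t ht => ?_)
      have ht' : (A₀ φ : ℝ → ℝ) t = ∫ t', k t t' * φ t' ∂μ := ht
      simp only [ht']
      simp [sq]
    rw [e2, hS, integral_prod _ hk2, ← integral_mul_const]
    refine integral_mono_ae ?_ (hk2.integral_prod_left.mul_const _) (hmem.mono fun s hs => hcs φ s hs)
    exact (hLp φ).integrable_sq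
  refine ⟨A₀.mkContinuous (Real.sqrt S) hbound, fun φ => (hLp φ).coeFn_toLp, ?_⟩
  have h1 := A₀.mkContinuous_norm_le (Real.sqrt_nonneg S) hbound
  calc _ ≤ Real.sqrt S ^ 2 := by gcongr
    _ = S := Real.sq_sqrt hS0

/-- A contraction argument on a graph. If `V` is a closed relation, such as that between a function
and its weak derivative, which is respected by a small operator, then a solution `φ` of
`φ + R φ = a` has a partner as soon as `a` has one. -/
theorem exists_partner_of_contraction {E : Type*} [NormedAddCommGroup E] [NormedSpace ℝ E]
    [CompleteSpace E] {V : Submodule ℝ (E × E)} (hV : IsClosed (V : Set (E × E)))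
    {R R' B : E →L[ℝ] E} (hR : ‖R‖ ≤ 1 / 4) (hR' : ‖R'‖ ≤ 1 / 4)
    (hVR : ∀ p ∈ V, (R p.1, R' p.2 + B p.1) ∈ V) {a b φ : E} (hab : (a, b) ∈ V)
    (hφ : φ + R φ = a) : ∃ ψ, (φ, ψ) ∈ V := by
  -- the second component is rescaled so that the off-diagonal term `B` becomes small
  set l : ℝ := (4 * (‖B‖ + 1))⁻¹ with hl
  have hB := norm_nonneg B
  have hl0 : 0 < l := by positivity
  have hlB : l * ‖B‖ ≤ 1 / 4 := by
    rw [hl, inv_mul_le_iff₀ (by positivity)]; linarith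
  let Λ : E × E → E × E := fun p => (p.1, l⁻¹ • p.2)
  have hΛ : Continuous Λ := by fun_prop
  set W : Set (E × E) := Λ ⁻¹' (V : Set (E × E)) with hW
  have hWc : IsComplete W := (hV.preimage hΛ).isComplete
  let Θ : E × E → E × E := fun p => (a - R p.1, l • b - R' p.2 - l • B p.1)
  have hmaps : MapsTo Θ W W := by
    intro p hp
    have h1 := V.sub_mem hab (hVR _ hp)
    have : Λ (Θ p) = (a, b) - (R (Λ p).1, R' (Λ p).2 + B (Λ p).1) := by
      simp only [Λ, Θ, Prod.mk_sub_mk, map_smul, smul_sub, smul_smul, inv_mul_cancel₀ hl0.ne',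
        one_smul]
      congr 1; abel
    change Λ (Θ p) ∈ V
    rw [this]; exact h1
  have hlip : LipschitzWith (1 / 2 : NNReal) Θ := by
    refine LipschitzWith.of_dist_le_mul fun p q => ?_
    have h1 : ‖p.1 - q.1‖ ≤ dist p q := by rw [← dist_eq_norm]; exact le_max_left _ _
    have h2 : ‖p.2 - q.2‖ ≤ dist p q := by rw [← dist_eq_norm]; exact le_max_right _ _
    have hd := dist_nonneg (x := p) (y := q)
    rw [Prod.dist_eq]
    push_cast
    refine max_le ?_ ?_
    · rw [dist_eq_norm]
      have : (Θ p).1 - (Θ q).1 = -R (p.1 - q.1) := by simp only [Θ, map_sub]; abel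
      rw [this, norm_neg]
      calc _ ≤ ‖R‖ * ‖p.1 - q.1‖ := R.le_opNorm _
        _ ≤ 1 / 4 * dist p q := by gcongr
        _ ≤ _ := by linarith
    · rw [dist_eq_norm]
      have : (Θ p).2 - (Θ q).2 = -(R' (p.2 - q.2) + l • B (p.1 - q.1)) := by
        simp only [Θ, map_sub, smul_sub]; abel
      rw [this, norm_neg]
      refine (norm_add_le _ _).trans ?_
      rw [norm_smul, Real.norm_of_nonneg hl0.le]
      calc _ ≤ ‖R'‖ * ‖p.2 - q.2‖ + l * (‖B‖ * ‖p.1 - q.1‖) := by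
            gcongr
            · exact R'.le_opNorm _
            · exact B.le_opNorm _
        _ = ‖R'‖ * ‖p.2 - q.2‖ + l * ‖B‖ * ‖p.1 - q.1‖ := by ring
        _ ≤ 1 / 4 * dist p q + 1 / 4 * dist p q := by gcongr
        _ = _ := by ring
  have hcon : ContractingWith (1 / 2 : NNReal) (hmaps.restrict Θ W W) :=
    ⟨by rw [← NNReal.coe_lt_coe]; norm_num, fun x y => hlip x y⟩
  have h0 : (0 : E × E) ∈ W := by
    change Λ 0 ∈ V
    have : Λ 0 = 0 := by simp [Λ]
    rw [this]; exact V.zero_mem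
  obtain ⟨p, hpW, hp, -⟩ := hcon.exists_fixedPoint' hWc hmaps h0 (edist_ne_top _ _)
  have hp1 : a - R p.1 = p.1 := congrArg Prod.fst hp
  have heq : p.1 - φ = -R (p.1 - φ) := by
    rw [map_sub, ← sub_eq_zero]
    have : p.1 + R p.1 - (φ + R φ) = 0 := by
      rw [hφ]; exact sub_eq_zero.2 (sub_eq_iff_eq_add.1 hp1).symm
    rw [← this]; abel
  have h0' : ‖p.1 - φ‖ ≤ 1 / 4 * ‖p.1 - φ‖ := by
    conv_lhs => rw [heq, norm_neg]
    exact (R.le_opNorm _).trans (by gcongr)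
  have h1 : p.1 - φ = 0 := norm_le_zero_iff.1 (by linarith [norm_nonneg (p.1 - φ)])
  refine ⟨l⁻¹ • p.2, ?_⟩
  rw [← sub_eq_zero.1 h1]
  exact hpW

/-- Pairs consisting of a square integrable function and its weak derivative. -/
def weakGraph (L : ℝ) : Submodule ℝ (Lp ℝ 2 (arcMeasure L) × Lp ℝ 2 (arcMeasure L)) where
  carrier := {p | WeakDeriv L p.1 p.2}
  add_mem' := by
    intro p q hp hq
    have hi : ∀ φ : Lp ℝ 2 (arcMeasure L), Integrable φ (arcMeasure L) :=
      fun φ => (Lp.memLp φ).integrable one_le_two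
    refine (WeakDeriv.lin hp hq (hi _) (hi _) (hi _) (hi _) 1 1).congr ?_ ?_
    · filter_upwards [Lp.coeFn_add p.1 q.1] with t ht
      simpa using ht
    · filter_upwards [Lp.coeFn_add p.2 q.2] with t ht
      simpa using ht
  zero_mem' := by
    intro η _ _
    have h : ((0 : Lp ℝ 2 (arcMeasure L)) : ℝ → ℝ) =ᵐ[arcMeasure L] 0 := Lp.coeFn_zero _ _ _
    have e : ∀ g : ℝ → ℝ,
        ∫ t, ((0 : Lp ℝ 2 (arcMeasure L)) : ℝ → ℝ) t * g t ∂(arcMeasure L) = 0 := by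
      intro g
      rw [← integral_zero ℝ ℝ (μ := arcMeasure L)]
      exact integral_congr_ae (h.mono fun t ht => by simp only; rw [ht]; simp)
    simp only [Prod.fst_zero, Prod.snd_zero, e, neg_zero]
  smul_mem' := by
    intro a p hp
    have hi : ∀ φ : Lp ℝ 2 (arcMeasure L), Integrable φ (arcMeasure L) :=
      fun φ => (Lp.memLp φ).integrable one_le_two
    refine (WeakDeriv.lin hp hp (hi _) (hi _) (hi _) (hi _) a 0).congr ?_ ?_
    · filter_upwards [Lp.coeFn_smul a p.1] with t ht
      simpa using ht
    · filter_upwards [Lp.coeFn_smul a p.2] with t ht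
      simpa using ht

/-- The graph is an intersection of closed conditions, one for each test function. -/
theorem isClosed_weakGraph (L : ℝ) :
    IsClosed (weakGraph L : Set (Lp ℝ 2 (arcMeasure L) × Lp ℝ 2 (arcMeasure L))) := by
  have key : (weakGraph L : Set (Lp ℝ 2 (arcMeasure L) × Lp ℝ 2 (arcMeasure L))) =
      ⋂ (η : ℝ → ℝ) (h : ContDiff ℝ 1 η) (_ : η 0 = η L),
        {p | inner ℝ ((memLp_of_continuous (h.continuous_deriv le_rfl)).toLp (deriv η) :
            Lp ℝ 2 (arcMeasure L)) p.1 =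
          -inner ℝ ((memLp_of_continuous h.continuous).toLp η : Lp ℝ 2 (arcMeasure L)) p.2} := by
    ext p
    simp only [mem_iInter, mem_ofPred_eq, SetLike.mem_coe]
    have e : ∀ (g : ℝ → ℝ) (hg : MemLp g 2 (arcMeasure L)) (φ : Lp ℝ 2 (arcMeasure L)),
        inner ℝ (hg.toLp g) φ = ∫ t, φ t * g t ∂(arcMeasure L) := by
      intro g hg φ
      rw [L2.inner_def]
      refine integral_congr_ae (hg.coeFn_toLp.mono fun t ht => ?_)
      simp only [ht]
      simp
    simp only [e]
    rfl
  rw [key]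
  refine isClosed_iInter fun η => isClosed_iInter fun h => isClosed_iInter fun _ => ?_
  exact isClosed_eq (continuous_const.inner continuous_fst) (continuous_const.inner continuous_snd).neg

namespace IsArcCurve

variable {c : ℝ → ℂ} {L : ℝ}

/-- The derivative of `1 / c'`. -/
def _root_.tangentInvDeriv (c : ℝ → ℂ) (t : ℝ) : ℂ := -deriv (deriv c) t / deriv c t ^ 2

theorem hasDerivAt_inv_deriv (hc : IsArcCurve c L) (t : ℝ) :
    HasDerivAt (fun t => (deriv c t)⁻¹) (tangentInvDeriv c t) t :=
  (hc.hasDerivAt_deriv t).fun_inv (hc.deriv_ne_zero t)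

theorem continuous_inv_deriv (hc : IsArcCurve c L) : Continuous fun t => (deriv c t)⁻¹ :=
  hc.continuous_deriv.inv₀ hc.deriv_ne_zero

theorem continuous_tangentInvDeriv (hc : IsArcCurve c L) : Continuous (tangentInvDeriv c) :=
  hc.continuous_deriv₂.neg.div (hc.continuous_deriv.pow 2) fun t => pow_ne_zero 2 (hc.deriv_ne_zero t)

/-- Integration by parts for the squared Cauchy kernel against the holomorphic differential
`c'(t) dt`, weighted by `n`. -/
theorem cauchyTr₂_weak (hc : IsArcCurve c L) {φ ψ : ℝ → ℝ} (h : WeakDeriv L φ ψ)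
    (i1 : Integrable φ (arcMeasure L)) (i2 : Integrable ψ (arcMeasure L)) {n n' : ℝ → ℂ}
    (hn : ∀ t, HasDerivAt n (n' t) t) (hn' : Continuous n') (h0 : n 0 = n L)
    {z : ℂ} (hz : z ∉ range c) :
    cauchyTr₂ c L (fun t => n t * deriv c t * φ t) z =
      -cauchyTr c L (fun t => n t * ψ t + n' t * φ t) z := by
  have hne : ∀ t, z - c t ≠ 0 := fun t h => hz ⟨t, (sub_eq_zero.1 h).symm⟩
  have hnc : Continuous n := continuous_iff_continuousAt.2 fun t => (hn t).continuousAt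
  have ci : Continuous fun t => (z - c t)⁻¹ := (continuous_const.sub hc.continuous).inv₀ hne
  have cd := hc.continuous_deriv
  have hd : ∀ t, HasDerivAt (fun t => n t * (z - c t)⁻¹)
      (n' t * (z - c t)⁻¹ + n t * (deriv c t * ((z - c t)⁻¹ * (z - c t)⁻¹))) t := by
    intro t
    refine ((hn t).mul (((hc.hasDerivAt t).const_sub z).fun_inv (hne t))).congr_deriv ?_
    have := hne t
    field_simp
  have e := h.complex i1 i2 hd (by fun_prop) (by
    have := hc.periodic 0
    rw [zero_add] at this
    simp only [h0, this])
  unfold cauchyTr cauchyTr₂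
  have j1 : Integrable (fun t => (φ t : ℂ) * (n' t * (z - c t)⁻¹)) (arcMeasure L) :=
    integrable_mul_continuous i1.ofReal (by fun_prop)
  have j2 : Integrable (fun t => (φ t : ℂ) * (n t * (deriv c t * ((z - c t)⁻¹ * (z - c t)⁻¹))))
      (arcMeasure L) := integrable_mul_continuous i1.ofReal (by fun_prop)
  have j3 : Integrable (fun t => (ψ t : ℂ) * (n t * (z - c t)⁻¹)) (arcMeasure L) :=
    integrable_mul_continuous i2.ofReal (by fun_prop)
  simp only [mul_add] at e
  rw [integral_add j1 j2] at e
  have e3 : ∫ t, ((z - c t) ^ 2)⁻¹ * (n t * deriv c t * φ t) ∂(arcMeasure L) =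
      ∫ t, (φ t : ℂ) * (n t * (deriv c t * ((z - c t)⁻¹ * (z - c t)⁻¹))) ∂(arcMeasure L) := by
    congr 1; ext t; rw [sq, mul_inv]; ring
  have e4 : ∫ t, (z - c t)⁻¹ * (n t * ψ t + n' t * φ t) ∂(arcMeasure L) =
      ∫ t, (ψ t : ℂ) * (n t * (z - c t)⁻¹) ∂(arcMeasure L) +
      ∫ t, (φ t : ℂ) * (n' t * (z - c t)⁻¹) ∂(arcMeasure L) := by
    rw [← integral_add j3 j1]; congr 1; ext t; ring
  rw [e3, e4]
  linear_combination e

/-- The second derivative of the logarithmic potential of a weakly differentiable density is again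
a Cauchy integral. -/
theorem cauchyTr₂_eq (hc : IsArcCurve c L) {φ ψ : ℝ → ℝ} (h : WeakDeriv L φ ψ)
    (i1 : Integrable φ (arcMeasure L)) (i2 : Integrable ψ (arcMeasure L))
    {z : ℂ} (hz : z ∉ range c) :
    cauchyTr₂ c L (fun t => (φ t : ℂ)) z =
      -cauchyTr c L (fun t => (deriv c t)⁻¹ * ψ t + tangentInvDeriv c t * φ t) z := by
  have hT := hc.deriv_periodic 0
  rw [zero_add] at hT
  rw [← hc.cauchyTr₂_weak h i1 i2 hc.hasDerivAt_inv_deriv hc.continuous_tangentInvDeriv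
    (by simp only [hT]) hz]
  congr 1; ext t
  rw [inv_mul_cancel₀ (hc.deriv_ne_zero t), one_mul]

/-- The commutator of the tangential derivative with the boundary values of the normal
derivative of a logarithmic potential. -/
def _root_.tangentialCommutator (c : ℝ → ℂ) (L : ℝ) (φ : ℝ → ℝ) (s : ℝ) : ℝ :=
  (-Complex.I * deriv (deriv c) s * cauchyLim c L (fun t => (φ t : ℂ)) s +
    -Complex.I * deriv c s ^ 2 * cauchyLim c L (fun t => tangentInvDeriv c t * φ t) s).re

theorem continuous_cauchyInt (hc : IsArcCurve c L) {h : ℝ → ℂ} (hh : Integrable h (arcMeasure L))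
    {ε : ℝ} (hε : 0 < ε) (hε' : ε ≤ hc.width) : Continuous (cauchyInt c L ε h) := by
  refine continuous_iff_continuousAt.2 fun s => ?_
  have h1 := (hc.hasDerivAt_cauchyTr hh (hc.parallel_notMem hε hε' s)).continuousAt
  exact ContinuousAt.comp (f := parallel c ε) h1 (hc.continuous_parallel.comp
    (by fun_prop : Continuous fun s => (ε, s))).continuousAt

theorem traceLim_commutator (hc : IsArcCurve c L) {φ : ℝ → ℝ} (h : MemLp φ 2 (arcMeasure L)) :
    TraceLim (arcMeasure L)
      (fun ε s => (-Complex.I * deriv (deriv c) s * cauchyInt c L ε (fun t => (φ t : ℂ)) s +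
        -Complex.I * deriv c s ^ 2 * cauchyInt c L ε (fun t => tangentInvDeriv c t * φ t) s).re)
      (tangentialCommutator c L φ) := by
  obtain ⟨M, hM0, -, hM, -⟩ := hc.exists_deriv₂_bound
  have c1 := hc.continuous_deriv; have c2 := hc.continuous_deriv₂
  have h1 := (hc.traceLim_cauchyInt h.ofReal).bdd_mul
    (m := fun s => -Complex.I * deriv (deriv c) s) (C := M)
    (Continuous.aestronglyMeasurable (by fun_prop)) (fun s => by simpa using hM s)
  have h2 := (hc.traceLim_cauchyInt (memLp_mul_continuous h.ofReal
    hc.continuous_tangentInvDeriv)).bdd_mul (m := fun s => -Complex.I * deriv c s ^ 2) (C := 1)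
    (Continuous.aestronglyMeasurable (by fun_prop)) (fun s => by simp [hc.unit_speed])
  exact (h1.add h2).re

end IsArcCurve

/-- Families with a limit may be multiplied by a continuous function. -/
theorem TraceLim.continuous_mul {𝕜 : Type*} [RCLike 𝕜] {L : ℝ} {F : ℝ → ℝ → 𝕜} {e : ℝ → 𝕜}
    (hF : TraceLim (arcMeasure L) F e) {η : ℝ → 𝕜} (hη : Continuous η) :
    TraceLim (arcMeasure L) (fun ε s => η s * F ε s) (fun s => η s * e s) := by
  obtain ⟨C, hC⟩ := (isCompact_Icc (a := 0) (b := L)).exists_bound_of_continuousOn hη.continuousOn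
  have h := hF.bdd_mul (m := (Ioc 0 L).indicator η) (C := max C 0)
    ((hη.stronglyMeasurable.indicator measurableSet_Ioc).aestronglyMeasurable) (fun s => by
      by_cases hs : s ∈ Ioc 0 L
      · rw [indicator_of_mem hs]
        exact (hC s (Ioc_subset_Icc_self hs)).trans (le_max_left _ _)
      · rw [indicator_of_notMem hs]; simp)
  refine h.congr_of_forall one_pos (S := Ioc 0 L) (ae_restrict_mem measurableSet_Ioc)
    (fun ε _ _ s hs => by rw [indicator_of_mem hs]) ?_
  filter_upwards [ae_restrict_mem measurableSet_Ioc] with s hs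
  rw [indicator_of_mem hs]

/-- If functions have weak derivatives and both families have limits, the limit has a
weak derivative. -/
theorem WeakDeriv.of_traceLim {L : ℝ} {F F' : ℝ → ℝ → ℝ} {e e' : ℝ → ℝ}
    (hF : TraceLim (arcMeasure L) F e) (hF' : TraceLim (arcMeasure L) F' e')
    (h : ∀ᶠ ε in 𝓝[>] (0 : ℝ), WeakDeriv L (F ε) (F' ε)) : WeakDeriv L e e' := by
  intro η hη hη0
  have h1 := (hF.continuous_mul (hη.continuous_deriv le_rfl)).tendsto_integral
  have h2 := (hF'.continuous_mul hη.continuous).tendsto_integral.neg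
  have h3 := tendsto_nhds_unique_of_eventuallyEq h1 h2 (by
    filter_upwards [h] with ε hε
    have := hε η hη hη0
    simp only [mul_comm (deriv η _), mul_comm (η _)]
    exact this)
  simpa only [mul_comm] using h3

namespace IsArcCurve

variable {c : ℝ → ℂ} {L : ℝ}

/-- The tangential derivative of the boundary values of the normal derivative of a logarithmic
potential. -/
theorem weakDeriv_jump (hc : IsArcCurve c L) {φ ψ : ℝ → ℝ} (hφ : MemLp φ 2 (arcMeasure L))
    (hψ : MemLp ψ 2 (arcMeasure L)) (h : WeakDeriv L φ ψ) :
    WeakDeriv L (fun s => Real.pi * φ s + ∫ t, normalKer c s t * φ t ∂(arcMeasure L))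
      (fun s => (Real.pi * ψ s +
        ∫ t, weightedKer c (fun s t => deriv c s * (deriv c t)⁻¹) s t * ψ t ∂(arcMeasure L)) +
          tangentialCommutator c L φ s) := by
  obtain ⟨M, hM0, hMc, -⟩ := hc.exists_deriv₂_bound
  obtain ⟨K, hK⟩ := hc.isUnitSymbol_left
  have i1 := hφ.integrable one_le_two
  have i2 := hψ.integrable one_le_two
  have c1 := hc.continuous_deriv; have c2 := hc.continuous_deriv₂
  have c3 := hc.continuous_inv_deriv; have c4 := hc.continuous_tangentInvDeriv
  have c5 := hc.continuous_curvC
  -- The normal derivative is differentiated on the parallel curve at distance `ε`. The curvature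
  -- of the parallel curve brings a term with a factor `ε`, which vanishes in the limit.
  set g : ℝ → ℂ := fun t => (deriv c t)⁻¹ * ψ t + tangentInvDeriv c t * φ t with hg
  have hgL : MemLp g 2 (arcMeasure L) :=
    (memLp_mul_continuous hψ.ofReal c3).add (memLp_mul_continuous hφ.ofReal c4)
  have l1 := ((hc.traceLim_cauchyInt hgL).vanish
    (m := fun s => Complex.I * (curvC c s : ℂ) * deriv c s ^ 2) (C := M)
    (Continuous.aestronglyMeasurable (by fun_prop))
    (fun s => by simpa [hc.unit_speed] using hMc s)).re
  have l2 := ((hc.traceLim_weighted hK hψ).add (hc.traceLim_commutator hφ)).add l1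
  refine WeakDeriv.of_traceLim (hc.traceLim_normal hφ) (l2.congr_limit ?_) ?_
  · exact Eventually.of_forall fun s => by simp
  have hw : ∀ᶠ ε in 𝓝[>] (0 : ℝ), ε ∈ Ioo 0 hc.width := Ioo_mem_nhdsGT hc.width_pos
  filter_upwards [hw] with ε hε
  have iC : Integrable (fun t => (φ t : ℂ)) (arcMeasure L) := i1.ofReal
  have hcont := hc.continuous_cauchyInt (hgL.integrable one_le_two) hε.1 hε.2.le
  have hcont' := hc.continuous_cauchyInt iC hε.1 hε.2.le
  have hder : ∀ s, HasDerivAt (cauchyInt c L ε (fun t => (φ t : ℂ)))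
      (cauchyInt c L ε g s * (((1 - ε * curvC c s : ℝ) : ℂ) * deriv c s)) s := by
    intro s
    have hz := hc.parallel_notMem hε.1 hε.2.le s
    have h1 := hc.hasDerivAt_cauchyTr iC hz
    rw [hc.cauchyTr₂_eq h i1 i2 hz, neg_neg] at h1
    exact h1.comp s (hc.hasDerivAt_parallel ε s)
  have hder2 : ∀ s, HasDerivAt
      (fun s => (-Complex.I * deriv c s * cauchyInt c L ε (fun t => (φ t : ℂ)) s).re)
      (-Complex.I * deriv (deriv c) s * cauchyInt c L ε (fun t => (φ t : ℂ)) s +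
        -Complex.I * deriv c s * (cauchyInt c L ε g s *
          (((1 - ε * curvC c s : ℝ) : ℂ) * deriv c s))).re s := fun s =>
    Complex.reCLM.hasFDerivAt.comp_hasDerivAt s
      (((hc.hasDerivAt_deriv s).const_mul (-Complex.I)).mul (hder s))
  have hper : cauchyInt c L ε (fun t => (φ t : ℂ)) 0 = cauchyInt c L ε (fun t => (φ t : ℂ)) L := by
    have := hc.parallel_periodic ε 0
    rw [zero_add] at this
    rw [← cauchyTr_parallel, ← cauchyTr_parallel, this]
  have hT := hc.deriv_periodic 0
  rw [zero_add] at hT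
  refine (WeakDeriv.of_hasDerivAt hc.length_pos.le hder2 ?_ ?_).congr
    (Eventually.of_forall fun s => rfl) (Eventually.of_forall fun s => ?_)
  · exact Complex.continuous_re.comp (by fun_prop)
  · simp only [hper, hT]
  · have hz := hc.parallel_notMem hε.1 hε.2.le s
    have e1 : cauchyInt c L ε g s = cauchyInt c L ε (fun t => (deriv c t)⁻¹ * ψ t) s +
        cauchyInt c L ε (fun t => tangentInvDeriv c t * φ t) s := by
      have j1 := hc.integrable_inv_mul (z := parallel c ε s)
        ((memLp_mul_continuous hψ.ofReal c3).integrable one_le_two) hz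
      have j2 := hc.integrable_inv_mul (z := parallel c ε s)
        ((memLp_mul_continuous hφ.ofReal c4).integrable one_le_two) hz
      simp only [cauchyInt]
      refine Eq.trans ?_ (integral_add j1 j2)
      congr 1; ext t; rw [hg]; simp only [mul_add]
    have e2 : ∫ t, (parallel c ε s - c t)⁻¹ * (deriv c s * (deriv c t)⁻¹) * (ψ t : ℂ)
        ∂(arcMeasure L) = deriv c s * cauchyInt c L ε (fun t => (deriv c t)⁻¹ * ψ t) s := by
      unfold cauchyInt
      rw [← integral_const_mul]
      congr 1; ext t; ring
    simp only [RCLike.re_to_complex]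
    rw [e2, ← Complex.add_re, ← Complex.add_re]
    congr 1
    rw [e1]
    push_cast
    simp only [Complex.coe_algebraMap]
    ring

end IsArcCurve

theorem ae_mem_prod_Ioc (L : ℝ) :
    ∀ᵐ p ∂((arcMeasure L).prod (arcMeasure L)), p ∈ Ioc 0 L ×ˢ Ioc 0 L := by
  unfold arcMeasure
  rw [Measure.prod_restrict]
  exact ae_restrict_mem (measurableSet_Ioc.prod measurableSet_Ioc)

theorem exists_bound_of_continuous_uncurry {k : ℝ → ℝ → ℝ} (L : ℝ)
    (hk : Continuous (Function.uncurry k)) :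
    ∃ C : ℝ, ∀ s ∈ Ioc 0 L, ∀ t ∈ Ioc 0 L, |k s t| ≤ C := by
  obtain ⟨C, hC⟩ := ((isCompact_Icc (a := 0) (b := L)).prod
    (isCompact_Icc (a := 0) (b := L))).exists_bound_of_continuousOn hk.continuousOn
  exact ⟨C, fun s hs t ht => hC (s, t) ⟨Ioc_subset_Icc_self hs, Ioc_subset_Icc_self ht⟩⟩

/-! ### Smooth kernels -/

theorem continuous_deriv_left {q : ℝ → ℝ → ℝ} (hq : ContDiff ℝ 1 (Function.uncurry q)) :
    (∀ s t, HasDerivAt (fun s => q s t) (fderiv ℝ (Function.uncurry q) (s, t) (1, 0)) s) ∧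
    Continuous (Function.uncurry fun s t => fderiv ℝ (Function.uncurry q) (s, t) (1, 0)) := by
  refine ⟨fun s t => ?_, ?_⟩
  · have h1 := (hq.differentiable one_ne_zero (s, t)).hasFDerivAt
    have h2 : HasDerivAt (fun s : ℝ => (s, t)) ((1 : ℝ), (0 : ℝ)) s :=
      (hasDerivAt_id s).prodMk (hasDerivAt_const s t)
    exact h1.comp_hasDerivAt s h2
  · exact (hq.continuous_fderiv one_ne_zero).clm_apply continuous_const

theorem continuous_deriv_right {q : ℝ → ℝ → ℝ} (hq : ContDiff ℝ 1 (Function.uncurry q)) :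
    (∀ s t, HasDerivAt (fun t => q s t) (fderiv ℝ (Function.uncurry q) (s, t) (0, 1)) t) ∧
    Continuous (Function.uncurry fun s t => fderiv ℝ (Function.uncurry q) (s, t) (0, 1)) := by
  refine ⟨fun s t => ?_, ?_⟩
  · have h1 := (hq.differentiable one_ne_zero (s, t)).hasFDerivAt
    have h2 : HasDerivAt (fun t : ℝ => (s, t)) ((0 : ℝ), (1 : ℝ)) t :=
      (hasDerivAt_const t s).prodMk (hasDerivAt_id t)
    exact h1.comp_hasDerivAt t h2
  · exact (hq.continuous_fderiv one_ne_zero).clm_apply continuous_const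

/-- Functions produced by a smooth kernel have weak derivatives. -/
theorem WeakDeriv.kernel_left {L : ℝ} (hL : 0 ≤ L) {q q' : ℝ → ℝ → ℝ}
    (hq : Continuous (Function.uncurry q))
    (hd : ∀ s t, HasDerivAt (fun s => q s t) (q' s t) s) (hq' : Continuous (Function.uncurry q'))
    (hper : ∀ t, q 0 t = q L t) {φ : ℝ → ℝ} (hφ : Integrable φ (arcMeasure L)) :
    WeakDeriv L (fun s => ∫ t, q s t * φ t ∂(arcMeasure L))
      (fun s => ∫ t, q' s t * φ t ∂(arcMeasure L)) := by
  intro η hη hη0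
  have hη' := hη.continuous_deriv le_rfl
  set μ := arcMeasure L with hμ
  -- integrability on the product, for the interchange of the integrations
  have hint : ∀ (k : ℝ → ℝ → ℝ) (g : ℝ → ℝ), Continuous (Function.uncurry k) → Continuous g →
      Integrable (Function.uncurry fun s t => k s t * φ t * g s) (μ.prod μ) := by
    intro k g hk hg
    have hc : Continuous (Function.uncurry fun s t => k s t * g s) :=
      hk.mul (hg.comp continuous_fst)
    obtain ⟨C, hC⟩ := exists_bound_of_continuous_uncurry L hc
    have h1 : Integrable (fun p : ℝ × ℝ => φ p.2) (μ.prod μ) := hφ.comp_snd μ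
    have h2 := h1.bdd_mul (c := C) hc.aestronglyMeasurable
      ((ae_mem_prod_Ioc L).mono fun p hp => hC p.1 hp.1 p.2 hp.2)
    refine h2.congr (Eventually.of_forall fun p => ?_)
    simp only [Function.uncurry]; ring
  have hswap : ∀ (k : ℝ → ℝ → ℝ) (g : ℝ → ℝ), Continuous (Function.uncurry k) → Continuous g →
      ∫ s, (∫ t, k s t * φ t ∂μ) * g s ∂μ = ∫ t, φ t * ∫ s, k s t * g s ∂μ ∂μ := by
    intro k g hk hg
    simp only [← integral_mul_const]
    rw [integral_integral_swap (hint k g hk hg)]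
    congr 1; ext t
    rw [← integral_const_mul]
    congr 1; ext s; ring
  rw [hswap q _ hq hη', hswap q' _ hq' hη.continuous, ← integral_neg]
  congr 1; ext t
  rw [integral_deriv_mul_arcMeasure hL (fun s => hd s t)
    (hq'.comp (by fun_prop : Continuous fun s : ℝ => (s, t)))
    (fun t => (hη.differentiable one_ne_zero t).hasDerivAt) hη' (by rw [hper, hη0])]
  ring

/-- A smooth kernel moves a weak derivative onto itself. -/
theorem WeakDeriv.kernel_right {L : ℝ} {q q' : ℝ → ℝ → ℝ}
    (hd : ∀ s t, HasDerivAt (fun t => q s t) (q' s t) t) (hq' : Continuous (Function.uncurry q'))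
    (hper : ∀ s, q s 0 = q s L) {φ ψ : ℝ → ℝ} (h : WeakDeriv L φ ψ) (s : ℝ) :
    ∫ t, q s t * ψ t ∂(arcMeasure L) = -∫ t, q' s t * φ t ∂(arcMeasure L) := by
  have h1 : deriv (fun t => q s t) = fun t => q' s t := funext fun t => (hd s t).deriv
  have h2 : ContDiff ℝ 1 fun t => q s t := by
    refine contDiff_one_iff_deriv.2 ⟨fun t => (hd s t).differentiableAt, ?_⟩
    rw [h1]; exact hq'.comp (by fun_prop : Continuous fun t : ℝ => (s, t))
  have := h _ h2 (hper s)
  rw [h1] at this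
  simp only [mul_comm (q s _), mul_comm (q' s _)]
  linarith

namespace IsArcCurve

variable {c : ℝ → ℂ} {L : ℝ}

/-- The commutator is a bounded operator on `L²`, as a pointwise limit of bounded operators. -/
theorem exists_commutatorOperator (hc : IsArcCurve c L) :
    ∃ B : Lp ℝ 2 (arcMeasure L) →L[ℝ] Lp ℝ 2 (arcMeasure L),
      ∀ φ : Lp ℝ 2 (arcMeasure L), B φ =ᵐ[arcMeasure L] tangentialCommutator c L φ := by
  have c0 := hc.continuous
  have c1 := hc.continuous_deriv; have c2 := hc.continuous_deriv₂
  have c4 := hc.continuous_tangentInvDeriv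
  let k : ℝ → ℝ → ℝ → ℝ := fun ε s t => ((-Complex.I * deriv (deriv c) s +
    -Complex.I * deriv c s ^ 2 * tangentInvDeriv c t) * (parallel c ε s - c t)⁻¹).re
  have hk : ∀ ε, 0 < ε → ε < hc.width → Continuous (Function.uncurry (k ε)) := by
    intro ε hε hε'
    have h1 : Continuous fun p : ℝ × ℝ => parallel c ε p.1 :=
      hc.continuous_parallel.comp (by fun_prop : Continuous fun p : ℝ × ℝ => (ε, p.1))
    have h2 : Continuous fun p : ℝ × ℝ => (parallel c ε p.1 - c p.2)⁻¹ :=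
      (h1.sub (c0.comp continuous_snd)).inv₀ fun p => hc.parallel_sub_ne hε hε'.le p.1 p.2
    exact Complex.continuous_re.comp (by fun_prop)
  have hA : ∀ ε, 0 < ε → ε < hc.width → ∃ A : Lp ℝ 2 (arcMeasure L) →L[ℝ] Lp ℝ 2 (arcMeasure L),
      ∀ φ : Lp ℝ 2 (arcMeasure L), A φ =ᵐ[arcMeasure L]
        fun s => ∫ t, k ε s t * φ t ∂(arcMeasure L) := by
    intro ε hε hε'
    obtain ⟨C, hC⟩ := exists_bound_of_continuous_uncurry L (hk ε hε hε')
    obtain ⟨A, hA, -⟩ := exists_kernelOperator (hk ε hε hε').measurable hC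
    exact ⟨A, hA⟩
  choose! A hA using hA
  have ht := fun φ : Lp ℝ 2 (arcMeasure L) => hc.traceLim_commutator (Lp.memLp φ)
  have key : Tendsto (fun ε (φ : Lp ℝ 2 (arcMeasure L)) => A ε φ) (𝓝[>] 0)
      (𝓝 fun φ => (ht φ).memLp.toLp _) := by
    refine tendsto_pi_nhds.2 fun φ => ?_
    rw [Lp.tendsto_Lp_iff_tendsto_eLpNorm]
    refine (ht φ).l2_tendsto.congr' ?_
    have hw : ∀ᶠ ε in 𝓝[>] (0 : ℝ), ε ∈ Ioo 0 hc.width := Ioo_mem_nhdsGT hc.width_pos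
    filter_upwards [hw] with ε hε
    refine eLpNorm_congr_ae ?_
    filter_upwards [hA ε hε.1 hε.2 φ] with s hs
    rw [Pi.sub_apply, hs]
    congr 1
    have iC : Integrable (fun t => (φ t : ℂ)) (arcMeasure L) :=
      ((Lp.memLp φ).integrable one_le_two).ofReal
    have hz := hc.parallel_notMem hε.1 hε.2.le s
    have j1 := (hc.integrable_inv_mul iC hz).const_mul (-Complex.I * deriv (deriv c) s)
    have j2 := (hc.integrable_inv_mul (h := fun t => tangentInvDeriv c t * φ t)
      ((memLp_mul_continuous (Lp.memLp φ).ofReal c4).integrable one_le_two) hz).const_mul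
      (-Complex.I * deriv c s ^ 2)
    simp only [cauchyInt]
    rw [← integral_const_mul, ← integral_const_mul, ← integral_add j1 j2]
    refine Eq.trans (integral_re (j1.add j2)).symm ?_
    congr 1; ext t
    simp only [k, Pi.add_apply, RCLike.re_to_complex]
    rw [← Complex.re_mul_ofReal]
    congr 1; ring
  exact ⟨continuousLinearMapOfTendsto A key, fun φ => (ht φ).memLp.coeFn_toLp⟩

/-- A smooth approximation of `weightedKer`. -/
def _root_.smoothKer (c : ℝ → ℂ) (m : ℝ → ℝ → ℂ) (δ s t : ℝ) : ℝ :=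
  (-Complex.I * deriv c s * m s t * (starRingEnd ℂ) (c s - c t)).re /
    (Complex.normSq (c s - c t) + δ ^ 2)

theorem smoothKer_eq (c : ℝ → ℂ) (m : ℝ → ℝ → ℂ) {δ : ℝ} (hδ : 0 < δ) (s t : ℝ) :
    weightedKer c m s t - smoothKer c m δ s t =
      weightedKer c m s t * (δ ^ 2 / (Complex.normSq (c s - c t) + δ ^ 2)) := by
  unfold smoothKer weightedKer
  have h0 := Complex.normSq_nonneg (c s - c t)
  rw [Complex.inv_def, ← mul_assoc, Complex.re_mul_ofReal]
  rcases eq_or_ne (Complex.normSq (c s - c t)) 0 with h | h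
  · rw [Complex.normSq_eq_zero.1 h]; simp
  · have : Complex.normSq (c s - c t) + δ ^ 2 ≠ 0 := by positivity
    field_simp
    ring

theorem contDiff_smoothKer (hc : IsArcCurve c L) {m : ℝ → ℝ → ℂ}
    (hm : ContDiff ℝ 1 (Function.uncurry m)) {δ : ℝ} (hδ : 0 < δ) :
    ContDiff ℝ 1 (Function.uncurry (smoothKer c m δ)) := by
  have h1 : ContDiff ℝ 1 c := hc.contDiff.of_le (by norm_num)
  have h2 : ContDiff ℝ 1 (deriv c) := hc.contDiff_deriv
  have hm' : ContDiff ℝ 1 fun p : ℝ × ℝ => m p.1 p.2 := hm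
  have h3 : ContDiff ℝ 1 fun p : ℝ × ℝ => c p.1 - c p.2 :=
    (h1.comp contDiff_fst).sub (h1.comp contDiff_snd)
  have h4 : ContDiff ℝ 1 fun p : ℝ × ℝ => Complex.normSq (c p.1 - c p.2) + δ ^ 2 := by
    simp only [Complex.normSq_eq_norm_sq]
    exact (h3.norm_sq ℝ).add contDiff_const
  refine ContDiff.div ?_ h4 fun p => ?_
  · have h5 : ContDiff ℝ 1 fun p : ℝ × ℝ =>
        -Complex.I * deriv c p.1 * m p.1 p.2 * (starRingEnd ℂ) (c p.1 - c p.2) :=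
      ((contDiff_const.mul (h2.comp contDiff_fst)).mul hm').mul
        ((Complex.conjCLE : ℂ →L[ℝ] ℂ).contDiff.comp h3)
    exact Complex.reCLM.contDiff.comp h5
  · have := Complex.normSq_nonneg (c p.1 - c p.2)
    positivity

/-- The smooth kernels converge in the Hilbert-Schmidt norm. -/
theorem tendsto_smoothKer (hc : IsArcCurve c L) {m : ℝ → ℝ → ℂ} {K : ℝ}
    (hm : IsUnitSymbol L m K) :
    Tendsto (fun δ => ∫ p, (Function.uncurry (fun s t =>
        Real.pi⁻¹ * (weightedKer c m s t - smoothKer c m δ s t)) p) ^ 2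
      ∂((arcMeasure L).prod (arcMeasure L))) (𝓝[>] 0) (𝓝 0) := by
  obtain ⟨C, hC⟩ := hc.exists_weightedKer_bound hm
  have hC0 : 0 ≤ C := (abs_nonneg _).trans (hC 0 0)
  have hms := hc.measurable_weightedKer hm
  have hcm := hc.continuous.measurable
  have hpi := Real.pi_pos
  have h1 : Tendsto (fun δ => ∫ p : ℝ × ℝ, (Real.pi⁻¹ * (weightedKer c m p.1 p.2 *
      (δ ^ 2 / (Complex.normSq (c p.1 - c p.2) + δ ^ 2)))) ^ 2
      ∂((arcMeasure L).prod (arcMeasure L))) (𝓝[>] 0)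
      (𝓝 (∫ p : ℝ × ℝ, 0 ∂((arcMeasure L).prod (arcMeasure L)))) := by
    refine tendsto_integral_filter_of_dominated_convergence (fun _ => (Real.pi⁻¹ * C) ^ 2)
      (Eventually.of_forall fun δ => ?_) ?_ (integrable_const _) ?_
    · have hms' : Measurable fun p : ℝ × ℝ => weightedKer c m p.1 p.2 := hms
      have : Measurable Complex.normSq := Complex.continuous_normSq.measurable
      exact Measurable.aestronglyMeasurable (by fun_prop)
    · filter_upwards [self_mem_nhdsWithin] with δ hδ
      refine Eventually.of_forall fun p => ?_
      have h0 := Complex.normSq_nonneg (c p.1 - c p.2)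
      have hδ' : (0 : ℝ) < δ := hδ
      have h2 : |δ ^ 2 / (Complex.normSq (c p.1 - c p.2) + δ ^ 2)| ≤ 1 := by
        rw [abs_of_nonneg (by positivity), div_le_one (by positivity)]
        linarith
      rw [norm_pow, Real.norm_eq_abs, abs_mul, abs_mul, abs_of_pos (inv_pos.2 hpi)]
      gcongr
      calc _ ≤ C * 1 := by gcongr; exact hC _ _
        _ = C := mul_one C
    · refine Eventually.of_forall fun p => ?_
      rcases eq_or_ne (Complex.normSq (c p.1 - c p.2)) 0 with h | h
      · have : weightedKer c m p.1 p.2 = 0 := by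
          unfold weightedKer; rw [Complex.normSq_eq_zero.1 h]; simp
        simp [this]
      · have h3 : ContinuousAt (fun δ : ℝ => (Real.pi⁻¹ * (weightedKer c m p.1 p.2 *
            (δ ^ 2 / (Complex.normSq (c p.1 - c p.2) + δ ^ 2)))) ^ 2) 0 := by
          have : Complex.normSq (c p.1 - c p.2) + (0 : ℝ) ^ 2 ≠ 0 := by simpa using h
          fun_prop (disch := assumption)
        have h4 := h3.tendsto.mono_left (nhdsWithin_le_nhds (s := Ioi 0))
        simpa using h4
  rw [integral_zero] at h1
  refine h1.congr' ?_
  filter_upwards [self_mem_nhdsWithin] with δ hδ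
  congr 1; ext p
  simp only [Function.uncurry]
  rw [smoothKer_eq c m hδ]

theorem _root_.isUnitSymbol_one (L : ℝ) : IsUnitSymbol L (fun _ _ => 1) 0 :=
  ⟨measurable_const, le_rfl, fun s t k => by simp⟩

theorem _root_.weightedKer_one (c : ℝ → ℂ) : weightedKer c (fun _ _ => 1) = normalKer c := by
  ext s t
  simp [weightedKer, normalKer]

/-- The operator with kernel `weightedKer` is, up to a smooth kernel, as small as desired. -/
theorem exists_small_operator (hc : IsArcCurve c L) {m : ℝ → ℝ → ℂ} {K : ℝ}
    (hm : IsUnitSymbol L m K) (hm1 : ContDiff ℝ 1 (Function.uncurry m)) :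
    ∃ δ : ℝ, 0 < δ ∧ ∃ R : Lp ℝ 2 (arcMeasure L) →L[ℝ] Lp ℝ 2 (arcMeasure L), ‖R‖ ≤ 1 / 4 ∧
      ∀ φ : Lp ℝ 2 (arcMeasure L), R φ =ᵐ[arcMeasure L] fun s =>
        Real.pi⁻¹ * (∫ t, weightedKer c m s t * φ t ∂(arcMeasure L) -
          ∫ t, smoothKer c m δ s t * φ t ∂(arcMeasure L)) := by
  have h1 : ∀ᶠ δ in 𝓝[>] (0 : ℝ), ∫ p, (Function.uncurry (fun s t =>
        Real.pi⁻¹ * (weightedKer c m s t - smoothKer c m δ s t)) p) ^ 2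
      ∂((arcMeasure L).prod (arcMeasure L)) < (1 / 4) ^ 2 :=
    (hc.tendsto_smoothKer hm).eventually (gt_mem_nhds (by norm_num))
  obtain ⟨δ, hδ, hδ0⟩ := (h1.and self_mem_nhdsWithin).exists
  have hδ' : 0 < δ := hδ0
  have hq := (hc.contDiff_smoothKer hm1 hδ').continuous
  obtain ⟨C, hC⟩ := hc.exists_weightedKer_bound hm
  obtain ⟨C', hC'⟩ := exists_bound_of_continuous_uncurry L hq
  have hpi := Real.pi_pos
  obtain ⟨R, hR, hR'⟩ := exists_kernelOperator (L := L)
    (k := fun s t => Real.pi⁻¹ * (weightedKer c m s t - smoothKer c m δ s t))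
    (C := Real.pi⁻¹ * (C + C'))
    (((hc.measurable_weightedKer hm).sub hq.measurable).const_mul _)
    (fun s hs t ht => by
      rw [abs_mul, abs_of_pos (inv_pos.2 hpi)]
      gcongr
      exact (abs_sub _ _).trans (add_le_add (hC s t) (hC' s hs t ht)))
  refine ⟨δ, hδ', R, ?_, fun φ => ?_⟩
  · exact (abs_le_of_sq_le_sq' (hR'.trans hδ.le) (by norm_num)).2
  · filter_upwards [hR φ] with s hs
    have hi := (Lp.memLp φ).integrable one_le_two
    have hqs : Continuous (smoothKer c m δ s) := hq.uncurry_left s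
    have j2 : Integrable (fun t => smoothKer c m δ s t * φ t) (arcMeasure L) := by
      simpa only [mul_comm] using integrable_mul_continuous hi hqs
    rw [hs, ← integral_sub (hc.integrable_weightedKer_mul hm hi s) j2, ← integral_const_mul]
    congr 1; ext t; ring

theorem contDiff_symbol (hc : IsArcCurve c L) :
    ContDiff ℝ 1 (Function.uncurry fun s t => deriv c s * (deriv c t)⁻¹) := by
  have h1 : ContDiff ℝ 1 fun t => (deriv c t)⁻¹ :=
    contDiff_one_iff_deriv.2 ⟨fun t => (hc.hasDerivAt_inv_deriv t).differentiableAt, by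
      rw [funext fun t => (hc.hasDerivAt_inv_deriv t).deriv]
      exact hc.continuous_tangentInvDeriv⟩
  have h2 : ContDiff ℝ 1 fun p : ℝ × ℝ => (deriv c p.2)⁻¹ := h1.comp contDiff_snd
  have h3 : ContDiff ℝ 1 fun p : ℝ × ℝ => deriv c p.1 := hc.contDiff_deriv.comp contDiff_fst
  exact h3.mul h2

/-- A solution of the Neumann integral equation with continuously differentiable
right-hand side has a weak derivative. -/
theorem exists_weakDeriv (hc : IsArcCurve c L) {φ : ℝ → ℝ} (hφ : MemLp φ 2 (arcMeasure L))
    {g g' : ℝ → ℝ} (hg : ∀ s, HasDerivAt g (g' s) s) (hg' : Continuous g') (hg0 : g 0 = g L)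
    (h : ∀ᵐ s ∂(arcMeasure L),
      Real.pi * φ s + ∫ t, normalKer c s t * φ t ∂(arcMeasure L) = g s) :
    ∃ ψ : ℝ → ℝ, MemLp ψ 2 (arcMeasure L) ∧ WeakDeriv L φ ψ := by
  have hpi := Real.pi_pos
  have hL := hc.length_pos.le
  have hgc : Continuous g := continuous_iff_continuousAt.2 fun t => (hg t).continuousAt
  have hi : ∀ φ : Lp ℝ 2 (arcMeasure L), Integrable φ (arcMeasure L) :=
    fun φ => (Lp.memLp φ).integrable one_le_two
  obtain ⟨K, hK⟩ := hc.isUnitSymbol_left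
  have hper0 : c 0 = c L := by simpa using (hc.periodic 0).symm
  have hperT : deriv c 0 = deriv c L := by simpa using (hc.deriv_periodic 0).symm
  -- `R` and `R'` are the contractions left over after smooth kernels are split off from the kernels
  -- of the integral equation and of the equation for the derivative
  obtain ⟨δ, hδ, R, hR, hRφ⟩ := hc.exists_small_operator (isUnitSymbol_one L) contDiff_const
  obtain ⟨δ', hδ', R', hR', hRφ'⟩ := hc.exists_small_operator hK hc.contDiff_symbol
  obtain ⟨B, hB⟩ := hc.exists_commutatorOperator
  set q := smoothKer c (fun _ _ => 1) δ with hqdef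
  set r := smoothKer c (fun s t => deriv c s * (deriv c t)⁻¹) δ' with hrdef
  have hq : ContDiff ℝ 1 (Function.uncurry q) := hc.contDiff_smoothKer contDiff_const hδ
  have hr : ContDiff ℝ 1 (Function.uncurry r) := hc.contDiff_smoothKer hc.contDiff_symbol hδ'
  obtain ⟨hqd, hqc⟩ := continuous_deriv_left hq
  obtain ⟨hrd, hrc⟩ := continuous_deriv_right hr
  set q' : ℝ → ℝ → ℝ := fun s t => fderiv ℝ (Function.uncurry q) (s, t) (1, 0) with hq'
  set r' : ℝ → ℝ → ℝ := fun s t => fderiv ℝ (Function.uncurry r) (s, t) (0, 1) with hr'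
  obtain ⟨C1, hC1⟩ := exists_bound_of_continuous_uncurry L hq.continuous
  obtain ⟨Q, hQ, -⟩ := exists_kernelOperator hq.continuous.measurable hC1
  obtain ⟨C2, hC2⟩ := exists_bound_of_continuous_uncurry L hqc
  obtain ⟨Q', hQ', -⟩ := exists_kernelOperator hqc.measurable hC2
  obtain ⟨C3, hC3⟩ := exists_bound_of_continuous_uncurry L hrc
  obtain ⟨P, hP, -⟩ := exists_kernelOperator hrc.measurable hC3
  have hqper : ∀ t, q 0 t = q L t := fun t => by
    simp only [hqdef, smoothKer, hper0, hperT]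
  have hrper : ∀ s, r s 0 = r s L := fun s => by
    simp only [hrdef, smoothKer, hper0, hperT]
  -- the smooth part preserves the graph of the weak derivative
  have hQV : ∀ φ : Lp ℝ 2 (arcMeasure L), WeakDeriv L (Q φ) (Q' φ) := fun φ =>
    (WeakDeriv.kernel_left hL hq.continuous hqd hqc hqper (hi φ)).congr (hQ φ) (hQ' φ)
  set Φ : Lp ℝ 2 (arcMeasure L) := hφ.toLp φ with hΦ
  have hΦφ : Φ =ᵐ[arcMeasure L] φ := hφ.coeFn_toLp
  set G : Lp ℝ 2 (arcMeasure L) := (memLp_of_continuous hgc).toLp g with hG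
  set G' : Lp ℝ 2 (arcMeasure L) := (memLp_of_continuous hg').toLp g' with hG'
  have hGV : (G, G') ∈ weakGraph L := (WeakDeriv.of_hasDerivAt hL hg hg' hg0).congr
    (memLp_of_continuous hgc).coeFn_toLp (memLp_of_continuous hg').coeFn_toLp
  have hQV' : ∀ φ : Lp ℝ 2 (arcMeasure L), (Q φ, Q' φ) ∈ weakGraph L := hQV
  have hab : (Real.pi⁻¹ • (G - Q Φ), Real.pi⁻¹ • (G' - Q' Φ)) ∈ weakGraph L :=
    (weakGraph L).smul_mem Real.pi⁻¹ ((weakGraph L).sub_mem hGV (hQV' Φ))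
  have hint : ∀ f₁ f₂ : ℝ → ℝ, f₁ =ᵐ[arcMeasure L] f₂ → ∀ k : ℝ → ℝ,
      ∫ t, k t * f₁ t ∂(arcMeasure L) = ∫ t, k t * f₂ t ∂(arcMeasure L) := fun f₁ f₂ h12 k =>
    integral_congr_ae (h12.mono fun t ht => by simp only [ht])
  -- the jump relation, less its smooth part, maps the graph of the weak derivative to itself
  have hVR : ∀ p ∈ weakGraph L, (R p.1, R' p.2 + (Real.pi⁻¹ • (B - Q' - P)) p.1) ∈ weakGraph L := by
    rintro ⟨x, y⟩ hxy
    have hxy' : WeakDeriv L x y := hxy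
    have h1 := hc.weakDeriv_jump (Lp.memLp x) (Lp.memLp y) hxy'
    have e1 : ∀ᵐ s ∂(arcMeasure L), Real.pi * x s + ∫ t, normalKer c s t * x t ∂(arcMeasure L) =
        (Real.pi • (x + R x) + Q x : Lp ℝ 2 (arcMeasure L)) s := by
      filter_upwards [hRφ x, hQ x, Lp.coeFn_add (Real.pi • (x + R x)) (Q x),
        Lp.coeFn_smul Real.pi (x + R x), Lp.coeFn_add x (R x)] with s a1 a2 a3 a4 a5
      rw [a3, Pi.add_apply, a4, Pi.smul_apply, a5, Pi.add_apply, a1, a2, weightedKer_one,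
        smul_eq_mul]
      field_simp
      ring
    have e2 : ∀ᵐ s ∂(arcMeasure L), (Real.pi * y s +
        ∫ t, weightedKer c (fun s t => deriv c s * (deriv c t)⁻¹) s t * y t ∂(arcMeasure L)) +
          tangentialCommutator c L x s =
        (Real.pi • (y + R' y) + (B x - P x) : Lp ℝ 2 (arcMeasure L)) s := by
      filter_upwards [hRφ' y, hP x, hB x, Lp.coeFn_add (Real.pi • (y + R' y)) (B x - P x),
        Lp.coeFn_smul Real.pi (y + R' y), Lp.coeFn_add y (R' y), Lp.coeFn_sub (B x) (P x)]
        with s a1 a2 a3 a4 a5 a6 a7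
      rw [a4, Pi.add_apply, a5, Pi.smul_apply, a6, Pi.add_apply, a7, Pi.sub_apply, a1, a2, a3,
        smul_eq_mul, hxy'.kernel_right hrd hrc hrper s]
      field_simp
      ring
    have h2 : (Real.pi • (x + R x) + Q x, Real.pi • (y + R' y) + (B x - P x)) ∈ weakGraph L :=
      h1.congr (e1.mono fun s hs => hs.symm) (e2.mono fun s hs => hs.symm)
    have h3 := (weakGraph L).sub_mem ((weakGraph L).smul_mem Real.pi⁻¹
      ((weakGraph L).sub_mem h2 (hQV' x))) hxy
    convert! h3 using 1
    have hp := inv_mul_cancel₀ hpi.ne'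
    ext1
    · simp only [Prod.smul_mk, Prod.mk_sub_mk, add_sub_cancel_right, smul_smul, hp, one_smul]
      abel
    · simp only [Prod.smul_mk, Prod.mk_sub_mk, smul_sub, smul_add, smul_smul, hp, one_smul,
        smul_apply, sub_apply]
      abel
  -- the integral equation, with the smooth part moved to the right-hand side
  have hfix : Φ + R Φ = Real.pi⁻¹ • (G - Q Φ) := by
    rw [← sub_eq_zero]
    refine Lp.ext ?_
    filter_upwards [hRφ Φ, hQ Φ, hΦφ, h, (memLp_of_continuous (L := L) (p := 2) hgc).coeFn_toLp,
      Lp.coeFn_sub (Φ + R Φ) (Real.pi⁻¹ • (G - Q Φ)), Lp.coeFn_add Φ (R Φ),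
      Lp.coeFn_smul Real.pi⁻¹ (G - Q Φ), Lp.coeFn_sub G (Q Φ),
      Lp.coeFn_zero ℝ 2 (arcMeasure L)] with s a1 a2 a3 a4 a5 a6 a7 a8 a9 a10
    rw [a6, Pi.sub_apply, a7, Pi.add_apply, a8, Pi.smul_apply, a9, Pi.sub_apply, a1, a2, a10, a3,
      weightedKer_one, hint Φ φ hΦφ, hint Φ φ hΦφ, a5, ← a4, smul_eq_mul]
    simp only [Pi.zero_apply]
    field_simp
    ring
  obtain ⟨Ψ, hΨ⟩ := exists_partner_of_contraction (isClosed_weakGraph L) hR hR' hVR hab hfix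
  exact ⟨Ψ, Lp.memLp Ψ, WeakDeriv.congr hΨ hΦφ.symm (ae_eq_refl _)⟩

end IsArcCurve

/-! ### The plane as the complex line -/

/-- The standard isometry of the plane with the complex numbers. -/
def toC : Plane ≃ₗᵢ[ℝ] ℂ := Complex.orthonormalBasisOneI.repr.symm

theorem toC_apply (x : Plane) : toC x = x 0 + x 1 * Complex.I := by
  have : toC x = ∑ i, x i • Complex.orthonormalBasisOneI i := by
    rw [toC]; exact (Complex.orthonormalBasisOneI.sum_repr_symm x).symm
  rw [this, Fin.sum_univ_two]
  simp

theorem inner_eq_re (x y : Plane) : inner ℝ x y = (toC x * (starRingEnd ℂ) (toC y)).re := by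
  rw [← toC.inner_map_map, Complex.inner]
  simp [Complex.mul_re]; ring

/-- Inner products divided by the squared length are real parts of quotients. -/
theorem inner_div_norm_sq (x y : Plane) : inner ℝ x y / ‖x‖ ^ 2 = ((toC x)⁻¹ * toC y).re := by
  rw [Complex.inv_def, real_inner_comm, inner_eq_re, ← toC.norm_map x, Complex.normSq_eq_norm_sq]
  have e : (starRingEnd ℂ) (toC x) * ((‖toC x‖ ^ 2)⁻¹ : ℝ) * toC y =
      ((‖toC x‖ ^ 2)⁻¹ : ℝ) * (toC y * (starRingEnd ℂ) (toC x)) := by ring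
  rw [e, Complex.re_ofReal_mul]
  ring

/-- The linear form `v ↦ Re (z v)`, the differential of a function with complex gradient
`conj z`. -/
def gradForm : ℂ →L[ℝ] Plane →L[ℝ] ℝ :=
  (innerSL ℝ).comp ((toC.symm : ℂ →L[ℝ] Plane).comp (Complex.conjCLE : ℂ →L[ℝ] ℂ))

theorem gradForm_apply (z : ℂ) (v : Plane) : gradForm z v = (z * toC v).re := by
  have : gradForm z v = inner ℝ (toC.symm ((starRingEnd ℂ) z)) v := rfl
  rw [this, real_inner_comm, inner_eq_re, toC.apply_symm_apply, Complex.conj_conj, mul_comm]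

/-- A function whose differential is `Re (F dz)` with `F` holomorphic is harmonic. -/
theorem harmonicAt_of_gradForm {u : Plane → ℝ} {F F' : ℂ → ℂ} {S : Set Plane} (hS : IsOpen S)
    (hu : ∀ x ∈ S, HasFDerivAt u (gradForm (F (toC x))) x)
    (hF : ∀ x ∈ S, HasDerivAt F (F' (toC x)) (toC x)) {x : Plane} (hx : x ∈ S) :
    InnerProductSpace.HarmonicAt u x := by
  have hd : ∀ y ∈ S, HasFDerivAt (fun z => gradForm (F (toC z)))
      (gradForm.comp ((ContinuousLinearMap.mul ℝ ℂ (F' (toC y))).comp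
        (toC : Plane →L[ℝ] ℂ))) y := by
    intro y hy
    have h1 : HasFDerivAt F (ContinuousLinearMap.mul ℝ ℂ (F' (toC y))) (toC y) := by
      refine ((hF y hy).hasFDerivAt.restrictScalars ℝ).congr_fderiv ?_
      ext v
      simp [mul_comm]
    exact gradForm.hasFDerivAt.comp y (h1.comp y (toC : Plane →L[ℝ] ℂ).hasFDerivAt)
  refine ⟨?_, ?_⟩
  · have h1 : ContDiffAt ℝ (((1 : ℕ) : WithTop ℕ∞) + 1) u x := by
      rw [contDiffAt_succ_iff_hasFDerivAt]
      refine ⟨fun y => gradForm (F (toC y)), ⟨S, hS.mem_nhds hx, hu⟩, ?_⟩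
      have h2 : DifferentiableOn ℂ F (toC '' S) := by
        rintro _ ⟨y, hy, rfl⟩
        exact (hF y hy).differentiableAt.differentiableWithinAt
      have h3 : IsOpen (toC '' S) := toC.toHomeomorph.isOpenMap S hS
      have h4 : ContDiffAt ℂ 1 F (toC x) :=
        (h2.analyticAt (h3.mem_nhds (mem_image_of_mem _ hx))).contDiffAt
      exact gradForm.contDiff.contDiffAt.comp x
        ((h4.restrict_scalars ℝ).comp x toC.contDiff.contDiffAt)
    have e : ((1 : ℕ) : WithTop ℕ∞) + 1 = 2 := by norm_num
    rwa [e] at h1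
  · filter_upwards [hS.mem_nhds hx] with y hy
    rw [InnerProductSpace.laplacian_eq_iteratedFDeriv_orthonormalBasis u
      (EuclideanSpace.basisFun (Fin 2) ℝ)]
    simp only [iteratedFDeriv_two_apply]
    have h5 : fderiv ℝ u =ᶠ[𝓝 y] fun z => gradForm (F (toC z)) := by
      filter_upwards [hS.mem_nhds hy] with z hz using (hu z hz).fderiv
    rw [h5.fderiv_eq, (hd y hy).fderiv]
    simp only [Fin.sum_univ_two, Matrix.cons_val_zero, Matrix.cons_val_one, Pi.zero_apply,
      ContinuousLinearMap.comp_apply, gradForm_apply]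
    have e0 : toC (EuclideanSpace.basisFun (Fin 2) ℝ 0) = 1 := by rw [toC_apply]; simp
    have e1 : toC (EuclideanSpace.basisFun (Fin 2) ℝ 1) = Complex.I := by rw [toC_apply]; simp
    have e2 : ∀ v : Plane, (toC : Plane →L[ℝ] ℂ) v = toC v := fun v => rfl
    simp only [e2, e0, e1, ContinuousLinearMap.mul_apply', mul_one, mul_assoc, Complex.I_mul_I]
    simp

theorem dirDeriv₂_of_gradForm {u : Plane → ℝ} {F F' : ℂ → ℂ} {S : Set Plane} (hS : IsOpen S)
    (hu : ∀ x ∈ S, HasFDerivAt u (gradForm (F (toC x))) x)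
    (hF : ∀ x ∈ S, HasDerivAt F (F' (toC x)) (toC x)) {x : Plane} (hx : x ∈ S) (v : Plane) :
    dirDeriv₂ u x v = (F' (toC x) * toC v ^ 2).re := by
  unfold dirDeriv₂
  have h5 : (fun z => fderiv ℝ u z v) =ᶠ[𝓝 x] fun z => (F (toC z) * toC v).re := by
    filter_upwards [hS.mem_nhds hx] with z hz
    rw [(hu z hz).fderiv, gradForm_apply]
  have h1 := ((hF x hx).mul_const (toC v)).hasFDerivAt.restrictScalars ℝ
  have h2 : HasFDerivAt (fun z => (F (toC z) * toC v).re) _ x :=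
    Complex.reCLM.hasFDerivAt.comp x (h1.comp x (toC : Plane →L[ℝ] ℂ).hasFDerivAt)
  rw [h5.fderiv_eq, h2.fderiv]
  simp only [ContinuousLinearMap.comp_apply, ContinuousLinearMap.coe_restrictScalars',
    Complex.reCLM_apply]
  have e2 : (toC : Plane →L[ℝ] ℂ) v = toC v := rfl
  rw [e2]
  congr 1
  simp
  ring

/-- Real parts of holomorphic functions. -/
theorem hasFDerivAt_re {G : ℂ → ℂ} {g : ℂ} {x : Plane} (h : HasDerivAt G g (toC x)) :
    HasFDerivAt (fun x => (G (toC x)).re) (gradForm g) x := by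
  have h1 := h.hasFDerivAt.restrictScalars ℝ
  have h2 : HasFDerivAt (fun z => (G (toC z)).re) _ x :=
    Complex.reCLM.hasFDerivAt.comp x (h1.comp x (toC : Plane →L[ℝ] ℂ).hasFDerivAt)
  refine h2.congr_fderiv ?_
  ext v
  rw [gradForm_apply]
  have e2 : (toC : Plane →L[ℝ] ℂ) v = toC v := rfl
  simp [e2, mul_comm]

/-- The gradient of the logarithm of the distance. -/
theorem hasFDerivAt_log_norm {x y : Plane} (h : x ≠ y) :
    HasFDerivAt (fun x => Real.log ‖x - y‖) (gradForm (toC x - toC y)⁻¹) x := by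
  have h0 : x - y ≠ 0 := sub_ne_zero.2 h
  have hn : ‖x - y‖ ^ 2 ≠ 0 := pow_ne_zero 2 (norm_ne_zero_iff.2 h0)
  have h1 : HasFDerivAt (fun x => ‖x - y‖ ^ 2) (2 • innerSL ℝ (x - y)) x :=
    ((hasFDerivAt_id x).sub_const y).norm_sq.congr_fderiv (by ext; simp)
  have h2 := (h1.log hn).const_mul (1 / 2)
  have e : (fun x => Real.log ‖x - y‖) = fun x => 1 / 2 * Real.log (‖x - y‖ ^ 2) := by
    ext z; rw [Real.log_pow]; push_cast; ring
  rw [e]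
  refine h2.congr_fderiv ?_
  ext v
  rw [gradForm_apply, ← map_sub, ← inner_div_norm_sq]
  simp only [smul_apply, innerSL_apply_apply, smul_eq_mul, nsmul_eq_mul]
  push_cast
  field_simp

/-- Harmonic functions remain harmonic after an isometric change of variables. -/
theorem harmonicAt_comp_isometry {E F : Type*} [NormedAddCommGroup E] [InnerProductSpace ℝ E]
    [FiniteDimensional ℝ E] [NormedAddCommGroup F] [InnerProductSpace ℝ F] [FiniteDimensional ℝ F]
    (e : E ≃ₗᵢ[ℝ] F) {u : F → ℝ} {x : E} (h : InnerProductSpace.HarmonicAt u (e x)) :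
    InnerProductSpace.HarmonicAt (fun y => u (e y)) x := by
  refine ⟨h.1.comp x e.contDiff.contDiffAt, ?_⟩
  have h1 : ∀ᶠ y in 𝓝 x, Laplacian.laplacian u (e y) = 0 :=
    e.continuous.continuousAt.eventually h.2
  have h2 : ∀ᶠ y in 𝓝 x, ContDiffAt ℝ 2 u (e y) :=
    e.continuous.continuousAt.eventually (h.1.eventually (by simp))
  filter_upwards [h1, h2] with y hy hy2
  rw [InnerProductSpace.laplacian_eq_iteratedFDeriv_orthonormalBasis _ (stdOrthonormalBasis ℝ E)]
  rw [InnerProductSpace.laplacian_eq_iteratedFDeriv_orthonormalBasis _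
    ((stdOrthonormalBasis ℝ E).map e)] at hy
  rw [Pi.zero_apply, ← hy]
  refine Finset.sum_congr rfl fun i _ => ?_
  have e3 : (fun y => u (e y)) = u ∘ (e.toContinuousLinearEquiv : E → F) := rfl
  rw [e3, ← iteratedFDerivWithin_univ, ← iteratedFDerivWithin_univ, ← preimage_univ (f := e)]
  have := e.toContinuousLinearEquiv.iteratedFDerivWithin_comp_right u uniqueDiffOn_univ
    (x := y) (mem_univ _) 2
  erw [this]
  simp only [ContinuousMultilinearMap.compContinuousLinearMap_apply, OrthonormalBasis.map_apply]
  congr 1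
  ext j
  fin_cases j <;> rfl

/-- A harmonic function in the plane has differential `Re (F dz)` with `F` entire. -/
theorem exists_gradForm_of_harmonic {H : Plane → ℝ}
    (hH : InnerProductSpace.HarmonicOnNhd H univ) :
    ∃ G F F' : ℂ → ℂ, (∀ x, HasFDerivAt H (gradForm (F (toC x))) x) ∧
      (∀ z, HasDerivAt G (F z) z) ∧ (∀ z, HasDerivAt F (F' z) z) ∧ Continuous F' := by
  have h1 : InnerProductSpace.HarmonicOnNhd (fun z => H (toC.symm z)) univ := fun z _ =>
    harmonicAt_comp_isometry toC.symm (hH _ (mem_univ _))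
  obtain ⟨G, hG, hGH⟩ := h1.exists_analyticOnNhd_univ_re_eq
  refine ⟨G, deriv G, deriv (deriv G), fun x => ?_,
    fun z => (hG z (mem_univ _)).differentiableAt.hasDerivAt, fun z => ?_, ?_⟩
  · have h2 := hasFDerivAt_re (hG (toC x) (mem_univ _)).differentiableAt.hasDerivAt
    have e : (fun x => (G (toC x)).re) = H := by
      ext y
      have := congrFun hGH (toC y)
      simpa using this
    rwa [e] at h2
  · exact (hG.deriv z (mem_univ _)).differentiableAt.hasDerivAt
  · exact continuousOn_univ.1 hG.deriv.deriv.continuousOn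

/-! ### The boundary of a planar domain as a curve in the complex plane -/

/-- The boundary curve in the complex plane. -/
def curveC (γ : ℝ → Plane) (s : ℝ) : ℂ := toC (γ s)

namespace IsC2Domain

variable {D : Set Plane} {γ : ℝ → Plane} {L : ℝ}

theorem hasDerivAt (hD : IsC2Domain D γ L) (s : ℝ) : HasDerivAt γ (deriv γ s) s :=
  (hD.contDiff.differentiable (by norm_num) s).hasDerivAt

theorem hasDerivAt_deriv (hD : IsC2Domain D γ L) (s : ℝ) :
    HasDerivAt (deriv γ) (deriv (deriv γ) s) s :=
  ((((contDiff_succ_iff_deriv (n := 1)).1 hD.contDiff).2.2.differentiable (by norm_num)) s).hasDerivAt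

theorem deriv_curveC (hD : IsC2Domain D γ L) : deriv (curveC γ) = fun s => toC (deriv γ s) :=
  funext fun s => ((toC : Plane →L[ℝ] ℂ).hasFDerivAt.comp_hasDerivAt s (hD.hasDerivAt s)).deriv

theorem deriv₂_curveC (hD : IsC2Domain D γ L) :
    deriv (deriv (curveC γ)) = fun s => toC (deriv (deriv γ) s) := by
  rw [hD.deriv_curveC]
  exact funext fun s =>
    ((toC : Plane →L[ℝ] ℂ).hasFDerivAt.comp_hasDerivAt s (hD.hasDerivAt_deriv s)).deriv

theorem isArcCurve (hD : IsC2Domain D γ L) : IsArcCurve (curveC γ) L where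
  length_pos := hD.length_pos
  contDiff := toC.contDiff.comp hD.contDiff
  periodic := fun s => by simp only [curveC, hD.periodic s]
  unit_speed := fun s => by rw [hD.deriv_curveC]; simp [hD.unit_speed]
  injOn := fun s hs t ht h => hD.injOn hs ht (toC.injective h)

theorem toC_tangent (hD : IsC2Domain D γ L) (s : ℝ) : toC (tangent γ s) = deriv (curveC γ) s := by
  rw [hD.deriv_curveC]; rfl

theorem toC_normal (hD : IsC2Domain D γ L) (s : ℝ) :
    toC (normal γ s) = -Complex.I * deriv (curveC γ) s := by
  rw [hD.deriv_curveC]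
  simp only [toC_apply, normal]
  apply Complex.ext <;> simp

theorem curvature_eq (hD : IsC2Domain D γ L) (s : ℝ) : curvature γ s = curvC (curveC γ) s := by
  rw [curvature, inner_eq_re, hD.toC_normal, curvC, hD.deriv₂_curveC]

theorem toC_parallel (hD : IsC2Domain D γ L) (s ε : ℝ) :
    toC (γ s + ε • normal γ s) = parallel (curveC γ) ε s := by
  rw [map_add, map_smul, hD.toC_normal, parallel, curveC, Complex.real_smul]
  ring

theorem norm_sub (γ : ℝ → Plane) (s t : ℝ) : ‖curveC γ s - curveC γ t‖ = ‖γ s - γ t‖ := by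
  rw [curveC, curveC, ← map_sub, toC.norm_map]

theorem range_subset_closure (hD : IsC2Domain D γ L) : range γ ⊆ closure D := by
  rw [← hD.frontier_eq]; exact frontier_subset_closure

theorem toC_notMem (hD : IsC2Domain D γ L) {x : Plane} (hx : x ∈ (closure D)ᶜ) :
    toC x ∉ range (curveC γ) := by
  rintro ⟨s, hs⟩
  exact hx (hD.range_subset_closure ⟨s, toC.injective hs⟩)

theorem isOpen_exterior (D : Set Plane) : IsOpen (closure D)ᶜ := isClosed_closure.isOpen_compl

/-- The parallel curves lie in the exterior. -/
theorem parallel_mem (hD : IsC2Domain D γ L) {ε : ℝ} (hε : 0 < ε) (hε' : ε ≤ hD.isArcCurve.width)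
    (s : ℝ) : γ s + ε • normal γ s ∈ (closure D)ᶜ := by
  have hc := hD.isArcCurve
  set P : Set Plane := (fun t : ℝ => γ s + t • normal γ s) '' Ioc 0 hD.isArcCurve.width with hP
  have h1 : IsPreconnected P := isPreconnected_Ioc.image _ (by fun_prop)
  have h2 : P ⊆ (closure D)ᶜ ∪ D := by
    rintro _ ⟨t, ht, rfl⟩
    by_contra h
    rw [mem_union, not_or, notMem_compl_iff] at h
    have h3 : γ s + t • normal γ s ∈ frontier D := by
      rw [hD.isOpen.frontier_eq]; exact h
    rw [hD.frontier_eq] at h3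
    obtain ⟨r, hr⟩ := h3
    refine hc.parallel_notMem ht.1 ht.2 s ⟨r, ?_⟩
    rw [← hD.toC_parallel, ← hr, curveC]
  have h3 : (P ∩ (closure D)ᶜ).Nonempty := by
    have hw : ∀ᶠ t in 𝓝[>] (0 : ℝ), t ∈ Ioc 0 hc.width := Ioc_mem_nhdsGT hc.width_pos
    obtain ⟨t, ht, ht'⟩ := ((hD.outer_side s).and hw).exists
    exact ⟨_, ⟨t, ht', rfl⟩, ht⟩
  have hdisj : Disjoint (closure D)ᶜ D :=
    disjoint_compl_left_iff_subset.2 subset_closure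
  exact h1.subset_left_of_subset_union (isOpen_exterior D) hD.isOpen hdisj h2 h3
    ⟨ε, ⟨hε, hε'⟩, rfl⟩

end IsC2Domain

/-! ### Layer potentials as Cauchy transforms -/

theorem hasFDerivAt_green {x y : Plane} (h : x ≠ y) : HasFDerivAt (fun x => green x y)
    (gradForm (((1 / (2 * Real.pi) : ℝ) : ℂ) * (toC x - toC y)⁻¹)) x := by
  refine ((hasFDerivAt_log_norm h).const_mul (1 / (2 * Real.pi))).congr_fderiv ?_
  rw [← map_smul, Complex.real_smul]

theorem npKernel_eq {D : Set Plane} {γ : ℝ → Plane} {L : ℝ} (hD : IsC2Domain D γ L) {s t : ℝ}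
    (h : γ s ≠ γ t) : npKernel γ s t = 1 / (2 * Real.pi) * normalKer (curveC γ) s t := by
  rw [npKernel, dirDeriv, (hasFDerivAt_green h).fderiv, gradForm_apply, hD.toC_normal, normalKer,
    mul_assoc, Complex.re_ofReal_mul, curveC, curveC, mul_comm (_ - _)⁻¹]

namespace IsC2Domain

variable {D : Set Plane} {γ : ℝ → Plane} {L : ℝ}

/-- The gradient of a single layer potential, as a covector, is a Cauchy transform of its density. -/
theorem hasFDerivAt_singleLayer (hD : IsC2Domain D γ L) {ϑ : ℝ → ℝ}
    (hϑ : Integrable ϑ (arcMeasure L)) {x : Plane} (hx : x ∈ (closure D)ᶜ) :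
    HasFDerivAt (singleLayer γ L ϑ) (gradForm (((1 / (2 * Real.pi) : ℝ) : ℂ) *
      cauchyTr (curveC γ) L (fun t => (ϑ t : ℂ)) (toC x))) x := by
  have hc := hD.isArcCurve
  have hpi := Real.pi_pos
  obtain ⟨d, hd, hd'⟩ := hc.exists_dist_lower (hD.toC_notMem hx)
  have hγm := hD.contDiff.continuous.measurable
  have hcm := hc.continuous.measurable
  have hlow : ∀ y ∈ Metric.ball x d, ∀ t, d ≤ ‖y - γ t‖ := by
    intro y hy t
    have := hd' (toC y) (by rw [Metric.mem_ball, toC.dist_map]; exact hy) t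
    rwa [curveC, ← map_sub, toC.norm_map] at this
  have hne : ∀ y ∈ Metric.ball x d, ∀ t, y ≠ γ t := fun y hy t h => by
    have := hlow y hy t
    rw [h, sub_self, norm_zero] at this
    linarith
  have hiC : Integrable (fun t => (ϑ t : ℂ)) (arcMeasure L) := hϑ.ofReal
  have hgm : ∀ y, Measurable fun t => green y (γ t) := fun y => by unfold green; fun_prop
  have hgb : ∃ C, ∀ t, ‖green x (γ t)‖ ≤ C := by
    have hcont : ContinuousOn (fun t => green x (γ t)) univ := by
      unfold green
      have := hD.contDiff.continuous
      refine Continuous.continuousOn (continuous_const.mul (Continuous.log (by fun_prop) ?_))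
      intro t
      exact norm_ne_zero_iff.2 (sub_ne_zero.2 (hne x (Metric.mem_ball_self hd) t))
    have hp : Function.Periodic (fun t => green x (γ t)) L := fun t => by
      simp only [hD.periodic t]
    obtain ⟨M, -, hM⟩ := hp.exists_bound hD.length_pos (continuousOn_univ.1 hcont)
    exact ⟨M, hM⟩
  obtain ⟨C, hC⟩ := hgb
  have key := hasFDerivAt_integral_of_dominated_of_fderiv_le (μ := arcMeasure L)
    (F := fun y t => green y (γ t) * ϑ t)
    (F' := fun y t => gradForm (((1 / (2 * Real.pi) : ℝ) : ℂ) *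
      ((toC y - curveC γ t)⁻¹ * (ϑ t : ℂ))))
    (x₀ := x) (s := Metric.ball x d) (bound := fun t => ‖gradForm‖ *
      (1 / (2 * Real.pi) * (d⁻¹ * ‖ϑ t‖)))
    (Metric.ball_mem_nhds x hd) ?_ ?_ ?_ ?_ ((((hϑ.norm.const_mul _).const_mul _).const_mul _)) ?_
  · refine key.congr_fderiv ?_
    have hint := hc.integrable_inv_mul hiC (hD.toC_notMem hx)
    rw [gradForm.integral_comp_comm (hint.const_mul _), integral_const_mul]
    rfl
  · exact Eventually.of_forall fun y => (hgm y).aestronglyMeasurable.mul hϑ.1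
  · exact hϑ.bdd_mul (hgm x).aestronglyMeasurable (Eventually.of_forall hC)
  · exact gradForm.continuous.comp_aestronglyMeasurable
      (((Measurable.aestronglyMeasurable (by fun_prop)).mul hiC.1).const_mul _)
  · refine Eventually.of_forall fun t y hy => ?_
    refine (gradForm.le_opNorm _).trans ?_
    rw [norm_mul, norm_mul, norm_inv, Complex.norm_real, Complex.norm_real,
      Real.norm_of_nonneg (by positivity : (0 : ℝ) ≤ 1 / (2 * Real.pi)), curveC, ← map_sub,
      toC.norm_map]
    have := hlow y hy t
    gcongr
  · refine Eventually.of_forall fun t y hy => ?_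
    refine ((hasFDerivAt_green (hne y hy t)).mul_const (ϑ t)).congr_fderiv ?_
    rw [← map_smul, Complex.real_smul, curveC]
    congr 1; ring

theorem integrable_normal_mul (hD : IsC2Domain D γ L) {ϑ : ℝ → ℝ}
    (hϑ : Integrable ϑ (arcMeasure L)) :
    Integrable (fun t => -Complex.I * deriv (curveC γ) t * (ϑ t : ℂ)) (arcMeasure L) := by
  have hcd := hD.isArcCurve.continuous_deriv
  have hiC : Integrable (fun t => (ϑ t : ℂ)) (arcMeasure L) := hϑ.ofReal
  have := integrable_mul_continuous hiC (g := fun t => -Complex.I * deriv (curveC γ) t)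
    (by fun_prop)
  simpa only [mul_comm] using this

/-- The double-layer potential is the real part of a Cauchy transform. -/
theorem doubleLayer_eq (hD : IsC2Domain D γ L) {ϑ : ℝ → ℝ}
    (hϑ : Integrable ϑ (arcMeasure L)) {x : Plane} (hx : x ∈ (closure D)ᶜ) :
    doubleLayer γ L ϑ x = (((-(1 / (2 * Real.pi)) : ℝ) : ℂ) * cauchyTr (curveC γ) L
      (fun t => -Complex.I * deriv (curveC γ) t * (ϑ t : ℂ)) (toC x)).re := by
  have hc := hD.isArcCurve
  have hi2 := hD.integrable_normal_mul hϑ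
  have hint := hc.integrable_inv_mul hi2 (hD.toC_notMem hx)
  rw [Complex.re_ofReal_mul, cauchyTr, ← RCLike.re_to_complex, ← integral_re hint,
    ← integral_const_mul]
  unfold doubleLayer
  congr 1; ext t
  have hne : γ t ≠ x := fun h => hx (hD.range_subset_closure ⟨t, h⟩)
  have e : (fun y => green x y) = fun y => green y x := by
    ext y; rw [green, green, norm_sub_rev]
  rw [e, dirDeriv, (hasFDerivAt_green hne).fderiv, gradForm_apply, hD.toC_normal, mul_assoc,
    Complex.re_ofReal_mul, RCLike.re_to_complex, ← mul_assoc (toC x - curveC γ t)⁻¹,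
    Complex.re_mul_ofReal, ← neg_sub (toC x), inv_neg, neg_mul, Complex.neg_re, curveC]
  ring

theorem hasFDerivAt_doubleLayer (hD : IsC2Domain D γ L) {ϑ : ℝ → ℝ}
    (hϑ : Integrable ϑ (arcMeasure L)) {x : Plane} (hx : x ∈ (closure D)ᶜ) :
    HasFDerivAt (doubleLayer γ L ϑ) (gradForm (((1 / (2 * Real.pi) : ℝ) : ℂ) *
      cauchyTr₂ (curveC γ) L (fun t => -Complex.I * deriv (curveC γ) t * (ϑ t : ℂ)) (toC x))) x := by
  have hc := hD.isArcCurve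
  have hi2 := hD.integrable_normal_mul hϑ
  have h1 := hasFDerivAt_re ((hc.hasDerivAt_cauchyTr hi2 (hD.toC_notMem hx)).const_mul
    (((-(1 / (2 * Real.pi)) : ℝ) : ℂ)))
  have h2 : doubleLayer γ L ϑ =ᶠ[𝓝 x] fun x => (((-(1 / (2 * Real.pi)) : ℝ) : ℂ) *
      cauchyTr (curveC γ) L (fun t => -Complex.I * deriv (curveC γ) t * (ϑ t : ℂ)) (toC x)).re := by
    filter_upwards [(isOpen_exterior D).mem_nhds hx] with y hy using hD.doubleLayer_eq hϑ hy
  refine (h1.congr_of_eventuallyEq h2).congr_fderiv ?_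
  congr 1
  push_cast; ring

/-! ### Decay of layer potentials -/

theorem exists_norm_bound (hD : IsC2Domain D γ L) :
    ∃ M : ℝ, 0 < M ∧ ∀ x : Plane, 2 * M ≤ ‖x‖ → ∀ t, ‖γ t‖ ≤ M ∧ ‖x‖ / 2 ≤ ‖x - γ t‖ := by
  obtain ⟨M, hM0, hM⟩ := hD.periodic.exists_bound hD.length_pos hD.contDiff.continuous
  refine ⟨M, hM0, fun x hx t => ⟨hM t, ?_⟩⟩
  have := norm_sub_norm_le x (γ t)
  linarith [hM t]

theorem eventually_norm_ge (M : ℝ) : ∀ᶠ x in Bornology.cobounded Plane, M ≤ ‖x‖ :=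
  tendsto_norm_cobounded_atTop.eventually (eventually_ge_atTop M)

theorem eventually_exterior (hD : IsC2Domain D γ L) :
    ∀ᶠ x in Bornology.cobounded Plane, x ∈ (closure D)ᶜ :=
  Bornology.isBounded_def.1 hD.isBounded.closure

theorem norm_cauchyTr_le (hD : IsC2Domain D γ L) {h : ℝ → ℂ} (hh : Integrable h (arcMeasure L)) :
    ∃ M C : ℝ, ∀ x : Plane, M ≤ ‖x‖ → ‖cauchyTr (curveC γ) L h (toC x)‖ ≤ C * ‖x‖⁻¹ := by
  obtain ⟨M, hM0, hM⟩ := hD.exists_norm_bound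
  refine ⟨2 * M, 2 * ∫ t, ‖h t‖ ∂(arcMeasure L), fun x hx => ?_⟩
  have hx0 : 0 < ‖x‖ := by linarith
  have e : 2 * (∫ t, ‖h t‖ ∂(arcMeasure L)) * ‖x‖⁻¹ =
      ∫ t, 2 * ‖x‖⁻¹ * ‖h t‖ ∂(arcMeasure L) := by rw [integral_const_mul]; ring
  rw [e]
  refine norm_integral_le_of_norm_le (hh.norm.const_mul _) (Eventually.of_forall fun t => ?_)
  rw [norm_mul, norm_inv, curveC, ← map_sub, toC.norm_map]
  have := (hM x hx t).2
  have h2 : ‖x - γ t‖⁻¹ ≤ (‖x‖ / 2)⁻¹ := inv_anti₀ (by positivity) this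
  rw [inv_div, div_eq_mul_inv] at h2
  gcongr

/-- The kernel of the double layer potential is a derivative of the fundamental solution, so no
condition on the total charge is needed for decay. -/
theorem doubleLayer_isBigO (hD : IsC2Domain D γ L) {ϑ : ℝ → ℝ}
    (hϑ : Integrable ϑ (arcMeasure L)) :
    doubleLayer γ L ϑ =O[Bornology.cobounded Plane] fun x => ‖x‖⁻¹ := by
  have hi2 := hD.integrable_normal_mul hϑ
  obtain ⟨M, C, hC⟩ := hD.norm_cauchyTr_le hi2
  refine IsBigO.of_bound (‖((-(1 / (2 * Real.pi)) : ℝ) : ℂ)‖ * C) ?_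
  filter_upwards [eventually_norm_ge M, hD.eventually_exterior] with x hx hx'
  rw [hD.doubleLayer_eq hϑ hx', norm_inv, norm_norm, mul_assoc]
  refine (Complex.abs_re_le_norm _).trans ?_
  rw [norm_mul]
  gcongr
  exact hC x hx

/-- The single-layer potential of a density with integral zero decays. -/
theorem singleLayer_isBigO (hD : IsC2Domain D γ L) {ϑ : ℝ → ℝ}
    (hϑ : Integrable ϑ (arcMeasure L)) (h0 : ∫ t, ϑ t ∂(arcMeasure L) = 0) :
    singleLayer γ L ϑ =O[Bornology.cobounded Plane] fun x => ‖x‖⁻¹ := by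
  obtain ⟨M, hM0, hM⟩ := hD.exists_norm_bound
  have hpi := Real.pi_pos
  have hγm := hD.contDiff.continuous.measurable
  refine IsBigO.of_bound (1 / (2 * Real.pi) * (2 * M) * ∫ t, ‖ϑ t‖ ∂(arcMeasure L)) ?_
  filter_upwards [eventually_norm_ge (2 * M)] with x hx
  have hx0 : 0 < ‖x‖ := by linarith
  have hlog : ∀ t, |green x (γ t) - 1 / (2 * Real.pi) * Real.log ‖x‖| ≤
      1 / (2 * Real.pi) * (2 * M * ‖x‖⁻¹) := by
    intro t
    obtain ⟨h1, h2⟩ := hM x hx t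
    have hr0 : 0 < ‖x - γ t‖ := by linarith
    rw [green, ← mul_sub, abs_mul, abs_of_pos (by positivity : 0 < 1 / (2 * Real.pi))]
    gcongr
    have a1 : ‖x - γ t‖ ≤ ‖x‖ + M := (norm_sub_le _ _).trans (by gcongr)
    have a2 : ‖x‖ ≤ ‖x - γ t‖ + M := by
      have := norm_sub_norm_le x (γ t); linarith
    have b1 : Real.log ‖x - γ t‖ - Real.log ‖x‖ ≤ M * ‖x‖⁻¹ := by
      rw [← Real.log_div hr0.ne' hx0.ne']
      refine (Real.log_le_sub_one_of_pos (by positivity)).trans ?_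
      rw [div_sub_one hx0.ne', div_eq_mul_inv]
      gcongr; linarith
    have b2 : Real.log ‖x‖ - Real.log ‖x - γ t‖ ≤ 2 * M * ‖x‖⁻¹ := by
      rw [← Real.log_div hx0.ne' hr0.ne']
      refine (Real.log_le_sub_one_of_pos (by positivity)).trans ?_
      rw [div_sub_one hr0.ne', ← div_eq_mul_inv, div_le_div_iff₀ hr0 hx0]
      calc _ ≤ M * ‖x‖ := by gcongr; linarith
        _ ≤ M * (2 * ‖x - γ t‖) := by gcongr; linarith
        _ = _ := by ring
    rw [abs_le]
    have : 0 ≤ M * ‖x‖⁻¹ := by positivity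
    constructor <;> linarith
  have e : singleLayer γ L ϑ x =
      ∫ t, (green x (γ t) - 1 / (2 * Real.pi) * Real.log ‖x‖) * ϑ t ∂(arcMeasure L) := by
    have hg : Integrable (fun t => (green x (γ t) - 1 / (2 * Real.pi) * Real.log ‖x‖) * ϑ t)
        (arcMeasure L) := by
      refine hϑ.bdd_mul (Measurable.aestronglyMeasurable ?_) (Eventually.of_forall hlog)
      unfold green; fun_prop
    have h3 := integral_add hg (hϑ.const_mul (1 / (2 * Real.pi) * Real.log ‖x‖))
    rw [integral_const_mul, h0, mul_zero, add_zero] at h3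
    rw [← h3, singleLayer]
    congr 1; ext t; ring
  rw [e, norm_inv, norm_norm]
  have e2 : 1 / (2 * Real.pi) * (2 * M) * (∫ t, ‖ϑ t‖ ∂(arcMeasure L)) * ‖x‖⁻¹ =
      ∫ t, 1 / (2 * Real.pi) * (2 * M * ‖x‖⁻¹) * ‖ϑ t‖ ∂(arcMeasure L) := by
    rw [integral_const_mul]; ring
  rw [e2]
  refine norm_integral_le_of_norm_le (hϑ.norm.const_mul _) (Eventually.of_forall fun t => ?_)
  rw [norm_mul]
  gcongr
  exact hlog t

/-! ### Flux through the boundary -/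

/-- The Cauchy integral of the constant function vanishes in the exterior. -/
theorem cauchyTr_deriv_eq_zero (hD : IsC2Domain D γ L) {x : Plane} (hx : x ∈ (closure D)ᶜ) :
    cauchyTr (curveC γ) L (deriv (curveC γ)) (toC x) = 0 := by
  have hc := hD.isArcCurve
  have hi : Integrable (deriv (curveC γ)) (arcMeasure L) := integrable_of_continuous hc.continuous_deriv
  set S : Set ℂ := toC '' (closure D)ᶜ with hS
  have hSo : IsOpen S := toC.toHomeomorph.isOpenMap _ (isOpen_exterior D)
  have hSc : IsPreconnected S :=
    hD.isConnected_exterior.isPreconnected.image _ toC.continuous.continuousOn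
  have hW : WeakDeriv L (fun _ => 1) (fun _ => 0) :=
    WeakDeriv.of_hasDerivAt hc.length_pos.le (fun t => hasDerivAt_const t 1) continuous_const rfl
  have hder : ∀ z ∈ S, HasDerivAt (cauchyTr (curveC γ) L (deriv (curveC γ))) 0 z := by
    rintro _ ⟨y, hy, rfl⟩
    have hz := hD.toC_notMem hy
    have h1 := hc.hasDerivAt_cauchyTr hi hz
    have h2 := hc.cauchyTr₂_weak hW (integrable_const _) (integrable_const _)
      (n := fun _ => 1) (n' := fun _ => 0) (fun t => hasDerivAt_const t 1) continuous_const rfl hz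
    have e : (fun t => (1 : ℂ) * deriv (curveC γ) t * ((1 : ℝ) : ℂ)) = deriv (curveC γ) := by
      ext t; simp
    rw [e] at h2
    have e2 : cauchyTr (curveC γ) L (fun _ => (1 : ℂ) * ((0 : ℝ) : ℂ) + 0 * ((1 : ℝ) : ℂ))
        (toC y) = 0 := by simp [cauchyTr]
    rw [e2, neg_zero] at h2
    rwa [h2, neg_zero] at h1
  have hconst : ∀ y ∈ (closure D)ᶜ, cauchyTr (curveC γ) L (deriv (curveC γ)) (toC x) =
      cauchyTr (curveC γ) L (deriv (curveC γ)) (toC y) := fun y hy =>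
    hSo.is_const_of_deriv_eq_zero hSc
      (fun z hz => (hder z hz).differentiableAt.differentiableWithinAt)
      (fun z hz => (hder z hz).deriv) (mem_image_of_mem _ hx) (mem_image_of_mem _ hy)
  obtain ⟨M, C, hC⟩ := hD.norm_cauchyTr_le hi
  have hlim : Tendsto (fun y : Plane => C * ‖y‖⁻¹) (Bornology.cobounded Plane) (𝓝 0) := by
    have := (tendsto_inv_atTop_zero.comp (tendsto_norm_cobounded_atTop (E := Plane))).const_mul C
    simpa using this
  have hle : ‖cauchyTr (curveC γ) L (deriv (curveC γ)) (toC x)‖ ≤ 0 := by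
    refine ge_of_tendsto hlim ?_
    filter_upwards [eventually_norm_ge M, hD.eventually_exterior] with y hy hy'
    rw [hconst y hy']
    exact hC y hy
  exact norm_le_zero_iff.1 hle

/-- The solid angle: the normal derivative of the logarithm has flux `π` through the curve,
as seen from a boundary point. -/
theorem integral_normalKer_left (hD : IsC2Domain D γ L) :
    ∀ᵐ t ∂(arcMeasure L), ∫ s, normalKer (curveC γ) s t ∂(arcMeasure L) = Real.pi := by
  have hc := hD.isArcCurve
  obtain ⟨K, hK⟩ := hc.isUnitSymbol_right
  have h1 := hc.traceLim_weighted hK (h := fun _ => 1) (memLp_const _)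
  have h2 : TraceLim (arcMeasure L) (fun _ _ => (0 : ℝ)) (fun s => Real.pi * 1 +
      ∫ t, weightedKer (curveC γ) (fun s t => (deriv (curveC γ) s)⁻¹ * deriv (curveC γ) t) s t * 1
        ∂(arcMeasure L)) := by
    refine h1.congr_of_forall hc.width_pos (S := univ) (Eventually.of_forall mem_univ)
      (fun ε hε hε' s _ => ?_) (ae_of_all _ fun _ => rfl)
    have h3 := hD.cauchyTr_deriv_eq_zero (hD.parallel_mem hε hε'.le s)
    rw [hD.toC_parallel, cauchyTr] at h3
    have e : ∫ t, (parallel (curveC γ) ε s - curveC γ t)⁻¹ *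
        ((deriv (curveC γ) s)⁻¹ * deriv (curveC γ) t) * ((1 : ℝ) : ℂ) ∂(arcMeasure L) =
        (deriv (curveC γ) s)⁻¹ * ∫ t, (parallel (curveC γ) ε s - curveC γ t)⁻¹ *
          deriv (curveC γ) t ∂(arcMeasure L) := by
      rw [← integral_const_mul]
      congr 1; ext t; push_cast; ring
    rw [e, h3]; simp
  filter_upwards [h2.ae_tendsto] with s hs
  have h4 := tendsto_nhds_unique hs tendsto_const_nhds
  have e : (fun t => weightedKer (curveC γ)
      (fun s t => (deriv (curveC γ) s)⁻¹ * deriv (curveC γ) t) s t * 1) =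
      fun t => -normalKer (curveC γ) t s := by
    ext t
    rw [mul_one, weightedKer, normalKer, ← Complex.neg_re]
    congr 1
    rw [← neg_sub (curveC γ t), inv_neg, mul_assoc (-Complex.I), mul_inv_cancel_left₀
      (hc.deriv_ne_zero s)]
    ring
  rw [e, integral_neg] at h4
  linarith

/-- Integrating the jump relation for the normal derivative over the curve. -/
theorem integral_jump (hD : IsC2Domain D γ L) {φ : ℝ → ℝ} (hφ : Integrable φ (arcMeasure L)) :
    ∫ s, (Real.pi * φ s + ∫ t, normalKer (curveC γ) s t * φ t ∂(arcMeasure L)) ∂(arcMeasure L) =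
      2 * Real.pi * ∫ s, φ s ∂(arcMeasure L) := by
  have hc := hD.isArcCurve
  obtain ⟨C, hC⟩ := hc.exists_normalKer_bound
  have hint : Integrable (Function.uncurry fun s t => normalKer (curveC γ) s t * φ t)
      ((arcMeasure L).prod (arcMeasure L)) :=
    (hφ.comp_snd (arcMeasure L)).bdd_mul hc.measurable_normalKer.aestronglyMeasurable
      (ae_of_all _ fun p => hC p.1 p.2)
  have h1 : Integrable (fun s => ∫ t, normalKer (curveC γ) s t * φ t ∂(arcMeasure L))
      (arcMeasure L) := hint.integral_prod_left
  rw [integral_add (hφ.const_mul _) h1, integral_const_mul, integral_integral_swap hint]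
  have h2 : ∫ t, ∫ s, normalKer (curveC γ) s t * φ t ∂(arcMeasure L) ∂(arcMeasure L) =
      ∫ t, Real.pi * φ t ∂(arcMeasure L) := by
    refine integral_congr_ae ?_
    filter_upwards [hD.integral_normalKer_left] with t ht
    rw [integral_mul_const, ht]
  rw [h2, integral_const_mul]
  ring

/-! ### The Neumann-Poincaré operator -/

/-- The principal value of an integrable kernel is the integral. -/
theorem tendsto_truncated (hD : IsC2Domain D γ L) {s : ℝ} (hs : s ∈ Ioc 0 L) {g : ℝ → ℝ}
    (hg : Integrable g (arcMeasure L)) :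
    Tendsto (fun ε : ℝ => ∫ t in {t | ε < ‖γ s - γ t‖}, g t ∂(arcMeasure L)) (𝓝[>] 0)
      (𝓝 (∫ t, g t ∂(arcMeasure L))) := by
  have hγc := hD.contDiff.continuous
  have hms : ∀ ε : ℝ, MeasurableSet {t | ε < ‖γ s - γ t‖} := fun ε =>
    (isOpen_lt continuous_const (by fun_prop)).measurableSet
  simp only [← integral_indicator (hms _)]
  refine tendsto_integral_filter_of_dominated_convergence (fun t => ‖g t‖)
    (Eventually.of_forall fun ε => hg.1.indicator (hms ε))
    (Eventually.of_forall fun ε => ae_of_all _ fun t => norm_indicator_le_norm_self _ _) hg.norm ?_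
  filter_upwards [ae_mem_Ioc L, IsArcCurve.ae_ne L s] with t ht hts
  have h0 := norm_pos_iff.2 (hD.isArcCurve.sub_ne hs ht hts)
  rw [norm_sub] at h0
  refine tendsto_const_nhds.congr' ?_
  have : ∀ᶠ ε in 𝓝[>] (0 : ℝ), ε < ‖γ s - γ t‖ := nhdsWithin_le_nhds (gt_mem_nhds h0)
  filter_upwards [this] with ε hε
  exact (indicator_of_mem (s := {t | ε < ‖γ s - γ t‖}) hε g).symm

/-- The Neumann-Poincaré kernel being bounded, its principal value is an ordinary integral. -/
theorem eq_of_hasPV_npKernel (hD : IsC2Domain D γ L) {φ : ℝ → ℝ} (hφ : Integrable φ (arcMeasure L))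
    {s k : ℝ} (hs : s ∈ Ioc 0 L) (h : HasPV γ L (npKernel γ) φ s k) :
    k = 1 / (2 * Real.pi) * ∫ t, normalKer (curveC γ) s t * φ t ∂(arcMeasure L) := by
  have h1 := (hD.tendsto_truncated hs (hD.isArcCurve.integrable_normalKer_mul hφ s)).const_mul
    (1 / (2 * Real.pi))
  refine tendsto_nhds_unique h (h1.congr' ?_)
  filter_upwards [self_mem_nhdsWithin] with ε hε
  have hγc := hD.contDiff.continuous
  rw [← integral_const_mul]
  refine setIntegral_congr_fun (isOpen_lt continuous_const (by fun_prop)).measurableSet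
    fun t ht => ?_
  have hε' : (0 : ℝ) < ε := hε
  have hne : γ s ≠ γ t := fun h => by
    have h2 : ε < ‖γ s - γ t‖ := ht
    rw [h, sub_self, norm_zero] at h2
    linarith
  simp only [npKernel_eq hD hne]
  ring

end IsC2Domain

/-! ### Principal values of kernels with a cancelling singularity -/

theorem norm_ofReal_sub_I_sq (x : ℝ) : ‖((x : ℂ) - Complex.I) ^ 2‖ = 1 + x ^ 2 := by
  rw [norm_pow, ← Complex.normSq_eq_norm_sq, Complex.normSq_apply]
  simp; ring

theorem ofReal_sub_I_ne_zero (x : ℝ) : (x : ℂ) - Complex.I ≠ 0 := by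
  intro h
  have := congrArg Complex.im h
  simp at this

/-- The integral that makes the displaced kernel `(z - c)⁻²` carry no mass in the limit. -/
theorem integral_inv_sub_I_sq : ∫ x : ℝ, (((x : ℂ) - Complex.I) ^ 2)⁻¹ = 0 := by
  have hd : ∀ x : ℝ, HasDerivAt (fun x : ℝ => -((x : ℂ) - Complex.I)⁻¹)
      (((x : ℂ) - Complex.I) ^ 2)⁻¹ x := by
    intro x
    have h1 : HasDerivAt (fun x : ℝ => (x : ℂ) - Complex.I) 1 x :=
      Complex.ofRealCLM.hasDerivAt.sub_const _
    refine (h1.fun_inv (ofReal_sub_I_ne_zero x)).neg.congr_deriv ?_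
    rw [neg_div, neg_neg, one_div]
  have hi : Integrable fun x : ℝ => (((x : ℂ) - Complex.I) ^ 2)⁻¹ := by
    refine integrable_inv_one_add_sq.mono' ?_ (ae_of_all _ fun x => ?_)
    · exact Measurable.aestronglyMeasurable (by fun_prop)
    · rw [norm_inv, norm_ofReal_sub_I_sq]
  have hn : ∀ x : ℝ, |x| ≤ ‖(x : ℂ) - Complex.I‖ := fun x => by
    have := Complex.abs_re_le_norm ((x : ℂ) - Complex.I)
    simpa using this
  have hlim : ∀ l : Filter ℝ, Tendsto (fun x : ℝ => |x|) l atTop →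
      Tendsto (fun x : ℝ => -((x : ℂ) - Complex.I)⁻¹) l (𝓝 0) := by
    intro l hl
    have h1 : Tendsto (fun x : ℝ => ‖(x : ℂ) - Complex.I‖) l atTop := tendsto_atTop_mono hn hl
    have h2 := (tendsto_inv₀_cobounded.comp (tendsto_norm_atTop_iff_cobounded.1 h1)).neg
    simpa using h2
  rw [integral_of_hasDerivAt_of_tendsto hd hi (hlim _ tendsto_abs_atBot_atTop)
    (hlim _ tendsto_abs_atTop_atTop), sub_zero]

/-- The difference between the kernel `a / z² + b / z` with the singularity displaced off the
curve, and its truncation on the curve. -/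
def truncDiff (c : ℝ → ℂ) (a b : ℝ → ℂ) (s ε t : ℝ) : ℂ :=
  (a t * ((parallel c ε s - c t) ^ 2)⁻¹ + b t * (parallel c ε s - c t)⁻¹) -
    {t | ε < ‖c s - c t‖}.indicator (fun t => a t * ((c s - c t) ^ 2)⁻¹ + b t * (c s - c t)⁻¹) t

namespace IsArcCurve

variable {c : ℝ → ℂ} {L : ℝ}

theorem norm_sub_le_abs (hc : IsArcCurve c L) (s t : ℝ) : ‖c s - c t‖ ≤ |s - t| := by
  have h := Convex.norm_image_sub_le_of_norm_hasDerivWithin_le (f := c) (f' := deriv c) (C := 1)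
    (s := univ) (x := t) (y := s) (fun x _ => (hc.hasDerivAt x).hasDerivWithinAt)
    (fun x _ => (hc.unit_speed x).le) convex_univ (mem_univ _) (mem_univ _)
  simpa using h

/-- For `s` interior to the period, a bound from below by `|s - t|` without translating `t` by
periods. -/
theorem exists_lower_at (hc : IsArcCurve c L) {s : ℝ} (hs : s ∈ Ioo 0 L) :
    ∃ k : ℝ, 0 < k ∧ ∀ t ∈ Ioc 0 L, ∀ ε, 0 ≤ ε → ε ≤ hc.width →
      k * (|s - t| + ε) ≤ ‖parallel c ε s - c t‖ := by
  obtain ⟨m, hm0, hm1, hm⟩ := exists_period_shift hs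
  have hl := hc.lowerConst_pos
  refine ⟨hc.lowerConst * m, by positivity, fun t ht ε hε hε' => ?_⟩
  obtain ⟨k, hk, hk'⟩ := hm t ht
  refine le_trans ?_ (hc.parallel_sub_lower hk hε hε')
  rw [mul_assoc]
  gcongr
  nlinarith

theorem norm_parallel_sub (hc : IsArcCurve c L) {ε : ℝ} (hε : 0 ≤ ε) (s : ℝ) :
    ‖parallel c ε s - c s‖ = ε := by
  have : parallel c ε s - c s = -(ε * Complex.I * deriv c s) := by rw [parallel]; ring
  rw [this, norm_neg, norm_mul, norm_mul, hc.unit_speed, Complex.norm_I, Complex.norm_real,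
    Real.norm_of_nonneg hε]
  ring

/-- The difference is dominated by the Poisson kernel. -/
theorem exists_truncDiff_bound (hc : IsArcCurve c L) {a b : ℝ → ℂ} {s A : ℝ} (hs : s ∈ Ioo 0 L)
    (hA : 0 ≤ A) (ha : ∀ t ∈ Ioc 0 L, ‖a t‖ ≤ A * |s - t|) (hb : ∀ t ∈ Ioc 0 L, ‖b t‖ ≤ A) :
    ∃ C : ℝ, ∀ ε, 0 < ε → ε < hc.width → ∀ t ∈ Ioc 0 L,
      ‖truncDiff c a b s ε t‖ ≤ C * (ε / (ε ^ 2 + (s - t) ^ 2)) := by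
  obtain ⟨k, hk0, hk⟩ := hc.exists_lower_at hs
  refine ⟨max (6 * A / k ^ 4 + 2 * A / k ^ 2) ((A / k ^ 2 + A / k) * (1 + (k ^ 2)⁻¹)),
    fun ε hε hε' t ht => ?_⟩
  set ρ := |s - t| with hρ
  have hρ0 : 0 ≤ ρ := abs_nonneg _
  have hρ2 : (s - t) ^ 2 = ρ ^ 2 := (sq_abs _).symm
  have hR := hk t ht ε hε.le hε'.le
  have hr := hk t ht 0 le_rfl hc.width_pos.le
  rw [parallel_zero, add_zero] at hr
  set R := parallel c ε s - c t with hRdef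
  set r := c s - c t with hrdef
  have hRpos : 0 < ‖R‖ := lt_of_lt_of_le (by positivity) hR
  have hRr : ‖r - R‖ = ε := by
    have : r - R = -(parallel c ε s - c s) := by rw [hRdef, hrdef]; ring
    rw [this, norm_neg, hc.norm_parallel_sub hε.le]
  have hrle : ‖r‖ ≤ ρ := hc.norm_sub_le_abs s t
  have hat := ha t ht
  have hbt := hb t ht
  rw [hρ2]
  have hden : 0 < ε ^ 2 + ρ ^ 2 := by positivity
  by_cases h : ε < ‖r‖
  -- outside the truncation the two kernels are compared at distance `ε`
  · have hrpos : 0 < ‖r‖ := hε.trans h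
    have hρε : ε < ρ := h.trans_le hrle
    have hρpos : 0 < ρ := hε.trans hρε
    have e : truncDiff c a b s ε t = a t * ((r - R) * (r + R)) * ((R ^ 2)⁻¹ * (r ^ 2)⁻¹) +
        b t * (r - R) * (R⁻¹ * r⁻¹) := by
      have h1 : R ≠ 0 := norm_pos_iff.1 hRpos
      have h2 : r ≠ 0 := norm_pos_iff.1 hrpos
      rw [truncDiff, indicator_of_mem (show t ∈ {t | ε < ‖c s - c t‖} from h), ← hRdef, ← hrdef]
      field_simp
      ring
    have hsum : ‖r + R‖ ≤ 3 * ρ := by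
      have : r + R = 2 * r - (r - R) := by ring
      rw [this]
      refine (norm_sub_le _ _).trans ?_
      rw [hRr, norm_mul, Complex.norm_two]
      linarith
    have hRk : k * ρ ≤ ‖R‖ := le_trans (by nlinarith) hR
    have i1 : ‖R‖⁻¹ ≤ (k * ρ)⁻¹ := inv_anti₀ (by positivity) hRk
    have i2 : ‖r‖⁻¹ ≤ (k * ρ)⁻¹ := inv_anti₀ (by positivity) hr
    rw [e]
    have step : ‖a t * ((r - R) * (r + R)) * ((R ^ 2)⁻¹ * (r ^ 2)⁻¹) +
        b t * (r - R) * (R⁻¹ * r⁻¹)‖ ≤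
        A * ρ * (ε * (3 * ρ)) * (((k * ρ)⁻¹) ^ 2 * ((k * ρ)⁻¹) ^ 2) +
          A * ε * ((k * ρ)⁻¹ * (k * ρ)⁻¹) := by
      refine (norm_add_le _ _).trans ?_
      simp only [norm_mul, norm_inv, norm_pow, hRr, ← inv_pow]
      gcongr
    refine step.trans (le_trans ?_ (mul_le_mul_of_nonneg_right (le_max_left _ _) (by positivity)))
    have e2 : A * ρ * (ε * (3 * ρ)) * (((k * ρ)⁻¹) ^ 2 * ((k * ρ)⁻¹) ^ 2) +
          A * ε * ((k * ρ)⁻¹ * (k * ρ)⁻¹) =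
        (6 * A / k ^ 4 + 2 * A / k ^ 2) * (ε / (2 * ρ ^ 2)) := by
      field_simp
      ring
    rw [e2]
    gcongr
    nlinarith
  -- inside it `|s - t|` is at most of the order of `ε`, and only the displaced kernel is present
  · push Not at h
    have hkρ : k * ρ ≤ ε := hr.trans h
    have e : truncDiff c a b s ε t = a t * (R ^ 2)⁻¹ + b t * R⁻¹ := by
      rw [truncDiff, indicator_of_notMem (show t ∉ {t | ε < ‖c s - c t‖} from not_lt.2 h),
        sub_zero]
    have i1 : ‖R‖⁻¹ ≤ (k * (ρ + ε))⁻¹ := inv_anti₀ (by positivity) hR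
    rw [e]
    have step : ‖a t * (R ^ 2)⁻¹ + b t * R⁻¹‖ ≤
        A * (ρ + ε) * ((k * (ρ + ε))⁻¹) ^ 2 + A * (k * (ρ + ε))⁻¹ := by
      refine (norm_add_le _ _).trans ?_
      simp only [norm_mul, norm_inv, norm_pow, ← inv_pow]
      gcongr
      exact hat.trans (by gcongr; linarith)
    refine step.trans (le_trans ?_ (mul_le_mul_of_nonneg_right (le_max_right _ _) (by positivity)))
    have e2 : A * (ρ + ε) * ((k * (ρ + ε))⁻¹) ^ 2 + A * (k * (ρ + ε))⁻¹ =
        (A / k ^ 2 + A / k) * (1 / (ρ + ε)) := by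
      field_simp
    rw [e2, mul_assoc]
    refine mul_le_mul_of_nonneg_left ?_ (by positivity)
    have e3 : (1 + (k ^ 2)⁻¹) * (ε / (ε ^ 2 + ρ ^ 2)) = (k ^ 2 + 1) * ε / (k ^ 2 * (ε ^ 2 + ρ ^ 2)) := by
      field_simp
    rw [e3, div_le_div_iff₀ (by positivity) (by positivity)]
    have h4 : k ^ 2 * ρ ^ 2 ≤ ε ^ 2 := by
      rw [← mul_pow]; gcongr
    nlinarith [mul_nonneg (by positivity : 0 ≤ (k ^ 2 + 1) * ε) hρ0]

/-- The rescaled difference converges to a multiple of `(x - i)⁻²`: the leading singularities of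
`a / z²` and `b / z` cancel. -/
theorem tendsto_scaled_truncDiff (hc : IsArcCurve c L) {a b : ℝ → ℂ} {s : ℝ}
    (has : a s = 0) (had : HasDerivAt a (b s * deriv c s) s) (hbc : ContinuousAt b s)
    {x : ℝ} (hx : x ≠ 0) :
    Tendsto (fun ε : ℝ => (ε : ℂ) * truncDiff c a b s ε (s - ε * x)) (𝓝[>] 0)
      (𝓝 (-(b s * (deriv c s)⁻¹ * Complex.I) * (((x : ℂ) - Complex.I) ^ 2)⁻¹)) := by
  have hT := hc.deriv_ne_zero s
  have hxC : (x : ℂ) ≠ 0 := by exact_mod_cast hx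
  have hI := ofReal_sub_I_ne_zero x
  -- difference quotients along `t = s - ε x`
  have hquot : ∀ (g : ℝ → ℂ) (g' : ℂ), HasDerivAt g g' s →
      Tendsto (fun ε : ℝ => (g s - g (s - ε * x)) / (ε : ℂ)) (𝓝[>] 0) (𝓝 (x * g')) := by
    intro g g' hg
    have hin : HasDerivAt (fun ε : ℝ => s - ε * x) (-x) 0 := by
      simpa using ((hasDerivAt_id (0 : ℝ)).mul_const x).const_sub s
    have hg0 : HasDerivAt g g' (s - 0 * x) := by simpa using hg
    have h1 := (hg0.scomp 0 hin).tendsto_slope_zero_right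
    have h2 := h1.neg
    have e : -((-x) • g') = x * g' := by rw [neg_smul, neg_neg, Complex.real_smul]
    rw [e] at h2
    refine h2.congr' ?_
    filter_upwards [self_mem_nhdsWithin] with ε hε
    have hε' : (ε : ℂ) ≠ 0 := by exact_mod_cast (ne_of_gt hε)
    simp only [Function.comp_apply, zero_add, zero_mul, sub_zero, Complex.real_smul]
    push_cast
    field_simp
    ring
  have hr := hquot c _ (hc.hasDerivAt s)
  have ha : Tendsto (fun ε : ℝ => a (s - ε * x) / (ε : ℂ)) (𝓝[>] 0)
      (𝓝 (-(x * (b s * deriv c s)))) := by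
    refine (hquot a _ had).neg.congr fun ε => ?_
    rw [has]; ring
  have hb : Tendsto (fun ε : ℝ => b (s - ε * x)) (𝓝[>] 0) (𝓝 (b s)) := by
    have h1 : Tendsto (fun ε : ℝ => s - ε * x) (𝓝[>] 0) (𝓝 s) := by
      have : Continuous fun ε : ℝ => s - ε * x := by fun_prop
      have := this.tendsto 0
      rw [zero_mul, sub_zero] at this
      exact this.mono_left nhdsWithin_le_nhds
    exact hbc.tendsto.comp h1
  have hR : Tendsto (fun ε : ℝ => (parallel c ε s - c (s - ε * x)) / (ε : ℂ)) (𝓝[>] 0)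
      (𝓝 (deriv c s * (x - Complex.I))) := by
    have h1 := hr.sub_const (Complex.I * deriv c s)
    have e : x * deriv c s - Complex.I * deriv c s = deriv c s * (x - Complex.I) := by ring
    rw [e] at h1
    refine h1.congr' ?_
    filter_upwards [self_mem_nhdsWithin] with ε hε
    have hε' : (ε : ℂ) ≠ 0 := by exact_mod_cast (ne_of_gt hε)
    rw [parallel]
    field_simp
    ring
  have hlim1 := (ha.mul ((hR.pow 2).inv₀ (pow_ne_zero 2 (mul_ne_zero hT hI)))).add
    (hb.mul (hR.inv₀ (mul_ne_zero hT hI)))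
  have hlim2 := (ha.mul ((hr.pow 2).inv₀ (pow_ne_zero 2 (mul_ne_zero hxC hT)))).add
    (hb.mul (hr.inv₀ (mul_ne_zero hxC hT)))
  -- the leading singularities on the curve cancel, so the truncated part does not contribute
  have e2 : -(x * (b s * deriv c s)) * ((x * deriv c s) ^ 2)⁻¹ + b s * (x * deriv c s)⁻¹ = 0 := by
    field_simp
    ring
  rw [e2] at hlim2
  have hlim3 : Tendsto (fun ε : ℝ => (ε : ℂ) * {t | ε < ‖c s - c t‖}.indicator
      (fun t => a t * ((c s - c t) ^ 2)⁻¹ + b t * (c s - c t)⁻¹) (s - ε * x)) (𝓝[>] 0) (𝓝 0) := by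
    have hn := hlim2.norm
    rw [norm_zero] at hn
    refine squeeze_zero_norm' ?_ hn
    filter_upwards [self_mem_nhdsWithin] with ε hε
    have hε' : (ε : ℂ) ≠ 0 := by exact_mod_cast (ne_of_gt hε)
    rw [norm_mul]
    have h3 := norm_indicator_le_norm_self (s := {t | ε < ‖c s - c t‖})
      (fun t => a t * ((c s - c t) ^ 2)⁻¹ + b t * (c s - c t)⁻¹) (s - ε * x)
    refine (mul_le_mul_of_nonneg_left h3 (norm_nonneg _)).trans (le_of_eq ?_)
    rw [← norm_mul]
    congr 1
    rw [div_pow, inv_div, inv_div]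
    field_simp
  have hfin := hlim1.sub hlim3
  have e3 : -(x * (b s * deriv c s)) * ((deriv c s * (x - Complex.I)) ^ 2)⁻¹ +
      b s * (deriv c s * (x - Complex.I))⁻¹ - 0 =
      -(b s * (deriv c s)⁻¹ * Complex.I) * (((x : ℂ) - Complex.I) ^ 2)⁻¹ := by
    field_simp
    ring
  rw [e3] at hfin
  refine hfin.congr' ?_
  filter_upwards [self_mem_nhdsWithin] with ε hε
  have hε' : (ε : ℂ) ≠ 0 := by exact_mod_cast (ne_of_gt hε)
  rw [truncDiff, mul_sub]
  congr 1
  rw [div_pow, inv_div, inv_div]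
  field_simp

theorem measurable_truncDiff (hc : IsArcCurve c L) {a b : ℝ → ℂ} (ha : Continuous a)
    (hb : Continuous b) (s ε : ℝ) : Measurable (truncDiff c a b s ε) := by
  have h1 := hc.continuous
  have h2 := h1.measurable; have h3 := ha.measurable; have h4 := hb.measurable
  have hm : MeasurableSet {t | ε < ‖c s - c t‖} :=
    (isOpen_lt continuous_const (by fun_prop)).measurableSet
  have h5 : Measurable fun t => a t * ((c s - c t) ^ 2)⁻¹ + b t * (c s - c t)⁻¹ := by fun_prop
  have h6 := h5.indicator hm
  unfold truncDiff
  fun_prop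

/-- The total mass of the difference kernel tends to zero. After the substitution `t = s - ε x` the
integrand converges, with an integrable majorant, to a function of `x` of integral zero. -/
theorem tendsto_integral_truncDiff (hc : IsArcCurve c L) {a b : ℝ → ℂ} {s A : ℝ}
    (hs : s ∈ Ioo 0 L) (hA : 0 ≤ A) (ha : ∀ t ∈ Ioc 0 L, ‖a t‖ ≤ A * |s - t|)
    (hb : ∀ t ∈ Ioc 0 L, ‖b t‖ ≤ A) (hac : Continuous a) (hbc : Continuous b)
    (has : a s = 0) (had : HasDerivAt a (b s * deriv c s) s) :
    Tendsto (fun ε => ∫ t, truncDiff c a b s ε t ∂(arcMeasure L)) (𝓝[>] 0) (𝓝 0) := by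
  obtain ⟨C, hC⟩ := hc.exists_truncDiff_bound hs hA ha hb
  have hw : ∀ᶠ ε in 𝓝[>] (0 : ℝ), ε ∈ Ioo 0 hc.width := Ioo_mem_nhdsGT hc.width_pos
  set G : ℝ → ℝ → ℂ := fun ε x =>
    (ε : ℂ) * (Ioc 0 L).indicator (truncDiff c a b s ε) (s - ε * x) with hG
  have hint : ∀ᶠ ε in 𝓝[>] (0 : ℝ),
      ∫ x, G ε x = ∫ t, truncDiff c a b s ε t ∂(arcMeasure L) := by
    filter_upwards [hw] with ε hε
    rw [hG, integral_const_mul]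
    have h1 := Measure.integral_comp_mul_left
      (fun y => (Ioc 0 L).indicator (truncDiff c a b s ε) (s - y)) ε
    rw [integral_sub_left_eq_self, integral_indicator measurableSet_Ioc] at h1
    rw [h1, abs_of_pos (inv_pos.2 hε.1), Complex.real_smul, Complex.ofReal_inv,
      mul_inv_cancel_left₀ (by exact_mod_cast hε.1.ne')]
    rfl
  have key : Tendsto (fun ε => ∫ x, G ε x) (𝓝[>] 0)
      (𝓝 (∫ x : ℝ, -(b s * (deriv c s)⁻¹ * Complex.I) * (((x : ℂ) - Complex.I) ^ 2)⁻¹)) := by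
    refine tendsto_integral_filter_of_dominated_convergence (fun x => |C| * (1 + x ^ 2)⁻¹)
      (Eventually.of_forall fun ε => ?_) ?_ (integrable_inv_one_add_sq.const_mul _) ?_
    · have h1 := (hc.measurable_truncDiff hac hbc s ε).indicator
        (measurableSet_Ioc (a := (0 : ℝ)) (b := L))
      exact Measurable.aestronglyMeasurable (by fun_prop)
    · filter_upwards [hw] with ε hε
      refine ae_of_all _ fun x => ?_
      rw [hG, norm_mul, Complex.norm_real, Real.norm_of_nonneg hε.1.le]
      have h2 : 0 < 1 + x ^ 2 := by positivity
      by_cases hx : s - ε * x ∈ Ioc 0 L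
      · rw [indicator_of_mem hx]
        have h1 := hC ε hε.1 hε.2 _ hx
        have h3 := hε.1
        have e : ε / (ε ^ 2 + (s - (s - ε * x)) ^ 2) = ε⁻¹ * (1 + x ^ 2)⁻¹ := by
          field_simp
          ring
        rw [e] at h1
        calc _ ≤ ε * (C * (ε⁻¹ * (1 + x ^ 2)⁻¹)) := by gcongr
          _ = C * (1 + x ^ 2)⁻¹ := by field_simp
          _ ≤ _ := by gcongr; exact le_abs_self C
      · rw [indicator_of_notMem hx]
        simp only [norm_zero, mul_zero]
        positivity
    · filter_upwards [Measure.ae_ne volume (0 : ℝ)] with x hx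
      refine (hc.tendsto_scaled_truncDiff has had hbc.continuousAt hx).congr' ?_
      have h1 : Tendsto (fun ε : ℝ => s - ε * x) (𝓝[>] 0) (𝓝 s) := by
        have : Continuous fun ε : ℝ => s - ε * x := by fun_prop
        have := this.tendsto 0
        rw [zero_mul, sub_zero] at this
        exact this.mono_left nhdsWithin_le_nhds
      filter_upwards [h1.eventually (Ioo_mem_nhds hs.1 hs.2)] with ε hε
      rw [hG]
      simp only
      rw [indicator_of_mem (Ioo_subset_Ioc_self hε)]
  rw [integral_const_mul, integral_inv_sub_I_sq, mul_zero] at key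
  exact key.congr' hint

/-- At a Lebesgue point of the density, displacing the singularity off the curve and truncating
it lead to the same limit. -/
theorem tendsto_integral_truncDiff_mul (hc : IsArcCurve c L) {a b : ℝ → ℂ} {s A : ℝ}
    (hs : s ∈ Ioo 0 L) (hA : 0 ≤ A) (ha : ∀ t ∈ Ioc 0 L, ‖a t‖ ≤ A * |s - t|)
    (hb : ∀ t ∈ Ioc 0 L, ‖b t‖ ≤ A) (hac : Continuous a) (hbc : Continuous b)
    (has : a s = 0) (had : HasDerivAt a (b s * deriv c s) s)
    {h : ℝ → ℂ} (hh : Integrable h (arcMeasure L)) (hsh : IsPoissonPoint L h s) :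
    Tendsto (fun ε => ∫ t, truncDiff c a b s ε t * h t ∂(arcMeasure L)) (𝓝[>] 0) (𝓝 0) := by
  obtain ⟨C, hC⟩ := hc.exists_truncDiff_bound hs hA ha hb
  have := hsh.tendsto_integral hh (N := truncDiff c a b s) (C := C) hc.width_pos
    (fun ε _ _ => (hc.measurable_truncDiff hac hbc s ε).aestronglyMeasurable)
    (fun ε hε hε' => (ae_mem_Ioc L).mono fun t ht => hC ε hε hε' t ht)
    (hc.tendsto_integral_truncDiff hs hA ha hb hac hbc has had)
  rwa [zero_mul] at this

end IsArcCurve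

/-! ### The distance to the boundary -/

/-- The exterior domain in the complex plane. -/
def extC (D : Set Plane) : Set ℂ := toC.symm ⁻¹' (closure D)ᶜ

/-- The norm is bounded by the tangent to `√` at `ε ^ 2`. -/
theorem norm_add_smul_le {ε : ℝ} (hε : 0 < ε) {n : ℂ} (hn : ‖n‖ = 1) (h : ℂ) :
    ‖ε * n + h‖ ≤ ε + (h * (starRingEnd ℂ) n).re + ‖h‖ ^ 2 / (2 * ε) := by
  have h1 : ‖ε * n + h‖ ^ 2 = ε ^ 2 + 2 * ε * (h * (starRingEnd ℂ) n).re + ‖h‖ ^ 2 := by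
    rw [← Complex.normSq_eq_norm_sq, Complex.normSq_add, Complex.normSq_mul,
      Complex.normSq_eq_norm_sq n, hn, Complex.normSq_ofReal, Complex.normSq_eq_norm_sq h]
    have : ((ε : ℂ) * n * (starRingEnd ℂ) h).re = ε * (h * (starRingEnd ℂ) n).re := by
      rw [mul_assoc, Complex.re_ofReal_mul]
      congr 1
      simp [Complex.mul_re]; ring
    rw [this]; ring
  have h2 : ε + (h * (starRingEnd ℂ) n).re + ‖h‖ ^ 2 / (2 * ε) = (‖ε * n + h‖ ^ 2 + ε ^ 2) / (2 * ε) := by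
    rw [h1]; field_simp; ring
  rw [h2, le_div_iff₀ (by positivity)]
  nlinarith [sq_nonneg (‖ε * n + h‖ - ε)]

namespace IsC2Domain

variable {D : Set Plane} {γ : ℝ → Plane} {L : ℝ}

theorem isOpen_extC (D : Set Plane) : IsOpen (extC D) :=
  (isOpen_exterior D).preimage toC.symm.continuous

theorem parallel_mem_extC (hD : IsC2Domain D γ L) {ε : ℝ} (hε : 0 < ε)
    (hε' : ε ≤ hD.isArcCurve.width) (s : ℝ) : parallel (curveC γ) ε s ∈ extC D := by
  have := hD.parallel_mem hε hε' s
  rw [extC, mem_preimage, ← hD.toC_parallel, toC.symm_apply_apply]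
  exact this

theorem notMem_range (hD : IsC2Domain D γ L) {z : ℂ} (hz : z ∈ extC D) : z ∉ range (curveC γ) := by
  have := hD.toC_notMem hz
  rwa [toC.apply_symm_apply] at this

/-- The inner normal segment starts inside `D` and does not meet the boundary, so it stays in `D`. -/
theorem inner_parallel_mem (hD : IsC2Domain D γ L) {ε : ℝ} (hε : 0 < ε)
    (hε' : ε ≤ hD.isArcCurve.width) (s : ℝ) : parallel (curveC γ) (-ε) s ∉ extC D := by
  have hc := hD.isArcCurve
  have hnr : ∀ t ∈ Ioc 0 hc.width, parallel (curveC γ) (-t) s ∉ range (curveC γ) := by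
    rintro t ht ⟨r, hr⟩
    obtain ⟨k, hk⟩ := hc.exists_shift s r
    have h1 := hc.parallel_lower (s := s) (t := r + k * L) (ε := -t) (ε' := 0)
      (by rwa [← sub_sub]) (by rw [abs_neg, abs_of_pos ht.1]; exact ht.2)
      (by simpa using hc.width_pos.le)
    rw [hc.parallel_shift, parallel_zero, ← hr, sub_self, norm_zero, sub_zero, abs_neg,
      abs_of_pos ht.1] at h1
    have := mul_pos hc.lowerConst_pos (by linarith [ht.1, abs_nonneg (s - (r + k * L))] :
      0 < |s - (r + k * L)| + t)
    linarith
  have e : ∀ t : ℝ, toC (γ s - t • normal γ s) = parallel (curveC γ) (-t) s := fun t => by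
    rw [← hD.toC_parallel, neg_smul, sub_eq_add_neg]
  set P : Set Plane := (fun t : ℝ => γ s - t • normal γ s) '' Ioc 0 hc.width with hP
  have h1 : IsPreconnected P := isPreconnected_Ioc.image _ (by fun_prop)
  have h2 : P ⊆ D ∪ (closure D)ᶜ := by
    rintro _ ⟨t, ht, rfl⟩
    by_contra h
    rw [mem_union, not_or, notMem_compl_iff] at h
    have h3 : γ s - t • normal γ s ∈ frontier D := by
      rw [hD.isOpen.frontier_eq]; exact ⟨h.2, h.1⟩
    rw [hD.frontier_eq] at h3
    obtain ⟨r, hr⟩ := h3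
    exact hnr t ht ⟨r, by rw [← e, ← hr, curveC]⟩
  have h3 : (P ∩ D).Nonempty := by
    have hw : ∀ᶠ t in 𝓝[>] (0 : ℝ), t ∈ Ioc 0 hc.width := Ioc_mem_nhdsGT hc.width_pos
    obtain ⟨t, ht, ht'⟩ := ((hD.inner_side s).and hw).exists
    exact ⟨_, ⟨t, ht', rfl⟩, ht⟩
  have hdisj : Disjoint D (closure D)ᶜ :=
    (disjoint_compl_left_iff_subset.2 subset_closure).symm
  have h4 := h1.subset_left_of_subset_union hD.isOpen (isOpen_exterior D) hdisj h2 h3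
    ⟨ε, ⟨hε, hε'⟩, rfl⟩
  intro h5
  rw [extC, mem_preimage, ← e, toC.symm_apply_apply] at h5
  exact h5 (subset_closure h4)

/-- Off the exterior, either one is on the curve, or one stays off the exterior. -/
theorem mem_range_or_eventually (hD : IsC2Domain D γ L) {z : ℂ} (hz : z ∉ extC D) :
    z ∈ range (curveC γ) ∨ ∀ᶠ y in 𝓝 z, y ∉ extC D := by
  have h1 : toC.symm z ∈ closure D := by
    by_contra h; exact hz h
  rw [closure_eq_self_union_frontier, hD.frontier_eq] at h1
  rcases h1 with h1 | ⟨t, ht⟩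
  · right
    have h2 : IsOpen (toC.symm ⁻¹' D) := hD.isOpen.preimage toC.symm.continuous
    filter_upwards [h2.mem_nhds h1] with y hy hy'
    exact hy' (subset_closure hy)
  · left
    exact ⟨t, by rw [curveC, ht, toC.apply_symm_apply]⟩

/-- The distance to the boundary curve. -/
def _root_.curveDist (γ : ℝ → Plane) (z : ℂ) : ℝ := Metric.infDist z (range (curveC γ))

theorem curveDist_pos (hD : IsC2Domain D γ L) {z : ℂ} (hz : z ∈ extC D) : 0 < curveDist γ z :=
  (hD.isArcCurve.isCompact_range.isClosed.notMem_iff_infDist_pos (range_nonempty _)).1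
    (hD.notMem_range hz)

/-- Points of the exterior close to the boundary lie on the parallel curve at their distance. -/
theorem exists_foot (hD : IsC2Domain D γ L) {z : ℂ} (hz : z ∈ extC D)
    (hd : curveDist γ z ≤ hD.isArcCurve.width) :
    ∃ t ∈ Ioc 0 L, z = parallel (curveC γ) (curveDist γ z) t := by
  have hc := hD.isArcCurve
  obtain ⟨p, ⟨t, rfl⟩, hp⟩ := hc.isCompact_range.exists_infDist_eq_dist (range_nonempty _) z
  have hp' : curveDist γ z = ‖z - curveC γ t‖ := by rw [curveDist, hp, dist_eq_norm]
  have hmin : ∀ s, ‖z - curveC γ t‖ ≤ ‖z - curveC γ s‖ := fun s => by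
    rw [← hp', curveDist, ← dist_eq_norm]
    exact Metric.infDist_le_dist_of_mem (mem_range_self s)
  have hder : HasDerivAt (fun s => ‖z - curveC γ s‖ ^ 2)
      (2 * inner ℝ (z - curveC γ t) (-deriv (curveC γ) t)) t :=
    ((hc.hasDerivAt t).const_sub z).norm_sq
  have h0 : 2 * inner ℝ (z - curveC γ t) (-deriv (curveC γ) t) = 0 := by
    refine IsLocalMin.hasDerivAt_eq_zero ?_ hder
    refine Eventually.of_forall fun s => ?_
    simp only
    have := hmin s
    gcongr
  -- the foot vector is normal
  set l : ℂ := (z - curveC γ t) * (-Complex.I * deriv (curveC γ) t)⁻¹ with hl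
  have hT := hc.deriv_ne_zero t
  have hI : -Complex.I * deriv (curveC γ) t ≠ 0 := mul_ne_zero (neg_ne_zero.2 Complex.I_ne_zero) hT
  have hlim : l.im = 0 := by
    have e : l = (z - curveC γ t) * (starRingEnd ℂ) (deriv (curveC γ) t) * Complex.I := by
      rw [hl, mul_inv, hc.conj_deriv, ← neg_inv, Complex.inv_I]; ring
    rw [e, Complex.mul_I_im]
    rw [inner_neg_right, Complex.inner] at h0
    have e2 : ((z - curveC γ t) * (starRingEnd ℂ) (deriv (curveC γ) t)).re =
        (deriv (curveC γ) t * (starRingEnd ℂ) (z - curveC γ t)).re := by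
      simp [Complex.mul_re]; ring
    rw [e2]; linarith
  have hlre : l = (l.re : ℂ) := by
    apply Complex.ext <;> simp [hlim]
  have hz' : z = parallel (curveC γ) l.re t := by
    have : z - curveC γ t = l * (-Complex.I * deriv (curveC γ) t) := by
      rw [hl, inv_mul_cancel_right₀ hI]
    rw [hlre] at this
    rw [parallel, eq_add_of_sub_eq this]; ring
  have hnorm : |l.re| = curveDist γ z := by
    rw [hp', ← Real.norm_eq_abs, ← Complex.norm_real, ← hlre, hl, norm_mul, norm_inv, norm_mul,
      norm_neg, Complex.norm_I, hc.unit_speed]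
    simp
  have hpos := hD.curveDist_pos hz
  have hl0 : 0 < l.re := by
    by_contra h
    push Not at h
    rw [abs_of_nonpos h] at hnorm
    have := hD.inner_parallel_mem (ε := -l.re) (by linarith) (by rwa [hnorm]) t
    rw [neg_neg, ← hz'] at this
    exact this hz
  rw [abs_of_pos hl0] at hnorm
  obtain ⟨r, hr, hr'⟩ := (hc.parallel_periodic (curveDist γ z)).exists_mem_Ioc hc.length_pos t 0
  rw [zero_add] at hr
  exact ⟨r, hr, by rw [← hr', ← hnorm]; exact hz'⟩

/-- Within the width of the collar, the normal coordinate is the distance to the curve. -/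
theorem curveDist_parallel (hD : IsC2Domain D γ L) {ε : ℝ} (hε : 0 < ε)
    (hε' : ε ≤ hD.isArcCurve.width) (s : ℝ) :
    curveDist γ (parallel (curveC γ) ε s) = ε := by
  have hc := hD.isArcCurve
  have hz := hD.parallel_mem_extC hε hε' s
  have hle : curveDist γ (parallel (curveC γ) ε s) ≤ ε := by
    refine (Metric.infDist_le_dist_of_mem (mem_range_self s)).trans ?_
    rw [dist_eq_norm, hc.norm_parallel_sub hε.le]
  obtain ⟨t, -, ht⟩ := hD.exists_foot hz (hle.trans hε')
  set d := curveDist γ (parallel (curveC γ) ε s) with hd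
  have hd0 : 0 < d := hD.curveDist_pos hz
  obtain ⟨k, hk⟩ := hc.exists_shift s t
  have h1 := hc.parallel_lower (s := s) (t := t + k * L) (ε := ε) (ε' := d)
    (by rwa [← sub_sub]) (by rwa [abs_of_pos hε]) (by rw [abs_of_pos hd0]; exact hle.trans hε')
  rw [hc.parallel_shift, ← ht, sub_self, norm_zero] at h1
  have h2 : |s - (t + k * L)| + |ε - d| ≤ 0 := by
    by_contra h
    push Not at h
    linarith [mul_pos hc.lowerConst_pos h]
  have h3 : |ε - d| = 0 := le_antisymm (by linarith [abs_nonneg (s - (t + k * L))]) (abs_nonneg _)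
  linarith [abs_eq_zero.1 h3]

/-- The linear form `v ↦ ⟪ν, v⟫`. -/
def _root_.normalForm (γ : ℝ → Plane) (s : ℝ) : ℂ →L[ℝ] ℝ :=
  innerSL ℝ (-Complex.I * deriv (curveC γ) s)

theorem _root_.normalForm_apply (γ : ℝ → Plane) (s : ℝ) (v : ℂ) :
    normalForm γ s v = (v * (starRingEnd ℂ) (-Complex.I * deriv (curveC γ) s)).re := by
  rw [normalForm, innerSL_apply_apply, Complex.inner]

/-- The gradient of the distance is the normal at the foot point. -/
theorem hasFDerivAt_curveDist (hD : IsC2Domain D γ L) {ε : ℝ} (hε : 0 < ε)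
    (hε' : ε < hD.isArcCurve.width) (s : ℝ) :
    HasFDerivAt (curveDist γ) (normalForm γ s) (parallel (curveC γ) ε s) := by
  have hc := hD.isArcCurve
  obtain ⟨M, hM0, -, -, hMT, -⟩ := hc.exists_deriv₂_bound
  have hk0 := hc.lowerConst_pos
  set z₀ := parallel (curveC γ) ε s with hz₀
  have hz₀m : z₀ ∈ extC D := hD.parallel_mem_extC hε hε'.le s
  have hd₀ : curveDist γ z₀ = ε := hD.curveDist_parallel hε hε'.le s
  have hlip : ∀ z, |curveDist γ z - ε| ≤ ‖z - z₀‖ := fun z => by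
    rw [← hd₀, ← dist_eq_norm, ← Real.dist_eq]
    exact (Metric.lipschitz_infDist_pt (range (curveC γ))).dist_le_mul z z₀ |>.trans (by simp)
  have hn : ∀ r, ‖-Complex.I * deriv (curveC γ) r‖ = 1 := fun r => by
    rw [norm_mul, norm_neg, Complex.norm_I, hc.unit_speed, one_mul]
  have hquad : ∀ᶠ z in 𝓝 z₀, ‖curveDist γ z - curveDist γ z₀ - normalForm γ s (z - z₀)‖ ≤
      (1 / ε + M / hc.lowerConst) * ‖z - z₀‖ ^ 2 := by
    have hρ : 0 < min (ε / 2) (hc.width - ε) := lt_min (by positivity) (by linarith)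
    filter_upwards [Metric.ball_mem_nhds z₀ hρ, (isOpen_extC D).mem_nhds hz₀m] with z hz hzm
    rw [Metric.mem_ball, dist_eq_norm] at hz
    have hz1 : ‖z - z₀‖ < ε / 2 := hz.trans_le (min_le_left _ _)
    have hz2 : ‖z - z₀‖ < hc.width - ε := hz.trans_le (min_le_right _ _)
    set h := z - z₀ with hh
    set d := curveDist γ z with hd
    have hdε := abs_le.1 (hlip z)
    have hdw : d ≤ hc.width := by linarith
    have hd2 : ε / 2 ≤ d := by linarith
    have hd0 : 0 < d := by linarith
    rw [hd₀, Real.norm_eq_abs, abs_le]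
    constructor
    · -- the foot point of `z` is a competitor for `z₀`
      obtain ⟨t, -, ht⟩ := hD.exists_foot hzm hdw
      obtain ⟨k, hk⟩ := hc.exists_shift s t
      have h1 := hc.parallel_lower (s := s) (t := t + k * L) (ε := ε) (ε' := d)
        (by rwa [← sub_sub]) (by rw [abs_of_pos hε]; exact hε'.le) (by rwa [abs_of_pos hd0])
      rw [hc.parallel_shift, ← ht, ← hz₀, norm_sub_rev] at h1
      have h2 : |s - (t + k * L)| ≤ ‖h‖ / hc.lowerConst := by
        rw [le_div_iff₀ hk0]
        nlinarith [abs_nonneg (ε - d)]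
      have hTt : deriv (curveC γ) (t + k * L) = deriv (curveC γ) t := by
        simpa using hc.deriv_periodic.int_mul k t
      have h3 := hMT s (t + k * L)
      rw [hTt] at h3
      have h4 : ε ≤ ‖(d : ℂ) * (-Complex.I * deriv (curveC γ) t) + -h‖ := by
        have h5 : curveDist γ z₀ ≤ dist z₀ (curveC γ t) :=
          Metric.infDist_le_dist_of_mem (mem_range_self t)
        rw [hd₀, dist_eq_norm] at h5
        have e : z₀ - curveC γ t = (d : ℂ) * (-Complex.I * deriv (curveC γ) t) + -h := by
          have h6 : z₀ = z - h := by rw [hh]; ring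
          rw [h6]
          nth_rewrite 1 [ht]
          rw [parallel]; ring
        rwa [e] at h5
      have h5 := norm_add_smul_le hd0 (hn t) (-h)
      rw [norm_neg] at h5
      have h6 : ((-h) * (starRingEnd ℂ) (-Complex.I * deriv (curveC γ) t)).re ≤
          -normalForm γ s h + ‖h‖ * (M * (‖h‖ / hc.lowerConst)) := by
        rw [normalForm_apply]
        have e : ((-h) * (starRingEnd ℂ) (-Complex.I * deriv (curveC γ) t)).re =
            -(h * (starRingEnd ℂ) (-Complex.I * deriv (curveC γ) s)).re +
              (h * (starRingEnd ℂ) (-Complex.I * (deriv (curveC γ) s - deriv (curveC γ) t))).re := by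
          rw [mul_sub, map_sub, mul_sub, Complex.sub_re, neg_mul, Complex.neg_re]; ring
        rw [e]
        gcongr
        refine (Complex.re_le_norm _).trans ?_
        rw [norm_mul, Complex.norm_conj, norm_mul, norm_neg, Complex.norm_I, one_mul]
        gcongr
        exact h3.trans (by gcongr)
      have h7 : ‖h‖ ^ 2 / (2 * d) ≤ 1 / ε * ‖h‖ ^ 2 := by
        rw [div_eq_mul_inv, mul_comm, one_div]
        gcongr
        linarith
      have h8 : ‖h‖ * (M * (‖h‖ / hc.lowerConst)) = M / hc.lowerConst * ‖h‖ ^ 2 := by ring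
      linarith
    -- the foot point of `z₀` is a competitor for `z`
    · have h1 : d ≤ ‖(ε : ℂ) * (-Complex.I * deriv (curveC γ) s) + h‖ := by
        have h5 : curveDist γ z ≤ dist z (curveC γ s) :=
          Metric.infDist_le_dist_of_mem (mem_range_self s)
        rw [dist_eq_norm] at h5
        have e : z - curveC γ s = (ε : ℂ) * (-Complex.I * deriv (curveC γ) s) + h := by
          rw [hh, hz₀, parallel]; ring
        rwa [e] at h5
      have h2 := norm_add_smul_le hε (hn s) h
      rw [← normalForm_apply] at h2
      have h7 : ‖h‖ ^ 2 / (2 * ε) ≤ 1 / ε * ‖h‖ ^ 2 := by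
        rw [div_eq_mul_inv, mul_comm, one_div]
        gcongr
        linarith
      have h8 : 0 ≤ M / hc.lowerConst * ‖h‖ ^ 2 := by positivity
      linarith
  rw [hasFDerivAt_iff_isLittleO]
  refine IsBigO.trans_isLittleO (g := fun z => ‖z - z₀‖ ^ 2) (IsBigO.of_bound
    (1 / ε + M / hc.lowerConst) ?_) ?_
  · filter_upwards [hquad] with z hz
    rwa [norm_pow, norm_norm]
  · have h1 : Tendsto (fun z => z - z₀) (𝓝 z₀) (𝓝 0) := by
      have : Continuous fun z : ℂ => z - z₀ := by fun_prop
      simpa using this.tendsto z₀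
    exact (isLittleO_norm_pow_id one_lt_two).comp_tendsto h1

end IsC2Domain

/-! ### Cut-off functions near the boundary -/

/-- A cut-off function that vanishes within distance `δ` of the boundary and inside of it, and is
one in the exterior beyond distance `2 δ`. -/
def boundaryCutoff (D : Set Plane) (γ : ℝ → Plane) (δ : ℝ) : ℂ → ℝ :=
  (extC D).indicator fun z => Real.smoothTransition (curveDist γ z / δ - 1)

theorem boundaryCutoff_nonneg (D : Set Plane) (γ : ℝ → Plane) (δ : ℝ) (z : ℂ) :
    0 ≤ boundaryCutoff D γ δ z :=
  indicator_nonneg (fun _ _ => Real.smoothTransition.nonneg _) z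

theorem boundaryCutoff_le_one (D : Set Plane) (γ : ℝ → Plane) (δ : ℝ) (z : ℂ) :
    boundaryCutoff D γ δ z ≤ 1 := by
  unfold boundaryCutoff
  by_cases hz : z ∈ extC D
  · rw [indicator_of_mem hz]; exact Real.smoothTransition.le_one _
  · rw [indicator_of_notMem hz]; exact zero_le_one

theorem boundaryCutoff_eq_zero {D : Set Plane} {γ : ℝ → Plane} {δ : ℝ} (hδ : 0 < δ) {z : ℂ}
    (hz : curveDist γ z ≤ δ) : boundaryCutoff D γ δ z = 0 := by
  refine indicator_apply_eq_zero.2 fun _ => Real.smoothTransition.zero_of_nonpos ?_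
  rw [sub_nonpos]
  exact div_le_one_of_le₀ hz hδ.le

theorem boundaryCutoff_eq_one {D : Set Plane} {γ : ℝ → Plane} {δ : ℝ} (hδ : 0 < δ) {z : ℂ}
    (hz : z ∈ extC D) (hd : 2 * δ ≤ curveDist γ z) : boundaryCutoff D γ δ z = 1 := by
  rw [boundaryCutoff, indicator_of_mem hz]
  refine Real.smoothTransition.one_of_one_le ?_
  have : 2 ≤ curveDist γ z / δ := by rwa [le_div_iff₀ hδ]
  linarith

theorem continuous_curveDist (γ : ℝ → Plane) : Continuous (curveDist γ) :=
  Metric.continuous_infDist_pt _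

namespace IsC2Domain

variable {D : Set Plane} {γ : ℝ → Plane} {L : ℝ}

/-- The differential of the cut-off function is concentrated on the layer between the distances
`δ` and `2 δ`, where it points in the normal direction. -/
theorem exists_hasFDerivAt_boundaryCutoff (hD : IsC2Domain D γ L) : ∃ M : ℝ, 0 < M ∧
    ∀ δ, 0 < δ → 2 * δ < hD.isArcCurve.width → ∀ z, ∃ A : ℂ →L[ℝ] ℝ,
      HasFDerivAt (boundaryCutoff D γ δ) A z ∧
      (A = 0 ∨ ∃ s ∈ Ioc 0 L, ∃ ε ∈ Icc δ (2 * δ), ∃ m : ℝ, |m| ≤ M / δ ∧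
        z = parallel (curveC γ) ε s ∧ A = m • normalForm γ s) := by
  have hcont : Continuous (deriv Real.smoothTransition) :=
    (Real.smoothTransition.contDiff (n := 1)).continuous_deriv le_rfl
  obtain ⟨M₀, hM₀⟩ := isCompact_Icc.exists_bound_of_continuousOn (s := Icc (0 : ℝ) 1)
    hcont.continuousOn
  refine ⟨max M₀ 1, by positivity, fun δ hδ hw z => ?_⟩
  have hdc := continuous_curveDist γ
  by_cases h1 : curveDist γ z < δ
  · refine ⟨0, (hasFDerivAt_const (0 : ℝ) z).congr_of_eventuallyEq ?_, Or.inl rfl⟩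
    filter_upwards [(isOpen_lt hdc continuous_const).mem_nhds h1] with y hy
    exact boundaryCutoff_eq_zero hδ (le_of_lt hy)
  by_cases hz : z ∈ extC D
  swap
  · rcases hD.mem_range_or_eventually hz with h | h
    · exfalso
      apply h1
      rw [curveDist, Metric.infDist_zero_of_mem h]
      exact hδ
    · refine ⟨0, (hasFDerivAt_const (0 : ℝ) z).congr_of_eventuallyEq ?_, Or.inl rfl⟩
      filter_upwards [h] with y hy
      exact indicator_of_notMem hy _
  by_cases h2 : 2 * δ < curveDist γ z
  · refine ⟨0, (hasFDerivAt_const (1 : ℝ) z).congr_of_eventuallyEq ?_, Or.inl rfl⟩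
    filter_upwards [(isOpen_lt continuous_const hdc).mem_nhds h2, (isOpen_extC D).mem_nhds hz]
      with y hy hy'
    exact boundaryCutoff_eq_one hδ hy' (le_of_lt hy)
  push Not at h1 h2
  obtain ⟨s, hs, hzs⟩ := hD.exists_foot hz (h2.trans hw.le)
  set ε := curveDist γ z with hε
  have hd := hD.hasFDerivAt_curveDist (hδ.trans_le h1) (h2.trans_lt hw) s
  rw [← hzs] at hd
  have hθ : HasDerivAt Real.smoothTransition (deriv Real.smoothTransition (ε / δ - 1))
      (ε / δ - 1) :=
    ((Real.smoothTransition.contDiff (n := 1)).differentiable (by norm_num) _).hasDerivAt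
  have hd2 : HasFDerivAt (fun y => curveDist γ y / δ - 1) (δ⁻¹ • normalForm γ s) z := by
    simpa only [div_eq_inv_mul] using (hd.const_mul δ⁻¹).sub_const 1
  refine ⟨_, (hθ.comp_hasFDerivAt z hd2).congr_of_eventuallyEq ?_, Or.inr
    ⟨s, hs, ε, ⟨h1, h2⟩, deriv Real.smoothTransition (ε / δ - 1) * δ⁻¹, ?_, hzs, ?_⟩⟩
  · filter_upwards [(isOpen_extC D).mem_nhds hz] with y hy
    exact indicator_of_mem hy _
  · rw [abs_mul, abs_of_pos (inv_pos.2 hδ), div_eq_mul_inv (max M₀ 1)]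
    gcongr
    refine le_max_of_le_left (hM₀ _ ⟨?_, ?_⟩)
    · rw [sub_nonneg, le_div_iff₀ hδ]; linarith
    · rw [tsub_le_iff_right, div_le_iff₀ hδ]; linarith
  · rw [smul_smul]

end IsC2Domain

/-! ### Integration in normal coordinates -/

/-- Hadamard's inequality, for the Jacobian of the normal coordinates. -/
theorem abs_det_smulRight_le (a b : ℂ) :
    |(Complex.reCLM.smulRight a + Complex.imCLM.smulRight b).det| ≤ ‖a‖ * ‖b‖ := by
  have h : (Complex.reCLM.smulRight a + Complex.imCLM.smulRight b).det =
      ((starRingEnd ℂ) a * b).im := by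
    rw [ContinuousLinearMap.det, ← LinearMap.det_toMatrix Complex.basisOneI, Matrix.det_fin_two]
    simp [LinearMap.toMatrix_apply, Complex.mul_im]
    ring
  rw [h]
  refine (Complex.abs_im_le_norm _).trans ?_
  rw [norm_mul, Complex.norm_conj]

namespace IsArcCurve

variable {c : ℝ → ℂ} {L : ℝ}

theorem hasFDerivAt_normalCoord (hc : IsArcCurve c L) (p : ℂ) :
    HasFDerivAt (fun p : ℂ => parallel c p.im p.re)
      (Complex.reCLM.smulRight (((1 - p.im * curvC c p.re : ℝ) : ℂ) * deriv c p.re) +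
        Complex.imCLM.smulRight (-Complex.I * deriv c p.re)) p := by
  have hre : HasFDerivAt (fun p : ℂ => p.re) Complex.reCLM p := Complex.reCLM.hasFDerivAt
  have h1 : HasFDerivAt (fun p : ℂ => c p.re) _ p :=
    (hc.hasDerivAt p.re).hasFDerivAt.comp p hre
  have h2 : HasFDerivAt (fun p : ℂ => deriv c p.re) _ p :=
    (hc.hasDerivAt_deriv p.re).hasFDerivAt.comp p hre
  have h3 : HasFDerivAt (fun p : ℂ => (p.im : ℂ) * Complex.I)
      ((Complex.imCLM).smulRight Complex.I) p := by
    refine ((Complex.imCLM.smulRight Complex.I).hasFDerivAt (x := p)).congr_of_eventuallyEq ?_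
    exact Eventually.of_forall fun q => by simp
  refine (h1.sub (h3.mul h2)).congr_fderiv ?_
  ext w
  simp only [hc.deriv₂_eq]
  simp
  linear_combination (p.im * w.re * curvC c p.re * deriv c p.re : ℂ) * Complex.I_sq

theorem injOn_normalCoord (hc : IsArcCurve c L) :
    InjOn (fun p : ℂ => parallel c p.im p.re) (Ioc 0 L ×ℂ Icc 0 hc.width) := by
  intro p hp q hq h
  rw [Complex.mem_reProdIm] at hp hq
  simp only at h
  obtain ⟨k, hk⟩ := hc.exists_shift p.re q.re
  have h1 := hc.parallel_lower (s := p.re) (t := q.re + k * L) (ε := p.im) (ε' := q.im)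
    (by rwa [← sub_sub]) (by rw [abs_of_nonneg hp.2.1]; exact hp.2.2)
    (by rw [abs_of_nonneg hq.2.1]; exact hq.2.2)
  rw [hc.parallel_shift, h, sub_self, norm_zero] at h1
  have h2 : |p.re - (q.re + k * L)| + |p.im - q.im| ≤ 0 := by
    by_contra h
    push Not at h
    linarith [mul_pos hc.lowerConst_pos h]
  have h3 : |p.im - q.im| = 0 :=
    le_antisymm (by linarith [abs_nonneg (p.re - (q.re + k * L))]) (abs_nonneg _)
  have h4 : |p.re - (q.re + k * L)| = 0 :=
    le_antisymm (by linarith [abs_nonneg (p.im - q.im)]) (abs_nonneg _)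
  refine Complex.ext (hc.eq_of_mem_Ioc hp.1 hq.1 ?_) (sub_eq_zero.1 (abs_eq_zero.1 h3))
  rw [sub_eq_zero.1 (abs_eq_zero.1 h4), hc.shift]

/-- An integral over the layer between the distances `δ` and `2 δ` is bounded by the thickness
times the largest integral over a parallel curve. -/
theorem lintegral_layer_le (hc : IsArcCurve c L) {δ : ℝ} (hδ : 0 < δ) (hw : 2 * δ ≤ hc.width)
    {g : ℂ → ENNReal} (hg : Measurable g) {B : ENNReal}
    (hB : ∀ ε ∈ Icc δ (2 * δ), ∫⁻ s, g (parallel c ε s) ∂(arcMeasure L) ≤ B) :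
    ∫⁻ z in (fun p : ℂ => parallel c p.im p.re) '' (Ioc 0 L ×ℂ Icc δ (2 * δ)), g z ≤
      2 * (ENNReal.ofReal δ * B) := by
  set S : Set ℂ := Ioc 0 L ×ℂ Icc δ (2 * δ) with hS
  have hSm : MeasurableSet S := by
    rw [hS, Complex.reProdIm]
    exact (Complex.measurable_re measurableSet_Ioc).inter (Complex.measurable_im measurableSet_Icc)
  have hsub : S ⊆ Ioc 0 L ×ℂ Icc 0 hc.width := by
    intro p hp
    rw [hS, Complex.mem_reProdIm] at hp
    rw [Complex.mem_reProdIm]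
    exact ⟨hp.1, hδ.le.trans hp.2.1, hp.2.2.trans hw⟩
  rw [lintegral_image_eq_lintegral_abs_det_fderiv_mul volume hSm
    (fun p _ => (hc.hasFDerivAt_normalCoord p).hasFDerivWithinAt) (hc.injOn_normalCoord.mono hsub)]
  have hpm : Measurable fun p : ℂ => parallel c p.im p.re :=
    (hc.continuous_parallel.comp
      (Complex.continuous_im.prodMk Complex.continuous_re)).measurable
  calc _ ≤ ∫⁻ p in S, 2 * g (parallel c p.im p.re) := by
        refine setLIntegral_mono (hg.comp hpm |>.const_mul 2) fun p hp => ?_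
        gcongr
        have hp' := (Complex.mem_reProdIm.1 (hsub hp)).2
        have h1 := hc.width_mul_curvC_le p.re
        have h2 : |p.im * curvC c p.re| ≤ 1 / 2 := by
          rw [abs_mul, abs_of_nonneg hp'.1]
          exact (mul_le_mul_of_nonneg_right hp'.2 (abs_nonneg _)).trans h1
        have h3 := abs_le.1 h2
        refine ENNReal.ofReal_le_of_le_toReal ((abs_det_smulRight_le _ _).trans ?_)
        rw [norm_mul, norm_mul, hc.unit_speed, Complex.norm_real, norm_neg, Complex.norm_I,
          Real.norm_eq_abs, abs_of_nonneg (by linarith)]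
        norm_num
        linarith
    _ = 2 * ∫⁻ p in S, g (parallel c p.im p.re) := lintegral_const_mul _ (hg.comp hpm)
    _ ≤ _ := by
        gcongr
        have e1 : ∫⁻ p in S, g (parallel c p.im p.re) =
            ∫⁻ q in Ioc 0 L ×ˢ Icc δ (2 * δ), g (parallel c q.2 q.1) := by
          have := (Complex.volume_preserving_equiv_real_prod).setLIntegral_comp_preimage_emb
            Complex.measurableEquivRealProd.measurableEmbedding
            (fun q : ℝ × ℝ => g (parallel c q.2 q.1)) (Ioc 0 L ×ˢ Icc δ (2 * δ))
          rw [← this]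
          rfl
        have hm2 : Measurable fun q : ℝ × ℝ => g (parallel c q.2 q.1) :=
          hg.comp (hc.continuous_parallel.comp (continuous_snd.prodMk continuous_fst)).measurable
        rw [e1, Measure.volume_eq_prod, ← Measure.prod_restrict, lintegral_prod_symm _
          hm2.aemeasurable]
        calc _ ≤ ∫⁻ _ in Icc δ (2 * δ), B := setLIntegral_mono measurable_const hB
          _ = _ := by
            rw [lintegral_const, Measure.restrict_apply_univ, Real.volume_Icc, mul_comm]
            congr 2; ring

end IsArcCurve

/-! ### The energy estimate -/

theorem abs_arctan_le_abs (x : ℝ) : |Real.arctan x| ≤ |x| := by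
  have h : ∀ y : ℝ, 0 ≤ y → Real.arctan y ≤ y := fun y hy => by
    have := Real.le_tan (Real.arctan_nonneg.2 hy) (Real.arctan_lt_pi_div_two y)
    rwa [Real.tan_arctan] at this
  rcases le_total 0 x with hx | hx
  · rw [abs_of_nonneg hx, abs_of_nonneg (Real.arctan_nonneg.2 hx)]; exact h x hx
  · have := h (-x) (by linarith)
    rw [abs_of_nonpos hx, ← abs_neg, ← Real.arctan_neg,
      abs_of_nonneg (Real.arctan_nonneg.2 (by linarith))]
    exact this

theorem abs_arctan_le_pi_div_two (x : ℝ) : |Real.arctan x| ≤ Real.pi / 2 :=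
  abs_le.2 ⟨(Real.neg_pi_div_two_lt_arctan x).le, (Real.arctan_lt_pi_div_two x).le⟩

/-- The integral of a derivative of a compactly supported function vanishes. -/
theorem integral_fderiv_eq_zero {X : ℂ → ℂ} (hX : Differentiable ℝ X) {K : Set ℂ}
    (hKc : IsCompact K) (hK : ∀ z ∉ K, X z = 0) {C : ℝ} (hb : ∀ z ∈ K, ‖fderiv ℝ X z‖ ≤ C) (w : ℂ) :
    Integrable (fun z => fderiv ℝ X z w) ∧ ∫ z, fderiv ℝ X z w = 0 := by
  have h0 : ∀ z ∉ K, fderiv ℝ X z = 0 := fun z hz => by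
    have : X =ᶠ[𝓝 z] fun _ => 0 := by
      filter_upwards [hKc.isClosed.isOpen_compl.mem_nhds hz] with y hy using hK y hy
    rw [this.fderiv_eq]; simp
  have h1 : Integrable (fun z => fderiv ℝ X z w) := by
    rw [← integrableOn_iff_integrable_of_support_subset (s := K)]
    · refine Measure.integrableOn_of_bounded (M := C * ‖w‖) hKc.measure_lt_top.ne
        (measurable_fderiv_apply_const ℝ X w).aestronglyMeasurable ?_
      refine (ae_restrict_iff' hKc.measurableSet).2 (Eventually.of_forall fun z hz => ?_)
      exact (fderiv ℝ X z).le_of_opNorm_le (hb z hz) w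
    · intro z hz
      by_contra h
      simp [h0 z h] at hz
  have h2 : Integrable X := by
    refine hX.continuous.integrable_of_hasCompactSupport ?_
    exact HasCompactSupport.intro hKc hK
  refine ⟨h1, ?_⟩
  have := integral_bilinear_hasFDerivAt_right_eq_neg_left_of_integrable (μ := volume)
    (f := fun _ : ℂ => (1 : ℂ)) (f' := fun _ => 0) (g := X) (g' := fderiv ℝ X) (v := w)
    (B := ContinuousLinearMap.mul ℝ ℂ) (by simp) (by simpa using h1) (by simpa using h2)
    (fun x _ => hasFDerivAt_const _ _) (fun x _ => (hX x).hasFDerivAt)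
  simpa using this

/-- The complex gradient `V_x - i V_y`. -/
def complexGrad (V : ℂ → ℝ) (z : ℂ) : ℂ := fderiv ℝ V z 1 - Complex.I * fderiv ℝ V z Complex.I

theorem fderiv_eq_re_complexGrad (V : ℂ → ℝ) (z w : ℂ) :
    fderiv ℝ V z w = (complexGrad V z * w).re := by
  have e : w = w.re • (1 : ℂ) + w.im • Complex.I := by simp
  conv_lhs => rw [e]
  rw [map_add, map_smul, map_smul, complexGrad]
  simp [Complex.mul_re]
  ring

theorem measurable_complexGrad (V : ℂ → ℝ) : Measurable (complexGrad V) := by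
  have h1 := measurable_fderiv_apply_const ℝ V 1
  have h2 := measurable_fderiv_apply_const ℝ V Complex.I
  unfold complexGrad
  fun_prop

/-- The complex gradient of a real linear form. -/
def formGrad (A : ℂ →L[ℝ] ℝ) : ℂ := A 1 + Complex.I * A Complex.I

theorem norm_formGrad_le (A : ℂ →L[ℝ] ℝ) : ‖formGrad A‖ ≤ 2 * ‖A‖ := by
  have h1 : ‖(A 1 : ℂ)‖ ≤ ‖A‖ := by
    rw [Complex.norm_real]; simpa using A.le_opNorm 1
  have h2 : ‖Complex.I * (A Complex.I : ℂ)‖ ≤ ‖A‖ := by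
    rw [norm_mul, Complex.norm_real]; simpa using A.le_opNorm Complex.I
  rw [formGrad]
  linarith [norm_add_le (A 1 : ℂ) (Complex.I * A Complex.I)]

theorem formGrad_smul_normalForm (m : ℝ) (γ : ℝ → Plane) (s : ℝ) :
    formGrad (m • normalForm γ s) = m * (-Complex.I * deriv (curveC γ) s) := by
  rw [formGrad, smul_apply, smul_apply, normalForm_apply, normalForm_apply]
  apply Complex.ext <;> simp

/-- The divergence of `ψ b(V) ∇V` for `b = arctan` and a harmonic function `V` with complex
gradient `F`. -/
theorem divergence_eq {ψ V : ℂ → ℝ} {F : ℂ → ℂ} {z F' : ℂ} {A : ℂ →L[ℝ] ℝ}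
    (hψ : HasFDerivAt ψ A z) (hV : DifferentiableAt ℝ V z) (hF : HasDerivAt F F' z)
    (hFV : ∀ w, fderiv ℝ V z w = (F z * w).re) :
    ∃ X' : ℂ →L[ℝ] ℂ,
      HasFDerivAt (fun z => ((ψ z * Real.arctan (V z) : ℝ) : ℂ) * F z) X' z ∧
      X' 1 + Complex.I * X' Complex.I =
        ((ψ z * (‖F z‖ ^ 2 / (1 + V z ^ 2)) : ℝ) : ℂ) +
          (Real.arctan (V z) : ℂ) * (F z * formGrad A) ∧
      ‖X'‖ ≤ Real.pi / 2 * ‖F z‖ * ‖A‖ + |ψ z| * ‖F z‖ ^ 2 + Real.pi / 2 * |ψ z| * ‖F'‖ := by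
  have h1 := hψ.mul hV.hasFDerivAt.arctan
  have h2 := (Complex.ofRealCLM.hasFDerivAt (x := ψ z * Real.arctan (V z))).comp z h1
  have h3 := hF.hasFDerivAt.restrictScalars ℝ
  have h4 := HasFDerivAt.mul h2 h3
  have hq : 0 < 1 + V z ^ 2 := by positivity
  obtain ⟨X', hX', happ⟩ : ∃ X' : ℂ →L[ℝ] ℂ,
      HasFDerivAt (fun z => ((ψ z * Real.arctan (V z) : ℝ) : ℂ) * F z) X' z ∧
      ∀ w, X' w = ((ψ z * Real.arctan (V z) : ℝ) : ℂ) * (w * F') +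
        F z * ((ψ z * (1 / (1 + V z ^ 2) * (F z * w).re) + Real.arctan (V z) * A w : ℝ) : ℂ) := by
    refine ⟨_, h4, fun w => ?_⟩
    rw [← hFV]
    simp
    ring
  refine ⟨X', hX', ?_, ?_⟩
  · rw [happ, happ, formGrad]
    have e : ((‖F z‖ ^ 2 : ℝ) : ℂ) = F z * ((F z * 1).re + Complex.I * (F z * Complex.I).re) := by
      rw [← Complex.normSq_eq_norm_sq, ← Complex.mul_conj]
      congr 1
      apply Complex.ext <;> simp
    have e' : ((ψ z * (‖F z‖ ^ 2 / (1 + V z ^ 2)) : ℝ) : ℂ) =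
        ψ z * (1 / (1 + V z ^ 2)) * ((‖F z‖ ^ 2 : ℝ) : ℂ) := by
      push_cast; ring
    rw [e', e]
    generalize Real.arctan (V z) = b
    push_cast
    linear_combination (ψ z * b * F' : ℂ) * Complex.I_sq
  · have hπ := Real.pi_pos
    refine ContinuousLinearMap.opNorm_le_bound _ (by positivity) fun w => ?_
    rw [happ]
    have ha := abs_arctan_le_pi_div_two (V z)
    have hA := A.le_opNorm w
    rw [Real.norm_eq_abs] at hA
    have hr : |(F z * w).re| ≤ ‖F z‖ * ‖w‖ := (Complex.abs_re_le_norm _).trans (norm_mul_le _ _)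
    have hq1 : 1 / (1 + V z ^ 2) ≤ 1 := by
      rw [div_le_one hq]; nlinarith [sq_nonneg (V z)]
    have hq0 : 0 ≤ 1 / (1 + V z ^ 2) := by positivity
    have t1 : ‖((ψ z * Real.arctan (V z) : ℝ) : ℂ) * (w * F')‖ ≤
        Real.pi / 2 * |ψ z| * ‖F'‖ * ‖w‖ := by
      rw [norm_mul, Complex.norm_real, norm_mul w, Real.norm_eq_abs, abs_mul]
      calc |ψ z| * |Real.arctan (V z)| * (‖w‖ * ‖F'‖) ≤ |ψ z| * (Real.pi / 2) * (‖w‖ * ‖F'‖) := by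
            gcongr
        _ = _ := by ring
    have t2 : |ψ z * (1 / (1 + V z ^ 2) * (F z * w).re) + Real.arctan (V z) * A w| ≤
        |ψ z| * (‖F z‖ * ‖w‖) + Real.pi / 2 * (‖A‖ * ‖w‖) := by
      refine (abs_add_le _ _).trans ?_
      rw [abs_mul, abs_mul, abs_mul, abs_of_nonneg hq0]
      refine add_le_add (mul_le_mul_of_nonneg_left ?_ (abs_nonneg _))
        (mul_le_mul ha hA (abs_nonneg _) (by positivity))
      exact (mul_le_mul hq1 hr (abs_nonneg _) zero_le_one).trans_eq (one_mul _)
    calc _ ≤ Real.pi / 2 * |ψ z| * ‖F'‖ * ‖w‖ +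
          ‖F z‖ * (|ψ z| * (‖F z‖ * ‖w‖) + Real.pi / 2 * (‖A‖ * ‖w‖)) := by
          refine (norm_add_le _ _).trans (add_le_add t1 ?_)
          rw [norm_mul, Complex.norm_real, Real.norm_eq_abs]
          gcongr
      _ = _ := by ring

/-! ### Uniqueness for the exterior Neumann problem -/

/-- Cut-off functions at infinity. -/
theorem exists_outerCutoff : ∃ M : ℝ, 0 < M ∧ ∀ R : ℝ, 0 < R → ∃ η : ℂ → ℝ, Differentiable ℝ η ∧
    (∀ z, 0 ≤ η z) ∧ (∀ z, η z ≤ 1) ∧ (∀ z, ‖z‖ ≤ R → η z = 1) ∧ (∀ z, 2 * R ≤ ‖z‖ → η z = 0) ∧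
    (∀ z, ‖fderiv ℝ η z‖ ≤ M / R) ∧ ∀ z, ‖z‖ < R → fderiv ℝ η z = 0 := by
  set b : ContDiffBump (0 : ℂ) := ⟨1, 2, one_pos, by norm_num⟩ with hb
  have hbs : ContDiff ℝ 1 b := b.contDiff
  have hbd : Continuous (fderiv ℝ b) := hbs.continuous_fderiv one_ne_zero
  obtain ⟨M, hM⟩ := hbd.bounded_above_of_compact_support
    (b.hasCompactSupport.fderiv ℝ)
  refine ⟨max M 1, by positivity, fun R hR => ?_⟩
  have hd : ∀ z : ℂ, HasFDerivAt (fun z : ℂ => b (R⁻¹ • z))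
      ((fderiv ℝ b (R⁻¹ • z)).comp (R⁻¹ • ContinuousLinearMap.id ℝ ℂ)) z := fun z =>
    ((hbs.differentiable (by norm_num)) (R⁻¹ • z)).hasFDerivAt.comp z
      ((hasFDerivAt_id z).const_smul R⁻¹)
  have hn : ∀ z : ℂ, ‖R⁻¹ • z‖ = ‖z‖ / R := fun z => by
    rw [norm_smul, norm_inv, Real.norm_of_nonneg hR.le, div_eq_inv_mul]
  have h1 : ∀ z : ℂ, ‖z‖ ≤ R → b (R⁻¹ • z) = 1 := fun z hz => b.one_of_mem_closedBall (by
    rw [mem_closedBall_zero_iff, hn]; exact div_le_one_of_le₀ hz hR.le)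
  refine ⟨fun z => b (R⁻¹ • z), fun z => (hd z).differentiableAt, fun z => b.nonneg,
    fun z => b.le_one, h1, fun z hz => b.zero_of_le_dist ?_, fun z => ?_, fun z hz => ?_⟩
  · rw [dist_zero_right, hn]
    exact (le_div_iff₀ hR).2 hz
  · rw [(hd z).fderiv, ContinuousLinearMap.comp_smul, ContinuousLinearMap.comp_id, norm_smul,
      norm_inv, Real.norm_of_nonneg hR.le, div_eq_inv_mul]
    gcongr
    exact le_max_of_le_left (hM _)
  · have : (fun z : ℂ => b (R⁻¹ • z)) =ᶠ[𝓝 z] fun _ => 1 := by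
      filter_upwards [(isOpen_lt continuous_norm continuous_const).mem_nhds hz] with y hy
      exact h1 y (le_of_lt hy)
    rw [this.fderiv_eq]; simp

/-- The pointwise inequality behind the energy estimate: `Y` is the cut-off energy density and
`T₁`, `T₂` are the contributions of the inner and the outer cut-off function. -/
theorem energy_pointwise {χ η v f g b : ℝ} {a₁ a₂ : ℝ} (hχ : 0 ≤ χ) (hχ1 : χ ≤ 1) (hη : 0 ≤ η)
    (hη1 : η ≤ 1) {p : ℝ} (hb : |b| ≤ p) (ha₂ : |a₂| ≤ f * g) :
    χ * η ^ 2 * (f ^ 2 / (1 + v ^ 2)) / 2 ≤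
      χ * η ^ 2 * (f ^ 2 / (1 + v ^ 2)) + b * (η ^ 2 * a₁ + 2 * χ * η * a₂) + p * |a₁| +
        2 * (b ^ 2 * (1 + v ^ 2) * g ^ 2) := by
  have hq : 0 < 1 + v ^ 2 := by positivity
  have h1 : -(p * |a₁|) ≤ b * (η ^ 2 * a₁) := by
    have : |b * (η ^ 2 * a₁)| ≤ p * |a₁| := by
      rw [abs_mul, abs_mul, abs_of_nonneg (by positivity : 0 ≤ η ^ 2)]
      have h3 : η ^ 2 ≤ 1 := pow_le_one₀ hη hη1
      have h4 : η ^ 2 * |a₁| ≤ |a₁| := mul_le_of_le_one_left (abs_nonneg _) h3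
      exact mul_le_mul hb h4 (by positivity) ((abs_nonneg b).trans hb)
    exact (abs_le.1 this).1
  have h2 : -(2 * χ * η * (|b| * (f * g))) ≤ b * (2 * χ * η * a₂) := by
    have : |b * (2 * χ * η * a₂)| ≤ 2 * χ * η * (|b| * (f * g)) := by
      rw [abs_mul, abs_mul, abs_of_nonneg (by positivity : 0 ≤ 2 * χ * η)]
      calc |b| * (2 * χ * η * |a₂|) = 2 * χ * η * (|b| * |a₂|) := by ring
        _ ≤ _ := by gcongr
    exact (abs_le.1 this).1
  -- the inequality between the arithmetic and the geometric mean
  have h3 : 2 * χ * η * (|b| * (f * g)) ≤ χ * η ^ 2 * (f ^ 2 / (1 + v ^ 2)) / 2 +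
      χ * (2 * (b ^ 2 * (1 + v ^ 2) * g ^ 2)) := by
    have h4 : 0 ≤ χ * ((η * f - 2 * |b| * (1 + v ^ 2) * g) ^ 2 / (2 * (1 + v ^ 2))) := by positivity
    have h5 : χ * ((η * f - 2 * |b| * (1 + v ^ 2) * g) ^ 2 / (2 * (1 + v ^ 2))) =
        χ * η ^ 2 * (f ^ 2 / (1 + v ^ 2)) / 2 + χ * (2 * (|b| ^ 2 * (1 + v ^ 2) * g ^ 2)) -
          2 * χ * η * (|b| * (f * g)) := by
      field_simp; ring
    rw [h5, sq_abs] at h4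
    linarith
  have h6 : χ * (2 * (b ^ 2 * (1 + v ^ 2) * g ^ 2)) ≤ 2 * (b ^ 2 * (1 + v ^ 2) * g ^ 2) :=
    mul_le_of_le_one_left (by positivity) hχ1
  nlinarith

namespace IsC2Domain

variable {D : Set Plane} {γ : ℝ → Plane} {L : ℝ}

/-- Points at distance at least `δ` from the curve cannot leave the exterior in a limit. -/
theorem isCompact_truncatedExterior (hD : IsC2Domain D γ L) {δ : ℝ} (hδ : 0 < δ) (R : ℝ) :
    IsCompact {z : ℂ | z ∈ extC D ∧ δ ≤ curveDist γ z ∧ ‖z‖ ≤ R} := by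
  refine Metric.isCompact_of_isClosed_isBounded ?_ ?_
  · rw [← isOpen_compl_iff, isOpen_iff_mem_nhds]
    intro z hz
    have hdc := continuous_curveDist γ
    by_cases h1 : curveDist γ z < δ
    · filter_upwards [(isOpen_lt hdc continuous_const).mem_nhds h1] with y hy hy'
      exact absurd hy'.2.1 (not_le.2 hy)
    by_cases h2 : R < ‖z‖
    · filter_upwards [(isOpen_lt continuous_const continuous_norm).mem_nhds h2] with y hy hy'
      exact absurd hy'.2.2 (not_le.2 hy)
    push Not at h1 h2
    rcases hD.mem_range_or_eventually (fun h => hz ⟨h, h1, h2⟩) with h | h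
    · exfalso
      rw [curveDist, Metric.infDist_zero_of_mem h] at h1
      linarith
    · filter_upwards [h] with y hy hy'
      exact hy hy'.1
  · exact (Metric.isBounded_closedBall (x := (0 : ℂ)) (r := R)).subset fun z hz => by
      rw [mem_closedBall_zero_iff]; exact hz.2.2

theorem norm_normalForm_le (hD : IsC2Domain D γ L) (s : ℝ) : ‖normalForm γ s‖ ≤ 1 := by
  rw [normalForm, innerSL_apply_norm, norm_mul, norm_neg, Complex.norm_I, hD.isArcCurve.unit_speed,
    one_mul]

/-- The energy near the boundary is controlled by the mean normal derivative on the parallel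
curves. -/
theorem lintegral_cutoff_le (hD : IsC2Domain D γ L) {M δ B : ℝ} (hM : 0 < M) (hδ : 0 < δ)
    (hw : 2 * δ < hD.isArcCurve.width) {A : ℂ → ℂ →L[ℝ] ℝ}
    (hA : ∀ z, A z = 0 ∨ ∃ s ∈ Ioc 0 L, ∃ ε ∈ Icc δ (2 * δ), ∃ m : ℝ, |m| ≤ M / δ ∧
        z = parallel (curveC γ) ε s ∧ A z = m • normalForm γ s) (hAm : ∀ w, Measurable fun z => A z w)
    {F : ℂ → ℂ} (hF : Measurable F)
    (hB : ∀ ε ∈ Icc δ (2 * δ), ∫⁻ s, ENNReal.ofReal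
      |(F (parallel (curveC γ) ε s) * (-Complex.I * deriv (curveC γ) s)).re| ∂(arcMeasure L) ≤
        ENNReal.ofReal B) :
    ∫⁻ z, ENNReal.ofReal |(F z * formGrad (A z)).re| ≤ ENNReal.ofReal (2 * M * B) := by
  have hc := hD.isArcCurve
  set g : ℂ → ENNReal := fun z => ENNReal.ofReal |(F z * formGrad (A z)).re| with hg
  have hgm : Measurable g := by
    have h1 := hAm 1
    have h2 := hAm Complex.I
    have h3 : Measurable fun z => formGrad (A z) := by unfold formGrad; fun_prop
    have h4 : Measurable fun z => (F z * formGrad (A z)).re := Complex.measurable_re.comp (hF.mul h3)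
    exact h4.abs.ennreal_ofReal
  have hsupp : Function.support g ⊆
      (fun p : ℂ => parallel (curveC γ) p.im p.re) '' (Ioc 0 L ×ℂ Icc δ (2 * δ)) := by
    intro z hz
    rcases hA z with h | ⟨s, hs, ε, hε, m, -, hzs, -⟩
    · simp [hg, h, formGrad] at hz
    · exact ⟨⟨s, ε⟩, ⟨hs, hε⟩, hzs.symm⟩
  have hlay : ∀ ε ∈ Icc δ (2 * δ), ∫⁻ s, g (parallel (curveC γ) ε s) ∂(arcMeasure L) ≤
      ENNReal.ofReal (M / δ) * ENNReal.ofReal B := by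
    intro ε hε
    refine le_trans ?_ (mul_le_mul_right (hB ε hε) _)
    rw [← lintegral_const_mul' _ _ ENNReal.ofReal_ne_top]
    refine setLIntegral_mono_ae' measurableSet_Ioc (Eventually.of_forall fun s hs => ?_)
    rw [← ENNReal.ofReal_mul (by positivity)]
    refine ENNReal.ofReal_le_ofReal ?_
    rcases hA (parallel (curveC γ) ε s) with h | ⟨s', hs', ε', hε', m, hm, hzs, hAz⟩
    · rw [h]
      simp only [formGrad, zero_apply, Complex.ofReal_zero, mul_zero, add_zero, Complex.zero_re,
        abs_zero]
      positivity
    · have e : (⟨s, ε⟩ : ℂ) = ⟨s', ε'⟩ := by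
        refine hc.injOn_normalCoord ⟨hs, ?_⟩ ⟨hs', ?_⟩ hzs
        · exact ⟨hδ.le.trans hε.1, hε.2.trans hw.le⟩
        · exact ⟨hδ.le.trans hε'.1, hε'.2.trans hw.le⟩
      have e1 : s = s' := congrArg Complex.re e
      rw [hAz, formGrad_smul_normalForm, ← e1, mul_left_comm, Complex.re_ofReal_mul, abs_mul]
      gcongr
  calc ∫⁻ z, g z = ∫⁻ z in Function.support g, g z := by
        rw [← lintegral_indicator (measurableSet_support hgm), indicator_support]
    _ ≤ ∫⁻ z in (fun p : ℂ => parallel (curveC γ) p.im p.re) '' (Ioc 0 L ×ℂ Icc δ (2 * δ)), g z :=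
        lintegral_mono_set hsupp
    _ ≤ _ := hc.lintegral_layer_le hδ hw.le hgm hlay
    _ = _ := by
        rw [← mul_assoc (ENNReal.ofReal δ), ← ENNReal.ofReal_mul hδ.le, mul_div_cancel₀ _ hδ.ne',
          ← ENNReal.ofReal_mul hM.le, mul_assoc, ENNReal.ofReal_mul zero_le_two]
        simp

/-- The energy of a harmonic function in a bounded part of the exterior is controlled by the mean
normal derivatives on the parallel curves and by the decay at infinity. The function enters through
its arctangent, so that nothing needs to be known about its boundary values. -/
theorem energy_le (hD : IsC2Domain D γ L) : ∃ Kc : ℝ, 0 < Kc ∧ ∀ {V : ℂ → ℝ},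
    (∀ z ∈ extC D, InnerProductSpace.HarmonicAt V z) → ∀ {δ R C B m : ℝ} {U : Set ℂ},
    0 < δ → 2 * δ < hD.isArcCurve.width → 0 < R → 0 ≤ C → C ≤ R →
    (∀ z ∈ extC D, R ≤ ‖z‖ → |V z| ≤ C / ‖z‖) → 0 ≤ B →
    (∀ ε ∈ Icc δ (2 * δ), ∫⁻ s, ENNReal.ofReal
      |(complexGrad V (parallel (curveC γ) ε s) * (-Complex.I * deriv (curveC γ) s)).re|
        ∂(arcMeasure L) ≤ ENNReal.ofReal B) →
    MeasurableSet U → (∀ z ∈ U, z ∈ extC D ∧ 2 * δ ≤ curveDist γ z ∧ ‖z‖ ≤ R ∧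
      m ≤ ‖complexGrad V z‖ ^ 2 / (1 + V z ^ 2)) →
    m * volume.real U ≤ Kc * (B + C ^ 2 / R ^ 2) := by
  obtain ⟨M, hM0, hM⟩ := hD.exists_hasFDerivAt_boundaryCutoff
  obtain ⟨M₁, hM₁0, hM₁⟩ := exists_outerCutoff
  have hπ := Real.pi_pos
  refine ⟨2 * (Real.pi * M) + 2 * (Real.pi * 64 * M₁ ^ 2), by positivity,
    fun {V} hV {δ R C B m U} hδ hw hR hC hCR hdec hB hBε hU hUm => ?_⟩
  obtain ⟨η, hηd, hη0, hη1, hηone, hηzero, hηb, hηflat⟩ := hM₁ R hR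
  set χ := boundaryCutoff D γ δ with hχ
  set F := complexGrad V with hF
  have hχd : ∀ z, HasFDerivAt χ (fderiv ℝ χ z) z := fun z => by
    obtain ⟨A, hA, -⟩ := hM δ hδ hw z
    exact hA.differentiableAt.hasFDerivAt
  have hχA : ∀ z, fderiv ℝ χ z = 0 ∨ ∃ s ∈ Ioc 0 L, ∃ ε ∈ Icc δ (2 * δ), ∃ m : ℝ, |m| ≤ M / δ ∧
        z = parallel (curveC γ) ε s ∧ fderiv ℝ χ z = m • normalForm γ s := fun z => by
    obtain ⟨A, hA, hA'⟩ := hM δ hδ hw z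
    rwa [hA.fderiv]
  have hχn : ∀ z, ‖fderiv ℝ χ z‖ ≤ M / δ := fun z => by
    rcases hχA z with h | ⟨s, -, ε, -, m, hm, -, h⟩
    · rw [h, norm_zero]; positivity
    · rw [h, norm_smul, Real.norm_eq_abs]
      exact (mul_le_mul hm (hD.norm_normalForm_le s) (norm_nonneg _) (by positivity)).trans_eq
        (mul_one _)
  -- the support of the cut-off functions
  set K : Set ℂ := {z : ℂ | z ∈ extC D ∧ δ ≤ curveDist γ z ∧ ‖z‖ ≤ 2 * R} with hK
  have hKc : IsCompact K := hD.isCompact_truncatedExterior hδ (2 * R)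
  have hψ0 : ∀ z ∉ K, χ z * η z ^ 2 = 0 := by
    intro z hz
    by_cases h1 : curveDist γ z ≤ δ
    · rw [hχ, boundaryCutoff_eq_zero hδ h1, zero_mul]
    by_cases h2 : 2 * R ≤ ‖z‖
    · rw [hηzero z h2]; ring
    push Not at h1 h2
    have h3 : z ∉ extC D := fun h => hz ⟨h, h1.le, h2.le⟩
    rw [hχ, boundaryCutoff, indicator_of_notMem h3, zero_mul]
  -- The vector field `χ η² arctan(V) ∇V`, in complex form. It has compact support, so its
  -- divergence integrates to zero; as `arctan` is bounded, no bound on `V` is needed.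
  set X : ℂ → ℂ := fun z => ((χ z * η z ^ 2 * Real.arctan (V z) : ℝ) : ℂ) * F z with hX
  have hX0 : ∀ z ∉ K, X z = 0 := fun z hz => by
    simp only [hX, hψ0 z hz, zero_mul, Complex.ofReal_zero]
  have hFd : DifferentiableOn ℂ F (extC D) := fun z hz =>
    (HarmonicAt.differentiableAt_complex_partial (hV z hz)).differentiableWithinAt
  have hFa := hFd.analyticOnNhd (isOpen_extC D)
  have hKe : K ⊆ extC D := fun z hz => hz.1
  obtain ⟨b₁, hb₁⟩ := hKc.exists_bound_of_continuousOn (hFa.continuousOn.mono hKe)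
  obtain ⟨b₂, hb₂⟩ := hKc.exists_bound_of_continuousOn (hFa.deriv.continuousOn.mono hKe)
  have hder : ∀ z ∈ K, ∃ X' : ℂ →L[ℝ] ℂ, HasFDerivAt X X' z ∧
      X' 1 + Complex.I * X' Complex.I =
        ((χ z * η z ^ 2 * (‖F z‖ ^ 2 / (1 + V z ^ 2)) : ℝ) : ℂ) +
          (Real.arctan (V z) : ℂ) * (F z * ((η z ^ 2 : ℝ) * formGrad (fderiv ℝ χ z) +
            (2 * χ z * η z : ℝ) * formGrad (fderiv ℝ η z))) ∧
      ‖X'‖ ≤ Real.pi / 2 * b₁ * (M / δ + 2 * (M₁ / R)) + b₁ ^ 2 + Real.pi / 2 * b₂ := by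
    intro z hz
    have hψ : HasFDerivAt (fun z => χ z * η z ^ 2)
        ((η z ^ 2) • fderiv ℝ χ z + (2 * χ z * η z) • fderiv ℝ η z) z := by
      refine ((hχd z).mul ((hηd z).hasFDerivAt.pow 2)).congr_fderiv ?_
      ext w
      simp
      ring
    obtain ⟨X', h1, h2, h3⟩ := divergence_eq hψ ((hV z hz.1).1.differentiableAt (by norm_num))
      (hFd.differentiableAt ((isOpen_extC D).mem_nhds hz.1)).hasDerivAt
      (fderiv_eq_re_complexGrad V z)
    have hχ0 := boundaryCutoff_nonneg D γ δ z
    have hχ1 := boundaryCutoff_le_one D γ δ z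
    refine ⟨X', h1, h2.trans ?_, h3.trans ?_⟩
    · simp only [formGrad, add_apply, smul_apply, smul_eq_mul]
      push_cast
      ring
    · have hη2 : η z ^ 2 ≤ 1 := pow_le_one₀ (hη0 z) (hη1 z)
      have h4 : |χ z * η z ^ 2| ≤ 1 := by
        rw [abs_of_nonneg (by positivity)]
        exact mul_le_one₀ hχ1 (by positivity) hη2
      have h5 : ‖(η z ^ 2) • fderiv ℝ χ z + (2 * χ z * η z) • fderiv ℝ η z‖ ≤
          M / δ + 2 * (M₁ / R) := by
        refine (norm_add_le _ _).trans (add_le_add ?_ ?_)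
        · rw [norm_smul, Real.norm_of_nonneg (by positivity)]
          exact (mul_le_mul hη2 (hχn z) (norm_nonneg _) zero_le_one).trans_eq (one_mul _)
        · have := hη0 z
          rw [norm_smul, Real.norm_of_nonneg (by positivity)]
          have h6 : 2 * χ z * η z ≤ 2 := by
            have := mul_le_one₀ hχ1 (hη0 z) (hη1 z)
            linarith
          exact mul_le_mul h6 (hηb z) (norm_nonneg _) zero_le_two
      have h6 := hb₁ z hz
      have h7 := hb₂ z hz
      have hb₁0 : 0 ≤ b₁ := (norm_nonneg _).trans h6
      have hb₂0 : 0 ≤ b₂ := (norm_nonneg _).trans h7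
      refine add_le_add (add_le_add ?_ ?_) ?_
      · gcongr
      · calc _ ≤ 1 * b₁ ^ 2 := by gcongr
          _ = _ := one_mul _
      · calc _ ≤ Real.pi / 2 * 1 * b₂ := by gcongr
          _ = _ := by ring
  have hXz : ∀ z ∉ K, HasFDerivAt X (0 : ℂ →L[ℝ] ℂ) z := fun z hz => by
    refine (hasFDerivAt_const (0 : ℂ) z).congr_of_eventuallyEq ?_
    filter_upwards [hKc.isClosed.isOpen_compl.mem_nhds hz] with y hy using hX0 y hy
  have hXd : Differentiable ℝ X := fun z => by
    by_cases hz : z ∈ K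
    · obtain ⟨X', h, -⟩ := hder z hz
      exact h.differentiableAt
    · exact (hXz z hz).differentiableAt
  have hXb : ∀ z ∈ K, ‖fderiv ℝ X z‖ ≤
      Real.pi / 2 * b₁ * (M / δ + 2 * (M₁ / R)) + b₁ ^ 2 + Real.pi / 2 * b₂ := fun z hz => by
    obtain ⟨X', h, -, h'⟩ := hder z hz
    rwa [h.fderiv]
  obtain ⟨i1, e1⟩ := integral_fderiv_eq_zero hXd hKc hX0 hXb 1
  obtain ⟨i2, e2⟩ := integral_fderiv_eq_zero hXd hKc hX0 hXb Complex.I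
  set E : ℂ → ℝ := fun z => (fderiv ℝ X z 1 + Complex.I * fderiv ℝ X z Complex.I).re with hE
  have iE' := i1.add (i2.const_mul Complex.I)
  have iE : Integrable E := iE'.re
  have eE : ∫ z, E z = 0 := by
    have h1 : ∫ z, (fderiv ℝ X z 1 + Complex.I * fderiv ℝ X z Complex.I) = 0 := by
      rw [integral_add i1 (i2.const_mul _), integral_const_mul, e1, e2]; simp
    have h2 := integral_re iE'
    simp only [Pi.add_apply, RCLike.re_to_complex] at h2
    rw [h1] at h2
    simpa [hE] using h2
  -- the contribution of the inner cut-off function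
  set T₁ : ℂ → ℝ := fun z => |(F z * formGrad (fderiv ℝ χ z)).re| with hT₁
  have hχm : ∀ w, Measurable fun z => fderiv ℝ χ z w := measurable_fderiv_apply_const ℝ χ
  have hFm : Measurable F := measurable_complexGrad V
  have hT₁l := hD.lintegral_cutoff_le hM0 hδ hw hχA hχm hFm hBε
  have hT₁m : AEStronglyMeasurable T₁ := by
    have h1 := hχm 1
    have h2 := hχm Complex.I
    have h3 : Measurable fun z => formGrad (fderiv ℝ χ z) := by unfold formGrad; fun_prop
    have h4 : Measurable fun z => (F z * formGrad (fderiv ℝ χ z)).re :=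
      Complex.measurable_re.comp (hFm.mul h3)
    exact h4.abs.aestronglyMeasurable
  have hT₁0 : 0 ≤ᵐ[volume] T₁ := Eventually.of_forall fun z => abs_nonneg _
  have iT₁ : Integrable T₁ := by
    refine ⟨hT₁m, ?_⟩
    rw [hasFiniteIntegral_iff_ofReal hT₁0]
    exact hT₁l.trans_lt ENNReal.ofReal_lt_top
  have eT₁ : ∫ z, T₁ z ≤ 2 * M * B := by
    rw [integral_eq_lintegral_of_nonneg_ae hT₁0 hT₁m]
    exact ENNReal.toReal_le_of_le_ofReal (by positivity) hT₁l
  -- the contribution of the outer cut-off function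
  set q : ℝ := 16 * C ^ 2 * M₁ ^ 2 / R ^ 4 with hq
  set Q : Set ℂ := Metric.closedBall 0 (2 * R) with hQ
  have hQv : volume.real Q = 4 * R ^ 2 * Real.pi := by
    rw [hQ, Measure.real, Complex.volume_closedBall, ENNReal.toReal_mul, ENNReal.toReal_pow,
      ENNReal.toReal_ofReal (by positivity)]
    simp
    ring
  have hQf : volume Q ≠ ⊤ := (isCompact_closedBall (0 : ℂ) (2 * R)).measure_lt_top.ne
  have iQ : Integrable (Q.indicator fun _ => q) :=
    (integrable_indicator_iff Metric.isClosed_closedBall.measurableSet).2 (integrableOn_const hQf)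
  have hUK : U ⊆ K := fun z hz => by
    obtain ⟨h1, h2, h3, -⟩ := hUm z hz
    exact ⟨h1, by linarith, by linarith⟩
  have hUf : volume U ≠ ⊤ := ((measure_mono hUK).trans_lt hKc.measure_lt_top).ne
  have iU : Integrable (U.indicator fun _ => m / 2) :=
    (integrable_indicator_iff hU).2 (integrableOn_const hUf)
  -- the pointwise inequality to be integrated
  have hpt : ∀ z, U.indicator (fun _ => m / 2) z ≤
      E z + Real.pi / 2 * T₁ z + Q.indicator (fun _ => q) z := by
    intro z
    have hT₁z : 0 ≤ Real.pi / 2 * T₁ z := mul_nonneg (by positivity) (abs_nonneg _)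
    have hQz : 0 ≤ Q.indicator (fun _ => q) z := indicator_nonneg (fun _ _ => by positivity) z
    by_cases hz : z ∈ K
    swap
    · rw [indicator_of_notMem (fun h => hz (hUK h))]
      have : E z = 0 := by simp [hE, (hXz z hz).fderiv]
      linarith
    obtain ⟨X', h1, h2, -⟩ := hder z hz
    set a₂ := (F z * formGrad (fderiv ℝ η z)).re with ha₂
    have hEz : E z = χ z * η z ^ 2 * (‖F z‖ ^ 2 / (1 + V z ^ 2)) + Real.arctan (V z) *
        (η z ^ 2 * (F z * formGrad (fderiv ℝ χ z)).re + 2 * χ z * η z * a₂) := by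
      simp only [hE, h1.fderiv, h2]
      rw [Complex.add_re, Complex.ofReal_re, Complex.re_ofReal_mul, mul_add, Complex.add_re,
        mul_left_comm, Complex.re_ofReal_mul, mul_left_comm (F z), Complex.re_ofReal_mul]
    have hpw := energy_pointwise (v := V z) (f := ‖F z‖) (g := ‖formGrad (fderiv ℝ η z)‖)
      (b := Real.arctan (V z)) (a₁ := (F z * formGrad (fderiv ℝ χ z)).re) (a₂ := a₂)
      (boundaryCutoff_nonneg D γ δ z) (boundaryCutoff_le_one D γ δ z) (hη0 z) (hη1 z)
      (abs_arctan_le_pi_div_two _) ((Complex.abs_re_le_norm _).trans (norm_mul_le _ _))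
    have hlow : U.indicator (fun _ => m / 2) z ≤
        χ z * η z ^ 2 * (‖F z‖ ^ 2 / (1 + V z ^ 2)) / 2 := by
      by_cases hzU : z ∈ U
      · obtain ⟨h3, h4, h5, h6⟩ := hUm z hzU
        rw [indicator_of_mem hzU, hχ, boundaryCutoff_eq_one hδ h3 h4, hηone z h5]
        linarith
      · rw [indicator_of_notMem hzU]
        have := boundaryCutoff_nonneg D γ δ z
        positivity
    have hup : 2 * (Real.arctan (V z) ^ 2 * (1 + V z ^ 2) * ‖formGrad (fderiv ℝ η z)‖ ^ 2) ≤
        Q.indicator (fun _ => q) z := by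
      rw [indicator_of_mem (by rw [hQ, mem_closedBall_zero_iff]; exact hz.2.2)]
      rcases lt_or_ge ‖z‖ R with hzR | hzR
      · rw [hηflat z hzR]
        have : formGrad (0 : ℂ →L[ℝ] ℝ) = 0 := by simp [formGrad]
        rw [this, norm_zero]
        simp only [ne_eq, OfNat.ofNat_ne_zero, not_false_eq_true, zero_pow, mul_zero]
        positivity
      · have h3 : |V z| ≤ C / R := (hdec z hz.1 hzR).trans (by gcongr)
        have h4 : C / R ≤ 1 := div_le_one_of_le₀ hCR hR.le
        have h5 : V z ^ 2 ≤ (C / R) ^ 2 := by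
          rw [← sq_abs]; gcongr
        have h6 : (C / R) ^ 2 ≤ 1 := pow_le_one₀ (by positivity) h4
        have h7 : Real.arctan (V z) ^ 2 ≤ (C / R) ^ 2 := by
          rw [← sq_abs]
          have := (abs_arctan_le_abs (V z)).trans h3
          gcongr
        have h8 : ‖formGrad (fderiv ℝ η z)‖ ≤ 2 * (M₁ / R) :=
          (norm_formGrad_le _).trans (by gcongr; exact hηb z)
        calc _ ≤ 2 * ((C / R) ^ 2 * 2 * (2 * (M₁ / R)) ^ 2) := by
              gcongr
              linarith
          _ = q := by rw [hq]; field_simp; ring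
    rw [hEz]
    linarith
  have hint := integral_mono iU ((iE.add (iT₁.const_mul (Real.pi / 2))).add iQ) hpt
  simp only [Pi.add_apply] at hint
  rw [integral_indicator_const _ hU] at hint
  have e4 : ∫ z, (E z + Real.pi / 2 * T₁ z + Q.indicator (fun _ => q) z) =
      Real.pi / 2 * (∫ z, T₁ z) + 4 * R ^ 2 * Real.pi * q := by
    refine (integral_add (iE.add (iT₁.const_mul (Real.pi / 2))) iQ).trans ?_
    rw [integral_indicator_const _ Metric.isClosed_closedBall.measurableSet, hQv, smul_eq_mul]
    congr 1
    refine (integral_add iE (iT₁.const_mul (Real.pi / 2))).trans ?_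
    rw [eE, integral_const_mul, zero_add]
  rw [e4, smul_eq_mul] at hint
  have e3 : 4 * R ^ 2 * Real.pi * q = 64 * Real.pi * M₁ ^ 2 * (C ^ 2 / R ^ 2) := by
    rw [hq]; field_simp; ring
  rw [e3] at hint
  have h9 : Real.pi / 2 * ∫ z, T₁ z ≤ Real.pi / 2 * (2 * M * B) := by gcongr
  have h10 : 0 ≤ Real.pi * M * (C ^ 2 / R ^ 2) := by positivity
  have h11 : 0 ≤ Real.pi * M₁ ^ 2 * B := by positivity
  nlinarith

/-- A harmonic function whose mean normal derivatives tend to zero at the boundary, and which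
decays at infinity, has gradient zero. -/
theorem complexGrad_eq_zero (hD : IsC2Domain D γ L) {V : ℂ → ℝ}
    (hV : ∀ z ∈ extC D, InnerProductSpace.HarmonicAt V z) {C R₀ : ℝ}
    (hdec : ∀ z ∈ extC D, R₀ ≤ ‖z‖ → |V z| ≤ C / ‖z‖)
    (hn : Tendsto (fun ε => ∫⁻ s, ENNReal.ofReal
      |(complexGrad V (parallel (curveC γ) ε s) * (-Complex.I * deriv (curveC γ) s)).re|
        ∂(arcMeasure L)) (𝓝[>] 0) (𝓝 0)) {z₀ : ℂ} (hz₀ : z₀ ∈ extC D) :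
    complexGrad V z₀ = 0 := by
  by_contra hne
  obtain ⟨Kc, hKc, henergy⟩ := hD.energy_le
  have hw := hD.isArcCurve.width_pos
  set F := complexGrad V with hF
  -- a ball on which the energy density is bounded below
  set k : ℂ → ℝ := fun z => ‖F z‖ ^ 2 / (1 + V z ^ 2) with hk
  have hkc : ContinuousAt k z₀ := by
    have h1 : ContinuousAt F z₀ :=
      (HarmonicAt.differentiableAt_complex_partial (hV z₀ hz₀)).continuousAt
    have h2 : ContinuousAt V z₀ := (hV z₀ hz₀).1.continuousAt
    refine (h1.norm.pow 2).div (continuousAt_const.add (h2.pow 2)) ?_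
    positivity
  set m := k z₀ / 2 with hm
  have hk0 : 0 < k z₀ := by
    have := norm_pos_iff.2 hne
    simp only [hk]; positivity
  have hd0 := hD.curveDist_pos hz₀
  have hev : ∀ᶠ z in 𝓝 z₀, z ∈ extC D ∧ curveDist γ z₀ / 2 < curveDist γ z ∧ ‖z‖ < ‖z₀‖ + 1 ∧
      m < k z := by
    filter_upwards [(isOpen_extC D).mem_nhds hz₀,
      (continuous_curveDist γ).continuousAt.eventually (lt_mem_nhds (half_lt_self hd0)),
      continuous_norm.continuousAt.eventually (gt_mem_nhds (lt_add_one ‖z₀‖)),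
      hkc.eventually (lt_mem_nhds (half_lt_self hk0))] with z h1 h2 h3 h4
    exact ⟨h1, h2, h3, h4⟩
  obtain ⟨ρ, hρ, hball⟩ := Metric.eventually_nhds_iff_ball.1 hev
  set U := Metric.ball z₀ ρ with hU
  have hUv : 0 < volume.real U := by
    refine ENNReal.toReal_pos (Metric.measure_ball_pos volume z₀ hρ).ne' ?_
    exact measure_ball_lt_top.ne
  have hm0 : 0 < m := by positivity
  set a := m * volume.real U with ha
  have ha0 : 0 < a := mul_pos hm0 hUv
  set C' := max C 0 with hC'
  set B := a / (4 * Kc) with hB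
  have hB0 : 0 < B := by positivity
  -- the inner cut-off
  have hnB : ∀ᶠ ε in 𝓝[>] (0 : ℝ), ∫⁻ s, ENNReal.ofReal
      |(F (parallel (curveC γ) ε s) * (-Complex.I * deriv (curveC γ) s)).re| ∂(arcMeasure L) <
        ENNReal.ofReal B :=
    hn.eventually (gt_mem_nhds (ENNReal.ofReal_pos.2 hB0))
  obtain ⟨ε₀, hε₀, hε₀B⟩ := mem_nhdsGT_iff_exists_Ioo_subset.1 hnB
  rw [mem_Ioi] at hε₀
  obtain ⟨δ, hδ0, hδ⟩ := exists_between
    (lt_min (lt_min (half_pos hε₀) (half_pos hw)) (by positivity : 0 < curveDist γ z₀ / 4))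
  have hδ1 : δ < ε₀ / 2 := hδ.trans_le ((min_le_left _ _).trans (min_le_left _ _))
  have hδ2 : δ < hD.isArcCurve.width / 2 := hδ.trans_le ((min_le_left _ _).trans (min_le_right _ _))
  have hδ3 : δ < curveDist γ z₀ / 4 := hδ.trans_le (min_le_right _ _)
  -- the outer cut-off
  have hlim : Tendsto (fun R : ℝ => C' ^ 2 / R ^ 2) atTop (𝓝 0) :=
    Tendsto.div_atTop tendsto_const_nhds (tendsto_pow_atTop two_ne_zero)
  obtain ⟨R, hR1, hR2⟩ := ((hlim.eventually (gt_mem_nhds hB0)).and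
    (eventually_ge_atTop (max (max C' R₀) (‖z₀‖ + 1)))).exists
  have hR3 : C' ≤ R := ((le_max_left _ _).trans (le_max_left _ _)).trans hR2
  have hR4 : R₀ ≤ R := ((le_max_right _ _).trans (le_max_left _ _)).trans hR2
  have hR5 : ‖z₀‖ + 1 ≤ R := (le_max_right _ _).trans hR2
  have hR0 : 0 < R := by linarith [norm_nonneg z₀]
  have key := henergy hV (m := m) (B := B) (C := C') (U := U) hδ0 (by linarith) hR0
    (le_max_right _ _) hR3
    (fun z hz hzR => (hdec z hz (hR4.trans hzR)).trans (by gcongr; exact le_max_left _ _)) hB0.le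
    (fun ε hε => le_of_lt (hε₀B ⟨hδ0.trans_le hε.1, by linarith [hε.2]⟩)) measurableSet_ball
    (fun z hz => by
      obtain ⟨h1, h2, h3, h4⟩ := hball z hz
      exact ⟨h1, by linarith, by linarith, h4.le⟩)
  have h5 : Kc * (B + C' ^ 2 / R ^ 2) ≤ Kc * (B + B) := by gcongr
  have h6 : Kc * (B + B) = a / 2 := by rw [hB]; field_simp; ring
  linarith

/-- The exterior Neumann problem with decay at infinity has at most one solution, with boundary
values in the mean-square sense and no assumption on the boundary values of the solution. -/
theorem eq_zero_of_neumann (hD : IsC2Domain D γ L) {v : Plane → ℝ}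
    (hv : InnerProductSpace.HarmonicOnNhd v (closure D)ᶜ)
    (hn : HasExteriorTrace γ L (fun x s => dirDeriv v x (normal γ s)) (fun _ => 0))
    (hdec : v =O[Bornology.cobounded Plane] fun x => ‖x‖⁻¹) {x : Plane} (hx : x ∈ (closure D)ᶜ) :
    v x = 0 := by
  have hc := hD.isArcCurve
  set V : ℂ → ℝ := fun z => v (toC.symm z) with hVdef
  have hV : ∀ z ∈ extC D, InnerProductSpace.HarmonicAt V z := fun z hz =>
    harmonicAt_comp_isometry toC.symm (hv _ hz)
  have hmem : ∀ y ∈ (closure D)ᶜ, toC y ∈ extC D := fun y hy => by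
    rwa [extC, mem_preimage, toC.symm_apply_apply]
  have hfd : ∀ y ∈ (closure D)ᶜ, ∀ w, fderiv ℝ v y w = (complexGrad V (toC y) * toC w).re := by
    intro y hy w
    rw [← fderiv_eq_re_complexGrad]
    have h1 : HasFDerivAt V (fderiv ℝ V (toC y)) (toC y) :=
      ((hV _ (hmem y hy)).1.differentiableAt (by norm_num)).hasFDerivAt
    have h2 : HasFDerivAt (fun y => V (toC y)) _ y :=
      h1.comp y (toC : Plane →L[ℝ] ℂ).hasFDerivAt
    have h3 : (fun y => V (toC y)) = v := funext fun y => by simp [hVdef]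
    rw [h3] at h2
    rw [h2.fderiv]
    rfl
  obtain ⟨C, hC⟩ := hdec.bound
  obtain ⟨R₀, -, hR₀⟩ := (hasBasis_cobounded_norm (E := Plane)).eventually_iff.1 hC
  -- the trace in `L²` controls the flux in `L¹`, and the energy estimate applies
  have hgrad : ∀ z ∈ extC D, complexGrad V z = 0 := by
    refine fun z hz => hD.complexGrad_eq_zero hV (C := C) (R₀ := R₀) (fun z _ hzR => ?_) ?_ hz
    · have h1 : R₀ ≤ ‖toC.symm z‖ := by rwa [toC.symm.norm_map]
      have h2 := hR₀ h1
      rwa [Real.norm_eq_abs, norm_inv, norm_norm, toC.symm.norm_map, ← div_eq_mul_inv] at h2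
    · set N : ℝ → ℝ → ℝ := fun ε s => (complexGrad V (parallel (curveC γ) ε s) *
        (-Complex.I * deriv (curveC γ) s)).re with hN
      have hNm : ∀ ε, Measurable (N ε) := fun ε => by
        have h1 := (measurable_complexGrad V).comp (hc.measurable_parallel ε)
        have h2 := hc.continuous_deriv.measurable
        exact Complex.measurable_re.comp (h1.mul (h2.const_mul _))
      have h1 : Tendsto (fun ε => eLpNorm (N ε) 2 (arcMeasure L) *
          arcMeasure L univ ^ (1 / (1 : ENNReal).toReal - 1 / (2 : ENNReal).toReal))
          (𝓝[>] 0) (𝓝 0) := by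
        rw [← zero_mul (arcMeasure L univ ^ (1 / (1 : ENNReal).toReal - 1 / (2 : ENNReal).toReal))]
        refine ENNReal.Tendsto.mul_const ?_ (Or.inr ?_)
        · refine hn.2.congr' ?_
          filter_upwards [Ioo_mem_nhdsGT hc.width_pos] with ε hε
          congr 1
          ext s
          rw [sub_zero, dirDeriv, hfd _ (hD.parallel_mem hε.1 hε.2.le s), hD.toC_parallel,
            hD.toC_normal]
        · exact ENNReal.rpow_ne_top_of_nonneg (by norm_num) (measure_ne_top _ _)
      refine tendsto_of_tendsto_of_tendsto_of_le_of_le tendsto_const_nhds h1 (fun _ => zero_le)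
        fun ε => ?_
      refine le_trans (le_of_eq ?_) (eLpNorm_le_eLpNorm_mul_rpow_measure_univ
        (one_le_two (α := ENNReal)) (hNm ε).aestronglyMeasurable)
      rw [eLpNorm_one_eq_lintegral_enorm]
      simp only [← ofReal_norm, Real.norm_eq_abs, hN]
  -- `v` is constant on the connected exterior, and the constant is the limit zero at infinity
  have hfz : EqOn (fderiv ℝ v) 0 (closure D)ᶜ := fun y hy => by
    ext w
    rw [hfd y hy, hgrad _ (hmem y hy)]
    simp
  obtain ⟨a, ha⟩ := (isOpen_exterior D).exists_is_const_of_fderiv_eq_zero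
    hD.isConnected_exterior.isPreconnected
    (fun y hy => ((hv y hy).1.differentiableAt (by norm_num)).differentiableWithinAt) hfz
  have h0 : Tendsto v (Bornology.cobounded Plane) (𝓝 0) :=
    hdec.trans_tendsto (tendsto_inv_atTop_zero.comp tendsto_norm_cobounded_atTop)
  have h1 : Tendsto v (Bornology.cobounded Plane) (𝓝 a) := by
    refine tendsto_const_nhds.congr' ?_
    filter_upwards [hD.eventually_exterior] with y hy using (ha y hy).symm
  rw [ha x hx]
  exact tendsto_nhds_unique h1 h0

end IsC2Domain

/-! ### Boundary values of the potentials -/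

namespace IsArcCurve

variable {c : ℝ → ℂ} {L : ℝ}

/-- A continuous function of the plane has its restriction as trace. -/
theorem traceLim_continuous (hc : IsArcCurve c L) {F : ℂ → ℂ} (hF : Continuous F) :
    TraceLim (arcMeasure L) (fun ε s => F (parallel c ε s)) (fun s => F (c s)) := by
  have hcont : Continuous fun p : ℝ × ℝ => F (parallel c p.1 p.2) := hF.comp hc.continuous_parallel
  obtain ⟨C, hC⟩ := (isCompact_Icc.prod isCompact_Icc : IsCompact
    (Icc (0 : ℝ) 1 ×ˢ Icc (0 : ℝ) L)).exists_bound_of_continuousOn hcont.continuousOn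
  refine TraceLim.of_bounded C (Eventually.of_forall fun ε => ?_) ?_ ?_
  · exact (hF.measurable.comp (hc.measurable_parallel ε)).aestronglyMeasurable
  · filter_upwards [Ioo_mem_nhdsGT one_pos] with ε hε
    filter_upwards [ae_mem_Ioc L] with s hs
    exact hC (ε, s) ⟨Ioo_subset_Icc_self hε, Ioc_subset_Icc_self hs⟩
  · exact Eventually.of_forall fun s => (hF.tendsto _).comp (tendsto_parallel c s)

/-- Integration by parts on the boundary for the boundary values of a holomorphic function and of
its derivative. -/
theorem integral_trace_eq_zero (hc : IsArcCurve c L) {W W' : ℂ → ℂ} {w w' : ℝ → ℂ}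
    (hW : ∀ ε, 0 < ε → ε < hc.width → ∀ s, HasDerivAt W (W' (parallel c ε s)) (parallel c ε s))
    (hW' : ∀ ε, 0 < ε → ε < hc.width → Continuous fun s => W' (parallel c ε s))
    (hw : TraceLim (arcMeasure L) (fun ε s => W (parallel c ε s)) w)
    (hw' : TraceLim (arcMeasure L) (fun ε s => W' (parallel c ε s)) w')
    {n n' : ℝ → ℂ} (hn : ∀ t, HasDerivAt n (n' t) t) (hn' : Continuous n') (h0 : n 0 = n L) :
    ∫ s, (n' s * w s + n s * deriv c s * w' s) ∂(arcMeasure L) = 0 := by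
  have hL := hc.length_pos.le
  have cn : Continuous n := continuous_iff_continuousAt.2 fun t => (hn t).continuousAt
  have cT := hc.continuous_deriv
  have cτ := hc.continuous_curvC
  have h1 := (hw.continuous_mul hn').add (hw'.continuous_mul (cn.mul cT))
  have h2 := hw'.continuous_mul ((cn.mul cT).mul (Complex.continuous_ofReal.comp cτ))
  have h3 := h2.vanish (m := fun _ => (1 : ℂ)) (C := 1) aestronglyMeasurable_const (by simp)
  have h4 := (h1.sub h3).tendsto_integral
  simp only [sub_zero] at h4
  refine tendsto_nhds_unique h4 (tendsto_const_nhds.congr' ?_)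
  filter_upwards [Ioo_mem_nhdsGT hc.width_pos] with ε hε
  have hd : ∀ s, HasDerivAt (fun s => n s * W (parallel c ε s))
      (n' s * W (parallel c ε s) + n s * (W' (parallel c ε s) *
        (((1 - ε * curvC c s : ℝ) : ℂ) * deriv c s))) s := fun s =>
    (hn s).mul ((hW ε hε.1 hε.2 s).comp s (hc.hasDerivAt_parallel ε s))
  have hWc : Continuous fun s => W (parallel c ε s) := continuous_iff_continuousAt.2 fun s =>
    ((hW ε hε.1 hε.2 s).comp s (hc.hasDerivAt_parallel ε s)).continuousAt
  have hdc : Continuous fun s => n' s * W (parallel c ε s) + n s * (W' (parallel c ε s) *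
        (((1 - ε * curvC c s : ℝ) : ℂ) * deriv c s)) :=
    (hn'.mul hWc).add (cn.mul ((hW' ε hε.1 hε.2).mul
      ((Complex.continuous_ofReal.comp (by fun_prop)).mul cT)))
  have hint := intervalIntegral.integral_eq_sub_of_hasDerivAt (a := 0) (b := L) (fun s _ => hd s)
    (hdc.intervalIntegrable _ _)
  have hper := hc.parallel_periodic ε 0
  rw [zero_add] at hper
  rw [← integral_arcMeasure hL, hper, ← h0, sub_self] at hint
  rw [← hint]
  refine integral_congr_ae (Eventually.of_forall fun s => ?_)
  have hco : ((ε : ℝ) : ℂ) = (RCLike.ofReal ε : ℂ) := rfl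
  simp only [Function.comp_apply, Pi.mul_apply]
  push_cast
  rw [← hco]
  ring

end IsArcCurve

theorem HasExteriorTrace.ae_unique {γ : ℝ → Plane} {L : ℝ} {F : Plane → ℝ → ℝ} {e e' : ℝ → ℝ}
    (h : HasExteriorTrace γ L F e)
    (h' : TraceLim (arcMeasure L) (fun ε s => F (γ s + ε • normal γ s) s) e') :
    e =ᵐ[arcMeasure L] e' := by
  filter_upwards [h.1, h'.ae_tendsto] with s h1 h2 using tendsto_nhds_unique h1 h2

namespace IsC2Domain

variable {D : Set Plane} {γ : ℝ → Plane} {L : ℝ}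

theorem measurable_dirDeriv_normal (hD : IsC2Domain D γ L) (v : Plane → ℝ) (ε : ℝ) :
    Measurable fun s => dirDeriv v (γ s + ε • normal γ s) (normal γ s) := by
  have hdγ : Continuous (deriv γ) := hD.contDiff.continuous_deriv (by norm_num)
  have h0 : Continuous fun s => deriv γ s 0 := by fun_prop
  have h1 : Continuous fun s => deriv γ s 1 := by fun_prop
  have hn : Continuous (normal γ) := by
    unfold normal
    refine (PiLp.continuous_toLp 2 _).comp (continuous_pi fun i => ?_)
    fin_cases i
    · exact h1
    · exact h0.neg
  have hp : Measurable fun s => γ s + ε • normal γ s :=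
    (hD.contDiff.continuous.add (hn.const_smul ε)).measurable
  have e : ∀ s, dirDeriv v (γ s + ε • normal γ s) (normal γ s) =
      deriv γ s 1 * fderiv ℝ v (γ s + ε • normal γ s) (EuclideanSpace.single 0 1) -
        deriv γ s 0 * fderiv ℝ v (γ s + ε • normal γ s) (EuclideanSpace.single 1 1) := by
    intro s
    have : normal γ s = deriv γ s 1 • EuclideanSpace.single (0 : Fin 2) (1 : ℝ) -
        deriv γ s 0 • EuclideanSpace.single (1 : Fin 2) (1 : ℝ) := by
      ext i
      fin_cases i <;> simp [normal]
    rw [dirDeriv]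
    conv_lhs => rw [this]
    rw [map_sub, map_smul, map_smul, smul_eq_mul, smul_eq_mul]
    rw [← this]
  simp only [e]
  exact (h1.measurable.mul ((measurable_fderiv_apply_const ℝ v _).comp hp)).sub
    (h0.measurable.mul ((measurable_fderiv_apply_const ℝ v _).comp hp))

theorem traceLim_of_hasExteriorTrace (hD : IsC2Domain D γ L) {v : Plane → ℝ} {e e' : ℝ → ℝ}
    (h : HasExteriorTrace γ L (fun x s => dirDeriv v x (normal γ s)) e)
    (he' : MemLp e' 2 (arcMeasure L)) (hee' : e =ᵐ[arcMeasure L] e') :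
    TraceLim (arcMeasure L) (fun ε s => dirDeriv v (γ s + ε • normal γ s) (normal γ s)) e' := by
  have hl2 : Tendsto (fun ε : ℝ => eLpNorm (fun s =>
      dirDeriv v (γ s + ε • normal γ s) (normal γ s) - e' s) 2 (arcMeasure L)) (𝓝[>] 0) (𝓝 0) := by
    refine h.2.congr fun ε => eLpNorm_congr_ae ?_
    filter_upwards [hee'] with s hs
    simp only [hs]
  refine ⟨?_, ?_, hl2⟩
  · filter_upwards [hl2.eventually (gt_mem_nhds one_pos)] with ε hε
    have h1 : MemLp (fun s => dirDeriv v (γ s + ε • normal γ s) (normal γ s) - e' s) 2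
        (arcMeasure L) :=
      ⟨(hD.measurable_dirDeriv_normal v ε).aestronglyMeasurable.sub he'.1,
        hε.trans ENNReal.one_lt_top⟩
    refine (memLp_congr_ae (Eventually.of_forall fun s => ?_)).1 (h1.add he')
    simp
  · filter_upwards [h.1, hee'] with s h1 h2
    rw [← h2]; exact h1

/-- Harmonic functions in the exterior with the same normal derivative at the boundary, whose
difference decays at infinity, are equal. -/
theorem eq_of_neumann (hD : IsC2Domain D γ L) {u v : Plane → ℝ} {e : ℝ → ℝ}
    (hu : InnerProductSpace.HarmonicOnNhd u (closure D)ᶜ)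
    (hv : InnerProductSpace.HarmonicOnNhd v (closure D)ᶜ)
    (hun : TraceLim (arcMeasure L)
      (fun ε s => dirDeriv u (γ s + ε • normal γ s) (normal γ s)) e)
    (hvn : TraceLim (arcMeasure L)
      (fun ε s => dirDeriv v (γ s + ε • normal γ s) (normal γ s)) e)
    (hdec : (fun x => u x - v x) =O[Bornology.cobounded Plane] fun x => ‖x‖⁻¹)
    {x : Plane} (hx : x ∈ (closure D)ᶜ) : u x = v x := by
  refine sub_eq_zero.1 (hD.eq_zero_of_neumann (v := fun x => u x - v x)
    (fun y hy => (hu y hy).sub (hv y hy)) ?_ hdec hx)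
  refine TraceLim.hasExteriorTrace ((hun.sub hvn).congr_of_forall hD.isArcCurve.width_pos
    (S := univ) (by simp) (fun ε hε hε' s _ => ?_) (Eventually.of_forall fun s => (sub_self _).symm))
  have hm := hD.parallel_mem hε hε'.le s
  have h1 := ((hu _ hm).1.differentiableAt (by norm_num)).hasFDerivAt
  have h2 := ((hv _ hm).1.differentiableAt (by norm_num)).hasFDerivAt
  rw [dirDeriv, (h1.fun_sub h2).fderiv]
  rfl

end IsC2Domain

/-! ### The unperturbed potential -/

namespace IsC2Domain

variable {D : Set Plane} {γ : ℝ → Plane} {L : ℝ}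

theorem harmonicOnNhd_singleLayer (hD : IsC2Domain D γ L) {ϑ : ℝ → ℝ}
    (hϑ : Integrable ϑ (arcMeasure L)) :
    InnerProductSpace.HarmonicOnNhd (singleLayer γ L ϑ) (closure D)ᶜ := fun _ hx =>
  harmonicAt_of_gradForm (isOpen_exterior D)
    (F := fun z => ((1 / (2 * Real.pi) : ℝ) : ℂ) * cauchyTr (curveC γ) L (fun t => (ϑ t : ℂ)) z)
    (F' := fun z => ((1 / (2 * Real.pi) : ℝ) : ℂ) * -cauchyTr₂ (curveC γ) L (fun t => (ϑ t : ℂ)) z)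
    (fun _ hy => hD.hasFDerivAt_singleLayer hϑ hy)
    (fun _ hy => (hD.isArcCurve.hasDerivAt_cauchyTr hϑ.ofReal (hD.toC_notMem hy)).const_mul _) hx

/-- The jump relation for the normal derivative of the single-layer potential. -/
theorem traceLim_normal_singleLayer (hD : IsC2Domain D γ L) {ϑ : ℝ → ℝ}
    (hϑ : MemLp ϑ 2 (arcMeasure L)) :
    TraceLim (arcMeasure L)
      (fun ε s => dirDeriv (singleLayer γ L ϑ) (γ s + ε • normal γ s) (normal γ s))
      (fun s => 1 / (2 * Real.pi) *
        (Real.pi * ϑ s + ∫ t, normalKer (curveC γ) s t * ϑ t ∂(arcMeasure L))) := by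
  have hc := hD.isArcCurve
  refine ((hc.traceLim_normal hϑ).const_mul (1 / (2 * Real.pi))).congr_of_forall hc.width_pos
    (S := univ) (by simp) (fun ε hε hε' s _ => ?_) (Eventually.of_forall fun s => rfl)
  rw [dirDeriv, (hD.hasFDerivAt_singleLayer (hϑ.integrable one_le_two)
    (hD.parallel_mem hε hε'.le s)).fderiv, gradForm_apply, hD.toC_parallel, hD.toC_normal,
    IsArcCurve.cauchyTr_parallel, mul_assoc, Complex.re_ofReal_mul, mul_comm (cauchyInt _ _ _ _ _)]

/-- The integral equation of the zeroth-order density. -/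
theorem zeroth_equation (hD : IsC2Domain D γ L) {H : Plane → ℝ} {F : ℂ → ℂ}
    (hH : ∀ x, HasFDerivAt H (gradForm (F (toC x))) x) {φ : ℝ → ℝ}
    (hφ : IsZerothDensity γ L H φ) :
    ∀ᵐ s ∂(arcMeasure L), Real.pi * φ s + ∫ t, normalKer (curveC γ) s t * φ t ∂(arcMeasure L) =
      -(2 * Real.pi) * (F (curveC γ s) * (-Complex.I * deriv (curveC γ) s)).re := by
  have hπ := Real.pi_pos
  filter_upwards [hφ.2, ae_mem_Ioc L] with s ⟨k, hk, hs⟩ hsm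
  have h1 := hD.eq_of_hasPV_npKernel (hφ.1.integrable one_le_two) hsm hk
  rw [dirDeriv, (hH _).fderiv, gradForm_apply, hD.toC_normal, h1] at hs
  rw [curveC, neg_mul, ← mul_neg, ← hs]
  field_simp

/-- The zeroth-order density is as regular as the data of its integral equation, which are the normal
derivative of an entire gradient on a curve of class `C²`. -/
theorem exists_weakDeriv_zeroth (hD : IsC2Domain D γ L) {H : Plane → ℝ} {F F' : ℂ → ℂ}
    (hH : ∀ x, HasFDerivAt H (gradForm (F (toC x))) x) (hF : ∀ z, HasDerivAt F (F' z) z)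
    (hF' : Continuous F') {φ : ℝ → ℝ} (hφ : IsZerothDensity γ L H φ) :
    ∃ ψ : ℝ → ℝ, MemLp ψ 2 (arcMeasure L) ∧ WeakDeriv L φ ψ := by
  have hc := hD.isArcCurve
  have hd : ∀ s, HasDerivAt (fun s => F (curveC γ s) * (-Complex.I * deriv (curveC γ) s))
      (F' (curveC γ s) * deriv (curveC γ) s * (-Complex.I * deriv (curveC γ) s) +
        F (curveC γ s) * (-Complex.I * deriv (deriv (curveC γ)) s)) s := fun s =>
    ((hF _).comp s (hc.hasDerivAt s)).mul ((hc.hasDerivAt_deriv s).const_mul _)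
  have hFc : Continuous F := continuous_iff_continuousAt.2 fun z => (hF z).continuousAt
  have c0 := hc.continuous; have c1 := hc.continuous_deriv; have c2 := hc.continuous_deriv₂
  have hdr : ∀ s, HasDerivAt (fun s => -(2 * Real.pi) *
      (F (curveC γ s) * (-Complex.I * deriv (curveC γ) s)).re) _ s := fun s =>
    (Complex.reCLM.hasFDerivAt.comp_hasDerivAt s (hd s)).const_mul (-(2 * Real.pi))
  refine hc.exists_weakDeriv hφ.1 hdr ?_ ?_ (hD.zeroth_equation hH hφ)
  · simp only [Complex.reCLM_apply]
    fun_prop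
  · have h1 := hc.periodic 0; have h2 := hc.deriv_periodic 0
    rw [zero_add] at h1 h2
    rw [h1, h2]

/-- The zeroth-order density has no total charge, since `H` has no flux through the curve. -/
theorem integral_zeroth (hD : IsC2Domain D γ L) {H : Plane → ℝ} {G F F' : ℂ → ℂ}
    (hH : ∀ x, HasFDerivAt H (gradForm (F (toC x))) x) (hG : ∀ z, HasDerivAt G (F z) z)
    (hF : ∀ z, HasDerivAt F (F' z) z) {φ : ℝ → ℝ} (hφ : IsZerothDensity γ L H φ) :
    ∫ s, φ s ∂(arcMeasure L) = 0 := by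
  have hc := hD.isArcCurve
  have hL := hc.length_pos.le
  have hπ := Real.pi_pos
  have hFc : Continuous F := continuous_iff_continuousAt.2 fun z => (hF z).continuousAt
  have c0 := hc.continuous; have c1 := hc.continuous_deriv
  have h1 : ∫ s, F (curveC γ s) * deriv (curveC γ) s ∂(arcMeasure L) = 0 := by
    rw [integral_arcMeasure hL, intervalIntegral.integral_eq_sub_of_hasDerivAt
      (f := fun s => G (curveC γ s)) (fun s _ => (hG _).comp s (hc.hasDerivAt s))
      (Continuous.intervalIntegrable (by fun_prop) _ _)]
    have h1 := hc.periodic 0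
    rw [zero_add] at h1
    rw [h1, sub_self]
  have h2 : ∫ s, (F (curveC γ s) * (-Complex.I * deriv (curveC γ) s)).re ∂(arcMeasure L) = 0 := by
    have hi : Integrable (fun s => F (curveC γ s) * (-Complex.I * deriv (curveC γ) s))
        (arcMeasure L) := integrable_of_continuous (by fun_prop)
    have h3 := integral_re hi
    simp only [RCLike.re_to_complex] at h3
    rw [h3]
    have e : ∀ s, F (curveC γ s) * (-Complex.I * deriv (curveC γ) s) =
        -Complex.I * (F (curveC γ s) * deriv (curveC γ) s) := fun s => by ring
    simp only [e]
    rw [integral_const_mul, h1]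
    simp
  have h3 := hD.integral_jump (hφ.1.integrable one_le_two)
  rw [integral_congr_ae (hD.zeroth_equation hH hφ), integral_const_mul, h2, mul_zero] at h3
  have : 2 * Real.pi ≠ 0 := by positivity
  exact (mul_eq_zero.1 h3.symm).resolve_left this

/-- The unperturbed potential is `H + S[φ]`. -/
theorem unperturbed_eq (hD : IsC2Domain D γ L) {H w : Plane → ℝ} {G F F' : ℂ → ℂ}
    (hH : ∀ x, HasFDerivAt H (gradForm (F (toC x))) x) (hG : ∀ z, HasDerivAt G (F z) z)
    (hF : ∀ z, HasDerivAt F (F' z) z) {φ : ℝ → ℝ} (hφ : IsZerothDensity γ L H φ)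
    (hw : IsUnperturbedPotential D γ L H w) {x : Plane} (hx : x ∈ (closure D)ᶜ) :
    w x = H x + singleLayer γ L φ x := by
  have hc := hD.isArcCurve
  have hπ := Real.pi_pos
  have hi := hφ.1.integrable one_le_two
  have hFc : Continuous F := continuous_iff_continuousAt.2 fun z => (hF z).continuousAt
  have hHh : InnerProductSpace.HarmonicOnNhd H (closure D)ᶜ := fun y _ =>
    harmonicAt_of_gradForm isOpen_univ (fun y _ => hH y) (fun y _ => hF _) (mem_univ y)
  have h1 := hD.traceLim_of_hasExteriorTrace hw.neumann (memLp_const 0) (ae_eq_refl _)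
  have h2 : TraceLim (arcMeasure L)
      (fun ε s => (F (parallel (curveC γ) ε s) * (-Complex.I * deriv (curveC γ) s)).re)
      (fun s => (F (curveC γ s) * (-Complex.I * deriv (curveC γ) s)).re) := by
    have c1 := hc.continuous_deriv
    have := ((hc.traceLim_continuous hFc).continuous_mul
      (η := fun s => -Complex.I * deriv (curveC γ) s) (by fun_prop)).re
    simp only [RCLike.re_to_complex] at this
    simpa only [mul_comm] using this
  have h3 : TraceLim (arcMeasure L)
      (fun ε s => dirDeriv (fun x => H x + singleLayer γ L φ x) (γ s + ε • normal γ s)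
        (normal γ s)) (fun _ => 0) := by
    refine (h2.add (hD.traceLim_normal_singleLayer hφ.1)).congr_of_forall hc.width_pos
      (ae_mem_Ioc L) (fun ε hε hε' s _ => ?_) ?_
    · have hm := hD.parallel_mem hε hε'.le s
      rw [dirDeriv, ((hH _).fun_add (hD.hasFDerivAt_singleLayer hi hm)).fderiv, dirDeriv,
        (hD.hasFDerivAt_singleLayer hi hm).fderiv, add_apply, gradForm_apply, hD.toC_normal,
        hD.toC_parallel]
    · filter_upwards [hD.zeroth_equation hH hφ] with s hs
      rw [hs]
      field_simp
      ring
  refine hD.eq_of_neumann (v := fun x => H x + singleLayer γ L φ x) hw.harmonic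
    (fun y hy => (hHh y hy).add (hD.harmonicOnNhd_singleLayer hi y hy)) h1 h3 ?_ hx
  have h4 := hw.decay.sub (hD.singleLayer_isBigO hi (hD.integral_zeroth hH hG hF hφ))
  simpa only [sub_sub] using h4

/-- The complex gradient of the unperturbed potential. -/
theorem hasFDerivAt_unperturbed (hD : IsC2Domain D γ L) {H w : Plane → ℝ} {G F F' : ℂ → ℂ}
    (hH : ∀ x, HasFDerivAt H (gradForm (F (toC x))) x) (hG : ∀ z, HasDerivAt G (F z) z)
    (hF : ∀ z, HasDerivAt F (F' z) z) {φ : ℝ → ℝ} (hφ : IsZerothDensity γ L H φ)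
    (hw : IsUnperturbedPotential D γ L H w) {x : Plane} (hx : x ∈ (closure D)ᶜ) :
    HasFDerivAt w (gradForm (F (toC x) + ((1 / (2 * Real.pi) : ℝ) : ℂ) *
      cauchyTr (curveC γ) L (fun t => (φ t : ℂ)) (toC x))) x := by
  rw [map_add]
  refine ((hH x).fun_add (hD.hasFDerivAt_singleLayer (hφ.1.integrable one_le_two) hx)).congr_of_eventuallyEq ?_
  filter_upwards [(isOpen_exterior D).mem_nhds hx] with y hy
  exact hD.unperturbed_eq hH hG hF hφ hw hy

end IsC2Domain

/-! ### The kernel of the first-order term -/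

/-- The numerator of the squared Cauchy kernel in the complex form of `npKernel₁`. -/
def firstNum₂ (c : ℝ → ℂ) (f : ℝ → ℝ) (s t : ℝ) : ℂ :=
  -(-Complex.I * deriv c s) *
    (f s * (-Complex.I * deriv c s) - f t * (-Complex.I * deriv c t))

/-- The numerator of the Cauchy kernel in the complex form of `npKernel₁`. -/
def firstNum₁ (c : ℝ → ℂ) (f : ℝ → ℝ) (s t : ℝ) : ℂ :=
  -(deriv f s * deriv c s + f t * curvC c t * (-Complex.I * deriv c s))

/-- The identity `2 Re p Re q - Re (q p̄) = Re (p q)` combines the two most singular terms of the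
kernel into a holomorphic one. -/
theorem npKernel₁_eq {D : Set Plane} {γ : ℝ → Plane} {L : ℝ} (hD : IsC2Domain D γ L) (f : ℝ → ℝ)
    {s t : ℝ} (h : γ s ≠ γ t) : npKernel₁ γ f s t = 1 / (2 * Real.pi) *
      (firstNum₂ (curveC γ) f s t * ((curveC γ s - curveC γ t) ^ 2)⁻¹ +
        firstNum₁ (curveC γ) f s t * (curveC γ s - curveC γ t)⁻¹).re := by
  set r : Plane := γ s - γ t with hr
  set δ : Plane := f s • normal γ s - f t • normal γ t with hδ
  have hr0 : toC r ≠ 0 := by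
    rw [hr, map_sub, sub_ne_zero]; exact fun h' => h (toC.injective h')
  have hrn : ‖r‖ ≠ 0 := by
    rw [hr]; exact norm_ne_zero_iff.2 (sub_ne_zero.2 h)
  have hcr : curveC γ s - curveC γ t = toC r := by rw [hr, map_sub, curveC, curveC]
  -- normal vector and displacement divided by `r`; the inner products are expressed by `p` and `q`
  set p : ℂ := (toC r)⁻¹ * toC (normal γ s) with hp
  set q : ℂ := (toC r)⁻¹ * toC δ with hq
  have e1 : inner ℝ r (normal γ s) * inner ℝ r δ / ‖r‖ ^ 4 = p.re * q.re := by
    rw [hp, hq, ← inner_div_norm_sq, ← inner_div_norm_sq]; field_simp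
  have e2 : inner ℝ δ (normal γ s) / ‖r‖ ^ 2 = (q * (starRingEnd ℂ) p).re := by
    rw [inner_eq_re, hp, hq, map_mul]
    have : (toC r)⁻¹ * toC δ * ((starRingEnd ℂ) (toC r)⁻¹ * (starRingEnd ℂ) (toC (normal γ s))) =
        (((‖r‖ ^ 2)⁻¹ : ℝ) : ℂ) * (toC δ * (starRingEnd ℂ) (toC (normal γ s))) := by
      rw [← toC.norm_map r, ← Complex.normSq_eq_norm_sq, ← Complex.normSq_inv, ← Complex.mul_conj]
      ring
    rw [this, Complex.re_ofReal_mul, div_eq_inv_mul]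
  have e3 := inner_div_norm_sq r ((curvature γ s * f s) • normal γ s + deriv f s • tangent γ s)
  have e4 : inner ℝ r (normal γ s) / ‖r‖ ^ 2 = p.re := inner_div_norm_sq r (normal γ s)
  have hδC : toC δ = f s * toC (normal γ s) - f t * toC (normal γ t) := by
    rw [hδ, map_sub, map_smul, map_smul, Complex.real_smul, Complex.real_smul]
  have hdef : npKernel₁ γ f s t = 1 / (2 * Real.pi) *
      (-2 * (inner ℝ r (normal γ s) * inner ℝ r δ) / ‖r‖ ^ 4 + inner ℝ δ (normal γ s) / ‖r‖ ^ 2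
      - inner ℝ r ((curvature γ s * f s) • normal γ s + deriv f s • tangent γ s) / ‖r‖ ^ 2
      + inner ℝ r (normal γ s) / ‖r‖ ^ 2 * (f s * curvature γ s - f t * curvature γ t)) := rfl
  rw [hdef, e3, e4, e2, mul_div_assoc, e1, hcr]
  congr 1
  have e5 : firstNum₂ (curveC γ) f s t * (toC r ^ 2)⁻¹ = -(p * q) := by
    rw [hp, hq, hδC, firstNum₂, hD.toC_normal, hD.toC_normal]
    field_simp
  have e6 : firstNum₁ (curveC γ) f s t * (toC r)⁻¹ =
      -((toC r)⁻¹ * ((curvature γ s * f s : ℝ) * toC (normal γ s) + deriv f s * toC (tangent γ s))) +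
        ((f s * curvature γ s - f t * curvature γ t : ℝ) : ℂ) * p := by
    rw [hp, firstNum₁, hD.toC_normal, hD.toC_tangent, hD.curvature_eq, hD.curvature_eq]
    push_cast
    ring
  rw [e5, e6, map_add, map_smul, map_smul, Complex.real_smul, Complex.real_smul, Complex.add_re,
    Complex.neg_re, Complex.add_re, Complex.re_ofReal_mul, Complex.neg_re]
  simp only [Complex.mul_re, Complex.conj_re, Complex.conj_im]
  ring

namespace IsArcCurve

variable {c : ℝ → ℂ} {L : ℝ}

theorem continuous_firstNum₂ (hc : IsArcCurve c L) {f : ℝ → ℝ} (hf : ContDiff ℝ 1 f) (s : ℝ) :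
    Continuous (firstNum₂ c f s) := by
  have h1 := hc.continuous_deriv; have h2 := hf.continuous
  unfold firstNum₂; fun_prop

theorem continuous_firstNum₁ (hc : IsArcCurve c L) {f : ℝ → ℝ} (hf : ContDiff ℝ 1 f) (s : ℝ) :
    Continuous (firstNum₁ c f s) := by
  have h1 := hc.continuous_curvC; have h2 := hf.continuous
  unfold firstNum₁; fun_prop

theorem hasDerivAt_firstNum₂ (hc : IsArcCurve c L) {f : ℝ → ℝ} (hf : ContDiff ℝ 1 f) (s t : ℝ) :
    HasDerivAt (firstNum₂ c f s) (-Complex.I * deriv c s *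
      (deriv f t * (-Complex.I * deriv c t) - f t * curvC c t * deriv c t)) t := by
  have h1 : HasDerivAt (fun t => (f t : ℂ)) ((deriv f t : ℝ) : ℂ) t :=
    ((hf.differentiable one_ne_zero t).hasDerivAt).ofReal_comp
  have h2 := (hc.hasDerivAt_deriv t).const_mul (-Complex.I)
  refine (((h1.mul h2).const_sub (f s * (-Complex.I * deriv c s))).const_mul
    (-(-Complex.I * deriv c s))).congr_deriv ?_
  rw [hc.deriv₂_eq]
  linear_combination (-Complex.I * deriv c s * f t * curvC c t * deriv c t : ℂ) * Complex.I_sq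

theorem exists_firstNum_bound (hc : IsArcCurve c L) {f : ℝ → ℝ} (hf : ContDiff ℝ 1 f) {s : ℝ}
    (hs : s ∈ Ioo 0 L) : ∃ A : ℝ, 0 ≤ A ∧ (∀ t ∈ Ioc 0 L, ‖firstNum₂ c f s t‖ ≤ A * |s - t|) ∧
      ∀ t ∈ Ioc 0 L, ‖firstNum₁ c f s t‖ ≤ A := by
  have c1 := hc.continuous_deriv; have c2 := hc.continuous_curvC
  have c3 := hf.continuous; have c4 := hf.continuous_deriv le_rfl
  have hdc : Continuous fun t => -Complex.I * deriv c s *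
      (deriv f t * (-Complex.I * deriv c t) - f t * curvC c t * deriv c t) := by fun_prop
  obtain ⟨A₁, hA₁⟩ := (isCompact_Icc (a := 0) (b := L)).exists_bound_of_continuousOn
    hdc.continuousOn
  obtain ⟨A₂, hA₂⟩ := (isCompact_Icc (a := 0) (b := L)).exists_bound_of_continuousOn
    (hc.continuous_firstNum₁ hf s).continuousOn
  refine ⟨max (max A₁ A₂) 0, le_max_right _ _, fun t ht => ?_, fun t ht =>
    (hA₂ t (Ioc_subset_Icc_self ht)).trans ((le_max_right _ _).trans (le_max_left _ _))⟩
  have h0 : firstNum₂ c f s s = 0 := by rw [firstNum₂, sub_self, mul_zero]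
  have h1 := (convex_Icc 0 L).norm_image_sub_le_of_norm_hasDerivWithin_le (x := s) (y := t)
    (fun x _ => (hc.hasDerivAt_firstNum₂ hf s x).hasDerivWithinAt) hA₁ (Ioo_subset_Icc_self hs)
    (Ioc_subset_Icc_self ht)
  rw [h0, sub_zero, Real.norm_eq_abs, abs_sub_comm] at h1
  exact h1.trans (by gcongr; exact (le_max_left _ _).trans (le_max_left _ _))

end IsArcCurve

namespace IsC2Domain

variable {D : Set Plane} {γ : ℝ → Plane} {L : ℝ}

/-- The principal value of `npKernel₁` is the limit of the field obtained by moving the evaluation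
point off the curve in the complex form of the kernel. -/
theorem tendsto_firstField (hD : IsC2Domain D γ L) {f : ℝ → ℝ} (hf : ContDiff ℝ 1 f)
    {φ : ℝ → ℝ} (hφ : Integrable φ (arcMeasure L)) {s k : ℝ} (hs : s ∈ Ioo 0 L)
    (hsP : IsPoissonPoint L (fun t => (φ t : ℂ)) s) (hk : HasPV γ L (npKernel₁ γ f) φ s k) :
    Tendsto (fun ε => (∫ t, (firstNum₂ (curveC γ) f s t *
        ((parallel (curveC γ) ε s - curveC γ t) ^ 2)⁻¹ + firstNum₁ (curveC γ) f s t *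
          (parallel (curveC γ) ε s - curveC γ t)⁻¹) * (φ t : ℂ) ∂(arcMeasure L)).re)
      (𝓝[>] 0) (𝓝 (2 * Real.pi * k)) := by
  have hc := hD.isArcCurve
  have hπ := Real.pi_pos
  obtain ⟨A, hA0, hA₂, hA₁⟩ := hc.exists_firstNum_bound hf hs
  have hφC : Integrable (fun t => (φ t : ℂ)) (arcMeasure L) := hφ.ofReal
  have c₁ := hc.continuous_firstNum₁ hf s
  have c₂ := hc.continuous_firstNum₂ hf s
  -- the cancellation that makes the principal value exist, a condition on the first-order terms
  have had : HasDerivAt (firstNum₂ (curveC γ) f s)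
      (firstNum₁ (curveC γ) f s s * deriv (curveC γ) s) s := by
    refine (hc.hasDerivAt_firstNum₂ hf s s).congr_deriv ?_
    rw [firstNum₁]
    linear_combination (deriv f s * deriv (curveC γ) s ^ 2 : ℂ) * Complex.I_sq
  have h0 : firstNum₂ (curveC γ) f s s = 0 := by rw [firstNum₂, sub_self, mul_zero]
  have hlim := hc.tendsto_integral_truncDiff_mul hs hA0 hA₂ hA₁ c₂ c₁ h0 had hφC hsP
  obtain ⟨C, hC⟩ := hc.exists_truncDiff_bound hs hA0 hA₂ hA₁
  have hlim2 := ((Complex.continuous_re.tendsto 0).comp hlim).add (hk.const_mul (2 * Real.pi))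
  rw [Complex.zero_re, zero_add] at hlim2
  refine hlim2.congr' ?_
  filter_upwards [Ioo_mem_nhdsGT hc.width_pos] with ε hε
  have hnm := hc.parallel_notMem hε.1 hε.2.le s
  set S : Set ℝ := {t | ε < ‖curveC γ s - curveC γ t‖} with hS
  have c0 := hc.continuous
  have hSm : MeasurableSet S := (isOpen_lt continuous_const (by fun_prop)).measurableSet
  set k₁ : ℝ → ℂ := fun t => firstNum₂ (curveC γ) f s t *
        ((parallel (curveC γ) ε s - curveC γ t) ^ 2)⁻¹ + firstNum₁ (curveC γ) f s t *
          (parallel (curveC γ) ε s - curveC γ t)⁻¹ with hk₁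
  set k₀ : ℝ → ℂ := fun t => firstNum₂ (curveC γ) f s t *
        ((curveC γ s - curveC γ t) ^ 2)⁻¹ + firstNum₁ (curveC γ) f s t *
          (curveC γ s - curveC γ t)⁻¹ with hk₀
  have htd : ∀ t, truncDiff (curveC γ) (firstNum₂ (curveC γ) f s) (firstNum₁ (curveC γ) f s) s ε t =
      k₁ t - S.indicator k₀ t := fun t => rfl
  have i1 : Integrable (fun t => truncDiff (curveC γ) (firstNum₂ (curveC γ) f s)
      (firstNum₁ (curveC γ) f s) s ε t * (φ t : ℂ)) (arcMeasure L) := by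
    refine hφC.bdd_mul (c := |C| * ε⁻¹) (hc.measurable_truncDiff c₂ c₁ s ε).aestronglyMeasurable ?_
    filter_upwards [ae_mem_Ioc L] with t ht
    refine (hC ε hε.1 hε.2 t ht).trans ?_
    have h1 : ε / (ε ^ 2 + (s - t) ^ 2) ≤ ε⁻¹ := by
      rw [div_le_iff₀ (by have := hε.1; positivity)]
      have : ε⁻¹ * (ε ^ 2 + (s - t) ^ 2) = ε + ε⁻¹ * (s - t) ^ 2 := by
        have := hε.1.ne'; field_simp
      rw [this]
      have := hε.1
      linarith [(by positivity : 0 ≤ ε⁻¹ * (s - t) ^ 2)]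
    have := hε.1
    exact mul_le_mul (le_abs_self C) h1 (by positivity) (abs_nonneg C)
  have i2 : Integrable (fun t => k₁ t * (φ t : ℂ)) (arcMeasure L) := by
    have h1 := hc.integrable_inv_sq_mul (integrable_mul_continuous hφC c₂) hnm
    have h2 := hc.integrable_inv_mul (integrable_mul_continuous hφC c₁) hnm
    refine (h1.add h2).congr (Eventually.of_forall fun t => ?_)
    simp only [hk₁, Pi.add_apply]
    ring
  have i3 : Integrable (fun t => S.indicator k₀ t * (φ t : ℂ)) (arcMeasure L) := by
    refine (i2.sub i1).congr (Eventually.of_forall fun t => ?_)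
    simp only [Pi.sub_apply, htd]
    ring
  have hpv : 2 * Real.pi * ∫ t in {t | ε < ‖γ s - γ t‖}, npKernel₁ γ f s t * φ t ∂(arcMeasure L) =
      (∫ t, S.indicator k₀ t * (φ t : ℂ) ∂(arcMeasure L)).re := by
    have h1 := integral_re i3
    simp only [RCLike.re_to_complex] at h1
    have hSe : {t | ε < ‖γ s - γ t‖} = S := by
      ext t; simp only [hS, mem_ofPred_eq, IsC2Domain.norm_sub]
    rw [← h1, hSe, ← integral_indicator hSm, ← integral_const_mul]
    refine integral_congr_ae (Eventually.of_forall fun t => ?_)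
    by_cases ht : t ∈ S
    · have hne : γ s ≠ γ t := by
        intro h
        have : ε < ‖curveC γ s - curveC γ t‖ := ht
        rw [IsC2Domain.norm_sub, h, sub_self, norm_zero] at this
        exact absurd this (not_lt.2 hε.1.le)
      simp only [indicator_of_mem ht]
      rw [npKernel₁_eq hD f hne, mul_comm (k₀ t), Complex.re_ofReal_mul]
      simp only [hk₀]
      field_simp
    · simp only [indicator_of_notMem ht]; simp
  simp only [Function.comp_apply]
  rw [hpv, ← Complex.add_re]
  congr 1
  refine (integral_add i1 i3).symm.trans (integral_congr_ae (Eventually.of_forall fun t => ?_))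
  simp only [htd]
  ring

end IsC2Domain

/-! ### The boundary condition of the first-order potential -/

/-- The data of the first-order problem: the complex gradient `F` of the background potential `H`,
with primitive `G` and derivative `F'`, and the weak derivative `ψ` of the zeroth-order density. -/
structure FirstOrderData (D : Set Plane) (γ : ℝ → Plane) (L : ℝ) (H w : Plane → ℝ)
    (G F F' : ℂ → ℂ) (f φ φ₁ ψ : ℝ → ℝ) : Prop where
  domain : IsC2Domain D γ L
  gradient : ∀ x, HasFDerivAt H (gradForm (F (toC x))) x
  primitive : ∀ z, HasDerivAt G (F z) z
  hasDerivAt : ∀ z, HasDerivAt F (F' z) z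
  continuous : Continuous F'
  contDiff : ContDiff ℝ 1 f
  periodic : Function.Periodic f L
  unperturbed : IsUnperturbedPotential D γ L H w
  zeroth : IsZerothDensity γ L H φ
  first : IsFirstDensity γ L H f φ φ₁
  memLp_weakDeriv : MemLp ψ 2 (arcMeasure L)
  weakDeriv : WeakDeriv L φ ψ

/-- The complex gradient of the single-layer potential. -/
def singleGrad (γ : ℝ → Plane) (L : ℝ) (ϑ : ℝ → ℝ) (z : ℂ) : ℂ :=
  ((1 / (2 * Real.pi) : ℝ) : ℂ) * cauchyTr (curveC γ) L (fun t => (ϑ t : ℂ)) z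

/-- The derivative of the complex gradient of the single-layer potential. -/
def singleGrad₂ (γ : ℝ → Plane) (L : ℝ) (ϑ : ℝ → ℝ) (z : ℂ) : ℂ :=
  -(((1 / (2 * Real.pi) : ℝ) : ℂ) * cauchyTr₂ (curveC γ) L (fun t => (ϑ t : ℂ)) z)

/-- The complex gradient of the double-layer potential. -/
def doubleGrad (γ : ℝ → Plane) (L : ℝ) (ϑ : ℝ → ℝ) (z : ℂ) : ℂ :=
  ((1 / (2 * Real.pi) : ℝ) : ℂ) *
    cauchyTr₂ (curveC γ) L (fun t => -Complex.I * deriv (curveC γ) t * (ϑ t : ℂ)) z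

namespace FirstOrderData

variable {D : Set Plane} {γ : ℝ → Plane} {L : ℝ} {H w : Plane → ℝ} {G F F' : ℂ → ℂ}
  {f φ φ₁ ψ : ℝ → ℝ}

theorem integrable_zeroth (h : FirstOrderData D γ L H w G F F' f φ φ₁ ψ) :
    Integrable φ (arcMeasure L) := h.zeroth.1.integrable one_le_two

theorem memLp_mul (h : FirstOrderData D γ L H w G F F' f φ φ₁ ψ) :
    MemLp (fun s => f s * φ s) 2 (arcMeasure L) :=
  memLp_mul_continuous h.zeroth.1 h.contDiff.continuous

theorem memLp_curv_mul (h : FirstOrderData D γ L H w G F F' f φ φ₁ ψ) :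
    MemLp (fun s => curvature γ s * f s * φ s) 2 (arcMeasure L) := by
  have e : curvature γ = curvC (curveC γ) := funext h.domain.curvature_eq
  rw [e]
  exact memLp_mul_continuous h.zeroth.1
    (h.domain.isArcCurve.continuous_curvC.mul h.contDiff.continuous)

theorem hasFDerivAt_unperturbed (h : FirstOrderData D γ L H w G F F' f φ φ₁ ψ) {x : Plane}
    (hx : x ∈ (closure D)ᶜ) :
    HasFDerivAt w (gradForm (F (toC x) + singleGrad γ L φ (toC x))) x :=
  h.domain.hasFDerivAt_unperturbed h.gradient h.primitive h.hasDerivAt h.zeroth h.unperturbed hx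

theorem hasDerivAt_grad (h : FirstOrderData D γ L H w G F F' f φ φ₁ ψ) {z : ℂ}
    (hz : z ∉ range (curveC γ)) :
    HasDerivAt (fun z => F z + singleGrad γ L φ z) (F' z + singleGrad₂ γ L φ z) z := by
  have hi : Integrable (fun t => (φ t : ℂ)) (arcMeasure L) := h.integrable_zeroth.ofReal
  refine ((h.hasDerivAt z).add ((h.domain.isArcCurve.hasDerivAt_cauchyTr hi hz).const_mul
    ((1 / (2 * Real.pi) : ℝ) : ℂ))).congr_deriv ?_
  rw [singleGrad₂]; ring

/-- The second derivative of the unperturbed potential is a Cauchy transform of an `L²` density. -/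
theorem singleGrad₂_eq (h : FirstOrderData D γ L H w G F F' f φ φ₁ ψ) {z : ℂ}
    (hz : z ∉ range (curveC γ)) :
    singleGrad₂ γ L φ z = ((1 / (2 * Real.pi) : ℝ) : ℂ) * cauchyTr (curveC γ) L
      (fun t => (deriv (curveC γ) t)⁻¹ * ψ t + tangentInvDeriv (curveC γ) t * φ t) z := by
  rw [singleGrad₂, h.domain.isArcCurve.cauchyTr₂_eq h.weakDeriv h.integrable_zeroth
    (h.memLp_weakDeriv.integrable one_le_two) hz]
  ring

/-- The gradient of the double-layer potential is a Cauchy transform of an `L²` density. -/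
theorem doubleGrad_eq (h : FirstOrderData D γ L H w G F F' f φ φ₁ ψ) {z : ℂ}
    (hz : z ∉ range (curveC γ)) :
    doubleGrad γ L (fun s => f s * φ s) z = ((1 / (2 * Real.pi) : ℝ) : ℂ) *
      cauchyTr (curveC γ) L (fun t => Complex.I * ((deriv f t * φ t + f t * ψ t : ℝ) : ℂ)) z := by
  have hf0 : f 0 = f L := by have := h.periodic 0; rw [zero_add] at this; exact this.symm
  have i1 := h.integrable_zeroth
  have i2 := h.memLp_weakDeriv.integrable one_le_two
  have c1 := h.contDiff.continuous
  have c2 := h.contDiff.continuous_deriv le_rfl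
  have i3 : Integrable (fun t => deriv f t * φ t + f t * ψ t) (arcMeasure L) := by
    have := (integrable_mul_continuous i1 c2).add (integrable_mul_continuous i2 c1)
    refine this.congr (Eventually.of_forall fun t => ?_)
    simp only [Pi.add_apply]; ring
  have key := h.domain.isArcCurve.cauchyTr₂_weak (h.weakDeriv.mul_contDiff i1 i2 h.contDiff hf0)
    (h.memLp_mul.integrable one_le_two) i3 (n := fun _ => -Complex.I) (n' := fun _ => 0)
    (fun t => hasDerivAt_const t _) continuous_const rfl hz
  rw [doubleGrad, key, cauchyTr, cauchyTr, ← integral_neg]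
  congr 2
  ext t
  ring

theorem memLp_weakDeriv_mul (h : FirstOrderData D γ L H w G F F' f φ φ₁ ψ) :
    MemLp (fun t => Complex.I * ((deriv f t * φ t + f t * ψ t : ℝ) : ℂ)) 2 (arcMeasure L) := by
  have h1 := memLp_mul_continuous h.zeroth.1 (h.contDiff.continuous_deriv le_rfl)
  have h2 := memLp_mul_continuous h.memLp_weakDeriv h.contDiff.continuous
  have h3 : MemLp (fun t => ((deriv f t * φ t + f t * ψ t : ℝ) : ℂ)) 2 (arcMeasure L) :=
    (h1.add h2).ofReal
  exact h3.const_mul _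

theorem memLp_second (h : FirstOrderData D γ L H w G F F' f φ φ₁ ψ) :
    MemLp (fun t => (deriv (curveC γ) t)⁻¹ * ψ t + tangentInvDeriv (curveC γ) t * φ t) 2
      (arcMeasure L) := by
  have hc := h.domain.isArcCurve
  have h1 : MemLp (fun t => (φ t : ℂ)) 2 (arcMeasure L) := h.zeroth.1.ofReal
  have h2 : MemLp (fun t => (ψ t : ℂ)) 2 (arcMeasure L) := h.memLp_weakDeriv.ofReal
  exact (memLp_mul_continuous h2 hc.continuous_inv_deriv).add
    (memLp_mul_continuous h1 hc.continuous_tangentInvDeriv)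

theorem continuous_gradient (h : FirstOrderData D γ L H w G F F' f φ φ₁ ψ) : Continuous F :=
  continuous_iff_continuousAt.2 fun z => (h.hasDerivAt z).continuousAt

theorem exists_traceLim_grad (h : FirstOrderData D γ L H w G F F' f φ φ₁ ψ) : ∃ W₀ : ℝ → ℂ,
    TraceLim (arcMeasure L) (fun ε s => F (parallel (curveC γ) ε s) +
      singleGrad γ L φ (parallel (curveC γ) ε s)) W₀ := by
  have hc := h.domain.isArcCurve
  have h1 : MemLp (fun t => (φ t : ℂ)) 2 (arcMeasure L) := h.zeroth.1.ofReal
  exact ⟨_, (hc.traceLim_continuous h.continuous_gradient).add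
    ((hc.traceLim_cauchyInt h1).const_mul ((1 / (2 * Real.pi) : ℝ) : ℂ))⟩

theorem exists_traceLim_grad₂ (h : FirstOrderData D γ L H w G F F' f φ φ₁ ψ) : ∃ W₁ : ℝ → ℂ,
    TraceLim (arcMeasure L) (fun ε s => F' (parallel (curveC γ) ε s) +
      singleGrad₂ γ L φ (parallel (curveC γ) ε s)) W₁ := by
  have hc := h.domain.isArcCurve
  exact ⟨_, ((hc.traceLim_continuous h.continuous).add
    ((hc.traceLim_cauchyInt h.memLp_second).const_mul ((1 / (2 * Real.pi) : ℝ) : ℂ))).congr_of_forall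
      hc.width_pos (S := univ) (by simp) (fun ε hε hε' s _ => by
        rw [h.singleGrad₂_eq (hc.parallel_notMem hε hε'.le s), IsArcCurve.cauchyTr_parallel])
      (Eventually.of_forall fun _ => rfl)⟩

theorem exists_traceLim_doubleGrad (h : FirstOrderData D γ L H w G F F' f φ φ₁ ψ) : ∃ d : ℝ → ℂ,
    TraceLim (arcMeasure L) (fun ε s => doubleGrad γ L (fun s => f s * φ s)
      (parallel (curveC γ) ε s)) d := by
  have hc := h.domain.isArcCurve
  exact ⟨_, ((hc.traceLim_cauchyInt h.memLp_weakDeriv_mul).const_mul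
    ((1 / (2 * Real.pi) : ℝ) : ℂ)).congr_of_forall
      hc.width_pos (S := univ) (by simp) (fun ε hε hε' s _ => by
        rw [h.doubleGrad_eq (hc.parallel_notMem hε hε'.le s), IsArcCurve.cauchyTr_parallel])
      (Eventually.of_forall fun _ => rfl)⟩

/-- The tangential derivative of the unperturbed potential. -/
theorem traceLim_tangent (h : FirstOrderData D γ L H w G F F' f φ φ₁ ψ) {W₀ : ℝ → ℂ}
    (hW : TraceLim (arcMeasure L) (fun ε s => F (parallel (curveC γ) ε s) +
      singleGrad γ L φ (parallel (curveC γ) ε s)) W₀) :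
    TraceLim (arcMeasure L) (fun ε s => dirDeriv w (γ s + ε • normal γ s) (tangent γ s))
      (fun s => (deriv (curveC γ) s * W₀ s).re) := by
  have hc := h.domain.isArcCurve
  have h1 := (hW.continuous_mul hc.continuous_deriv).re
  simp only [RCLike.re_to_complex] at h1
  refine h1.congr_of_forall hc.width_pos (S := univ) (by simp) (fun ε hε hε' s _ => ?_)
    (Eventually.of_forall fun _ => rfl)
  rw [dirDeriv, (h.hasFDerivAt_unperturbed (h.domain.parallel_mem hε hε'.le s)).fderiv,
    gradForm_apply, h.domain.toC_tangent, h.domain.toC_parallel, mul_comm]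

theorem traceLim_normal (h : FirstOrderData D γ L H w G F F' f φ φ₁ ψ) {W₀ : ℝ → ℂ}
    (hW : TraceLim (arcMeasure L) (fun ε s => F (parallel (curveC γ) ε s) +
      singleGrad γ L φ (parallel (curveC γ) ε s)) W₀) :
    TraceLim (arcMeasure L) (fun ε s => dirDeriv w (γ s + ε • normal γ s) (normal γ s))
      (fun s => (-Complex.I * deriv (curveC γ) s * W₀ s).re) := by
  have hc := h.domain.isArcCurve
  have h1 := (hW.continuous_mul (hc.continuous_deriv.const_mul (-Complex.I))).re
  simp only [RCLike.re_to_complex] at h1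
  refine h1.congr_of_forall hc.width_pos (S := univ) (by simp) (fun ε hε hε' s _ => ?_)
    (Eventually.of_forall fun _ => rfl)
  rw [dirDeriv, (h.hasFDerivAt_unperturbed (h.domain.parallel_mem hε hε'.le s)).fderiv,
    gradForm_apply, h.domain.toC_normal, h.domain.toC_parallel, mul_comm]

/-- The second normal derivative of the unperturbed potential. -/
theorem traceLim_normal₂ (h : FirstOrderData D γ L H w G F F' f φ φ₁ ψ) {W₁ : ℝ → ℂ}
    (hW : TraceLim (arcMeasure L) (fun ε s => F' (parallel (curveC γ) ε s) +
      singleGrad₂ γ L φ (parallel (curveC γ) ε s)) W₁) :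
    TraceLim (arcMeasure L) (fun ε s => dirDeriv₂ w (γ s + ε • normal γ s) (normal γ s))
      (fun s => ((-Complex.I * deriv (curveC γ) s) ^ 2 * W₁ s).re) := by
  have hc := h.domain.isArcCurve
  have cT := hc.continuous_deriv
  have h1 := (hW.continuous_mul (η := fun s => (-Complex.I * deriv (curveC γ) s) ^ 2)
    (by fun_prop)).re
  simp only [RCLike.re_to_complex] at h1
  refine h1.congr_of_forall hc.width_pos (S := univ) (by simp) (fun ε hε hε' s _ => ?_)
    (Eventually.of_forall fun _ => rfl)
  rw [dirDeriv₂_of_gradForm (IsC2Domain.isOpen_exterior D)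
    (F := fun z => F z + singleGrad γ L φ z)
    (F' := fun z => F' z + singleGrad₂ γ L φ z) (fun x hx => h.hasFDerivAt_unperturbed hx)
    (fun x hx => h.hasDerivAt_grad (h.domain.toC_notMem hx)) (h.domain.parallel_mem hε hε'.le s),
    h.domain.toC_normal, h.domain.toC_parallel, mul_comm]

end FirstOrderData

/-! ### The first-order potential -/

/-- The representation formula for the first-order potential. -/
def firstOrderFormula (γ : ℝ → Plane) (L : ℝ) (f φ φ₁ : ℝ → ℝ) (x : Plane) : ℝ :=
  singleLayer γ L φ₁ x - singleLayer γ L (fun s => curvature γ s * f s * φ s) x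
    + doubleLayer γ L (fun s => f s * φ s) x

namespace FirstOrderData

variable {D : Set Plane} {γ : ℝ → Plane} {L : ℝ} {H w : Plane → ℝ} {G F F' : ℂ → ℂ}
  {f φ φ₁ ψ : ℝ → ℝ}

theorem hasFDerivAt_formula (h : FirstOrderData D γ L H w G F F' f φ φ₁ ψ) {x : Plane}
    (hx : x ∈ (closure D)ᶜ) :
    HasFDerivAt (firstOrderFormula γ L f φ φ₁) (gradForm (singleGrad γ L φ₁ (toC x) -
      singleGrad γ L (fun s => curvature γ s * f s * φ s) (toC x) +
        doubleGrad γ L (fun s => f s * φ s) (toC x))) x := by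
  rw [map_add, map_sub]
  exact ((h.domain.hasFDerivAt_singleLayer (h.first.1.integrable one_le_two) hx).sub
    (h.domain.hasFDerivAt_singleLayer (h.memLp_curv_mul.integrable one_le_two) hx)).add
      (h.domain.hasFDerivAt_doubleLayer (h.memLp_mul.integrable one_le_two) hx)

/-- Integrating by parts along the curve turns the gradient of the double layer, too, into a Cauchy
transform, so that the whole gradient is holomorphic. -/
theorem harmonicOnNhd_formula (h : FirstOrderData D γ L H w G F F' f φ φ₁ ψ) :
    InnerProductSpace.HarmonicOnNhd (firstOrderFormula γ L f φ φ₁) (closure D)ᶜ := by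
  intro x hx
  have hc := h.domain.isArcCurve
  set κ : ℂ := ((1 / (2 * Real.pi) : ℝ) : ℂ) with hκ
  set θ : ℝ → ℂ := fun t => Complex.I * ((deriv f t * φ t + f t * ψ t : ℝ) : ℂ) with hθ
  have hS : ∀ {ϑ : ℝ → ℝ}, Integrable ϑ (arcMeasure L) → ∀ y ∈ (closure D)ᶜ,
      HasDerivAt (singleGrad γ L ϑ) (singleGrad₂ γ L ϑ (toC y)) (toC y) := by
    intro ϑ hϑ y hy
    refine ((hc.hasDerivAt_cauchyTr hϑ.ofReal (h.domain.toC_notMem hy)).const_mul κ).congr_deriv ?_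
    rw [singleGrad₂, mul_neg]
    rfl
  refine harmonicAt_of_gradForm (IsC2Domain.isOpen_exterior D)
    (F := fun z => singleGrad γ L φ₁ z - singleGrad γ L (fun s => curvature γ s * f s * φ s) z +
      κ * cauchyTr (curveC γ) L θ z)
    (F' := fun z => singleGrad₂ γ L φ₁ z - singleGrad₂ γ L (fun s => curvature γ s * f s * φ s) z +
      κ * -cauchyTr₂ (curveC γ) L θ z) (fun y hy => ?_) (fun y hy => ?_) hx
  · rw [← h.doubleGrad_eq (h.domain.toC_notMem hy)]
    exact h.hasFDerivAt_formula hy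
  · exact ((hS (h.first.1.integrable one_le_two) y hy).sub
      (hS (h.memLp_curv_mul.integrable one_le_two) y hy)).add
      ((hc.hasDerivAt_cauchyTr (h.memLp_weakDeriv_mul.integrable one_le_two)
        (h.domain.toC_notMem hy)).const_mul κ)

/-- The normal derivative of the formula at the boundary. -/
theorem traceLim_formula (h : FirstOrderData D γ L H w G F F' f φ φ₁ ψ) {d : ℝ → ℂ}
    (hd : TraceLim (arcMeasure L) (fun ε s => doubleGrad γ L (fun s => f s * φ s)
      (parallel (curveC γ) ε s)) d) :
    TraceLim (arcMeasure L)
      (fun ε s => dirDeriv (firstOrderFormula γ L f φ φ₁) (γ s + ε • normal γ s) (normal γ s))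
      (fun s => 1 / (2 * Real.pi) * (Real.pi * φ₁ s +
          ∫ t, normalKer (curveC γ) s t * φ₁ t ∂(arcMeasure L)) -
        1 / (2 * Real.pi) * (Real.pi * (curvature γ s * f s * φ s) +
          ∫ t, normalKer (curveC γ) s t * (curvature γ t * f t * φ t) ∂(arcMeasure L)) +
        (-Complex.I * deriv (curveC γ) s * d s).re) := by
  have hc := h.domain.isArcCurve
  have h1 := h.domain.traceLim_normal_singleLayer h.first.1
  have h2 := h.domain.traceLim_normal_singleLayer h.memLp_curv_mul
  have h3 := (hd.continuous_mul (hc.continuous_deriv.const_mul (-Complex.I))).re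
  simp only [RCLike.re_to_complex] at h3
  refine ((h1.sub h2).add h3).congr_of_forall hc.width_pos (S := univ) (by simp)
    (fun ε hε hε' s _ => ?_) (Eventually.of_forall fun _ => rfl)
  have hm := h.domain.parallel_mem hε hε'.le s
  have e1 := h.domain.hasFDerivAt_singleLayer (h.first.1.integrable one_le_two) hm
  have e2 := h.domain.hasFDerivAt_singleLayer (h.memLp_curv_mul.integrable one_le_two) hm
  simp only [dirDeriv]
  rw [(h.hasFDerivAt_formula hm).fderiv, e1.fderiv, e2.fderiv, map_add, map_sub, add_apply,
    sub_apply, gradForm_apply (doubleGrad _ _ _ _), h.domain.toC_normal, h.domain.toC_parallel,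
    mul_comm (doubleGrad _ _ _ _)]
  rfl

/-- The field obtained from the complex form of `npKernel₁`, in terms of Cauchy transforms. -/
theorem integral_firstNum (h : FirstOrderData D γ L H w G F F' f φ φ₁ ψ) (s : ℝ) {z : ℂ}
    (hz : z ∉ range (curveC γ)) :
    ((1 / (2 * Real.pi) : ℝ) : ℂ) * ∫ t, (firstNum₂ (curveC γ) f s t * ((z - curveC γ t) ^ 2)⁻¹ +
        firstNum₁ (curveC γ) f s t * (z - curveC γ t)⁻¹) * (φ t : ℂ) ∂(arcMeasure L) =
      f s * (-Complex.I * deriv (curveC γ) s) ^ 2 * singleGrad₂ γ L φ z +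
        -Complex.I * deriv (curveC γ) s * doubleGrad γ L (fun s => f s * φ s) z -
        deriv f s * deriv (curveC γ) s * singleGrad γ L φ z -
        -Complex.I * deriv (curveC γ) s *
          singleGrad γ L (fun s => curvature γ s * f s * φ s) z := by
  have hc := h.domain.isArcCurve
  have i1 : Integrable (fun t => (φ t : ℂ)) (arcMeasure L) := h.integrable_zeroth.ofReal
  have i2 := h.domain.integrable_normal_mul (h.memLp_mul.integrable one_le_two)
  have i3 : Integrable (fun t => ((curvature γ t * f t * φ t : ℝ) : ℂ)) (arcMeasure L) :=
    (h.memLp_curv_mul.integrable one_le_two).ofReal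
  have j1 := (hc.integrable_inv_sq_mul i1 hz).const_mul
    (-(f s * (-Complex.I * deriv (curveC γ) s) ^ 2))
  have j2 := (hc.integrable_inv_sq_mul i2 hz).const_mul (-Complex.I * deriv (curveC γ) s)
  have j3 := (hc.integrable_inv_mul i1 hz).const_mul (deriv f s * deriv (curveC γ) s : ℂ)
  have j4 := (hc.integrable_inv_mul i3 hz).const_mul (-Complex.I * deriv (curveC γ) s)
  have key : ∫ t, (firstNum₂ (curveC γ) f s t * ((z - curveC γ t) ^ 2)⁻¹ +
        firstNum₁ (curveC γ) f s t * (z - curveC γ t)⁻¹) * (φ t : ℂ) ∂(arcMeasure L) =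
      -(f s * (-Complex.I * deriv (curveC γ) s) ^ 2) *
          cauchyTr₂ (curveC γ) L (fun t => (φ t : ℂ)) z +
        -Complex.I * deriv (curveC γ) s * cauchyTr₂ (curveC γ) L
          (fun t => -Complex.I * deriv (curveC γ) t * ((f t * φ t : ℝ) : ℂ)) z -
        deriv f s * deriv (curveC γ) s * cauchyTr (curveC γ) L (fun t => (φ t : ℂ)) z -
        -Complex.I * deriv (curveC γ) s *
          cauchyTr (curveC γ) L (fun t => ((curvature γ t * f t * φ t : ℝ) : ℂ)) z := by
    simp only [cauchyTr, cauchyTr₂]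
    rw [← integral_const_mul, ← integral_const_mul, ← integral_const_mul, ← integral_const_mul,
      ← integral_add j1 j2]
    refine Eq.trans ?_ (congrArg (· - _) (integral_sub (j1.add j2) j3))
    refine Eq.trans ?_ (integral_sub ((j1.add j2).sub j3) j4)
    refine integral_congr_ae (Eventually.of_forall fun t => ?_)
    simp only [firstNum₁, firstNum₂, ← h.domain.curvature_eq]
    push_cast
    ring
  rw [key, singleGrad, singleGrad, singleGrad₂, doubleGrad]
  ring

/-- The boundary condition of the first-order potential. -/
theorem boundary_condition (h : FirstOrderData D γ L H w G F F' f φ φ₁ ψ) {d W₀ W₁ : ℝ → ℂ}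
    (hd : TraceLim (arcMeasure L) (fun ε s => doubleGrad γ L (fun s => f s * φ s)
      (parallel (curveC γ) ε s)) d)
    (hW₀ : TraceLim (arcMeasure L) (fun ε s => F (parallel (curveC γ) ε s) +
      singleGrad γ L φ (parallel (curveC γ) ε s)) W₀)
    (hW₁ : TraceLim (arcMeasure L) (fun ε s => F' (parallel (curveC γ) ε s) +
      singleGrad₂ γ L φ (parallel (curveC γ) ε s)) W₁) :
    ∀ᵐ s ∂(arcMeasure L), 1 / (2 * Real.pi) * (Real.pi * φ₁ s +
          ∫ t, normalKer (curveC γ) s t * φ₁ t ∂(arcMeasure L)) -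
        1 / (2 * Real.pi) * (Real.pi * (curvature γ s * f s * φ s) +
          ∫ t, normalKer (curveC γ) s t * (curvature γ t * f t * φ t) ∂(arcMeasure L)) +
        (-Complex.I * deriv (curveC γ) s * d s).re =
      deriv f s * (deriv (curveC γ) s * W₀ s).re -
        f s * ((-Complex.I * deriv (curveC γ) s) ^ 2 * W₁ s).re := by
  have hD := h.domain
  have hc := hD.isArcCurve
  have hπ := Real.pi_pos
  have hφC : Integrable (fun t => (φ t : ℂ)) (arcMeasure L) := h.integrable_zeroth.ofReal
  filter_upwards [(h.traceLim_formula hd).ae_tendsto, (h.traceLim_tangent hW₀).ae_tendsto,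
    (h.traceLim_normal₂ hW₁).ae_tendsto, (hD.traceLim_normal_singleLayer h.first.1).ae_tendsto,
    h.first.2, ae_mem_Ioo L, ae_isPoissonPoint hφC] with s hU hT hN hS ⟨k, k₁, hk, hk₁, hkk⟩ hs hsP
  have hkv := hD.eq_of_hasPV_npKernel (h.first.1.integrable one_le_two) (Ioo_subset_Ioc_self hs) hk
  have hfield := (hD.tendsto_firstField h.contDiff h.integrable_zeroth hs hsP hk₁).const_mul
    (1 / (2 * Real.pi))
  have hF : Tendsto (fun ε => (deriv (curveC γ) s * F (parallel (curveC γ) ε s)).re) (𝓝[>] 0)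
      (𝓝 (deriv (curveC γ) s * F (curveC γ s)).re) :=
    (Complex.continuous_re.tendsto _).comp
      (((h.continuous_gradient.tendsto _).comp (IsArcCurve.tendsto_parallel _ s)).const_mul _)
  have hF' : Tendsto (fun ε => ((-Complex.I * deriv (curveC γ) s) ^ 2 *
      F' (parallel (curveC γ) ε s)).re) (𝓝[>] 0)
      (𝓝 ((-Complex.I * deriv (curveC γ) s) ^ 2 * F' (curveC γ s)).re) :=
    (Complex.continuous_re.tendsto _).comp
      (((h.continuous.tendsto _).comp (IsArcCurve.tendsto_parallel _ s)).const_mul _)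
  have hleft := (hU.sub (hT.const_mul (deriv f s))).add (hN.const_mul (f s))
  have hright := ((hS.add hfield).sub (hF.const_mul (deriv f s))).add (hF'.const_mul (f s))
  -- off the curve both sides are the same field, by the complex form of `npKernel₁`
  have heq := tendsto_nhds_unique_of_eventuallyEq hleft hright (by
    filter_upwards [Ioo_mem_nhdsGT hc.width_pos] with ε hε
    have hm := hD.parallel_mem hε.1 hε.2.le s
    have hnm := hc.parallel_notMem hε.1 hε.2.le s
    have key := congrArg Complex.re (h.integral_firstNum s hnm)
    rw [Complex.re_ofReal_mul] at key
    rw [key, dirDeriv, (h.hasFDerivAt_formula hm).fderiv, dirDeriv,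
      (h.hasFDerivAt_unperturbed hm).fderiv, dirDeriv,
      (hD.hasFDerivAt_singleLayer (h.first.1.integrable one_le_two) hm).fderiv,
      dirDeriv₂_of_gradForm (IsC2Domain.isOpen_exterior D)
        (F := fun z => F z + singleGrad γ L φ z) (F' := fun z => F' z + singleGrad₂ γ L φ z)
        (fun x hx => h.hasFDerivAt_unperturbed hx)
        (fun x hx => h.hasDerivAt_grad (hD.toC_notMem hx)) hm,
      gradForm_apply, gradForm_apply, gradForm_apply, hD.toC_normal, hD.toC_tangent,
      hD.toC_parallel]
    have e : (((1 / (2 * Real.pi) : ℝ) : ℂ) * cauchyTr (curveC γ) L (fun t => (φ₁ t : ℂ))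
        (parallel (curveC γ) ε s)) = singleGrad γ L φ₁ (parallel (curveC γ) ε s) := rfl
    rw [e]
    rw [← Complex.re_ofReal_mul, ← Complex.re_ofReal_mul, ← Complex.re_ofReal_mul,
      ← Complex.re_ofReal_mul, ← Complex.sub_re, ← Complex.add_re, ← Complex.add_re,
      ← Complex.sub_re, ← Complex.add_re]
    congr 1
    ring)
  have hHT : dirDeriv H (γ s) (tangent γ s) = (deriv (curveC γ) s * F (curveC γ s)).re := by
    rw [dirDeriv, (h.gradient _).fderiv, gradForm_apply, hD.toC_tangent, mul_comm]; rfl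
  have hHN : dirDeriv₂ H (γ s) (normal γ s) =
      ((-Complex.I * deriv (curveC γ) s) ^ 2 * F' (curveC γ s)).re := by
    rw [dirDeriv₂_of_gradForm isOpen_univ (fun x _ => h.gradient x)
      (fun x _ => h.hasDerivAt _) (mem_univ _), hD.toC_normal, mul_comm]; rfl
  rw [hHT, hHN, hkv] at hkk
  have h1 : 1 / (2 * Real.pi) * (Real.pi * φ₁ s +
      ∫ t, normalKer (curveC γ) s t * φ₁ t ∂(arcMeasure L)) = 1 / 2 * φ₁ s +
      1 / (2 * Real.pi) * ∫ t, normalKer (curveC γ) s t * φ₁ t ∂(arcMeasure L) := by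
    field_simp
  have h2 : 1 / (2 * Real.pi) * (2 * Real.pi * k₁) = k₁ := by field_simp
  rw [h2] at heq
  linarith

end FirstOrderData

namespace IsC2Domain

variable {D : Set Plane} {γ : ℝ → Plane} {L : ℝ}

theorem singleLayer_sub (hD : IsC2Domain D γ L) {ϑ ϑ' : ℝ → ℝ} (h : Integrable ϑ (arcMeasure L))
    (h' : Integrable ϑ' (arcMeasure L)) {x : Plane} (hx : x ∈ (closure D)ᶜ) :
    singleLayer γ L (fun s => ϑ s - ϑ' s) x = singleLayer γ L ϑ x - singleLayer γ L ϑ' x := by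
  have hne : ∀ t, ‖x - γ t‖ ≠ 0 := fun t h0 =>
    hx (hD.range_subset_closure ⟨t, (sub_eq_zero.1 (norm_eq_zero.1 h0)).symm⟩)
  have hγc := hD.contDiff.continuous
  have hc : Continuous fun t => green x (γ t) := by
    unfold green
    exact ((continuous_const.sub hγc).norm.log hne).const_mul _
  have i1 := integrable_mul_continuous h hc
  have i2 := integrable_mul_continuous h' hc
  unfold singleLayer
  simp only [mul_comm (green _ _)]
  refine Eq.trans ?_ (integral_sub i1 i2)
  simp only [sub_mul]

end IsC2Domain

namespace FirstOrderData

variable {D : Set Plane} {γ : ℝ → Plane} {L : ℝ} {H w : Plane → ℝ} {G F F' : ℂ → ℂ}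
  {f φ φ₁ ψ : ℝ → ℝ}

/-- The Neumann datum of the first-order potential has mean zero: it is the tangential derivative
of `f ∂w/∂T`. -/
theorem integral_datum (h : FirstOrderData D γ L H w G F F' f φ φ₁ ψ) {W₀ W₁ : ℝ → ℂ}
    (hW₀ : TraceLim (arcMeasure L) (fun ε s => F (parallel (curveC γ) ε s) +
      singleGrad γ L φ (parallel (curveC γ) ε s)) W₀)
    (hW₁ : TraceLim (arcMeasure L) (fun ε s => F' (parallel (curveC γ) ε s) +
      singleGrad₂ γ L φ (parallel (curveC γ) ε s)) W₁) :
    ∫ s, (deriv f s * (deriv (curveC γ) s * W₀ s).re -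
        f s * ((-Complex.I * deriv (curveC γ) s) ^ 2 * W₁ s).re) ∂(arcMeasure L) = 0 := by
  have hc := h.domain.isArcCurve
  set T := deriv (curveC γ) with hT
  have c1 := hc.continuous_deriv; have c2 := hc.continuous_curvC
  have c3 := h.contDiff.continuous; have c4 := h.contDiff.continuous_deriv le_rfl
  have hn : ∀ t, HasDerivAt (fun t => (f t : ℂ) * T t)
      (((deriv f t : ℝ) : ℂ) * T t + f t * (curvC (curveC γ) t * (-Complex.I * T t))) t := by
    intro t
    have h1 : HasDerivAt (fun t => (f t : ℂ)) ((deriv f t : ℝ) : ℂ) t :=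
      ((h.contDiff.differentiable one_ne_zero t).hasDerivAt).ofReal_comp
    refine (h1.mul (hc.hasDerivAt_deriv t)).congr_deriv ?_
    rw [hc.deriv₂_eq]
  have hn' : Continuous fun t => ((deriv f t : ℝ) : ℂ) * T t +
      f t * (curvC (curveC γ) t * (-Complex.I * T t)) := by fun_prop
  have h0 : (f 0 : ℂ) * T 0 = f L * T L := by
    have h1 := h.periodic 0; have h2 := hc.deriv_periodic 0
    rw [zero_add] at h1 h2
    rw [h1, hT, h2]
  have hcont : ∀ ε, 0 < ε → ε < hc.width → Continuous fun s => F' (parallel (curveC γ) ε s) +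
      singleGrad₂ γ L φ (parallel (curveC γ) ε s) := by
    intro ε hε hε'
    have e : ∀ s, singleGrad₂ γ L φ (parallel (curveC γ) ε s) = ((1 / (2 * Real.pi) : ℝ) : ℂ) *
        cauchyInt (curveC γ) L ε (fun t => (T t)⁻¹ * ψ t + tangentInvDeriv (curveC γ) t * φ t) s :=
      fun s => h.singleGrad₂_eq (hc.parallel_notMem hε hε'.le s)
    simp only [e]
    refine (h.continuous.comp (hc.continuous_parallel.comp
      (continuous_const.prodMk continuous_id))).add (continuous_const.mul ?_)
    exact hc.continuous_cauchyInt (h.memLp_second.integrable one_le_two) hε hε'.le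
  have key := hc.integral_trace_eq_zero (W := fun z => F z + singleGrad γ L φ z)
    (W' := fun z => F' z + singleGrad₂ γ L φ z) (fun ε hε hε' s =>
    h.hasDerivAt_grad (hc.parallel_notMem hε hε'.le s)) hcont hW₀ hW₁ hn hn' h0
  have hint : Integrable (fun s => (((deriv f s : ℝ) : ℂ) * T s +
      f s * (curvC (curveC γ) s * (-Complex.I * T s))) * W₀ s + (f s : ℂ) * T s * T s * W₁ s)
      (arcMeasure L) := by
    have j1 := memLp_mul_continuous hW₀.memLp hn'
    have j2 := memLp_mul_continuous hW₁.memLp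
      (g := fun s => (f s : ℂ) * T s * T s) (by fun_prop)
    exact (j1.add j2).integrable one_le_two
  have hre := integral_re hint
  simp only [RCLike.re_to_complex] at hre
  rw [key, Complex.zero_re] at hre
  rw [← hre]
  refine integral_congr_ae ?_
  -- the curvature term carries the normal derivative of `w`, which vanishes on the boundary
  have hneu : (fun _ => (0 : ℝ)) =ᵐ[arcMeasure L] _ :=
    h.unperturbed.neumann.ae_unique (h.traceLim_normal hW₀)
  filter_upwards [hneu] with s hs
  have e : (((deriv f s : ℝ) : ℂ) * T s + f s * (curvC (curveC γ) s * (-Complex.I * T s))) * W₀ s +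
      (f s : ℂ) * T s * T s * W₁ s = ((deriv f s : ℝ) : ℂ) * (T s * W₀ s) +
        ((f s * curvC (curveC γ) s : ℝ) : ℂ) * (-Complex.I * T s * W₀ s) -
          (f s : ℂ) * ((-Complex.I * T s) ^ 2 * W₁ s) := by
    push_cast
    linear_combination (f s * T s ^ 2 * W₁ s : ℂ) * Complex.I_sq
  rw [e, Complex.sub_re, Complex.add_re, Complex.re_ofReal_mul, Complex.re_ofReal_mul,
    Complex.re_ofReal_mul, ← hs]
  ring

/-- The normal derivative of the double-layer potential has mean zero. -/
theorem integral_doubleGrad (h : FirstOrderData D γ L H w G F F' f φ φ₁ ψ) {d : ℝ → ℂ}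
    (hd : TraceLim (arcMeasure L) (fun ε s => doubleGrad γ L (fun s => f s * φ s)
      (parallel (curveC γ) ε s)) d) :
    ∫ s, (-Complex.I * deriv (curveC γ) s * d s).re ∂(arcMeasure L) = 0 := by
  have hc := h.domain.isArcCurve
  have cT := hc.continuous_deriv
  set κ : ℂ := ((1 / (2 * Real.pi) : ℝ) : ℂ) with hκ
  set g : ℝ → ℂ := fun t => -Complex.I * deriv (curveC γ) t * ((f t * φ t : ℝ) : ℂ) with hg
  have hgm : MemLp g 2 (arcMeasure L) := by
    have h1 : MemLp (fun t => ((f t * φ t : ℝ) : ℂ)) 2 (arcMeasure L) := h.memLp_mul.ofReal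
    exact memLp_mul_continuous h1 (by fun_prop)
  have hW := (hc.traceLim_cauchyInt hgm).const_mul (-κ)
  have hder : ∀ ε, 0 < ε → ε < hc.width → ∀ s, HasDerivAt
      (fun z => -κ * cauchyTr (curveC γ) L g z)
      (doubleGrad γ L (fun s => f s * φ s) (parallel (curveC γ) ε s)) (parallel (curveC γ) ε s) := by
    intro ε hε hε' s
    refine ((hc.hasDerivAt_cauchyTr (hgm.integrable one_le_two)
      (hc.parallel_notMem hε hε'.le s)).const_mul (-κ)).congr_deriv ?_
    rw [doubleGrad, neg_mul_neg]
  have hcont : ∀ ε, 0 < ε → ε < hc.width → Continuous fun s =>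
      doubleGrad γ L (fun s => f s * φ s) (parallel (curveC γ) ε s) := by
    intro ε hε hε'
    have e : ∀ s, doubleGrad γ L (fun s => f s * φ s) (parallel (curveC γ) ε s) = κ *
        cauchyInt (curveC γ) L ε
          (fun t => Complex.I * ((deriv f t * φ t + f t * ψ t : ℝ) : ℂ)) s :=
      fun s => h.doubleGrad_eq (hc.parallel_notMem hε hε'.le s)
    simp only [e]
    exact continuous_const.mul
      (hc.continuous_cauchyInt (h.memLp_weakDeriv_mul.integrable one_le_two) hε hε'.le)
  have key := hc.integral_trace_eq_zero hder hcont hW hd (n := fun _ => 1) (n' := fun _ => 0)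
    (fun t => hasDerivAt_const t _) continuous_const rfl
  have hint : Integrable (fun s => -Complex.I * deriv (curveC γ) s * d s) (arcMeasure L) :=
    (memLp_mul_continuous hd.memLp (g := fun s => -Complex.I * deriv (curveC γ) s)
      (by fun_prop)).integrable one_le_two
  have hre := integral_re hint
  simp only [RCLike.re_to_complex] at hre
  have e : ∫ s, -Complex.I * deriv (curveC γ) s * d s ∂(arcMeasure L) = 0 := by
    simp only [zero_mul, zero_add, one_mul] at key
    simp only [mul_assoc]
    rw [integral_const_mul, key, mul_zero]
  rw [hre, e, Complex.zero_re]

/-- The total charge of the single-layer part of the formula vanishes. -/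
theorem integral_first_eq (h : FirstOrderData D γ L H w G F F' f φ φ₁ ψ) :
    ∫ s, (φ₁ s - curvature γ s * f s * φ s) ∂(arcMeasure L) = 0 := by
  have hπ := Real.pi_pos
  have hc := h.domain.isArcCurve
  obtain ⟨W₀, hW₀⟩ := h.exists_traceLim_grad
  obtain ⟨W₁, hW₁⟩ := h.exists_traceLim_grad₂
  obtain ⟨d, hd⟩ := h.exists_traceLim_doubleGrad
  have i1 := h.first.1.integrable one_le_two
  have i2 := h.memLp_curv_mul.integrable one_le_two
  have t1 := ((h.domain.traceLim_normal_singleLayer h.first.1).memLp).integrable one_le_two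
  have t2 := ((h.domain.traceLim_normal_singleLayer h.memLp_curv_mul).memLp).integrable one_le_two
  have t3 : Integrable (fun s => (-Complex.I * deriv (curveC γ) s * d s).re) (arcMeasure L) := by
    have cT := hc.continuous_deriv
    exact ((memLp_mul_continuous hd.memLp (g := fun s => -Complex.I * deriv (curveC γ) s)
      (by fun_prop)).integrable one_le_two).re
  have key := (integral_congr_ae (h.boundary_condition hd hW₀ hW₁)).trans
    (h.integral_datum hW₀ hW₁)
  have e1 := (integral_add (t1.sub t2) t3).symm.trans key
  rw [h.integral_doubleGrad hd, add_zero] at e1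
  have e2 := (integral_sub t1 t2).symm.trans e1
  rw [integral_const_mul, integral_const_mul, h.domain.integral_jump i1,
    h.domain.integral_jump i2, ← mul_sub, ← mul_sub] at e2
  rw [integral_sub i1 i2]
  have h1 : 1 / (2 * Real.pi) ≠ 0 := by positivity
  have h2 : 2 * Real.pi ≠ 0 := by positivity
  exact (mul_eq_zero.1 ((mul_eq_zero.1 e2).resolve_left h1)).resolve_left h2

/-- The logarithmic terms of the two single layers cancel, by `integral_first_eq`. -/
theorem formula_isBigO (h : FirstOrderData D γ L H w G F F' f φ φ₁ ψ) :
    firstOrderFormula γ L f φ φ₁ =O[Bornology.cobounded Plane] fun x => ‖x‖⁻¹ := by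
  have i1 := h.first.1.integrable one_le_two
  have i2 := h.memLp_curv_mul.integrable one_le_two
  refine IsBigO.congr' ((h.domain.singleLayer_isBigO (i1.sub i2) h.integral_first_eq).add
    (h.domain.doubleLayer_isBigO (h.memLp_mul.integrable one_le_two))) ?_ EventuallyEq.rfl
  filter_upwards [h.domain.eventually_exterior] with x hx
  rw [firstOrderFormula, ← h.domain.singleLayer_sub i1 i2 hx]
  rfl

/-- The formula solves the first-order problem. -/
theorem isFirstOrderPotential (h : FirstOrderData D γ L H w G F F' f φ φ₁ ψ) {u : Plane → ℝ}
    (hu : ∀ x ∈ (closure D)ᶜ, u x = firstOrderFormula γ L f φ φ₁ x) :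
    IsFirstOrderPotential D γ L f w u := by
  have hD := h.domain
  have hev : ∀ x ∈ (closure D)ᶜ, u =ᶠ[𝓝 x] firstOrderFormula γ L f φ φ₁ := fun x hx => by
    filter_upwards [(IsC2Domain.isOpen_exterior D).mem_nhds hx] with y hy using hu y hy
  obtain ⟨W₀, hW₀⟩ := h.exists_traceLim_grad
  obtain ⟨W₁, hW₁⟩ := h.exists_traceLim_grad₂
  obtain ⟨d, hd⟩ := h.exists_traceLim_doubleGrad
  refine ⟨fun x hx => ?_, ⟨_, _, (h.traceLim_tangent hW₀).hasExteriorTrace,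
    (h.traceLim_normal₂ hW₁).hasExteriorTrace, ?_⟩, ?_⟩
  · exact (InnerProductSpace.harmonicAt_congr_nhds (hev x hx)).2 (h.harmonicOnNhd_formula x hx)
  · refine TraceLim.hasExteriorTrace ((h.traceLim_formula hd).congr_of_forall
      hD.isArcCurve.width_pos (S := univ) (by simp) (fun ε hε hε' s _ => ?_) ?_)
    · rw [dirDeriv, (hev _ (hD.parallel_mem hε hε'.le s)).fderiv_eq, dirDeriv]
    · filter_upwards [h.boundary_condition hd hW₀ hW₁] with s hs using hs.symm
  · refine h.formula_isBigO.congr' ?_ EventuallyEq.rfl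
    filter_upwards [hD.eventually_exterior] with x hx using (hu x hx).symm

/-- A solution of the first-order problem is given by the formula. -/
theorem eq_formula (h : FirstOrderData D γ L H w G F F' f φ φ₁ ψ) {u : Plane → ℝ}
    (hu : IsFirstOrderPotential D γ L f w u) {x : Plane} (hx : x ∈ (closure D)ᶜ) :
    u x = firstOrderFormula γ L f φ φ₁ x := by
  have hD := h.domain
  obtain ⟨W₀, hW₀⟩ := h.exists_traceLim_grad
  obtain ⟨W₁, hW₁⟩ := h.exists_traceLim_grad₂
  obtain ⟨d, hd⟩ := h.exists_traceLim_doubleGrad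
  obtain ⟨wT, wν, hT, hν, hn⟩ := hu.neumann
  have hU := h.traceLim_formula hd
  have hT' := hT.ae_unique (h.traceLim_tangent hW₀)
  have hν' := hν.ae_unique (h.traceLim_normal₂ hW₁)
  refine hD.eq_of_neumann hu.harmonic h.harmonicOnNhd_formula
    (hD.traceLim_of_hasExteriorTrace hn hU.memLp ?_) hU (hu.decay.sub h.formula_isBigO) hx
  filter_upwards [hT', hν', h.boundary_condition hd hW₀ hW₁] with s h1 h2 h3
  rw [h3, h1, h2]

end FirstOrderData

theorem mainTheorem5 (D : Set Plane) (γ : ℝ → Plane) (L : ℝ) (hD : IsC2Domain D γ L)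
    (H : Plane → ℝ) (hH : InnerProductSpace.HarmonicOnNhd H Set.univ)
    (f : ℝ → ℝ) (hf : ContDiff ℝ 1 f) (hfL : Function.Periodic f L)
    (w : Plane → ℝ) (hw : IsUnperturbedPotential D γ L H w)
    (φ φ₁ : ℝ → ℝ) (hφ : IsZerothDensity γ L H φ) (hφ₁ : IsFirstDensity γ L H f φ φ₁)
    (u : Plane → ℝ) :
    IsFirstOrderPotential D γ L f w u ↔
      ∀ x ∈ (closure D)ᶜ,
        u x = singleLayer γ L φ₁ x
          - singleLayer γ L (fun s => curvature γ s * f s * φ s) x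
          + doubleLayer γ L (fun s => f s * φ s) x := by
  obtain ⟨G, F, F', h1, h2, h3, h4⟩ := exists_gradForm_of_harmonic hH
  obtain ⟨ψ, hψ, hφψ⟩ := hD.exists_weakDeriv_zeroth h1 h3 h4 hφ
  have h : FirstOrderData D γ L H w G F F' f φ φ₁ ψ :=
    ⟨hD, h1, h2, h3, h4, hf, hfL, hw, hφ, hφ₁, hψ, hφψ⟩
  exact ⟨fun hu x hx => h.eq_formula hu hx, fun hu => h.isFirstOrderPotential hu⟩

end
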